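/- Let $(M,g)$ be a smooth Riemannian manifold (without boundary, Hausdorff, second countable) of dimension $n$, let $Y\subset M$ be a smooth hypersurface with defining function $f$, i.e. $f\in C^\infty(M;\mathbb R)$, $Y=\{f=0\}$ and $df\neq0$ on $Y$, and let $V$ be a real-valued function on $M$ that is smooth on $M\setminus Y$. For $k\in\{1,2\}$ write $V\in IW^{k,1}(Y)$ if for every $N\ge 0$ and all smooth vector fields $X_1,\dots,X_N$ on $M$ tangent to $Y$ the distributional derivative $X_1\cdots X_N V$ belongs to $W^{k,1}_{\mathrm{loc}}(M)$ (for $N=0$: $V\in W^{k,1}_{\mathrm{loc}}(M)$). If $V\in IW^{1,1}(Y)$, then $V|_{M\setminus Y}$ extends (uniquely) to a continuous function on $M$; if $V\in IW^{2,1}(Y)$, the extension is of class $C^1$. Denote this extension again by $V$ (it differs from the original function only on the null set $Y$). On $T^*M$, with projection $\pi:T^*M\to M$, let $p=|\xi|_g^2+V$, and let $H_p$ be its Hamilton vector field, in canonical coordinates $H_p=\partial_\xi p\cdot\partial_x-\partial_x p\cdot\partial_\xi$. Put $$\mathcal H=\{p=0\}\cap\big(\{\pi^*f\neq0\}\cup\{H_p\pi^*f\neq0\}\big),$$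 and, when $V\in IW^{2,1}(Y)$, $$\mathcal G_2=\{p=0\}\cap\{\pi^*f=0,\ H_p\pi^*f=0,\ H_p^2\pi^*f\neq0\}.$$ (Since $\pi^*f$ does not depend on $\xi$, $H_p\pi^*f=H_{|\xi|_g^2}\pi^*f$ involves no derivative of $V$.) For $S\subset T^*M$ and $\rho\in S$, an integral curve of $H_p$ in $S$ through $\rho$ is a locally absolutely continuous map $\gamma:J\to T^*M$ on an open interval $J\ni0$ with $\gamma(0)=\rho$ and $\gamma(J)\subset S$ that satisfies Hamilton's equations $\dot x=\partial_\xi p$, $\dot\xi=-\partial_x p$ in canonical coordinates for almost every $t\in J$; it is maximal if it does not extend to such a curve on a strictly larger open interval. Theorem. (1) If $V\in IW^{1,1}(Y)$, then through every $\rho\in\mathcal H$ there is a unique maximal integral curve of $H_p$ in $\mathcal H$. (2) If $V\in IW^{2,1}(Y)$, then through every $\rho\in\mathcal H\cup\mathcal G_2$ there is a unique maximal integral curve of $H_p$ in $\mathcal H\cup\mathcal G_2$. In both cases every integral curve through $\rho$ in the respective set is a restriction of the maximal one. -/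

import Mathlib

open scoped Manifold ContDiff

namespace ConormalFlow

noncomputable section

/-- The coordinate space `ℝⁿ`. -/
abbrev Coord (n : ℕ) : Type := EuclideanSpace ℝ (Fin n)

section Manifold

variable {n : ℕ} {M : Type*} [TopologicalSpace M] [ChartedSpace (Coord n) M]

/-! ### Hypersurfaces and vector fields -/

/-- `f` is a (global) defining function of the hypersurface `Y`: it is smooth, `Y = {f = 0}`, and
`df ≠ 0` at every point of `Y`. In particular `Y` is a closed embedded hypersurface and
`T_m Y = ker df_m` for `m ∈ Y`. -/
structure IsDefiningFunction (Y : Set M) (f : M → ℝ) : Prop where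
  smooth : ContMDiff (𝓡 n) 𝓘(ℝ) ∞ f
  mem_iff : ∀ m, m ∈ Y ↔ f m = 0
  mfderiv_ne_zero : ∀ m ∈ Y, mfderiv (𝓡 n) 𝓘(ℝ) f m ≠ 0

/-- `X` is a smooth vector field on `M`. -/
def IsSmoothField [IsManifold (𝓡 n) ∞ M] (X : ∀ m : M, TangentSpace (𝓡 n) m) : Prop :=
  ContMDiff (𝓡 n) (𝓡 n).tangent ∞ (fun m => (⟨m, X m⟩ : TangentBundle (𝓡 n) M))

/-- The vector field `X` is tangent to the hypersurface `Y` with defining function `f`. -/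
def IsTangentTo (Y : Set M) (f : M → ℝ) (X : ∀ m : M, TangentSpace (𝓡 n) m) : Prop :=
  ∀ m ∈ Y, mfderiv (𝓡 n) 𝓘(ℝ) f m (X m) = 0

/-! ### Weak derivatives, Sobolev spaces and conormal Sobolev spaces -/

/-- `u ∈ L¹_loc(M)`: in every smooth chart `u` is locally Lebesgue integrable. -/
def MemL1Loc (n : ℕ) {M : Type*} [TopologicalSpace M] [ChartedSpace (Coord n) M]
    (u : M → ℝ) : Prop :=
  ∀ e ∈ IsManifold.maximalAtlas (𝓡 n) ∞ M,
    MeasureTheory.LocallyIntegrableOn (fun x : Coord n => u (e.symm x)) e.target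

/-- The vector field `X` read in the chart `e`, as a map `ℝⁿ → ℝⁿ` (relevant on `e.target`). -/
def fieldInChart (e : OpenPartialHomeomorph M (Coord n)) (X : ∀ m : M, TangentSpace (𝓡 n) m)
    (x : Coord n) : Coord n :=
  mfderiv (𝓡 n) (𝓡 n) e (e.symm x) (X (e.symm x))

/-- Euclidean divergence of a vector field on `ℝⁿ`. -/
def divergence (Z : Coord n → Coord n) (x : Coord n) : ℝ :=
  LinearMap.trace ℝ (Coord n) (fderiv ℝ Z x).toLinearMap

/-- `w` is the distributional derivative `X u`: in every smooth chart,
`∫ u div(φ X) = - ∫ w φ` for all test functions `φ` supported in the chart. -/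
def IsWeakDeriv (X : ∀ m : M, TangentSpace (𝓡 n) m) (u w : M → ℝ) : Prop :=
  ∀ e ∈ IsManifold.maximalAtlas (𝓡 n) ∞ M, ∀ φ : Coord n → ℝ,
    ContDiff ℝ ∞ φ → HasCompactSupport φ → tsupport φ ⊆ e.target →
      ∫ x, u (e.symm x) * divergence (fun y => φ y • fieldInChart e X y) x
        = - ∫ x, w (e.symm x) * φ x

/-- `u ∈ W^{k,1}_loc(M)`: `u` and all its distributional derivatives along at most `k` smooth vector
fields are in `L¹_loc`. -/
def MemW1Loc [IsManifold (𝓡 n) ∞ M] : ℕ → (M → ℝ) → Prop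
  | 0, u => MemL1Loc n u
  | k + 1, u => MemL1Loc n u ∧
      ∀ X : (∀ m : M, TangentSpace (𝓡 n) m), IsSmoothField X →
        ∃ w : M → ℝ, IsWeakDeriv X u w ∧ MemW1Loc k w

/-- `X₁ ⋯ X_j u ∈ W^{k,1}_loc(M)` for all `j ≤ N` and all smooth vector fields `X₁, …, X_j` tangent
to `Y`. -/
def MemIWUpTo [IsManifold (𝓡 n) ∞ M] (Y : Set M) (f : M → ℝ) (k : ℕ) : ℕ → (M → ℝ) → Prop
  | 0, u => MemW1Loc (n := n) k u
  | N + 1, u => MemW1Loc (n := n) k u ∧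
      ∀ X : (∀ m : M, TangentSpace (𝓡 n) m), IsSmoothField X → IsTangentTo Y f X →
        ∃ w : M → ℝ, IsWeakDeriv X u w ∧ MemIWUpTo Y f k N w

/-- The conormal Sobolev space `IW^{k,1}(Y)` (in its local form). -/
def MemIW (n : ℕ) {M : Type*} [TopologicalSpace M] [ChartedSpace (Coord n) M]
    [IsManifold (𝓡 n) ∞ M] (Y : Set M) (f : M → ℝ) (k : ℕ) (u : M → ℝ) : Prop :=
  ∀ N, MemIWUpTo (n := n) Y f k N u

/-! ### The cotangent bundle and the Hamilton vector field -/

/-- The cotangent bundle `T^*M`. -/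
abbrev Cotangent (n : ℕ) (M : Type*) [TopologicalSpace M] [ChartedSpace (Coord n) M] : Type _ :=
  Bundle.TotalSpace (Coord n →L[ℝ] ℝ) (fun m : M => TangentSpace (𝓡 n) m →L[ℝ] ℝ)

/-- Canonical coordinates `(x, ξ)` on `T^*M` induced by the chart `e` of `M`: the covector is
`∑ ξᵢ dxᵢ`. -/
def toCoord (e : OpenPartialHomeomorph M (Coord n)) (ρ : Cotangent n M) : Coord n × Coord n :=
  (e ρ.proj, (InnerProductSpace.toDual ℝ (Coord n)).symm
    (ρ.snd.comp (mfderiv (𝓡 n) (𝓡 n) e ρ.proj).inverse))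

/-- The point of `T^*M` with canonical coordinates `z = (x, ξ)`. -/
def ofCoord (e : OpenPartialHomeomorph M (Coord n)) (z : Coord n × Coord n) : Cotangent n M :=
  ⟨e.symm z.1, ContinuousLinearMap.comp (InnerProductSpace.toDual ℝ (Coord n) z.2)
    (mfderiv (𝓡 n) (𝓡 n) e (e.symm z.1))⟩

/-- The Hamilton vector field `(∂_ξ P, -∂_x P)` of a function `P(x, ξ)` on `ℝⁿ × ℝⁿ`. -/
def hamField (P : Coord n × Coord n → ℝ) (z : Coord n × Coord n) : Coord n × Coord n :=
  (gradient (fun ξ => P (z.1, ξ)) z.2, - gradient (fun x => P (x, z.2)) z.1)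

/-- The derivative `H_p a` of a function `a` on `T^*M` along the Hamilton vector field of `p`. -/
def hamDeriv (p a : Cotangent n M → ℝ) (ρ : Cotangent n M) : ℝ :=
  let e := chartAt (Coord n) ρ.proj
  fderiv ℝ (fun z => a (ofCoord e z)) (toCoord e ρ)
    (hamField (fun z => p (ofCoord e z)) (toCoord e ρ))

/-- `γ` is an integral curve of `H_p` on the open interval `J`: it is locally absolutely continuous,
and in canonical coordinates it satisfies Hamilton's equations
`ẋ = ∂_ξ p`, `ξ̇ = -∂_x p` at almost every time. -/
structure IsIntegralCurve (p : Cotangent n M → ℝ) (γ : ℝ → Cotangent n M) (J : Set ℝ) :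
    Prop where
  isOpen : IsOpen J
  ordConnected : J.OrdConnected
  continuousOn : ContinuousOn (fun t => (γ t).proj) J
  absolutelyContinuous : ∀ e ∈ IsManifold.maximalAtlas (𝓡 n) ∞ M, ∀ a b : ℝ,
    Set.uIcc a b ⊆ J → (∀ t ∈ Set.uIcc a b, (γ t).proj ∈ e.source) →
      AbsolutelyContinuousOnInterval (fun t => toCoord e (γ t)) a b
  equation : ∀ e ∈ IsManifold.maximalAtlas (𝓡 n) ∞ M,
    ∀ᵐ t : ℝ, t ∈ J → (γ t).proj ∈ e.source →
      HasDerivAt (fun s => toCoord e (γ s))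
        (hamField (fun z => p (ofCoord e z)) (toCoord e (γ t))) t

/-- `γ`, defined on the open interval `J ∋ 0`, is an integral curve of `H_p` through `ρ` (at time
`0`) which stays in `S`. -/
structure IsIntegralCurveIn (p : Cotangent n M → ℝ) (S : Set (Cotangent n M))
    (ρ : Cotangent n M) (γ : ℝ → Cotangent n M) (J : Set ℝ) : Prop
    extends IsIntegralCurve p γ J where
  zero_mem : 0 ∈ J
  map_zero : γ 0 = ρ
  mapsTo : Set.MapsTo γ J S

/-- `γ` on `J` is a maximal integral curve of `H_p` in `S` through `ρ`: it has no extension to a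
larger open interval. -/
structure IsMaximalIntegralCurveIn (p : Cotangent n M → ℝ) (S : Set (Cotangent n M))
    (ρ : Cotangent n M) (γ : ℝ → Cotangent n M) (J : Set ℝ) : Prop
    extends IsIntegralCurveIn p S ρ γ J where
  maximal : ∀ (γ' : ℝ → Cotangent n M) (J' : Set ℝ), IsIntegralCurveIn p S ρ γ' J' →
    J ⊆ J' → Set.EqOn γ γ' J → J' = J

/-- Through every point of `S` there is a unique maximal integral curve of `H_p` in `S`, and every
integral curve in `S` through that point is a restriction of it. -/
def HasUniqueMaximalCurves (p : Cotangent n M → ℝ) (S : Set (Cotangent n M)) : Prop :=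
  ∀ ρ ∈ S, ∃ (γ : ℝ → Cotangent n M) (J : Set ℝ),
    IsMaximalIntegralCurveIn p S ρ γ J ∧
    (∀ (γ' : ℝ → Cotangent n M) (J' : Set ℝ),
      IsMaximalIntegralCurveIn p S ρ γ' J' → J' = J ∧ Set.EqOn γ' γ J) ∧
    (∀ (γ' : ℝ → Cotangent n M) (J' : Set ℝ),
      IsIntegralCurveIn p S ρ γ' J' → J' ⊆ J ∧ Set.EqOn γ' γ J')

/-! ### The symbol, the hyperbolic set and the second order glancing set -/

/-- A smooth Riemannian metric on `M`. -/
abbrev RiemannianMetric (n : ℕ) (M : Type*) [TopologicalSpace M] [ChartedSpace (Coord n) M]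
    [IsManifold (𝓡 n) ∞ M] : Type _ :=
  Bundle.ContMDiffRiemannianMetric (𝓡 n) ∞ (Coord n) (fun m : M => TangentSpace (𝓡 n) m)

variable [IsManifold (𝓡 n) ∞ M]

/-- The dual metric `|α|²_g = α(α^♯)`, where `α^♯` is the vector with `g(α^♯, ·) = α`. -/
def conormSq (g : RiemannianMetric n M) (ρ : Cotangent n M) : ℝ :=
  ρ.snd ((g.inner ρ.proj).inverse ρ.snd)

/-- The symbol `p = |ξ|²_g + V`. -/
def symbol (g : RiemannianMetric n M) (V : M → ℝ) (ρ : Cotangent n M) : ℝ :=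
  conormSq g ρ + V ρ.proj

/-- `H_p π^*f`. (As `π^*f` does not depend on `ξ`, no derivative of `V` enters.) -/
def hamDefining (g : RiemannianMetric n M) (V f : M → ℝ) : Cotangent n M → ℝ :=
  hamDeriv (symbol g V) (fun ρ => f ρ.proj)

/-- The hyperbolic set `{p = 0} ∩ ({f ≠ 0} ∪ {H_p π^*f ≠ 0})`. -/
def hyperbolicSet (g : RiemannianMetric n M) (V f : M → ℝ) : Set (Cotangent n M) :=
  {ρ | symbol g V ρ = 0 ∧ (f ρ.proj ≠ 0 ∨ hamDefining g V f ρ ≠ 0)}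

/-- The set `{p = 0, f = H_p π^*f = 0, H_p² π^*f ≠ 0}` of points that are glancing to exactly second
order. -/
def glancingSet (g : RiemannianMetric n M) (V f : M → ℝ) : Set (Cotangent n M) :=
  {ρ | symbol g V ρ = 0 ∧ f ρ.proj = 0 ∧ hamDefining g V f ρ = 0 ∧
    hamDeriv (symbol g V) (hamDefining g V f) ρ ≠ 0}

end Manifold

end

end ConormalFlow

open ConormalFlow

/-! Regularity of the potential. In a chart where `f` is a coordinate x_i, conormal regularity puts
the normal derivative ∂_i V and all its tangential derivatives locally in L¹. Sobolev embedding in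
the tangential variables alone then gives |∂_i V| ≤ h(x_i) with h integrable on the line
(`TangentiallyIntegrable.exists_bound`), and the same holds with V replaced by a tangential
derivative of V. Since the distribution ∂_i V is a function, V cannot jump across Y
(`limits_eq_of_isWeakPd`). With H a primitive of h this yields |V(x) - V(y)| ≤ C |x - y| + |H(x_i) -
H(y_i)| (`exists_lipUpTo`), hence the continuous extension. The tangential derivatives of V obey the
same bound, and in the class IW^{2,1} so do all first derivatives, which makes the extension C¹.
`IsLocalPotential` records the outcome.

Uniqueness. A field F with |F(z) - F(y)| ≤ C (|z - y| + |H(z_i) - H(y_i)|) need not be Lipschitz,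
because H is only monotone and continuous. Uniqueness still holds when x_i is monotone along
solutions. If two solutions with the same initial point differ by at most D, each reaches the
x_i-level of the other after a delay of at most K D; then the integral of |H(x_i) - H(y_i)|
telescopes to at most K D times oscillations of H along the solutions, and for short times D ≤ D / 2
(`eq_zero_of_norm_deriv_le_of_delay`). At transversal points the delay bound is immediate. At a
second order glancing point the velocity of x_i at time τ is at least c τ, while the two values of
x_i differ by at most L D τ, so the delay is again O(D). Negative times follow by reversing the
field.

Hyperbolic points. In the class IW^{2,1} the Hamilton vector field itself satisfies such an
estimate, which settles the glancing set. In the class IW^{1,1} the derivative ∂_i V may be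
unbounded, and the equation for ξ_i is out of reach of the argument. Instead ξ_i is eliminated: on p
= 0 it is a simple root of a quadratic polynomial, hence a C¹ function of x, the remaining momenta
and V. The closed system for x and ξ_j, j ≠ i, involves only V and its tangential derivatives, so
the transversal uniqueness result applies. Peano's theorem gives a solution of it, and ξ_i is
recovered from the energy. The recovered ξ_i is absolutely continuous because H is absolutely
continuous and x_i is monotone, and it satisfies its own equation away from the single crossing time
because the energy is constant.

Away from Y the equation is classical. The symplectic invariance of the Hamilton vector field makes
everything independent of the chart, and local existence and uniqueness give the maximal curves by
gluing. -/

namespace ConormalFlow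

open scoped Manifold ContDiff Topology NNReal ENNReal
open Set Filter MeasureTheory

noncomputable section

/-! ### Absolutely continuous functions: comparison, composition, regularity -/

section AbsolutelyContinuous

open AbsolutelyContinuousOnInterval

/-- A function whose increments are controlled by those of two absolutely continuous functions is
absolutely continuous. -/
theorem absolutelyContinuousOnInterval_of_dist_le {X Y Z : Type*} [PseudoMetricSpace X]
    [PseudoMetricSpace Y] [PseudoMetricSpace Z] {f : ℝ → X} {φ : ℝ → Y} {ψ : ℝ → Z} {a b K : ℝ}
    (hφ : AbsolutelyContinuousOnInterval φ a b) (hψ : AbsolutelyContinuousOnInterval ψ a b)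
    (h : ∀ s ∈ uIcc a b, ∀ t ∈ uIcc a b,
      dist (f s) (f t) ≤ K * (dist (φ s) (φ t) + dist (ψ s) (ψ t))) :
    AbsolutelyContinuousOnInterval f a b := by
  unfold AbsolutelyContinuousOnInterval at hφ hψ ⊢
  refine squeeze_zero' (.of_forall fun _ => Finset.sum_nonneg fun _ _ => dist_nonneg) ?_
    (by simpa using (hφ.add hψ).const_mul K)
  rw [eventually_inf_principal]
  filter_upwards with E hE
  rw [← Finset.sum_add_distrib, Finset.mul_sum]
  exact Finset.sum_le_sum fun i hi => h _ (hE.1 i hi).1 _ (hE.1 i hi).2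

theorem absolutelyContinuousOnInterval_prodMk {X Y : Type*} [PseudoMetricSpace X]
    [PseudoMetricSpace Y] {f : ℝ → X} {g : ℝ → Y} {a b : ℝ}
    (hf : AbsolutelyContinuousOnInterval f a b) (hg : AbsolutelyContinuousOnInterval g a b) :
    AbsolutelyContinuousOnInterval (fun t => (f t, g t)) a b := by
  refine absolutelyContinuousOnInterval_of_dist_le (K := 1) hf hg fun s _ t _ => ?_
  rw [Prod.dist_eq, one_mul]
  exact max_le_add_of_nonneg dist_nonneg dist_nonneg

theorem absolutelyContinuousOnInterval_lipschitz_comp {X Y : Type*} [PseudoMetricSpace X]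
    [PseudoMetricSpace Y] {f : ℝ → X} {Φ : X → Y} {a b : ℝ} {K : ℝ≥0} {s : Set X}
    (hf : AbsolutelyContinuousOnInterval f a b) (hΦ : LipschitzOnWith K Φ s)
    (hs : ∀ t ∈ uIcc a b, f t ∈ s) :
    AbsolutelyContinuousOnInterval (fun t => Φ (f t)) a b := by
  refine absolutelyContinuousOnInterval_of_dist_le (K := K) hf hf fun s hs' t ht' => ?_
  have := hΦ.dist_le_mul _ (hs s hs') _ (hs t ht')
  have h2 : 0 ≤ K * dist (f s) (f t) := by positivity
  linarith

/-- An absolutely continuous function composed with a monotone or antitone Lipschitz function. -/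
theorem absolutelyContinuousOnInterval_comp_monotone {X : Type*} [PseudoMetricSpace X]
    {H : ℝ → X} {x : ℝ → ℝ} {a b c d : ℝ} {K : ℝ≥0}
    (hH : AbsolutelyContinuousOnInterval H c d) (hx : LipschitzOnWith K x (uIcc a b))
    (hmono : MonotoneOn x (uIcc a b) ∨ AntitoneOn x (uIcc a b))
    (hmaps : ∀ t ∈ uIcc a b, x t ∈ uIcc c d) :
    AbsolutelyContinuousOnInterval (fun t => H (x t)) a b := by
  rw [absolutelyContinuousOnInterval_iff] at hH ⊢
  intro ε hε
  obtain ⟨δ, hδ, h⟩ := hH ε hε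
  -- Monotonicity of x keeps the images of disjoint intervals disjoint, and their total length grows
  -- at most by the factor K; K + 1 avoids division by zero.
  refine ⟨δ / (K + 1), by positivity, fun E hE hlen => ?_⟩
  refine h (E.1, fun k => (x (E.2 k).1, x (E.2 k).2)) ⟨fun k hk => ⟨hmaps _ (hE.1 k hk).1,
    hmaps _ (hE.1 k hk).2⟩, ?_⟩ ?_
  · intro k hk l hl hkl
    have hd := hE.2 hk hl hkl
    have hk' := hE.1 k hk
    have hl' := hE.1 l hl
    simp only [Function.onFun, Set.disjoint_left, mem_uIoc] at hd ⊢
    generalize (E.2 k).1 = u at *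
    generalize (E.2 k).2 = v at *
    generalize (E.2 l).1 = u' at *
    generalize (E.2 l).2 = v' at *
    -- Disjoint half-open intervals are empty or ordered: if all four alternatives fail, the smaller
    -- of the two right endpoints lies in both intervals.
    have key : (u = v) ∨ (u' = v') ∨ max u v ≤ min u' v' ∨ max u' v' ≤ min u v := by
      by_contra hcon
      push Not at hcon
      obtain ⟨h1, h2, h3, h4⟩ := hcon
      have := @hd (min (max u v) (max u' v'))
      rcases lt_or_gt_of_ne h1 with h1 | h1 <;> rcases lt_or_gt_of_ne h2 with h2 | h2 <;>
        simp only [max_eq_left h1.le, max_eq_right h1.le, max_eq_left h2.le, max_eq_right h2.le,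
          min_eq_left h1.le, min_eq_right h1.le, min_eq_left h2.le, min_eq_right h2.le] at * <;>
        grind
    intro r hr hr'
    rcases key with rfl | rfl | hlt | hlt
    · rcases hr with hr | hr <;> linarith [hr.1, hr.2]
    · rcases hr' with hr | hr <;> linarith [hr.1, hr.2]
    · rw [max_le_iff, le_min_iff, le_min_iff] at hlt
      rcases hmono with hm | hm
      · have := hm hk'.1 hl'.1 hlt.1.1
        have := hm hk'.1 hl'.2 hlt.1.2
        have := hm hk'.2 hl'.1 hlt.2.1
        have := hm hk'.2 hl'.2 hlt.2.2
        rcases hr with hr | hr <;> rcases hr' with hr' | hr' <;> linarith [hr.1, hr.2, hr'.1, hr'.2]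
      · have := hm hk'.1 hl'.1 hlt.1.1
        have := hm hk'.1 hl'.2 hlt.1.2
        have := hm hk'.2 hl'.1 hlt.2.1
        have := hm hk'.2 hl'.2 hlt.2.2
        rcases hr with hr | hr <;> rcases hr' with hr' | hr' <;> linarith [hr.1, hr.2, hr'.1, hr'.2]
    · rw [max_le_iff, le_min_iff, le_min_iff] at hlt
      rcases hmono with hm | hm
      · have := hm hl'.1 hk'.1 hlt.1.1
        have := hm hl'.1 hk'.2 hlt.1.2
        have := hm hl'.2 hk'.1 hlt.2.1
        have := hm hl'.2 hk'.2 hlt.2.2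
        rcases hr with hr | hr <;> rcases hr' with hr' | hr' <;> linarith [hr.1, hr.2, hr'.1, hr'.2]
      · have := hm hl'.1 hk'.1 hlt.1.1
        have := hm hl'.1 hk'.2 hlt.1.2
        have := hm hl'.2 hk'.1 hlt.2.1
        have := hm hl'.2 hk'.2 hlt.2.2
        rcases hr with hr | hr <;> rcases hr' with hr' | hr' <;> linarith [hr.1, hr.2, hr'.1, hr'.2]
  · calc ∑ i ∈ Finset.range E.1, dist (x (E.2 i).1) (x (E.2 i).2)
        ≤ ∑ i ∈ Finset.range E.1, K * dist (E.2 i).1 (E.2 i).2 :=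
          Finset.sum_le_sum fun i hi => hx.dist_le_mul _ (hE.1 i hi).1 _ (hE.1 i hi).2
      _ = K * ∑ i ∈ Finset.range E.1, dist (E.2 i).1 (E.2 i).2 := by rw [Finset.mul_sum]
      _ ≤ K * (δ / (K + 1)) := by gcongr
      _ < (K + 1) * (δ / (K + 1)) := by gcongr; linarith
      _ = δ := by field_simp

/-- An absolutely continuous function whose derivative agrees almost everywhere with a continuous
function is differentiable everywhere. -/
theorem hasDerivAt_of_absolutelyContinuous {E : Type*} [NormedAddCommGroup E] [NormedSpace ℝ E]
    [CompleteSpace E] {f g : ℝ → E} {a b : ℝ} (hab : a ≤ b)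
    (hf : AbsolutelyContinuousOnInterval f a b) (hg : ContinuousOn g (Icc a b))
    (h : ∀ᵐ t, t ∈ Icc a b → HasDerivAt f (g t) t) {t : ℝ} (ht : t ∈ Ioo a b) :
    HasDerivAt f (g t) t := by
  -- Extending g constantly beyond the interval gives it a C¹ primitive on the whole line. The
  -- difference of f and this primitive is absolutely continuous with derivative zero almost
  -- everywhere, hence constant.
  set g' : ℝ → E := IccExtend hab ((Icc a b).domRestrict g) with hg'
  have hg'c : Continuous g' := (continuousOn_iff_continuous_domRestrict.1 hg).Icc_extend'
  have hgg : ∀ s ∈ Icc a b, g' s = g s := fun s hs => by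
    rw [hg', IccExtend_of_mem _ _ hs]; rfl
  have hG : ∀ s, HasDerivAt (fun r => ∫ τ in a..r, g' τ) (g' s) s := fun s =>
    (hg'c.integral_hasStrictDerivAt a s).hasDerivAt
  have hGac : AbsolutelyContinuousOnInterval (fun r => ∫ τ in a..r, g' τ) a b := by
    apply ContDiffOn.absolutelyContinuousOnInterval
    apply ContDiff.contDiffOn
    rw [contDiff_one_iff_deriv]
    exact ⟨fun s => (hG s).differentiableAt, by
      convert hg'c using 1; ext s; exact (hG s).deriv⟩
  obtain ⟨C, hC⟩ := (hf.sub hGac).const_of_ae_hasDerivAt_zero (by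
    filter_upwards [h] with s hs hs'
    rw [uIcc_of_le hab] at hs'
    have := (hs hs').sub (hG s)
    rwa [hgg s hs', sub_self] at this)
  rw [uIcc_of_le hab] at hC
  have h1 := (hG t).add_const C
  rw [hgg t (Ioo_subset_Icc_self ht)] at h1
  refine h1.congr_of_eventuallyEq ?_
  filter_upwards [Icc_mem_nhds ht.1 ht.2] with s hs
  have := hC s hs
  simp only [Pi.sub_apply] at this
  rw [← this]; abel

end AbsolutelyContinuous

/-! ### Peano's existence theorem -/

section Peano

variable {E : Type*} [NormedAddCommGroup E] [NormedSpace ℝ E] [FiniteDimensional ℝ E]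

/-- Near each point the constant value of F there is admissible, and admissibility is a convex
condition, so a partition of unity glues the constants. -/
theorem exists_contDiff_norm_sub_le {F : E → E} (hF : Continuous F) {ε : ℝ} (hε : 0 < ε) :
    ∃ G : E → E, ContDiff ℝ ∞ G ∧ ∀ x, ‖G x - F x‖ ≤ ε := by
  obtain ⟨G, hG⟩ := exists_contMDiffMap_forall_mem_convex_of_local_const (n := (⊤ : ℕ∞)) (𝓘(ℝ, E))
    (t := fun x => Metric.closedBall (F x) ε) (fun x => convex_closedBall _ _) (fun x => by
      refine ⟨F x, ?_⟩
      filter_upwards [hF.continuousAt.eventually (Metric.closedBall_mem_nhds (F x) hε)] with y hy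
      rwa [Metric.mem_closedBall_comm])
  exact ⟨G, contMDiff_iff_contDiff.1 G.contMDiff, fun x => by simpa [dist_eq_norm] using hG x⟩

/-- **Peano's existence theorem** for a bounded continuous vector field. -/
theorem exists_hasDerivAt_of_continuous {F : E → E} (hF : Continuous F) {L : ℝ}
    (hL : ∀ x, ‖F x‖ ≤ L) (z₀ : E) :
    ∃ z : ℝ → E, z 0 = z₀ ∧ ∀ t ∈ Ioo (-1 : ℝ) 1, HasDerivAt z (F (z t)) t := by
  have hL0 : 0 ≤ L := (norm_nonneg _).trans (hL z₀)
  -- Smooth approximations G have speed at most L + 1, so their Picard–Lindelöf solutions exist on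
  -- all of [-1, 1] inside the ball of radius L + 1.
  have hex : ∀ k : ℕ, ∃ α : ℝ → E, α 0 = z₀ ∧ ∃ G : E → E,
      (∀ x, ‖G x - F x‖ ≤ 1 / ((k : ℝ) + 1)) ∧
      ∀ t ∈ Icc (-1 : ℝ) 1, HasDerivWithinAt α (G (α t)) (Icc (-1 : ℝ) 1) t := by
    intro k
    obtain ⟨G, hG, hGF⟩ := exists_contDiff_norm_sub_le hF (ε := 1 / ((k : ℝ) + 1)) (by positivity)
    have hGL : ∀ x, ‖G x‖ ≤ L + 1 := fun x => by
      have h1 : 1 / ((k : ℝ) + 1) ≤ 1 := by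
        rw [div_le_one (by positivity)]; linarith [k.cast_nonneg (α := ℝ)]
      calc ‖G x‖ = ‖F x + (G x - F x)‖ := by abel_nf
        _ ≤ ‖F x‖ + ‖G x - F x‖ := norm_add_le _ _
        _ ≤ L + 1 := add_le_add (hL x) ((hGF x).trans h1)
    obtain ⟨K, hK⟩ := (hG.contDiffOn (s := Metric.closedBall z₀ (L + 1))).exists_lipschitzOnWith
      (by simp) (convex_closedBall _ _) (isCompact_closedBall _ _)
    have hPL : IsPicardLindelof (fun _ => G) (tmin := -1) (tmax := 1) ⟨0, by norm_num⟩ z₀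
        ⟨L + 1, by positivity⟩ 0 ⟨L + 1, by positivity⟩ K := by
      refine IsPicardLindelof.of_time_independent (fun x _ => hGL x) hK ?_
      simp
    obtain ⟨α, hα0, hα⟩ := hPL.exists_eq_forall_mem_Icc_hasDerivWithinAt₀
    exact ⟨α, hα0, G, hGF, hα⟩
  choose α hα0 G hGF hα using hex
  have h1k : ∀ k : ℕ, 1 / ((k : ℝ) + 1) ≤ 1 := fun k => by
    rw [div_le_one (by positivity)]; linarith [k.cast_nonneg (α := ℝ)]
  have hGL : ∀ k x, ‖G k x‖ ≤ L + 1 := fun k x => by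
    calc ‖G k x‖ = ‖F x + (G k x - F x)‖ := by abel_nf
      _ ≤ ‖F x‖ + ‖G k x - F x‖ := norm_add_le _ _
      _ ≤ L + 1 := add_le_add (hL x) ((hGF k x).trans (h1k k))
  have hlip : ∀ k, ∀ s ∈ Icc (-1 : ℝ) 1, ∀ t ∈ Icc (-1 : ℝ) 1,
      ‖α k t - α k s‖ ≤ (L + 1) * ‖t - s‖ := fun k s hs t ht =>
    (convex_Icc (-1 : ℝ) 1).norm_image_sub_le_of_norm_hasDerivWithin_le (hα k)
      (fun x _ => hGL k _) hs ht
  have h0 : (0 : ℝ) ∈ Icc (-1 : ℝ) 1 := by norm_num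
  set B := Metric.closedBall z₀ (L + 1)
  have hB : ∀ k, ∀ t ∈ Icc (-1 : ℝ) 1, α k t ∈ B := fun k t ht => by
    have := hlip k 0 h0 t ht
    rw [hα0, sub_zero, Real.norm_eq_abs] at this
    rw [Metric.mem_closedBall, dist_eq_norm]
    have h2 : |t| ≤ 1 := abs_le.2 ht
    nlinarith [abs_nonneg t]
  have hBc : IsCompact B := isCompact_closedBall _ _
  -- Pointwise limits along a fixed ultrafilter in a compact ball take the place of the
  -- Arzelà–Ascoli theorem: no subsequence has to be extracted.
  have hlim : ∀ t : ℝ, ∃ y, t ∈ Icc (-1 : ℝ) 1 →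
      (y ∈ B ∧ Tendsto (fun k => α k t) (hyperfilter ℕ) (𝓝 y)) := by
    intro t
    by_cases ht : t ∈ Icc (-1 : ℝ) 1
    · obtain ⟨y, hy, hy'⟩ := hBc.ultrafilter_le_nhds ((hyperfilter ℕ).map (fun k => α k t)) (by
        rw [le_principal_iff]
        exact mem_map.2 (univ_mem' fun k => hB k t ht))
      exact ⟨y, fun _ => ⟨hy, hy'⟩⟩
    · exact ⟨0, fun h => absurd h ht⟩
  choose z hz using hlim
  refine ⟨z, ?_, fun s hs => ?_⟩
  · refine tendsto_nhds_unique (hz 0 h0).2 ?_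
    simp only [hα0]
    exact tendsto_const_nhds
  have hs' : s ∈ Icc (-1 : ℝ) 1 := Ioo_subset_Icc_self hs
  rw [hasDerivAt_iff_isLittleO, Asymptotics.isLittleO_iff]
  intro η hη
  have huc := hBc.uniformContinuousOn_of_continuous hF.continuousOn
  obtain ⟨δ, hδ, hδF⟩ := Metric.uniformContinuousOn_iff.1 huc η hη
  have hpos : 0 < δ / (L + 1) := by positivity
  filter_upwards [Icc_mem_nhds hs.1 hs.2, Metric.ball_mem_nhds s hpos] with t ht htδ
  -- The first order expansion at s holds with an error that is uniform in k apart from 1 / (k + 1),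
  -- so it survives the limit and gives the derivative of z.
  have hk : ∀ k, ‖α k t - α k s - (t - s) • F (α k s)‖ ≤ (η + 1 / ((k : ℝ) + 1)) * ‖t - s‖ := by
    intro k
    have hsub : uIcc s t ⊆ Icc (-1 : ℝ) 1 := by
      rw [uIcc_eq_union]; exact union_subset (Icc_subset_Icc hs'.1 ht.2) (Icc_subset_Icc ht.1 hs'.2)
    have := (convex_uIcc s t).norm_image_sub_le_of_norm_hasDerivWithin_le
      (f := fun τ => α k τ - τ • F (α k s)) (f' := fun τ => G k (α k τ) - F (α k s))
      (C := η + 1 / ((k : ℝ) + 1)) (x := s) (y := t) (fun τ hτ => by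
        have h1 := ((hα k τ (hsub hτ)).mono hsub)
        have h2 := ((hasDerivWithinAt_id τ (uIcc s t)).smul_const (F (α k s)))
        have h3 := h1.sub h2
        rw [one_smul] at h3
        exact h3) (fun τ hτ => by
        have h3 : dist (α k τ) (α k s) < δ := by
          rw [dist_eq_norm]
          refine (hlip k s hs' τ (hsub hτ)).trans_lt ?_
          have h4 : ‖τ - s‖ ≤ ‖t - s‖ := by
            simpa [abs_sub_comm] using abs_sub_left_of_mem_uIcc hτ
          rw [Metric.mem_ball, dist_eq_norm, lt_div_iff₀ (by positivity)] at htδ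
          nlinarith
        have h5 := hδF _ (hB k τ (hsub hτ)) _ (hB k s hs') h3
        rw [dist_eq_norm] at h5
        calc ‖G k (α k τ) - F (α k s)‖
            = ‖(G k (α k τ) - F (α k τ)) + (F (α k τ) - F (α k s))‖ := by abel_nf
          _ ≤ ‖G k (α k τ) - F (α k τ)‖ + ‖F (α k τ) - F (α k s)‖ := norm_add_le _ _
          _ ≤ η + 1 / ((k : ℝ) + 1) := by linarith [hGF k (α k τ)])
      left_mem_uIcc right_mem_uIcc
    convert this using 2
    simp only [sub_smul]; abel
  have hlim1 : Tendsto (fun k => ‖α k t - α k s - (t - s) • F (α k s)‖) (hyperfilter ℕ)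
      (𝓝 ‖z t - z s - (t - s) • F (z s)‖) :=
    (((hz t ht).2.sub (hz s hs').2).sub
      (((hF.tendsto _).comp (hz s hs').2).const_smul (t - s))).norm
  have hlim2 : Tendsto (fun k : ℕ => (η + 1 / ((k : ℝ) + 1)) * ‖t - s‖) (hyperfilter ℕ)
      (𝓝 ((η + 0) * ‖t - s‖)) :=
    ((tendsto_one_div_add_atTop_nhds_zero_nat.const_add η).mul_const _).mono_left
      Nat.hyperfilter_le_atTop
  simpa using le_of_tendsto_of_tendsto' hlim1 hlim2 hk

/-- Local form of Peano's theorem: a solution exists near `0` for a vector field which is continuous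
near the initial point. -/
theorem exists_eventually_hasDerivAt_of_continuousOn {F : E → E} {U : Set E} (hU : IsOpen U)
    (hF : ContinuousOn F U) {z₀ : E} (hz₀ : z₀ ∈ U) :
    ∃ z : ℝ → E, z 0 = z₀ ∧ ∀ᶠ t in 𝓝 (0 : ℝ), HasDerivAt z (F (z t)) t := by
  obtain ⟨r, hr, hrU⟩ := Metric.nhds_basis_closedBall.mem_iff.1 (hU.mem_nhds hz₀)
  -- Cutting off makes the field globally continuous and bounded; it is unchanged on the ball of
  -- radius r / 2, where the solution stays for short times.
  let ψ : ContDiffBump z₀ := ⟨r / 2, r, by positivity, by linarith⟩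
  have hFc : Continuous (fun x => ψ x • F x) := by
    refine continuous_of_tsupport fun x hx => ?_
    have hx' : x ∈ tsupport ψ := tsupport_smul_subset_left _ _ hx
    rw [ψ.tsupport_eq] at hx'
    exact ψ.continuous.continuousAt.smul (hF.continuousAt (hU.mem_nhds (hrU hx')))
  have hcs : HasCompactSupport (fun x => ψ x • F x) := ψ.hasCompactSupport.smul_right
  obtain ⟨L, hL⟩ := hcs.exists_bound_of_continuous hFc
  obtain ⟨z, hz0, hz⟩ := exists_hasDerivAt_of_continuous hFc hL z₀
  refine ⟨z, hz0, ?_⟩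
  have hc : ContinuousAt z 0 := (hz 0 (by norm_num)).continuousAt
  have hb : ∀ᶠ t in 𝓝 (0 : ℝ), z t ∈ Metric.closedBall z₀ (r / 2) :=
    hc.eventually (by rw [hz0]; exact Metric.closedBall_mem_nhds _ (by positivity))
  filter_upwards [hb, Ioo_mem_nhds (by norm_num : (-1 : ℝ) < 0) (by norm_num : (0 : ℝ) < 1)]
    with t ht ht'
  have := hz t ht'
  rwa [ψ.one_of_mem_closedBall ht, one_smul] at this

end Peano

/-! ### Uniqueness for fields that are Lipschitz up to a monotone function of one coordinate -/

section Uniqueness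

variable {E : Type*} [NormedAddCommGroup E] [NormedSpace ℝ E]

/-- After a shift of variables the integral collapses to the integral of φ over [t, t + k] minus
that over [0, k], and both are estimated by monotonicity. The gain is the factor k, the delay, in
front of an oscillation that is small for short times. -/
theorem integral_shift_sub_le {φ : ℝ → ℝ} (hφ : Continuous φ) (hm : Monotone φ) {t k m : ℝ}
    (hk : 0 ≤ k) (htk : t + k ≤ m) :
    ∫ τ in (0 : ℝ)..t, (φ (τ + k) - φ τ) ≤ k * (φ m - φ 0) := by
  have hi : ∀ a b : ℝ, IntervalIntegrable φ volume a b := fun a b => hφ.intervalIntegrable a b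
  have hc : Continuous fun τ => φ (τ + k) := by fun_prop
  rw [intervalIntegral.integral_sub (hc.intervalIntegrable _ _) (hi _ _),
    intervalIntegral.integral_comp_add_right, zero_add]
  have h1 := intervalIntegral.integral_add_adjacent_intervals (hi 0 k) (hi k (t + k))
  have h2 := intervalIntegral.integral_add_adjacent_intervals (hi 0 t) (hi t (t + k))
  have h3 : ∫ τ in t..(t + k), φ τ ≤ k * φ m := by
    have := intervalIntegral.integral_mono_on (by linarith : t ≤ t + k) (hi t (t + k))
      (intervalIntegrable_const (c := φ m)) (fun x hx => hm (hx.2.trans htk))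
    simpa using this
  have h4 : k * φ 0 ≤ ∫ τ in (0 : ℝ)..k, φ τ := by
    have := intervalIntegral.integral_mono_on hk (intervalIntegrable_const (c := φ 0)) (hi 0 k)
      (fun x hx => hm hx.1)
    simpa using this
  linarith

/-- A Grönwall type lemma: the non-Lipschitz part `|H (a t) - H (b t)|` of the bound is absorbed
because each of `a`, `b` catches up with the other after a time delay bounded by `δ`. -/
theorem eq_zero_of_norm_deriv_le_of_delay {δ δ' : ℝ → E} {a b H : ℝ → ℝ} {T C K : ℝ} (hT : 0 < T)
    (hC : 0 ≤ C) (hK : 0 ≤ K) (hδ0 : δ 0 = 0)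
    (hδ : ∀ t ∈ Icc 0 T, HasDerivAt δ (δ' t) t)
    (hbound : ∀ t ∈ Icc 0 T, ‖δ' t‖ ≤ C * (‖δ t‖ + |H (a t) - H (b t)|))
    (ha : ContinuousOn a (Icc 0 T)) (hb : ContinuousOn b (Icc 0 T))
    (hma : MonotoneOn a (Icc 0 T)) (hmb : MonotoneOn b (Icc 0 T))
    (hH : Monotone H) (hHc : Continuous H)
    (hshift : ∀ D ≥ 0, ∀ τ ≥ 0, τ + K * D ≤ T → (∀ σ ∈ Icc 0 τ, ‖δ σ‖ ≤ D) →
      b τ ≤ a (τ + K * D) ∧ a τ ≤ b (τ + K * D)) :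
    ∃ ε > 0, ∀ t ∈ Icc 0 ε, δ t = 0 := by
  -- The constant extension beyond [0, T] makes H ∘ c monotone and continuous on the whole line, so
  -- that it may be shifted freely.
  have ext : ∀ c : ℝ → ℝ, ContinuousOn c (Icc 0 T) → MonotoneOn c (Icc 0 T) →
      ∃ φ : ℝ → ℝ, Continuous φ ∧ Monotone φ ∧ ∀ t ∈ Icc 0 T, φ t = H (c t) := by
    intro c hc hmc
    refine ⟨IccExtend hT.le ((Icc 0 T).domRestrict fun t => H (c t)),
      (continuousOn_iff_continuous_domRestrict.1 (hHc.comp_continuousOn hc)).Icc_extend', ?_, ?_⟩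
    · exact Monotone.IccExtend _ fun x y hxy => hH (hmc x.2 y.2 hxy)
    · intro t ht
      rw [IccExtend_of_mem _ _ ht]; rfl
  obtain ⟨φ, hφc, hφm, hφ⟩ := ext a ha hma
  obtain ⟨ψ, hψc, hψm, hψ⟩ := ext b hb hmb
  -- The oscillations of φ and ψ contribute at most C K κ D ≤ D / 8 each, and the Lipschitz part at
  -- most D / 4 since C t₀ ≤ 1 / 4; together at most D / 2.
  set κ : ℝ := 1 / (8 * (C * K + 1)) with hκ
  have hκ0 : 0 < κ := by positivity
  have hev : ∀ᶠ r in 𝓝[>] (0 : ℝ), φ (2 * r) < φ 0 + κ ∧ ψ (2 * r) < ψ 0 + κ ∧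
      r < T / 2 ∧ r < 1 / (4 * (C + 1)) := by
    have h2 : Tendsto (fun r : ℝ => 2 * r) (𝓝 0) (𝓝 0) := by
      simpa using (continuous_const_mul (2 : ℝ)).tendsto 0
    have e1 := ((hφc.tendsto 0).comp h2).eventually (gt_mem_nhds (by linarith : φ 0 < φ 0 + κ))
    have e2 := ((hψc.tendsto 0).comp h2).eventually (gt_mem_nhds (by linarith : ψ 0 < ψ 0 + κ))
    have e3 := gt_mem_nhds (by positivity : (0 : ℝ) < T / 2)
    have e4 := gt_mem_nhds (by positivity : (0 : ℝ) < 1 / (4 * (C + 1)))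
    exact nhdsWithin_le_nhds (e1.and (e2.and (e3.and e4)))
  obtain ⟨r, ⟨h1, h2, h3, h4⟩, hr⟩ := (hev.and self_mem_nhdsWithin).exists
  replace hr : 0 < r := hr
  have hδcont : ∀ t ∈ Icc 0 T, ContinuousAt δ t := fun t ht => (hδ t ht).continuousAt
  have h0T : (0 : ℝ) ∈ Icc 0 T := ⟨le_rfl, hT.le⟩
  have hsmall : ∀ᶠ t in 𝓝 (0 : ℝ), K * ‖δ t‖ < r := by
    have : Tendsto (fun t => K * ‖δ t‖) (𝓝 0) (𝓝 (K * ‖δ 0‖)) :=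
      ((hδcont 0 h0T).norm.const_mul K)
    rw [hδ0, norm_zero, mul_zero] at this
    exact this.eventually (gt_mem_nhds hr)
  obtain ⟨ε', hε', hball⟩ := Metric.eventually_nhds_iff_ball.1 hsmall
  set ε := min r (ε' / 2) with hε
  have hε0 : 0 < ε := by positivity
  have hεr : ε ≤ r := min_le_left _ _
  have hεT : Icc 0 ε ⊆ Icc 0 T := Icc_subset_Icc_right (by linarith)
  have hKδ : ∀ t ∈ Icc 0 ε, K * ‖δ t‖ ≤ r := fun t ht => by
    refine (hball t ?_).le
    rw [Metric.mem_ball, Real.dist_eq, sub_zero, abs_of_nonneg ht.1]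
    linarith [ht.2, min_le_right r (ε' / 2)]
  -- D is the largest deviation on [0, ε] and k = K D the corresponding delay. Since k ≤ r and ε ≤
  -- r, all shifted times stay below 2 r < T.
  obtain ⟨t₀, ht₀, hmax⟩ := isCompact_Icc.exists_isMaxOn (nonempty_Icc.2 hε0.le)
    (f := fun t => ‖δ t‖) (fun t ht => (hδcont t (hεT ht)).norm.continuousWithinAt)
  set D := ‖δ t₀‖ with hD
  have hmax' : ∀ t ∈ Icc 0 ε, ‖δ t‖ ≤ D := fun t ht => hmax ht
  have hD0 : 0 ≤ D := norm_nonneg _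
  set k := K * D with hk
  have hk0 : 0 ≤ k := by positivity
  have hkr : k ≤ r := hKδ t₀ ht₀
  set ψφ : ℝ → ℝ := fun τ => (φ (τ + k) - φ τ) + (ψ (τ + k) - ψ τ) with hψφ
  have hψφc : Continuous ψφ := by fun_prop
  -- As each of a, b has passed the present level of the other at time τ + k, the difference of H ∘
  -- a and H ∘ b at τ is bounded by the increments of φ and ψ over [τ, τ + k].
  have hder : ∀ τ ∈ Icc 0 ε, ‖δ' τ‖ ≤ C * (D + ψφ τ) := by
    intro τ hτ
    refine (hbound τ (hεT hτ)).trans ?_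
    gcongr
    · exact hmax' τ hτ
    · have hτk : τ + k ∈ Icc 0 T := ⟨by linarith [hτ.1], by linarith [hτ.2]⟩
      obtain ⟨s1, s2⟩ := hshift D hD0 τ hτ.1 hτk.2 fun σ hσ => hmax' σ ⟨hσ.1, hσ.2.trans hτ.2⟩
      have e1 := hH s1
      have e2 := hH s2
      have m1 := hφm (by linarith : τ ≤ τ + k)
      have m2 := hψm (by linarith : τ ≤ τ + k)
      rw [← hφ _ hτk, ← hψ _ (hεT hτ)] at e1
      rw [← hψ _ hτk, ← hφ _ (hεT hτ)] at e2
      rw [← hφ _ (hεT hτ), ← hψ _ (hεT hτ), abs_le]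
      constructor <;> simp only [hψφ] <;> linarith
  have hB : ∀ t, HasDerivAt (fun t => C * (D * t + ∫ τ in (0 : ℝ)..t, ψφ τ)) (C * (D + ψφ t)) t :=
    fun t => by
      have := (((hasDerivAt_id t).const_mul D).add
        (hψφc.integral_hasStrictDerivAt 0 t).hasDerivAt).const_mul C
      simpa using this
  have hle := image_norm_le_of_norm_deriv_right_le_deriv_boundary (f := δ) (f' := δ') (a := 0)
    (b := ε) (fun t ht => (hδcont t (hεT ht)).continuousWithinAt)
    (fun t ht => (hδ t (hεT (Ico_subset_Icc_self ht))).hasDerivWithinAt) (by simp [hδ0]) hB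
    (fun t ht => hder t (Ico_subset_Icc_self ht)) ht₀
  have hinteg : ∫ τ in (0 : ℝ)..t₀, ψφ τ ≤ k * κ + k * κ := by
    rw [hψφ, intervalIntegral.integral_add
      (Continuous.intervalIntegrable (by fun_prop) _ _)
      (Continuous.intervalIntegrable (by fun_prop) _ _)]
    refine add_le_add ?_ ?_
    · exact (integral_shift_sub_le hφc hφm hk0 (by linarith [ht₀.2] : t₀ + k ≤ 2 * r)).trans
        (by gcongr; linarith)
    · exact (integral_shift_sub_le hψc hψm hk0 (by linarith [ht₀.2] : t₀ + k ≤ 2 * r)).trans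
        (by gcongr; linarith)
  have hfin : D ≤ D / 2 := by
    have e1 : C * t₀ ≤ 1 / 4 := by
      have : t₀ ≤ 1 / (4 * (C + 1)) := by linarith [ht₀.2]
      calc C * t₀ ≤ (C + 1) * (1 / (4 * (C + 1))) := by
            gcongr
            · exact ht₀.1
            · linarith
        _ = 1 / 4 := by field_simp
    have e2 : C * K * κ ≤ 1 / 8 := by
      calc C * K * κ ≤ (C * K + 1) * κ := by gcongr; linarith
        _ = 1 / 8 := by rw [hκ]; field_simp
    calc D ≤ C * (D * t₀ + ∫ τ in (0 : ℝ)..t₀, ψφ τ) := hle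
      _ ≤ C * (D * t₀ + (k * κ + k * κ)) := by gcongr
      _ = D * (C * t₀) + 2 * D * (C * K * κ) := by rw [hk]; ring
      _ ≤ D * (1 / 4) + 2 * D * (1 / 8) := by gcongr
      _ = D / 2 := by ring
  have hDz : D = 0 := by linarith
  exact ⟨ε, hε0, fun t ht => norm_le_zero_iff.1 ((hmax' t ht).trans hDz.le)⟩

theorem exists_Icc_of_eventually_nhds {p : ℝ → Prop} (h : ∀ᶠ t in 𝓝 (0 : ℝ), p t) :
    ∃ T > 0, ∀ t ∈ Icc 0 T, p t := by
  obtain ⟨ε, hε, hb⟩ := Metric.eventually_nhds_iff_ball.1 h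
  refine ⟨ε / 2, by positivity, fun t ht => hb t ?_⟩
  rw [Metric.mem_ball, Real.dist_eq, sub_zero, abs_of_nonneg ht.1]
  linarith [ht.2]

/-- `F` is Lipschitz near `z₀` up to increments of `H ∘ lam`, where `H` is monotone and continuous. -/
structure LipschitzUpTo (F : E → E) (lam : E →L[ℝ] ℝ) (H : ℝ → ℝ) (C : ℝ) (z₀ : E) : Prop where
  monotone : Monotone H
  continuous : Continuous H
  nonneg : 0 ≤ C
  le : ∃ U ∈ 𝓝 z₀, ∀ z ∈ U, ∀ y ∈ U, ‖F z - F y‖ ≤ C * (‖z - y‖ + |H (lam z) - H (lam y)|)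

/-- Allows the case where `lam` decreases along solutions to be reduced to the increasing one; r ↦
-H(-r) is again monotone and has the same absolute increments. -/
theorem LipschitzUpTo.neg_functional {F : E → E} {lam : E →L[ℝ] ℝ} {H : ℝ → ℝ} {C : ℝ} {z₀ : E}
    (h : LipschitzUpTo F lam H C z₀) : LipschitzUpTo F (-lam) (fun r => -H (-r)) C z₀ where
  monotone r s hrs := neg_le_neg (h.monotone (neg_le_neg hrs))
  continuous := (h.continuous.comp continuous_neg).neg
  nonneg := h.nonneg
  le := by
    obtain ⟨U, hU, hle⟩ := h.le
    refine ⟨U, hU, fun z hz y hy => (hle z hz y hy).trans_eq ?_⟩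
    simp only [neg_apply, neg_neg]
    rw [← abs_neg (H (lam z) - H (lam y))]; ring_nf

/-- Used to reverse time. -/
theorem LipschitzUpTo.neg {F : E → E} {lam : E →L[ℝ] ℝ} {H : ℝ → ℝ} {C : ℝ} {z₀ : E}
    (h : LipschitzUpTo F lam H C z₀) : LipschitzUpTo (fun z => -F z) lam H C z₀ where
  monotone := h.monotone
  continuous := h.continuous
  nonneg := h.nonneg
  le := by
    obtain ⟨U, hU, hle⟩ := h.le
    refine ⟨U, hU, fun z hz y hy => le_trans (le_of_eq ?_) (hle z hz y hy)⟩
    rw [← norm_neg]; congr 1; abel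

variable {F : E → E} {lam : E →L[ℝ] ℝ} {H : ℝ → ℝ} {C : ℝ} {z₀ : E} {z y : ℝ → E}

theorem monotoneOn_of_hasDerivAt_nonneg {a a' : ℝ → ℝ} {T : ℝ}
    (h : ∀ t ∈ Icc 0 T, HasDerivAt a (a' t) t) (h' : ∀ t ∈ Icc 0 T, 0 ≤ a' t) :
    MonotoneOn a (Icc 0 T) := by
  refine monotoneOn_of_deriv_nonneg (convex_Icc _ _)
    (fun t ht => (h t ht).continuousAt.continuousWithinAt)
    (fun t ht => (h t (interior_subset ht)).differentiableAt.differentiableWithinAt) fun t ht => ?_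
  rw [(h t (interior_subset ht)).deriv]
  exact h' t (interior_subset ht)

theorem mul_sub_le_image_sub {a a' : ℝ → ℝ} {s t c : ℝ} (hst : s ≤ t)
    (h : ∀ r ∈ Icc s t, HasDerivAt a (a' r) r) (h' : ∀ r ∈ Icc s t, c ≤ a' r) :
    c * (t - s) ≤ a t - a s := by
  refine (convex_Icc s t).mul_sub_le_image_sub_of_le_deriv
    (fun r hr => (h r hr).continuousAt.continuousWithinAt)
    (fun r hr => (h r (interior_subset hr)).differentiableAt.differentiableWithinAt)
    (fun r hr => ?_) s (left_mem_Icc.2 hst) t (right_mem_Icc.2 hst) hst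
  rw [(h r (interior_subset hr)).deriv]
  exact h' r (interior_subset hr)

/-- With c half the initial speed of `lam`, the value of `lam` grows at rate at least c along both
solutions. Deviations up to D separate the values by at most ‖lam‖ D, which is made up after the
delay ‖lam‖ D / c. -/
theorem exists_eq_right_of_transversal_pos (hF : LipschitzUpTo F lam H C z₀)
    (hFc : ContinuousAt F z₀) (hpos : 0 < lam (F z₀))
    (hz : ∀ᶠ t in 𝓝 (0 : ℝ), HasDerivAt z (F (z t)) t) (hz0 : z 0 = z₀)
    (hy : ∀ᶠ t in 𝓝 (0 : ℝ), HasDerivAt y (F (y t)) t) (hy0 : y 0 = z₀) :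
    ∃ ε > 0, ∀ t ∈ Icc 0 ε, z t = y t := by
  obtain ⟨U, hU, hle⟩ := hF.le
  set c := lam (F z₀) / 2 with hc
  have hc0 : 0 < c := by positivity
  have hUc : ∀ᶠ w in 𝓝 z₀, w ∈ U ∧ c < lam (F w) := by
    refine Eventually.and hU ?_
    have : ContinuousAt (fun w => lam (F w)) z₀ := lam.continuous.continuousAt.comp hFc
    exact this.eventually (lt_mem_nhds (by linarith))
  have hzc : ContinuousAt z 0 := hz.self_of_nhds.continuousAt
  have hyc : ContinuousAt y 0 := hy.self_of_nhds.continuousAt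
  have hzU := hzc.eventually (hz0.symm ▸ hUc)
  have hyU := hyc.eventually (hy0.symm ▸ hUc)
  obtain ⟨T, hT, hall⟩ := exists_Icc_of_eventually_nhds (hz.and (hy.and (hzU.and hyU)))
  have hza : ∀ t ∈ Icc 0 T, HasDerivAt (fun t => lam (z t)) (lam (F (z t))) t := fun t ht =>
    lam.hasFDerivAt.comp_hasDerivAt t (hall t ht).1
  have hyb : ∀ t ∈ Icc 0 T, HasDerivAt (fun t => lam (y t)) (lam (F (y t))) t := fun t ht =>
    lam.hasFDerivAt.comp_hasDerivAt t (hall t ht).2.1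
  have hnorm : ∀ u v : E, |lam u - lam v| ≤ ‖lam‖ * ‖u - v‖ := fun u v => by
    rw [← map_sub]; exact lam.le_opNorm _
  obtain ⟨ε, hε, h0⟩ := eq_zero_of_norm_deriv_le_of_delay (δ := fun t => z t - y t)
    (δ' := fun t => F (z t) - F (y t)) (a := fun t => lam (z t)) (b := fun t => lam (y t))
    (K := ‖lam‖ / c) hT hF.nonneg (by positivity) (by simp [hz0, hy0])
    (fun t ht => (hall t ht).1.sub (hall t ht).2.1)
    (fun t ht => hle _ (hall t ht).2.2.1.1 _ (hall t ht).2.2.2.1)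
    (fun t ht => (hza t ht).continuousAt.continuousWithinAt)
    (fun t ht => (hyb t ht).continuousAt.continuousWithinAt)
    (monotoneOn_of_hasDerivAt_nonneg hza fun t ht => (hc0.trans (hall t ht).2.2.1.2).le)
    (monotoneOn_of_hasDerivAt_nonneg hyb fun t ht => (hc0.trans (hall t ht).2.2.2.2).le)
    hF.monotone hF.continuous (by
      intro D hD τ hτ hτT hδ
      have hd : 0 ≤ ‖lam‖ / c * D := by positivity
      have hsub : Icc τ (τ + ‖lam‖ / c * D) ⊆ Icc 0 T := Icc_subset_Icc hτ hτT
      have h1 := mul_sub_le_image_sub (c := c) (by linarith : τ ≤ τ + ‖lam‖ / c * D)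
        (fun r hr => hza r (hsub hr)) (fun r hr => (hall r (hsub hr)).2.2.1.2.le)
      have h2 := mul_sub_le_image_sub (c := c) (by linarith : τ ≤ τ + ‖lam‖ / c * D)
        (fun r hr => hyb r (hsub hr)) (fun r hr => (hall r (hsub hr)).2.2.2.2.le)
      have h3 : c * (τ + ‖lam‖ / c * D - τ) = ‖lam‖ * D := by field_simp; ring
      have h4 : |lam (z τ) - lam (y τ)| ≤ ‖lam‖ * D := (hnorm _ _).trans (by
        gcongr; exact hδ τ ⟨hτ, le_rfl⟩)
      rw [abs_le] at h4
      constructor <;> linarith)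
  exact ⟨ε, hε, fun t ht => sub_eq_zero.1 (h0 t ht)⟩

/-- Here the speed ζ of `lam` starts at zero but satisfies ζ ≥ c t along solutions, so `lam` is
still monotone for positive times. Integrating |ζ(z) - ζ(y)| ≤ L D shows that the levels differ by
at most L D τ at time τ, while from then on the speed is at least c τ. The factors τ cancel, and the
delay is L D / c. -/
theorem exists_eq_right_of_tangential_pos {ζ : E → ℝ} (hF : LipschitzUpTo F lam H C z₀)
    (hFc : ContinuousAt F z₀) (hζ : ContDiffAt ℝ 1 ζ z₀) (hζF : ∀ᶠ w in 𝓝 z₀, lam (F w) = ζ w)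
    (hζ0 : ζ z₀ = 0) (hpos : 0 < fderiv ℝ ζ z₀ (F z₀))
    (hz : ∀ᶠ t in 𝓝 (0 : ℝ), HasDerivAt z (F (z t)) t) (hz0 : z 0 = z₀)
    (hy : ∀ᶠ t in 𝓝 (0 : ℝ), HasDerivAt y (F (y t)) t) (hy0 : y 0 = z₀) :
    ∃ ε > 0, ∀ t ∈ Icc 0 ε, z t = y t := by
  obtain ⟨U, hU, hle⟩ := hF.le
  obtain ⟨L, W, hW, hLip⟩ := hζ.exists_lipschitzOnWith
  set c := fderiv ℝ ζ z₀ (F z₀) / 2 with hc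
  have hc0 : 0 < c := by positivity
  have hUc : ∀ᶠ w in 𝓝 z₀, w ∈ U ∧ w ∈ W ∧ lam (F w) = ζ w ∧ c < fderiv ℝ ζ w (F w) ∧
      DifferentiableAt ℝ ζ w := by
    refine Eventually.and hU (Eventually.and hW (hζF.and (Eventually.and ?_ ?_)))
    · have : ContinuousAt (fun w => fderiv ℝ ζ w (F w)) z₀ :=
        (hζ.continuousAt_fderiv one_ne_zero).clm_apply hFc
      exact this.eventually (lt_mem_nhds (by linarith))
    · exact (hζ.eventually (by simp)).mono fun w hw => hw.differentiableAt one_ne_zero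
  have hzc : ContinuousAt z 0 := hz.self_of_nhds.continuousAt
  have hyc : ContinuousAt y 0 := hy.self_of_nhds.continuousAt
  have hzU := hzc.eventually (hz0.symm ▸ hUc)
  have hyU := hyc.eventually (hy0.symm ▸ hUc)
  obtain ⟨T, hT, hall⟩ := exists_Icc_of_eventually_nhds (hz.and (hy.and (hzU.and hyU)))
  have h0T : (0 : ℝ) ∈ Icc 0 T := ⟨le_rfl, hT.le⟩
  have hza : ∀ t ∈ Icc 0 T, HasDerivAt (fun t => lam (z t)) (ζ (z t)) t := fun t ht => by
    rw [← (hall t ht).2.2.1.2.2.1]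
    exact lam.hasFDerivAt.comp_hasDerivAt t (hall t ht).1
  have hyb : ∀ t ∈ Icc 0 T, HasDerivAt (fun t => lam (y t)) (ζ (y t)) t := fun t ht => by
    rw [← (hall t ht).2.2.2.2.2.1]
    exact lam.hasFDerivAt.comp_hasDerivAt t (hall t ht).2.1
  have hza' : ∀ t ∈ Icc 0 T, HasDerivAt (fun t => ζ (z t)) (fderiv ℝ ζ (z t) (F (z t))) t :=
    fun t ht => (hall t ht).2.2.1.2.2.2.2.hasFDerivAt.comp_hasDerivAt t (hall t ht).1
  have hyb' : ∀ t ∈ Icc 0 T, HasDerivAt (fun t => ζ (y t)) (fderiv ℝ ζ (y t) (F (y t))) t :=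
    fun t ht => (hall t ht).2.2.2.2.2.2.2.hasFDerivAt.comp_hasDerivAt t (hall t ht).2.1
  have hzlow : ∀ t ∈ Icc 0 T, c * t ≤ ζ (z t) := fun t ht => by
    have := mul_sub_le_image_sub (c := c) ht.1
      (fun r hr => hza' r ⟨hr.1, hr.2.trans ht.2⟩)
      (fun r hr => (hall r ⟨hr.1, hr.2.trans ht.2⟩).2.2.1.2.2.2.1.le)
    rwa [hz0, hζ0, sub_zero, sub_zero] at this
  have hylow : ∀ t ∈ Icc 0 T, c * t ≤ ζ (y t) := fun t ht => by
    have := mul_sub_le_image_sub (c := c) ht.1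
      (fun r hr => hyb' r ⟨hr.1, hr.2.trans ht.2⟩)
      (fun r hr => (hall r ⟨hr.1, hr.2.trans ht.2⟩).2.2.2.2.2.2.1.le)
    rwa [hy0, hζ0, sub_zero, sub_zero] at this
  obtain ⟨ε, hε, h0⟩ := eq_zero_of_norm_deriv_le_of_delay (δ := fun t => z t - y t)
    (δ' := fun t => F (z t) - F (y t)) (a := fun t => lam (z t)) (b := fun t => lam (y t))
    (K := L / c) hT hF.nonneg (by positivity) (by simp [hz0, hy0])
    (fun t ht => (hall t ht).1.sub (hall t ht).2.1)
    (fun t ht => hle _ (hall t ht).2.2.1.1 _ (hall t ht).2.2.2.1)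
    (fun t ht => (hza t ht).continuousAt.continuousWithinAt)
    (fun t ht => (hyb t ht).continuousAt.continuousWithinAt)
    (monotoneOn_of_hasDerivAt_nonneg hza fun t ht =>
      (mul_nonneg hc0.le ht.1).trans (hzlow t ht))
    (monotoneOn_of_hasDerivAt_nonneg hyb fun t ht =>
      (mul_nonneg hc0.le ht.1).trans (hylow t ht))
    hF.monotone hF.continuous (by
      intro D hD τ hτ hτT hδ
      have hd : 0 ≤ L / c * D := by positivity
      have hτ' : Icc 0 τ ⊆ Icc 0 T := Icc_subset_Icc_right (by linarith)
      have hsub : Icc τ (τ + L / c * D) ⊆ Icc 0 T := Icc_subset_Icc hτ hτT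
      have h1 := mul_sub_le_image_sub (c := c * τ) (by linarith : τ ≤ τ + L / c * D)
        (fun r hr => hza r (hsub hr)) (fun r hr =>
          (mul_le_mul_of_nonneg_left hr.1 hc0.le).trans (hzlow r (hsub hr)))
      have h2 := mul_sub_le_image_sub (c := c * τ) (by linarith : τ ≤ τ + L / c * D)
        (fun r hr => hyb r (hsub hr)) (fun r hr =>
          (mul_le_mul_of_nonneg_left hr.1 hc0.le).trans (hylow r (hsub hr)))
      have h3 : c * τ * (τ + L / c * D - τ) = L * D * τ := by field_simp; ring
      have h5 : ∀ r ∈ Icc 0 τ, |ζ (z r) - ζ (y r)| ≤ L * D := fun r hr => by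
        have := hLip.dist_le_mul _ (hall r (hτ' hr)).2.2.1.2.1 _ (hall r (hτ' hr)).2.2.2.2.1
        rw [Real.dist_eq, dist_eq_norm] at this
        exact this.trans (by gcongr; exact hδ r hr)
      have h4 : ‖(lam (z τ) - lam (y τ)) - (lam (z 0) - lam (y 0))‖ ≤ L * D * ‖τ - 0‖ :=
        (convex_Icc 0 τ).norm_image_sub_le_of_norm_hasDerivWithin_le
          (f := fun r => lam (z r) - lam (y r)) (f' := fun r => ζ (z r) - ζ (y r))
          (fun r hr => ((hza r (hτ' hr)).sub (hyb r (hτ' hr))).hasDerivWithinAt)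
          h5 ⟨le_rfl, hτ⟩ ⟨hτ, le_rfl⟩
      rw [hz0, hy0, sub_self, sub_zero, sub_zero, Real.norm_eq_abs, Real.norm_eq_abs,
        abs_of_nonneg hτ, abs_le] at h4
      constructor <;> linarith)
  exact ⟨ε, hε, fun t ht => sub_eq_zero.1 (h0 t ht)⟩

theorem exists_eq_right_of_transversal (hF : LipschitzUpTo F lam H C z₀)
    (hFc : ContinuousAt F z₀) (hne : lam (F z₀) ≠ 0)
    (hz : ∀ᶠ t in 𝓝 (0 : ℝ), HasDerivAt z (F (z t)) t) (hz0 : z 0 = z₀)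
    (hy : ∀ᶠ t in 𝓝 (0 : ℝ), HasDerivAt y (F (y t)) t) (hy0 : y 0 = z₀) :
    ∃ ε > 0, ∀ t ∈ Icc 0 ε, z t = y t := by
  rcases lt_or_gt_of_ne hne with h | h
  · exact exists_eq_right_of_transversal_pos hF.neg_functional hFc (by simpa using h) hz hz0 hy hy0
  · exact exists_eq_right_of_transversal_pos hF hFc h hz hz0 hy hy0

theorem exists_eq_right_of_tangential {ζ : E → ℝ} (hF : LipschitzUpTo F lam H C z₀)
    (hFc : ContinuousAt F z₀) (hζ : ContDiffAt ℝ 1 ζ z₀) (hζF : ∀ᶠ w in 𝓝 z₀, lam (F w) = ζ w)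
    (hζ0 : ζ z₀ = 0) (hne : fderiv ℝ ζ z₀ (F z₀) ≠ 0)
    (hz : ∀ᶠ t in 𝓝 (0 : ℝ), HasDerivAt z (F (z t)) t) (hz0 : z 0 = z₀)
    (hy : ∀ᶠ t in 𝓝 (0 : ℝ), HasDerivAt y (F (y t)) t) (hy0 : y 0 = z₀) :
    ∃ ε > 0, ∀ t ∈ Icc 0 ε, z t = y t := by
  rcases lt_or_gt_of_ne hne with h | h
  · exact exists_eq_right_of_tangential_pos (ζ := fun w => -ζ w) hF.neg_functional hFc hζ.neg
      (hζF.mono fun w hw => by simp [hw]) (by simp [hζ0])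
      (by rw [fderiv_fun_neg]; simpa using h) hz hz0 hy hy0
  · exact exists_eq_right_of_tangential_pos hF hFc hζ hζF hζ0 h hz hz0 hy hy0

theorem eventuallyEq_of_right_of_left {X : Type*} {z y : ℝ → X} {t₀ : ℝ}
    (hr : ∃ ε > 0, ∀ t ∈ Icc 0 ε, z (t₀ + t) = y (t₀ + t))
    (hl : ∃ ε > 0, ∀ t ∈ Icc 0 ε, z (t₀ - t) = y (t₀ - t)) : z =ᶠ[𝓝 t₀] y := by
  obtain ⟨ε, hε, h⟩ := hr
  obtain ⟨ε', hε', h'⟩ := hl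
  filter_upwards [Ioo_mem_nhds (by linarith : t₀ - ε' < t₀) (by linarith : t₀ < t₀ + ε)] with t ht
  rcases le_total t₀ t with h0 | h0
  · simpa using h (t - t₀) ⟨by linarith, by linarith [ht.2]⟩
  · simpa using h' (t₀ - t) ⟨by linarith, by linarith [ht.1]⟩

theorem eventually_hasDerivAt_comp_add {t₀ : ℝ} (hz : ∀ᶠ t in 𝓝 t₀, HasDerivAt z (F (z t)) t) :
    ∀ᶠ t in 𝓝 (0 : ℝ), HasDerivAt (fun t => z (t₀ + t)) (F (z (t₀ + t))) t := by
  have : Tendsto (fun t : ℝ => t₀ + t) (𝓝 0) (𝓝 t₀) := by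
    simpa using (continuous_const_add t₀).tendsto 0
  filter_upwards [this.eventually hz] with t ht using ht.comp_const_add t₀ t

theorem eventually_hasDerivAt_comp_sub {t₀ : ℝ} (hz : ∀ᶠ t in 𝓝 t₀, HasDerivAt z (F (z t)) t) :
    ∀ᶠ t in 𝓝 (0 : ℝ), HasDerivAt (fun t => z (t₀ - t)) (-F (z (t₀ - t))) t := by
  have : Tendsto (fun t : ℝ => t₀ - t) (𝓝 0) (𝓝 t₀) := by
    simpa using (continuous_sub_left t₀).tendsto 0
  filter_upwards [this.eventually hz] with t ht using ht.comp_const_sub t₀ t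

/-- Uniqueness for solutions crossing the levels of `lam` transversally. -/
theorem eventuallyEq_of_transversal {t₀ : ℝ} (hF : LipschitzUpTo F lam H C z₀)
    (hFc : ContinuousAt F z₀) (hne : lam (F z₀) ≠ 0)
    (hz : ∀ᶠ t in 𝓝 t₀, HasDerivAt z (F (z t)) t) (hz0 : z t₀ = z₀)
    (hy : ∀ᶠ t in 𝓝 t₀, HasDerivAt y (F (y t)) t) (hy0 : y t₀ = z₀) : z =ᶠ[𝓝 t₀] y := by
  refine eventuallyEq_of_right_of_left ?_ ?_
  · exact exists_eq_right_of_transversal hF hFc hne (eventually_hasDerivAt_comp_add hz)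
      (by simp [hz0]) (eventually_hasDerivAt_comp_add hy) (by simp [hy0])
  · exact exists_eq_right_of_transversal hF.neg hFc.neg (by simpa using hne)
      (eventually_hasDerivAt_comp_sub hz) (by simp [hz0]) (eventually_hasDerivAt_comp_sub hy)
      (by simp [hy0])

/-- Uniqueness for solutions that touch a level of `lam` to exactly second order. -/
theorem eventuallyEq_of_tangential {t₀ : ℝ} {ζ : E → ℝ} (hF : LipschitzUpTo F lam H C z₀)
    (hFc : ContinuousAt F z₀) (hζ : ContDiffAt ℝ 1 ζ z₀) (hζF : ∀ᶠ w in 𝓝 z₀, lam (F w) = ζ w)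
    (hζ0 : ζ z₀ = 0) (hne : fderiv ℝ ζ z₀ (F z₀) ≠ 0)
    (hz : ∀ᶠ t in 𝓝 t₀, HasDerivAt z (F (z t)) t) (hz0 : z t₀ = z₀)
    (hy : ∀ᶠ t in 𝓝 t₀, HasDerivAt y (F (y t)) t) (hy0 : y t₀ = z₀) : z =ᶠ[𝓝 t₀] y := by
  refine eventuallyEq_of_right_of_left ?_ ?_
  · exact exists_eq_right_of_tangential hF hFc hζ hζF hζ0 hne (eventually_hasDerivAt_comp_add hz)
      (by simp [hz0]) (eventually_hasDerivAt_comp_add hy) (by simp [hy0])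
  · exact exists_eq_right_of_tangential (ζ := fun w => -ζ w) hF.neg hFc.neg hζ.neg
      (hζF.mono fun w hw => by simp [hw]) (by simp [hζ0])
      (by rw [fderiv_fun_neg]; simpa using hne)
      (eventually_hasDerivAt_comp_sub hz) (by simp [hz0]) (eventually_hasDerivAt_comp_sub hy)
      (by simp [hy0])

end Uniqueness

/-! ### Partial derivatives -/

section PartialDerivatives

variable {n : ℕ}

/-- The `j`-th coordinate vector of `ℝⁿ`. -/
abbrev coordVec (j : Fin n) : Coord n := EuclideanSpace.single j (1 : ℝ)

/-- The partial derivative `∂_j U`. -/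
def pd (j : Fin n) (U : Coord n → ℝ) (x : Coord n) : ℝ := fderiv ℝ U x (coordVec j)

/-- Iterated partial derivatives. -/
def pds (l : List (Fin n)) (U : Coord n → ℝ) : Coord n → ℝ := l.foldr pd U

@[simp] theorem pds_nil (U : Coord n → ℝ) : pds [] U = U := rfl

/-- `pds` applies the last entry of its list first, so a derivative that acts before the others is
appended at the end. -/
theorem pds_pd (l : List (Fin n)) (j : Fin n) (U : Coord n → ℝ) :
    pds l (pd j U) = pds (l ++ [j]) U := by simp [pds]

variable {D : Set (Coord n)} {U W : Coord n → ℝ}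

theorem contDiffOn_pd (hD : IsOpen D) (hU : ContDiffOn ℝ ∞ U D) (j : Fin n) :
    ContDiffOn ℝ ∞ (pd j U) D :=
  (hU.fderiv_of_isOpen hD (by simp)).clm_apply contDiffOn_const

theorem contDiffOn_pds (hD : IsOpen D) (hU : ContDiffOn ℝ ∞ U D) (l : List (Fin n)) :
    ContDiffOn ℝ ∞ (pds l U) D := by
  induction l with
  | nil => exact hU
  | cons j l ih => exact contDiffOn_pd hD ih j

theorem eqOn_pd (hD : IsOpen D) (h : EqOn U W D) (j : Fin n) : EqOn (pd j U) (pd j W) D := by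
  intro x hx
  have : U =ᶠ[𝓝 x] W := h.eventuallyEq_of_mem (hD.mem_nhds hx)
  simp only [pd, this.fderiv_eq]

theorem pd_comm (hD : IsOpen D) (hU : ContDiffOn ℝ ∞ U D) (i j : Fin n) :
    EqOn (pd i (pd j U)) (pd j (pd i U)) D := by
  intro x hx
  have hat : ContDiffAt ℝ ∞ U x := hU.contDiffAt (hD.mem_nhds hx)
  have hd : DifferentiableAt ℝ (fderiv ℝ U) x :=
    ((hU.fderiv_of_isOpen (m := ∞) hD (by simp)).contDiffAt (hD.mem_nhds hx)).differentiableAt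
      (by simp)
  have h (k l : Fin n) : pd k (pd l U) x = fderiv ℝ (fderiv ℝ U) x (coordVec k) (coordVec l) := by
    have : pd l U = fun y => fderiv ℝ U y (coordVec l) := rfl
    rw [pd, this, fderiv_clm_apply hd (differentiableAt_const _)]
    simp
  rw [h, h]
  exact hat.isSymmSndFDerivAt (by
    rw [minSmoothness_of_isRCLikeNormedField]; exact WithTop.coe_le_coe.2 le_top) _ _

theorem pd_pds_comm (hD : IsOpen D) (hU : ContDiffOn ℝ ∞ U D) (i : Fin n) (l : List (Fin n)) :
    EqOn (pd i (pds l U)) (pds l (pd i U)) D := by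
  induction l with
  | nil => exact fun _ _ => rfl
  | cons j l ih =>
    exact (pd_comm hD (contDiffOn_pds hD hU l) i j).trans (eqOn_pd hD ih j)

theorem hasDerivAt_line (hD : IsOpen D) (hU : ContDiffOn ℝ ∞ U D) (j : Fin n) (x : Coord n)
    (c : ℝ) {s : ℝ} (hs : x + (s - c) • coordVec j ∈ D) :
    HasDerivAt (fun s => U (x + (s - c) • coordVec j)) (pd j U (x + (s - c) • coordVec j)) s := by
  have h1 : HasFDerivAt U (fderiv ℝ U (x + (s - c) • coordVec j)) (x + (s - c) • coordVec j) :=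
    ((hU.contDiffAt (hD.mem_nhds hs)).differentiableAt (by simp)).hasFDerivAt
  have h2 : HasDerivAt (fun s : ℝ => x + (s - c) • coordVec j) (coordVec j) s := by
    simpa using (((hasDerivAt_id s).sub_const c).smul_const (coordVec j)).const_add x
  exact h1.comp_hasDerivAt s h2

theorem toLp_update (x : Fin n → ℝ) (j : Fin n) (s : ℝ) :
    (WithLp.toLp 2 (Function.update x j s) : Coord n) =
      WithLp.toLp 2 x + (s - x j) • coordVec j := by
  ext k
  by_cases h : k = j
  · subst h; simp
  · simp [h]

end PartialDerivatives

/-! ### Pointwise bounds by integrals of mixed derivatives -/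

section SupBound

theorem enorm_sub_le_lintegral_deriv {u u' : ℝ → ℝ} {a b x y : ℝ}
    (hu : ∀ s ∈ Ioo a b, HasDerivAt u (u' s) s) (hc : ContinuousOn u' (Ioo a b))
    (hx : x ∈ Ioo a b) (hy : y ∈ Ioo a b) :
    ‖u x - u y‖ₑ ≤ ∫⁻ s in uIoc y x, ‖u' s‖ₑ := by
  have hsub : uIcc y x ⊆ Ioo a b := ordConnected_Ioo.uIcc_subset hy hx
  rw [← intervalIntegral.integral_eq_sub_of_hasDerivAt (fun s hs => hu s (hsub hs))
    (hc.mono hsub).intervalIntegrable]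
  rw [← ofReal_norm, intervalIntegral.norm_integral_eq_norm_integral_uIoc,
    ofReal_norm]
  exact enorm_integral_le_lintegral_enorm _

/-- The one-dimensional Sobolev inequality: average |u(x)| ≤ |u(y)| + ∫ |u'| over y in the interval.
With extended nonnegative integrals no integrability has to be assumed. -/
theorem enorm_le_lintegral_add_deriv {u u' : ℝ → ℝ} {a b x : ℝ}
    (hu : ∀ s ∈ Ioo a b, HasDerivAt u (u' s) s) (hc : ContinuousOn u' (Ioo a b))
    (hx : x ∈ Ioo a b) :
    ‖u x‖ₑ ≤ ∫⁻ s in Ioo a b, (ENNReal.ofReal (1 / (b - a)) * ‖u s‖ₑ + ‖u' s‖ₑ) := by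
  have hab : 0 < b - a := by linarith [hx.1, hx.2]
  set I := ∫⁻ s in Ioo a b, ‖u' s‖ₑ with hI
  have h1 : ∀ y ∈ Ioo a b, ‖u x‖ₑ ≤ ‖u y‖ₑ + I := fun y hy => by
    have h2 := enorm_sub_le_lintegral_deriv hu hc hx hy
    have hsub : uIoc y x ⊆ Ioo a b :=
      uIoc_subset_uIcc.trans (ordConnected_Ioo.uIcc_subset hy hx)
    calc ‖u x‖ₑ = ‖u y + (u x - u y)‖ₑ := by ring_nf
      _ ≤ ‖u y‖ₑ + ‖u x - u y‖ₑ := enorm_add_le _ _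
      _ ≤ ‖u y‖ₑ + I := by gcongr; exact h2.trans (lintegral_mono_set hsub)
  have hucont : ContinuousOn u (Ioo a b) := fun s hs => (hu s hs).continuousAt.continuousWithinAt
  have hmeas : AEMeasurable (fun s => ‖u s‖ₑ) (volume.restrict (Ioo a b)) :=
    (hucont.aemeasurable measurableSet_Ioo).enorm
  set c := ENNReal.ofReal (1 / (b - a)) with hcdef
  have hcv : c * ENNReal.ofReal (b - a) = 1 := by
    rw [hcdef, ← ENNReal.ofReal_mul (by positivity), one_div_mul_cancel hab.ne', ENNReal.ofReal_one]
  have h3 : ∫⁻ _ in Ioo a b, ‖u x‖ₑ ≤ ∫⁻ y in Ioo a b, (‖u y‖ₑ + I) :=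
    setLIntegral_mono' measurableSet_Ioo h1
  rw [lintegral_add_right _ measurable_const, setLIntegral_const, setLIntegral_const,
    Real.volume_Ioo] at h3
  rw [lintegral_add_left' (hmeas.const_mul c), lintegral_const_mul'' _ hmeas]
  calc ‖u x‖ₑ = c * (‖u x‖ₑ * ENNReal.ofReal (b - a)) := by
        rw [mul_comm ‖u x‖ₑ, ← mul_assoc, hcv, one_mul]
    _ ≤ c * ((∫⁻ y in Ioo a b, ‖u y‖ₑ) + I * ENNReal.ofReal (b - a)) := by gcongr
    _ = c * (∫⁻ y in Ioo a b, ‖u y‖ₑ) + I := by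
        rw [mul_add, mul_comm I, ← mul_assoc, hcv, one_mul]

variable {n : ℕ}

/-- The open cube of half side `R` about `x₀`. -/
def box (x₀ : Coord n) (R : ℝ) : Set (Coord n) := {x | ∀ k, |x k - x₀ k| < R}

theorem isOpen_box (x₀ : Coord n) (R : ℝ) : IsOpen (box x₀ R) := by
  have : box x₀ R = ⋂ k, {x : Coord n | |x k - x₀ k| < R} := by ext; simp [box]
  rw [this]
  exact isOpen_iInter_of_finite fun k => isOpen_lt (by fun_prop) continuous_const

/-- The cube with the hyperplane `x_i = 0` removed. -/
def cutBox (x₀ : Coord n) (R : ℝ) (i : Fin n) : Set (Coord n) := box x₀ R ∩ {x | x i ≠ 0}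

theorem isOpen_cutBox (x₀ : Coord n) (R : ℝ) (i : Fin n) : IsOpen (cutBox x₀ R i) :=
  (isOpen_box x₀ R).inter (isOpen_ne_fun (by fun_prop) continuous_const)

/-- `w` is smooth off the hyperplane, and all its tangential derivatives are integrable. -/
structure TangentiallyIntegrable (x₀ : Coord n) (R : ℝ) (i : Fin n) (w : Coord n → ℝ) : Prop where
  contDiffOn : ContDiffOn ℝ ∞ w (cutBox x₀ R i)
  integrableOn : ∀ l : List (Fin n), (∀ j ∈ l, j ≠ i) → IntegrableOn (pds l w) (box x₀ R)

variable {x₀ : Coord n} {R : ℝ} {i : Fin n} {w : Coord n → ℝ}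

theorem TangentiallyIntegrable.pd (hw : TangentiallyIntegrable x₀ R i w) {j : Fin n} (hj : j ≠ i) :
    TangentiallyIntegrable x₀ R i (pd j w) where
  contDiffOn := contDiffOn_pd (isOpen_cutBox _ _ _) hw.contDiffOn j
  integrableOn l hl := by
    rw [pds_pd]
    exact hw.integrableOn _ fun k hk => by
      rcases List.mem_append.1 hk with hk | hk
      · exact hl k hk
      · rw [List.mem_singleton.1 hk]; exact hj

/-- The Sobolev inequality is applied in one tangential variable after another. Each step trades the
value in the variable j for an integral in j of the bounds for w and for `pd j w`. The induction
starts with |w| itself, set to zero off the cut cube. -/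
theorem TangentiallyIntegrable.exists_lmarginal_bound (hw : TangentiallyIntegrable x₀ R i w)
    (s : Finset (Fin n)) (his : i ∉ s) :
    ∃ k : (Fin n → ℝ) → ℝ≥0∞, Measurable k ∧ ∫⁻ x, k x ≠ ⊤ ∧
      ∀ x : Fin n → ℝ, WithLp.toLp 2 x ∈ cutBox x₀ R i →
        ‖w (WithLp.toLp 2 x)‖ₑ ≤ (∫⋯∫⁻_s, k ∂(fun _ => volume)) x := by
  classical
  induction s using Finset.induction_on generalizing w with
  | empty =>
    have hmeas : Measurable ((cutBox x₀ R i).piecewise (fun x => ‖w x‖ₑ) (fun _ => 0)) :=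
      (hw.contDiffOn.continuousOn.enorm).measurable_piecewise continuousOn_const
        (isOpen_cutBox x₀ R i).measurableSet
    refine ⟨fun x => (cutBox x₀ R i).piecewise (fun x => ‖w x‖ₑ) (fun _ => 0) (WithLp.toLp 2 x),
      hmeas.comp (PiLp.volume_preserving_toLp (Fin n)).measurable, ?_, ?_⟩
    · rw [(PiLp.volume_preserving_toLp (Fin n)).lintegral_comp hmeas]
      refine ne_top_of_le_ne_top (hw.integrableOn [] (by simp)).2.ne ?_
      rw [← lintegral_indicator (isOpen_box x₀ R).measurableSet]
      refine lintegral_mono fun x => ?_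
      by_cases hx : x ∈ cutBox x₀ R i
      · simp [hx, hx.1]
      · simp [hx]
    · intro x hx
      simp [hx]
  | insert j s hjs ih =>
    have hji : j ≠ i := fun h => his (h ▸ Finset.mem_insert_self j s)
    have his' : i ∉ s := fun h => his (Finset.mem_insert_of_mem h)
    obtain ⟨k₁, hm₁, hf₁, hb₁⟩ := ih hw his'
    obtain ⟨k₂, hm₂, hf₂, hb₂⟩ := ih (hw.pd hji) his'
    set c := ENNReal.ofReal (1 / ((x₀ j + R) - (x₀ j - R))) with hc
    have hm : Measurable fun x => c * k₁ x + k₂ x := (hm₁.const_mul c).add hm₂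
    refine ⟨fun x => c * k₁ x + k₂ x, hm, ?_, fun x hx => ?_⟩
    · rw [lintegral_add_left (hm₁.const_mul c), lintegral_const_mul _ hm₁]
      exact ENNReal.add_ne_top.2 ⟨ENNReal.mul_ne_top ENNReal.ofReal_ne_top hf₁, hf₂⟩
    rw [lmarginal_insert _ hm hjs]
    -- A line in a tangential direction never meets the hyperplane, so w is smooth along it.
    have hmem : ∀ t ∈ Ioo (x₀ j - R) (x₀ j + R),
        WithLp.toLp 2 (Function.update x j t) ∈ cutBox x₀ R i := by
      intro t ht
      refine ⟨fun m => ?_, ?_⟩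
      · by_cases hmj : m = j
        · subst hmj
          simp only [Function.update_self]
          rw [abs_lt]; constructor <;> linarith [ht.1, ht.2]
        · simpa [hmj] using hx.1 m
      · simpa [hji.symm] using hx.2
    have hxj : x j ∈ Ioo (x₀ j - R) (x₀ j + R) := by
      have := abs_lt.1 (hx.1 j)
      simp only at this
      constructor <;> linarith
    have hline : ∀ t ∈ Ioo (x₀ j - R) (x₀ j + R), HasDerivAt
        (fun t => w (WithLp.toLp 2 (Function.update x j t)))
        (ConormalFlow.pd j w (WithLp.toLp 2 (Function.update x j t))) t := by
      intro t ht
      have := hmem t ht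
      simp only [toLp_update] at this ⊢
      exact hasDerivAt_line (isOpen_cutBox _ _ _) hw.contDiffOn j _ _ this
    have hcont : ContinuousOn (fun t => ConormalFlow.pd j w
        (WithLp.toLp 2 (Function.update x j t))) (Ioo (x₀ j - R) (x₀ j + R)) :=
      (hw.pd hji).contDiffOn.continuousOn.comp
        (Continuous.continuousOn (by simp only [toLp_update]; fun_prop)) hmem
    have key := enorm_le_lintegral_add_deriv hline hcont hxj
    rw [Function.update_eq_self] at key
    refine key.trans ((setLIntegral_mono' measurableSet_Ioo fun t ht => ?_).trans
      (setLIntegral_le_lintegral _ _))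
    have hadd : (∫⋯∫⁻_s, (fun x => c * k₁ x + k₂ x) ∂(fun _ => volume)) (Function.update x j t) =
        c * (∫⋯∫⁻_s, k₁ ∂(fun _ => volume)) (Function.update x j t) +
          (∫⋯∫⁻_s, k₂ ∂(fun _ => volume)) (Function.update x j t) := by
      simp only [lmarginal]
      rw [lintegral_add_left, lintegral_const_mul]
      · exact hm₁.comp measurable_updateFinset
      · exact (hm₁.comp measurable_updateFinset).const_mul c
    rw [hadd]
    gcongr
    · exact hb₁ _ (hmem t ht)
    · exact hb₂ _ (hmem t ht)

/-- A tangentially integrable function is dominated by an integrable function of the normal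
variable. -/
theorem TangentiallyIntegrable.exists_bound (hw : TangentiallyIntegrable x₀ R i w) :
    ∃ h : ℝ → ℝ≥0∞, Measurable h ∧ ∫⁻ r, h r ≠ ⊤ ∧ ∀ x ∈ cutBox x₀ R i, ‖w x‖ₑ ≤ h (x i) := by
  classical
  obtain ⟨k, hm, hf, hb⟩ := hw.exists_lmarginal_bound (Finset.univ.erase i) (by simp)
  -- Integrated over all variables but the i-th, the bound depends on x only through x_i; the
  -- remaining entries may be taken to be 0.
  refine ⟨fun r => (∫⋯∫⁻_Finset.univ.erase i, k ∂(fun _ => volume)) (Function.update 0 i r),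
    (hm.lmarginal _).comp (measurable_update 0), ?_, fun x hx => ?_⟩
  · rw [← lmarginal_erase (μ := fun _ : Fin n => (volume : Measure ℝ)) k hm (Finset.mem_univ i) 0,
      lmarginal_univ]
    exact hf
  · refine (hb (WithLp.ofLp x) hx).trans_eq (lmarginal_congr _ _ fun j hj => ?_)
    have : j = i := by simpa using hj
    subst this
    simp

end SupBound

/-! ### Increments off the hyperplane -/

section Increments

variable {n : ℕ} {x₀ : Coord n} {R : ℝ} {i : Fin n}

theorem clm_apply_eq_sum (L : Coord n →L[ℝ] ℝ) (v : Coord n) :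
    L v = ∑ j, v j * L (coordVec j) := by
  conv_lhs => rw [← (EuclideanSpace.basisFun (Fin n) ℝ).sum_repr v]
  simp

theorem add_smul_coordVec_same (x : Coord n) (c : ℝ) : (x + c • coordVec i) i = x i + c := by simp

theorem add_smul_coordVec_of_ne (x : Coord n) (c : ℝ) {k : Fin n} (hk : k ≠ i) :
    (x + c • coordVec i) k = x k := by simp [hk]

theorem line_mem_box {x : Coord n} (hx : x ∈ box x₀ R) {s : ℝ} (hs : |s - x₀ i| < R) :
    x + (s - x i) • coordVec i ∈ box x₀ R := by
  intro k
  by_cases hk : k = i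
  · subst hk; rw [add_smul_coordVec_same]; simpa using hs
  · rw [add_smul_coordVec_of_ne _ _ hk]; exact hx k

theorem box_mono {r : ℝ} (h : r ≤ R) : box x₀ r ⊆ box x₀ R := fun _ hx k => (hx k).trans_le h

theorem cutBox_mono {r : ℝ} (h : r ≤ R) : cutBox x₀ r i ⊆ cutBox x₀ R i :=
  inter_subset_inter_left _ (box_mono h)

theorem convex_box : Convex ℝ (box x₀ R) := by
  have : box x₀ R = ⋂ k, {x : Coord n | |x k - x₀ k| < R} := by ext; simp [box]
  rw [this]
  refine convex_iInter fun k => ?_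
  have h2 : {x : Coord n | |x k - x₀ k| < R} =
      (EuclideanSpace.proj k : Coord n →L[ℝ] ℝ) ⁻¹' (Metric.ball (x₀ k) R) := by
    ext x; simp [Real.dist_eq]
  rw [h2]
  exact (convex_ball _ _).linear_preimage (EuclideanSpace.proj k : Coord n →L[ℝ] ℝ).toLinearMap

/-- The condition 0 < x_i s keeps the normal segment on one side of the hyperplane, where the
fundamental theorem of calculus applies. -/
theorem abs_sub_le_integral_of_line {G : Coord n → ℝ} {h : ℝ → ℝ≥0∞} (hx₀ : x₀ i = 0)
    (hG : ContDiffOn ℝ ∞ G (cutBox x₀ R i)) (hm : Measurable h) (hf : ∫⁻ r, h r ≠ ⊤)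
    (hb : ∀ x ∈ cutBox x₀ R i, ‖pd i G x‖ₑ ≤ h (x i)) {x : Coord n} (hx : x ∈ cutBox x₀ R i)
    {s : ℝ} (hs : |s| < R) (hxs : 0 < x i * s) :
    |G x - G (x + (s - x i) • coordVec i)| ≤ |∫ r in s..(x i), (h r).toReal| := by
  have hxR : |x i| < R := by simpa [hx₀] using hx.1 i
  have key : ∀ a b : ℝ, (∀ t ∈ Ioo a b, |t| < R ∧ t ≠ 0) → x i ∈ Ioo a b → s ∈ Ioo a b →
      ‖G x - G (x + (s - x i) • coordVec i)‖ₑ ≤ ∫⁻ r in uIoc s (x i), h r := by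
    intro a b hab hxab hsab
    have hmem : ∀ t ∈ Ioo a b, x + (t - x i) • coordVec i ∈ cutBox x₀ R i := fun t ht =>
      ⟨line_mem_box hx.1 (by simpa [hx₀] using (hab t ht).1), by
        have : (x + (t - x i) • coordVec i) i = t := by rw [add_smul_coordVec_same]; ring
        rw [mem_ofPred_eq, this]; exact (hab t ht).2⟩
    have h1 := enorm_sub_le_lintegral_deriv (x := x i) (y := s)
      (fun t ht => hasDerivAt_line (isOpen_cutBox _ _ _) hG i x (x i) (hmem t ht))
      ((contDiffOn_pd (isOpen_cutBox _ _ _) hG i).continuousOn.comp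
        (Continuous.continuousOn (by fun_prop)) hmem) hxab hsab
    simp only [sub_self, zero_smul, add_zero] at h1
    refine h1.trans (setLIntegral_mono' measurableSet_uIoc fun t ht => ?_)
    have ht' : t ∈ Ioo a b :=
      ordConnected_Ioo.uIcc_subset hsab hxab (uIoc_subset_uIcc ht)
    refine (hb _ (hmem t ht')).trans_eq ?_
    rw [add_smul_coordVec_same]; congr 1; ring
  have hle : ‖G x - G (x + (s - x i) • coordVec i)‖ₑ ≤ ∫⁻ r in uIoc s (x i), h r := by
    rcases pos_and_pos_or_neg_and_neg_of_mul_pos hxs with ⟨h1, h2⟩ | ⟨h1, h2⟩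
    · refine key 0 R (fun t ht => ⟨?_, ht.1.ne'⟩) ⟨h1, (abs_lt.1 hxR).2⟩ ⟨h2, (abs_lt.1 hs).2⟩
      rw [abs_of_pos ht.1]; exact ht.2
    · refine key (-R) 0 (fun t ht => ⟨?_, ht.2.ne⟩) ⟨(abs_lt.1 hxR).1, h1⟩ ⟨(abs_lt.1 hs).1, h2⟩
      rw [abs_of_neg ht.2]; linarith [ht.1]
  have hfin : ∫⁻ r in uIoc s (x i), h r ≠ ⊤ :=
    ne_top_of_le_ne_top hf (setLIntegral_le_lintegral _ _)
  rw [intervalIntegral.abs_intervalIntegral_eq, abs_of_nonneg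
    (integral_nonneg fun _ => ENNReal.toReal_nonneg),
    integral_toReal hm.aemeasurable (ae_lt_top hm hfin)]
  have := ENNReal.toReal_mono hfin hle
  rwa [toReal_enorm, Real.norm_eq_abs] at this

/-- The normal derivatives of `U` and of its tangential derivatives are dominated by a common
integrable function of the normal variable. -/
structure NormallyDominated (x₀ : Coord n) (R : ℝ) (i : Fin n) (U : Coord n → ℝ) (h : ℝ → ℝ≥0∞) :
    Prop where
  contDiffOn : ContDiffOn ℝ ∞ U (cutBox x₀ R i)
  measurable : Measurable h
  lintegral_ne_top : ∫⁻ r, h r ≠ ⊤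
  le : ∀ x ∈ cutBox x₀ R i, ‖pd i U x‖ₑ ≤ h (x i)
  le_pd : ∀ j ≠ i, ∀ x ∈ cutBox x₀ R i, ‖pd i (pd j U) x‖ₑ ≤ h (x i)

theorem exists_normallyDominated {U : Coord n → ℝ} (hU : ContDiffOn ℝ ∞ U (cutBox x₀ R i))
    (h₀ : TangentiallyIntegrable x₀ R i (pd i U))
    (h₁ : ∀ j ≠ i, TangentiallyIntegrable x₀ R i (pd i (pd j U))) :
    ∃ h, NormallyDominated x₀ R i U h := by
  classical
  obtain ⟨k₀, hm₀, hf₀, hb₀⟩ := h₀.exists_bound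
  have hex : ∀ j : Fin n, ∃ k : ℝ → ℝ≥0∞, Measurable k ∧ ∫⁻ r, k r ≠ ⊤ ∧
      (j ≠ i → ∀ x ∈ cutBox x₀ R i, ‖pd i (pd j U) x‖ₑ ≤ k (x i)) := fun j => by
    by_cases hj : j = i
    · exact ⟨0, measurable_zero, by simp, fun h => absurd hj h⟩
    · obtain ⟨k, h1, h2, h3⟩ := (h₁ j hj).exists_bound
      exact ⟨k, h1, h2, fun _ => h3⟩
  choose k hm hf hb using hex
  refine ⟨fun r => k₀ r + ∑ j, k j r, hU, hm₀.add (Finset.measurable_sum _ fun j _ => hm j), ?_,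
    fun x hx => (hb₀ x hx).trans le_self_add, fun j hj x hx => (hb j hj x hx).trans ?_⟩
  · rw [lintegral_add_left hm₀, lintegral_finsetSum _ fun j _ => hm j]
    exact ENNReal.add_ne_top.2 ⟨hf₀, ENNReal.sum_ne_top.2 fun j _ => hf j⟩
  · exact (Finset.single_le_sum (f := fun j => k j (x i)) (fun _ _ => zero_le) (Finset.mem_univ j)).trans
      le_add_self

variable {U : Coord n → ℝ} {h : ℝ → ℝ≥0∞}

theorem NormallyDominated.integrable (hU : NormallyDominated x₀ R i U h) :
    Integrable fun r => (h r).toReal :=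
  integrable_toReal_of_lintegral_ne_top hU.measurable.aemeasurable hU.lintegral_ne_top

theorem isCompact_closedBox (x₀ : Coord n) (r : ℝ) :
    IsCompact {x : Coord n | ∀ k, |x k - x₀ k| ≤ r} := by
  have h1 : IsCompact (univ.pi fun k => Icc (x₀ k - r) (x₀ k + r)) :=
    isCompact_univ_pi fun _ => isCompact_Icc
  convert h1.image (PiLp.continuous_toLp 2 (fun _ : Fin n => ℝ)) using 1
  ext x
  simp only [mem_ofPred_eq, mem_image, Set.mem_pi, mem_univ, true_implies, mem_Icc]
  constructor
  · intro hx
    exact ⟨WithLp.ofLp x, fun k => by have := abs_le.1 (hx k); constructor <;> linarith, rfl⟩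
  · rintro ⟨y, hy, rfl⟩ k
    have := hy k
    simp only [abs_le]
    constructor <;> linarith

/-- The tangential derivative is bounded on the two compact slices x_i = ±R/4. Every other point is
joined to the slice on its side by a normal segment, along which the derivative changes by at most
the total integral of h. -/
theorem NormallyDominated.exists_bound_pd (hU : NormallyDominated x₀ R i U h) (hx₀ : x₀ i = 0)
    (hR : 0 < R) {j : Fin n} (hj : j ≠ i) :
    ∃ M, ∀ x ∈ cutBox x₀ (R / 2) i, |pd j U x| ≤ M := by
  have hcd := contDiffOn_pd (isOpen_cutBox _ _ _) hU.contDiffOn j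
  have hK : ∀ c : ℝ, c ≠ 0 → IsCompact ({x : Coord n | ∀ k, |x k - x₀ k| ≤ R / 2} ∩ {x | x i = c}) :=
    fun c _ => (isCompact_closedBox x₀ (R / 2)).inter_right
      (isClosed_eq (by fun_prop) continuous_const)
  have hsub : ∀ c : ℝ, c ≠ 0 → {x : Coord n | ∀ k, |x k - x₀ k| ≤ R / 2} ∩ {x | x i = c} ⊆
      cutBox x₀ R i := by
    rintro c hc x ⟨h1, rfl⟩
    exact ⟨fun k => (h1 k).trans_lt (by linarith), hc⟩
  have hb : ∀ c : ℝ, c ≠ 0 → ∃ M, ∀ x ∈ {x : Coord n | ∀ k, |x k - x₀ k| ≤ R / 2} ∩ {x | x i = c},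
      ‖pd j U x‖ ≤ M := fun c hc =>
    (hK c hc).exists_bound_of_continuousOn (hcd.continuousOn.mono (hsub c hc))
  obtain ⟨M₁, hM₁⟩ := hb (R / 4) (by positivity)
  obtain ⟨M₂, hM₂⟩ := hb (-(R / 4)) (neg_ne_zero.2 (by positivity))
  set I := ∫ r, (h r).toReal with hI
  have hinteg : ∀ a b : ℝ, |∫ r in a..b, (h r).toReal| ≤ I := fun a b => by
    rw [intervalIntegral.abs_intervalIntegral_eq, abs_of_nonneg
      (integral_nonneg fun _ => ENNReal.toReal_nonneg)]
    exact setIntegral_le_integral hU.integrable (.of_forall fun _ => ENNReal.toReal_nonneg)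
  refine ⟨max M₁ M₂ + I, fun x hx => ?_⟩
  have hgen : ∀ s : ℝ, |s| = R / 4 → 0 < x i * s →
      |pd j U (x + (s - x i) • coordVec i)| ≤ max M₁ M₂ → |pd j U x| ≤ max M₁ M₂ + I := by
    intro s hs hxs hM
    have h1 := abs_sub_le_integral_of_line hx₀ hcd hU.measurable hU.lintegral_ne_top
      (hU.le_pd j hj) (cutBox_mono (by linarith) hx) (s := s) (by rw [hs]; linarith) hxs
    have h2 := h1.trans (hinteg s (x i))
    have h3 := abs_sub_abs_le_abs_sub (pd j U x) (pd j U (x + (s - x i) • coordVec i))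
    linarith
  have hmemK : ∀ s : ℝ, |s| = R / 4 → x + (s - x i) • coordVec i ∈
      {x : Coord n | ∀ k, |x k - x₀ k| ≤ R / 2} ∩ {x | x i = s} := fun s hs =>
    ⟨fun k => (line_mem_box hx.1 (by rw [hx₀, sub_zero, hs]; linarith) k).le, by
      rw [mem_ofPred_eq, add_smul_coordVec_same]; ring⟩
  rcases lt_or_gt_of_ne hx.2 with h0 | h0
  · refine hgen (-(R / 4)) (by rw [abs_neg, abs_of_pos (by positivity)])
      (mul_pos_of_neg_of_neg h0 (by linarith)) ?_
    exact (hM₂ _ (hmemK _ (by rw [abs_neg, abs_of_pos (by positivity)]))).trans (le_max_right _ _)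
  · refine hgen (R / 4) (abs_of_pos (by positivity)) (mul_pos h0 (by positivity)) ?_
    exact (hM₁ _ (hmemK _ (abs_of_pos (by positivity)))).trans (le_max_left _ _)

theorem abs_coord_le_norm (v : Coord n) (k : Fin n) : |v k| ≤ ‖v‖ := by
  simpa using PiLp.norm_apply_le v k

theorem norm_le_norm_add_smul {v : Coord n} (hv : v i = 0) (c : ℝ) :
    ‖v‖ ≤ ‖v + c • coordVec i‖ := by
  rw [EuclideanSpace.norm_eq, EuclideanSpace.norm_eq]
  refine Real.sqrt_le_sqrt (Finset.sum_le_sum fun k _ => ?_)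
  by_cases hk : k = i
  · subst hk; rw [hv, norm_zero, zero_pow two_ne_zero]; positivity
  · rw [add_smul_coordVec_of_ne _ _ hk]

/-- On either side of the hyperplane, `U` is Lipschitz up to increments of `∫ h`. -/
theorem NormallyDominated.exists_abs_sub_le (hU : NormallyDominated x₀ R i U h) (hx₀ : x₀ i = 0)
    (hR : 0 < R) :
    ∃ C ≥ 0, ∀ x ∈ cutBox x₀ (R / 2) i, ∀ y ∈ cutBox x₀ (R / 2) i, 0 < x i * y i →
      |U x - U y| ≤ C * ‖x - y‖ + |∫ r in (y i)..(x i), (h r).toReal| := by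
  have hex : ∀ j : Fin n, ∃ M, 0 ≤ M ∧ (j ≠ i → ∀ x ∈ cutBox x₀ (R / 2) i, |pd j U x| ≤ M) :=
    fun j => by
      by_cases hj : j = i
      · exact ⟨0, le_rfl, fun h => absurd hj h⟩
      · obtain ⟨M, hM⟩ := hU.exists_bound_pd hx₀ hR hj
        exact ⟨max M 0, le_max_right _ _, fun _ x hx => (hM x hx).trans (le_max_left _ _)⟩
  choose M hM0 hM using hex
  have hcd : ContDiffOn ℝ ∞ U (cutBox x₀ (R / 2) i) :=
    hU.contDiffOn.mono (cutBox_mono (by linarith))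
  refine ⟨∑ j, M j, Finset.sum_nonneg fun j _ => hM0 j, fun x hx y hy hxy => ?_⟩
  -- From y one first moves in the normal direction to y', at the cost of an integral of h, and then
  -- to x at constant x_i, where only the bounded tangential derivatives enter.
  set y' := y + (x i - y i) • coordVec i with hy'
  have hxR : |x i - x₀ i| < R / 2 := hx.1 i
  have hy'box : y' ∈ box x₀ (R / 2) := line_mem_box hy.1 hxR
  have hy'i : y' i = x i := by rw [hy', add_smul_coordVec_same]; ring
  have h1 : |U y - U y'| ≤ |∫ r in (x i)..(y i), (h r).toReal| :=
    abs_sub_le_integral_of_line hx₀ hU.contDiffOn hU.measurable hU.lintegral_ne_top hU.le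
      (cutBox_mono (by linarith) hy) (by rw [hx₀, sub_zero] at hxR; linarith) (by rwa [mul_comm])
  have hnorm : ‖y' - x‖ ≤ ‖x - y‖ := by
    have h0 : (y' - x) i = 0 := by
      change y' i - x i = 0
      rw [hy'i, sub_self]
    have := norm_le_norm_add_smul h0 (y i - x i)
    refine this.trans_eq ?_
    rw [norm_sub_rev]
    congr 1
    rw [hy']; module
  have hseg : ∀ t ∈ Icc (0 : ℝ) 1, x + t • (y' - x) ∈ cutBox x₀ (R / 2) i := fun t ht => by
    refine ⟨convex_box.add_smul_sub_mem hx.1 hy'box ht, ?_⟩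
    have : (x + t • (y' - x)) i = x i := by
      change x i + t * (y' i - x i) = x i
      rw [hy'i]; ring
    rw [mem_ofPred_eq, this]; exact hx.2
  have h2 : |U y' - U x| ≤ (∑ j, M j) * ‖x - y‖ := by
    have hder : ∀ t ∈ Icc (0 : ℝ) 1, HasDerivWithinAt (fun t : ℝ => U (x + t • (y' - x)))
        (fderiv ℝ U (x + t • (y' - x)) (y' - x)) (Icc 0 1) t := fun t ht => by
      have h3 : HasDerivAt (fun t : ℝ => x + t • (y' - x)) (y' - x) t := by
        simpa using ((hasDerivAt_id t).smul_const (y' - x)).const_add x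
      exact (((hcd.contDiffAt ((isOpen_cutBox _ _ _).mem_nhds (hseg t ht))).differentiableAt
        (by simp)).hasFDerivAt.comp_hasDerivAt t h3).hasDerivWithinAt
    have := (convex_Icc (0 : ℝ) 1).norm_image_sub_le_of_norm_hasDerivWithin_le hder
      (C := (∑ j, M j) * ‖x - y‖) (fun t ht => by
        rw [clm_apply_eq_sum, Finset.sum_mul]
        refine norm_sum_le_of_le _ fun j _ => ?_
        by_cases hj : j = i
        · subst hj
          have : (y' - x) j = 0 := by change y' j - x j = 0; rw [hy'i, sub_self]
          rw [this, zero_mul, norm_zero]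
          exact mul_nonneg (hM0 j) (norm_nonneg _)
        · rw [norm_mul, mul_comm]
          exact mul_le_mul (hM j hj _ (hseg t ht)) ((abs_coord_le_norm _ _).trans hnorm)
            (norm_nonneg _) (hM0 j)) (left_mem_Icc.2 zero_le_one) (right_mem_Icc.2 zero_le_one)
    simpa using this
  have h3 : |U x - U y| ≤ |U y' - U x| + |U y - U y'| := by
    rw [abs_sub_comm (U x)]
    have : U y - U x = (U y' - U x) + (U y - U y') := by ring
    rw [this]; exact abs_add_le _ _
  rw [intervalIntegral.integral_symm, abs_neg]
  linarith

end Increments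

/-! ### No jump across the hyperplane -/

section NoJump

theorem exists_tendsto_of_abs_sub_le {n : ℕ} {U : Coord n → ℝ} {S : Set (Coord n)} {H : ℝ → ℝ}
    {C : ℝ} {i : Fin n} (hH : Continuous H)
    (hS : ∀ x ∈ S, ∀ y ∈ S, |U x - U y| ≤ C * ‖x - y‖ + |H (x i) - H (y i)|) {z : Coord n}
    [(𝓝[S] z).NeBot] : ∃ ℓ, Tendsto U (𝓝[S] z) (𝓝 ℓ) := by
  refine cauchy_map_iff_exists_tendsto.1 (cauchy_map_iff.2 ⟨inferInstance, ?_⟩)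
  rw [Metric.uniformity_eq_comap_nhds_zero, tendsto_comap_iff]
  have hfst : Tendsto (fun p : Coord n × Coord n => p.1) (𝓝[S] z ×ˢ 𝓝[S] z) (𝓝 z) :=
    tendsto_fst.mono_right nhdsWithin_le_nhds
  have hsnd : Tendsto (fun p : Coord n × Coord n => p.2) (𝓝[S] z ×ˢ 𝓝[S] z) (𝓝 z) :=
    tendsto_snd.mono_right nhdsWithin_le_nhds
  have hev : Tendsto (fun x : Coord n => H (x i)) (𝓝 z) (𝓝 (H (z i))) :=
    Continuous.tendsto (by fun_prop) z
  have hlim : Tendsto (fun p : Coord n × Coord n => C * ‖p.1 - p.2‖ + |H (p.1 i) - H (p.2 i)|)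
      (𝓝[S] z ×ˢ 𝓝[S] z) (𝓝 0) := by
    simpa using ((hfst.sub hsnd).norm.const_mul C).add
      ((hev.comp hfst).sub (hev.comp hsnd)).abs
  refine squeeze_zero' (.of_forall fun _ => dist_nonneg) ?_ hlim
  have hmem : ∀ᶠ p in 𝓝[S] z ×ˢ 𝓝[S] z, p.1 ∈ S ∧ p.2 ∈ S :=
    Eventually.prod_mk (la := 𝓝[S] z) (lb := 𝓝[S] z) self_mem_nhdsWithin self_mem_nhdsWithin
  filter_upwards [hmem] with p hp
  exact hS _ hp.1 _ hp.2

theorem integrable_mul_of_tsupport_subset {n : ℕ} {U ψ : Coord n → ℝ} {Ω : Set (Coord n)}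
    (hU : IntegrableOn U Ω) (hψ : Continuous ψ) (hc : HasCompactSupport ψ)
    (hs : tsupport ψ ⊆ Ω) : Integrable fun x => U x * ψ x := by
  obtain ⟨B, hB⟩ := hc.exists_bound_of_continuous hψ
  have h1 : IntegrableOn (fun x => U x * ψ x) Ω :=
    Integrable.mul_bdd (c := B) hU hψ.aestronglyMeasurable (.of_forall hB)
  refine (integrableOn_iff_integrable_of_support_subset fun x hx => ?_).1 h1
  exact hs (subset_tsupport _ (right_ne_zero_of_mul hx))

theorem tsupport_pd_subset {n : ℕ} (i : Fin n) (φ : Coord n → ℝ) :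
    tsupport (pd i φ) ⊆ tsupport φ := tsupport_fderiv_apply_subset ℝ _

/-- `w` is the `i`-th weak derivative of `U` on `Ω`. -/
def IsWeakPd {n : ℕ} (i : Fin n) (Ω : Set (Coord n)) (U w : Coord n → ℝ) : Prop :=
  ∀ φ : Coord n → ℝ, ContDiff ℝ ∞ φ → HasCompactSupport φ → tsupport φ ⊆ Ω →
    ∫ x, U x * pd i φ x = -∫ x, w x * φ x

/-- The positive or negative side (according to the sign of `σ`) of the cube. -/
def sideBox {n : ℕ} (x₀ : Coord n) (R : ℝ) (i : Fin n) (σ : ℝ) : Set (Coord n) :=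
  box x₀ R ∩ {x | 0 < σ * x i}

theorem sideBox_subset_cutBox {n : ℕ} {x₀ : Coord n} {R : ℝ} {i : Fin n} {σ : ℝ} :
    sideBox x₀ R i σ ⊆ cutBox x₀ R i := fun x hx => ⟨hx.1, fun h => by
  have := hx.2
  simp [h] at this⟩

theorem mul_pos_of_mem_sideBox {n : ℕ} {x₀ x y : Coord n} {R : ℝ} {i : Fin n} {σ : ℝ}
    (hx : x ∈ sideBox x₀ R i σ) (hy : y ∈ sideBox x₀ R i σ) : 0 < x i * y i := by
  have h1 : 0 < σ * x i := hx.2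
  have h2 : 0 < σ * y i := hy.2
  rcases pos_and_pos_or_neg_and_neg_of_mul_pos h1 with ⟨_, h⟩ | ⟨hσ, h⟩
  · exact mul_pos h ((pos_iff_pos_of_mul_pos h2).1 ‹_›)
  · exact mul_pos_of_neg_of_neg h ((neg_iff_neg_of_mul_pos h2).1 hσ)

theorem tendsto_line_sideBox {n : ℕ} {x₀ z : Coord n} {R : ℝ} {i : Fin n} (hz : z ∈ box x₀ R)
    (hzi : z i = 0) :
    Tendsto (fun s : ℝ => z + s • coordVec i) (𝓝[>] 0) (𝓝[sideBox x₀ R i 1] z) ∧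
    Tendsto (fun s : ℝ => z + s • coordVec i) (𝓝[<] 0) (𝓝[sideBox x₀ R i (-1)] z) := by
  have hc : Tendsto (fun s : ℝ => z + s • coordVec i) (𝓝 0) (𝓝 z) := by
    have : Continuous fun s : ℝ => z + s • coordVec i := by fun_prop
    simpa using this.tendsto 0
  have hbox : ∀ᶠ s in 𝓝 (0 : ℝ), z + s • coordVec i ∈ box x₀ R :=
    hc.eventually ((isOpen_box x₀ R).mem_nhds hz)
  refine ⟨tendsto_nhdsWithin_iff.2 ⟨hc.mono_left nhdsWithin_le_nhds, ?_⟩,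
    tendsto_nhdsWithin_iff.2 ⟨hc.mono_left nhdsWithin_le_nhds, ?_⟩⟩
  · filter_upwards [nhdsWithin_le_nhds hbox, self_mem_nhdsWithin] with s h1 h2
    refine ⟨h1, ?_⟩
    rw [mem_ofPred_eq, add_smul_coordVec_same, hzi]
    simpa using h2
  · filter_upwards [nhdsWithin_le_nhds hbox, self_mem_nhdsWithin] with s h1 h2
    refine ⟨h1, ?_⟩
    rw [mem_ofPred_eq, add_smul_coordVec_same, hzi]
    simpa using h2

theorem neBot_sideBox {n : ℕ} {x₀ z : Coord n} {R : ℝ} {i : Fin n} (hz : z ∈ box x₀ R)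
    (hzi : z i = 0) : (𝓝[sideBox x₀ R i 1] z).NeBot ∧ (𝓝[sideBox x₀ R i (-1)] z).NeBot :=
  ⟨(tendsto_line_sideBox hz hzi).1.neBot, (tendsto_line_sideBox hz hzi).2.neBot⟩

theorem insertNth_eq_add {m : ℕ} (i : Fin (m + 1)) (s : ℝ) (x : Fin m → ℝ) :
    (WithLp.toLp 2 (i.insertNth s x) : Coord (m + 1)) =
      WithLp.toLp 2 (i.insertNth 0 x) + s • coordVec i := by
  ext k
  refine Fin.succAboveCases i ?_ (fun j => ?_) k
  · simp
  · simp

theorem measurePreserving_insertNth {m : ℕ} (i : Fin (m + 1)) :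
    MeasurePreserving (fun p : ℝ × (Fin m → ℝ) =>
      (WithLp.toLp 2 (i.insertNth p.1 p.2) : Coord (m + 1))) :=
  (PiLp.volume_preserving_toLp (Fin (m + 1))).comp
    (volume_preserving_piFinSuccAbove (fun _ => ℝ) i).symm

theorem measurableEmbedding_insertNth {m : ℕ} (i : Fin (m + 1)) :
    MeasurableEmbedding (fun p : ℝ × (Fin m → ℝ) =>
      (WithLp.toLp 2 (i.insertNth p.1 p.2) : Coord (m + 1))) :=
  (MeasurableEquiv.toLp 2 (Fin (m + 1) → ℝ)).measurableEmbedding.comp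
    (MeasurableEquiv.piFinSuccAbove (fun _ => ℝ) i).symm.measurableEmbedding

/-- If `∂_i U` is the weak derivative of `U` across the hyperplane `x_i = 0`, then the one-sided
limits of `U` coincide. -/
theorem limits_eq_of_isWeakPd {m : ℕ} {x₀ : Coord (m + 1)} {R : ℝ} {i : Fin (m + 1)}
    {U : Coord (m + 1) → ℝ} {H : ℝ → ℝ} {C : ℝ} (hx₀ : x₀ i = 0) (hH : Continuous H)
    (hU : ContDiffOn ℝ ∞ U (cutBox x₀ R i))
    (hC : ∀ x ∈ cutBox x₀ R i, ∀ y ∈ cutBox x₀ R i, 0 < x i * y i →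
      |U x - U y| ≤ C * ‖x - y‖ + |H (x i) - H (y i)|)
    (hUi : IntegrableOn U (box x₀ R)) (hUi' : IntegrableOn (pd i U) (box x₀ R))
    (hweak : IsWeakPd i (box x₀ R) U (pd i U)) {z₀ : Coord (m + 1)} (hz₀ : z₀ ∈ box x₀ R)
    (hz₀i : z₀ i = 0) {a b : ℝ} (ha : Tendsto U (𝓝[sideBox x₀ R i 1] z₀) (𝓝 a))
    (hb : Tendsto U (𝓝[sideBox x₀ R i (-1)] z₀) (𝓝 b)) : a = b := by
  by_contra hab
  set κ := a - b with hκ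
  have hκ0 : κ ≠ 0 := sub_ne_zero.2 hab
  -- one-sided limits at all points of the hyperplane
  have hlim : ∀ σ : ℝ, ∀ z ∈ box x₀ R, (𝓝[sideBox x₀ R i σ] z).NeBot →
      ∃ ℓ, Tendsto U (𝓝[sideBox x₀ R i σ] z) (𝓝 ℓ) := fun σ z _ _ =>
    exists_tendsto_of_abs_sub_le hH fun x hx y hy =>
      hC x (sideBox_subset_cutBox hx) y (sideBox_subset_cutBox hy) (mul_pos_of_mem_sideBox hx hy)
  have hlimp : ∀ z, ∃ ℓ, z ∈ box x₀ R → z i = 0 → Tendsto U (𝓝[sideBox x₀ R i 1] z) (𝓝 ℓ) := by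
    intro z
    by_cases hz : z ∈ box x₀ R ∧ z i = 0
    · obtain ⟨ℓ, h⟩ := hlim 1 z hz.1 (neBot_sideBox hz.1 hz.2).1
      exact ⟨ℓ, fun _ _ => h⟩
    · exact ⟨0, fun h1 h2 => absurd ⟨h1, h2⟩ hz⟩
  have hlimm : ∀ z, ∃ ℓ, z ∈ box x₀ R → z i = 0 → Tendsto U (𝓝[sideBox x₀ R i (-1)] z) (𝓝 ℓ) := by
    intro z
    by_cases hz : z ∈ box x₀ R ∧ z i = 0
    · obtain ⟨ℓ, h⟩ := hlim (-1) z hz.1 (neBot_sideBox hz.1 hz.2).2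
      exact ⟨ℓ, fun _ _ => h⟩
    · exact ⟨0, fun h1 h2 => absurd ⟨h1, h2⟩ hz⟩
  choose p hp using hlimp
  choose q hq using hlimm
  have hpa : p z₀ = a := by
    have := (neBot_sideBox hz₀ hz₀i).1
    exact tendsto_nhds_unique (hp z₀ hz₀ hz₀i) ha
  have hqb : q z₀ = b := by
    have := (neBot_sideBox hz₀ hz₀i).2
    exact tendsto_nhds_unique (hq z₀ hz₀ hz₀i) hb
  -- The two hyperplane points are approached with the same parameter s, so the increments of H
  -- cancel and the trace is Lipschitz.
  have hplip : ∀ z ∈ box x₀ R, z i = 0 → |p z - a| ≤ C * ‖z - z₀‖ := by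
    intro z hz hzi
    rw [← hpa]
    have h1 := ((hp z hz hzi).comp (tendsto_line_sideBox hz hzi).1).sub
      ((hp z₀ hz₀ hz₀i).comp (tendsto_line_sideBox hz₀ hz₀i).1)
    refine le_of_tendsto h1.abs ?_
    filter_upwards [(tendsto_line_sideBox hz hzi).1 self_mem_nhdsWithin,
      (tendsto_line_sideBox hz₀ hz₀i).1 self_mem_nhdsWithin] with s hs1 hs2
    have := hC _ (sideBox_subset_cutBox hs1) _ (sideBox_subset_cutBox hs2)
      (mul_pos_of_mem_sideBox hs1 hs2)
    simpa [hzi, hz₀i] using this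
  have hqlip : ∀ z ∈ box x₀ R, z i = 0 → |q z - b| ≤ C * ‖z - z₀‖ := by
    intro z hz hzi
    rw [← hqb]
    have h1 := ((hq z hz hzi).comp (tendsto_line_sideBox hz hzi).2).sub
      ((hq z₀ hz₀ hz₀i).comp (tendsto_line_sideBox hz₀ hz₀i).2)
    refine le_of_tendsto h1.abs ?_
    filter_upwards [(tendsto_line_sideBox hz hzi).2 self_mem_nhdsWithin,
      (tendsto_line_sideBox hz₀ hz₀i).2 self_mem_nhdsWithin] with s hs1 hs2
    have := hC _ (sideBox_subset_cutBox hs1) _ (sideBox_subset_cutBox hs2)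
      (mul_pos_of_mem_sideBox hs1 hs2)
    simpa [hzi, hz₀i] using this
  -- a small ball about `z₀`
  obtain ⟨r, hr, hrbox⟩ := Metric.nhds_basis_closedBall.mem_iff.1 ((isOpen_box x₀ R).mem_nhds hz₀)
  set ρ := min (r / 2) (|κ| / (8 * (|C| + 1))) with hρ
  have hκpos : 0 < |κ| := abs_pos.2 hκ0
  have hρ0 : 0 < ρ := by positivity
  have hρr : 2 * ρ ≤ r := by linarith [min_le_left (r / 2) (|κ| / (8 * (|C| + 1)))]
  have hCρ : C * ρ ≤ |κ| / 8 := by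
    calc C * ρ ≤ (|C| + 1) * (|κ| / (8 * (|C| + 1))) := by
          gcongr
          · linarith [le_abs_self C]
          · exact min_le_right _ _
      _ = |κ| / 8 := by field_simp
  have hρR : 2 * ρ < R := by
    have h1 : z₀ + (2 * ρ) • coordVec i ∈ Metric.closedBall z₀ r := by
      rw [Metric.mem_closedBall, dist_eq_norm, add_sub_cancel_left, norm_smul]
      simp [abs_of_pos hρ0]; linarith
    have h2 := hrbox h1 i
    rw [add_smul_coordVec_same, hz₀i, hx₀, zero_add, sub_zero, abs_of_pos (by positivity)] at h2
    exact h2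
  have hballbox : Metric.closedBall z₀ ρ ⊆ box x₀ R :=
    (Metric.closedBall_subset_closedBall (by linarith)).trans hrbox
  let φ : ContDiffBump z₀ := ⟨ρ / 2, ρ, by positivity, by linarith⟩
  have hφcd : ContDiff ℝ ∞ φ := φ.contDiff
  have hφsupp : tsupport φ = Metric.closedBall z₀ ρ := φ.tsupport_eq
  have hφpd : Continuous (pd i φ) :=
    (hφcd.continuous_fderiv (by simp)).clm_apply continuous_const
  have hφpdc : HasCompactSupport (pd i φ) :=
    φ.hasCompactSupport.of_isClosed_subset (isClosed_tsupport _) (tsupport_pd_subset i φ)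
  -- Off the hyperplane f is ∂_i(U φ). Its integral vanishes by the weak derivative identity,
  -- whereas integration along the lines in direction i produces the jump of U.
  set f : Coord (m + 1) → ℝ := fun x => U x * pd i φ x + pd i U x * φ x with hf
  have hi1 := integrable_mul_of_tsupport_subset hUi hφpd hφpdc
    ((tsupport_pd_subset i φ).trans (hφsupp ▸ hballbox))
  have hi2 := integrable_mul_of_tsupport_subset hUi' hφcd.continuous φ.hasCompactSupport
    (hφsupp ▸ hballbox)
  have hfi : Integrable f := hi1.add hi2
  have hf0 : ∫ x, f x = 0 := by
    rw [hf, integral_add hi1 hi2, hweak φ hφcd φ.hasCompactSupport (hφsupp ▸ hballbox)]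
    ring
  set ι : ℝ × (Fin m → ℝ) → Coord (m + 1) := fun p => WithLp.toLp 2 (i.insertNth p.1 p.2) with hι
  have hιp : MeasurePreserving ι := measurePreserving_insertNth i
  have hιe : MeasurableEmbedding ι := measurableEmbedding_insertNth i
  have hfι : Integrable (fun p => f (ι p)) (volume.prod volume) :=
    (hιp.integrable_comp_emb hιe).2 hfi
  have hfub : ∫ y : Fin m → ℝ, ∫ s : ℝ, f (ι (s, y)) = 0 := by
    rw [← integral_prod_symm (fun p => f (ι p)) hfι, ← hf0, ← hιp.integral_comp hιe]
    rfl
  set Z : (Fin m → ℝ) → Coord (m + 1) := fun y => ι (0, y) with hZ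
  have hιZ : ∀ s y, ι (s, y) = Z y + s • coordVec i := fun s y => insertNth_eq_add i s y
  have hZi : ∀ y, Z y i = 0 := fun y => by simp [hZ, hι]
  have hZcont : Continuous Z := by
    have : Continuous fun y : Fin m → ℝ => i.insertNth (α := fun _ => ℝ) (0 : ℝ) y :=
      Continuous.finInsertNth i continuous_const continuous_id
    exact (PiLp.continuous_toLp 2 _).comp this
  -- The fundamental theorem of calculus is used on both halves of [-2ρ, 2ρ]. The outer endpoints
  -- lie off the support of φ, so only the one-sided limits at s = 0 remain.
  have hJ : ∀ᵐ y : Fin m → ℝ, ∫ s : ℝ, f (ι (s, y)) = -((p (Z y) - q (Z y)) * φ (Z y)) := by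
    filter_upwards [hfι.prod_left_ae] with y hy
    simp only [hιZ] at hy ⊢
    set z := Z y with hz
    have hzi : z i = 0 := hZi y
    have hnot : ∀ s : ℝ, (ρ < |s| ∨ z ∉ Metric.closedBall z₀ ρ) →
        z + s • coordVec i ∉ tsupport φ := by
      intro s hs hmem
      rw [hφsupp, Metric.mem_closedBall, dist_eq_norm] at hmem
      have hdec : z + s • coordVec i - z₀ = (z - z₀) + s • coordVec i := by abel
      have hv : (z - z₀) i = 0 := by change z i - z₀ i = 0; rw [hzi, hz₀i, sub_zero]
      rcases hs with hs | hs
      · have h1 := abs_coord_le_norm (z + s • coordVec i - z₀) i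
        rw [hdec, add_smul_coordVec_same, hv, zero_add, ← hdec] at h1
        linarith
      · rw [hdec] at hmem
        exact hs (by rw [Metric.mem_closedBall, dist_eq_norm]
                     exact (norm_le_norm_add_smul hv s).trans hmem)
    have hzero : ∀ s : ℝ, (ρ < |s| ∨ z ∉ Metric.closedBall z₀ ρ) →
        φ (z + s • coordVec i) = 0 ∧ pd i φ (z + s • coordVec i) = 0 := fun s hs =>
      ⟨image_eq_zero_of_notMem_tsupport (hnot s hs),
        image_eq_zero_of_notMem_tsupport fun h => hnot s hs (tsupport_pd_subset i φ h)⟩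
    by_cases hzb : z ∈ Metric.closedBall z₀ ρ
    · have hzbox : z ∈ box x₀ R := hballbox hzb
      have hline : ∀ s : ℝ, |s| < R → s ≠ 0 → z + s • coordVec i ∈ cutBox x₀ R i := fun s hs hs0 =>
        ⟨by simpa [hzi] using line_mem_box hzbox (i := i) (s := s) (by simpa [hx₀] using hs), by
          rw [mem_ofPred_eq, add_smul_coordVec_same, hzi, zero_add]; exact hs0⟩
      have hder : ∀ s : ℝ, |s| < R → s ≠ 0 → HasDerivAt
          (fun s : ℝ => U (z + s • coordVec i) * φ (z + s • coordVec i))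
          (f (z + s • coordVec i)) s := by
        intro s hs hs0
        have e1 := hasDerivAt_line (isOpen_cutBox x₀ R i) hU i z 0 (s := s) (by
          rw [sub_zero]; exact hline s hs hs0)
        have e2 := hasDerivAt_line isOpen_univ (hφcd.contDiffOn) i z 0 (s := s) (mem_univ _)
        simp only [sub_zero] at e1 e2
        exact (e1.mul e2).congr_deriv (by simp only [hf]; ring)
      have hfs : ∀ s : ℝ, s ∉ Ioc (-(2 * ρ)) (2 * ρ) → f (z + s • coordVec i) = 0 := by
        intro s hs
        have : ρ < |s| := by
          by_contra hcon
          push Not at hcon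
          have := abs_le.1 hcon
          exact hs ⟨by linarith, by linarith⟩
        obtain ⟨h1, h2⟩ := hzero s (Or.inl this)
        simp only [hf, h1, h2, mul_zero, add_zero]
      rw [← setIntegral_eq_integral_of_forall_compl_eq_zero hfs,
        ← intervalIntegral.integral_of_le (by linarith : -(2 * ρ) ≤ 2 * ρ),
        ← intervalIntegral.integral_add_adjacent_intervals (b := 0) hy.intervalIntegrable
          hy.intervalIntegrable]
      have hφt : ∀ l : Filter ℝ, l ≤ 𝓝 0 →
          Tendsto (fun s : ℝ => φ (z + s • coordVec i)) l (𝓝 (φ z)) := fun l hl => by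
        have : Continuous fun s : ℝ => φ (z + s • coordVec i) :=
          hφcd.continuous.comp (by fun_prop)
        simpa using (this.tendsto 0).mono_left hl
      have hend : ∀ s : ℝ, ρ < |s| → |s| < R → ∀ l : Filter ℝ, l ≤ 𝓝 s →
          Tendsto (fun s : ℝ => U (z + s • coordVec i) * φ (z + s • coordVec i)) l (𝓝 0) := by
        intro s hs hsR l hl
        have hs0 : s ≠ 0 := fun h => by rw [h, abs_zero] at hs; linarith
        have := (hder s hsR hs0).continuousAt.tendsto.mono_left hl
        rwa [(hzero s (Or.inl hs)).1, mul_zero] at this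
      have habs : ∀ s, -(2 * ρ) < s → s < 2 * ρ → |s| < R := fun s h1 h2 =>
        (abs_lt.2 ⟨h1, h2⟩).trans hρR
      rw [intervalIntegral.integral_eq_sub_of_hasDerivAt_of_tendsto (by linarith : -(2 * ρ) < 0)
          (fun s hs => hder s (habs s hs.1 (by linarith [hs.2])) hs.2.ne) hy.intervalIntegrable
          (hend (-(2 * ρ)) (by rw [abs_neg, abs_of_pos (by positivity)]; linarith)
            (by rw [abs_neg, abs_of_pos (by positivity)]; exact hρR) _ nhdsWithin_le_nhds)
          (((hq z hzbox hzi).comp (tendsto_line_sideBox hzbox hzi).2).mul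
            (hφt _ nhdsWithin_le_nhds)),
        intervalIntegral.integral_eq_sub_of_hasDerivAt_of_tendsto (by linarith : 0 < 2 * ρ)
          (fun s hs => hder s (habs s (by linarith [hs.1]) hs.2) hs.1.ne') hy.intervalIntegrable
          (((hp z hzbox hzi).comp (tendsto_line_sideBox hzbox hzi).1).mul
            (hφt _ nhdsWithin_le_nhds))
          (hend (2 * ρ) (by rw [abs_of_pos (by positivity)]; linarith)
            (by rw [abs_of_pos (by positivity)]; exact hρR) _ nhdsWithin_le_nhds)]
      ring
    · have : ∀ s : ℝ, f (z + s • coordVec i) = 0 := fun s => by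
        obtain ⟨h1, h2⟩ := hzero s (Or.inr hzb)
        simp only [hf, h1, h2, mul_zero, add_zero]
      have hφz : φ z = 0 := by simpa using (hzero 0 (Or.inr hzb)).1
      simp [this, hφz]
  set g : (Fin m → ℝ) → ℝ := fun y => κ * -∫ s : ℝ, f (ι (s, y)) with hg
  have hgi : Integrable g := (hfι.integral_prod_right.neg).const_mul κ
  have hg0 : ∫ y, g y = 0 := by
    rw [hg, integral_const_mul, integral_neg, hfub, neg_zero, mul_zero]
  -- On the ball each trace stays within |κ| / 8 of its value at z₀, so p - q stays within |κ| / 4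
  -- of κ and keeps its sign.
  have hpos : ∀ z ∈ Metric.closedBall z₀ ρ, z i = 0 → 0 < κ * (p z - q z) := by
    intro z hz hzi
    have hzbox := hballbox hz
    rw [Metric.mem_closedBall, dist_eq_norm] at hz
    have hle : ∀ v : ℝ, v ≤ C * ‖z - z₀‖ → v ≤ |κ| / 8 := fun v hv => by
      rcases le_or_gt C 0 with hC0 | hC0
      · have : C * ‖z - z₀‖ ≤ 0 := mul_nonpos_of_nonpos_of_nonneg hC0 (norm_nonneg _)
        linarith
      · exact hv.trans ((mul_le_mul_of_nonneg_left hz hC0.le).trans hCρ)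
    have h1 := abs_le.1 (hle _ (hplip z hzbox hzi))
    have h2 := abs_le.1 (hle _ (hqlip z hzbox hzi))
    rcases lt_or_gt_of_ne hκ0 with h | h
    · rw [abs_of_neg h] at h1 h2
      exact mul_pos_of_neg_of_neg h (by linarith [h1.1, h1.2, h2.1, h2.2])
    · rw [abs_of_pos h] at h1 h2
      exact mul_pos h (by linarith [h1.1, h1.2, h2.1, h2.2])
  have hgJ : ∀ᵐ y, g y = κ * (p (Z y) - q (Z y)) * φ (Z y) := by
    filter_upwards [hJ] with y hy
    rw [hg]; simp only; rw [hy]; ring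
  have hgnn : 0 ≤ᵐ[volume] g := by
    filter_upwards [hgJ] with y hy
    rw [hy, Pi.zero_apply]
    by_cases hzb : Z y ∈ Metric.closedBall z₀ ρ
    · exact mul_nonneg (hpos _ hzb (hZi y)).le φ.nonneg
    · rw [image_eq_zero_of_notMem_tsupport (f := φ) (by rwa [hφsupp]), mul_zero]
  -- A nonnegative function with zero integral vanishes almost everywhere, but g agrees almost
  -- everywhere with an expression that is positive on a nonempty open set.
  have hgz := (integral_eq_zero_iff_of_nonneg_ae hgnn hgi).1 hg0
  have hopen : IsOpen (Z ⁻¹' Metric.ball z₀ ρ) := Metric.isOpen_ball.preimage hZcont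
  have hne : (Z ⁻¹' Metric.ball z₀ ρ).Nonempty := by
    refine ⟨fun j => z₀ (i.succAbove j), ?_⟩
    have : Z (fun j => z₀ (i.succAbove j)) = z₀ := by
      ext k
      refine Fin.succAboveCases i ?_ (fun j => ?_) k
      · rw [hZi, hz₀i]
      · simp [hZ, hι]
    rw [mem_preimage, this]
    exact Metric.mem_ball_self hρ0
  have hnull : ∀ᵐ y, y ∉ Z ⁻¹' Metric.ball z₀ ρ := by
    filter_upwards [hgz, hgJ] with y h1 h2 h3
    rw [h1, Pi.zero_apply] at h2
    have h4 := hpos (Z y) (Metric.ball_subset_closedBall h3) (hZi y)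
    have h5 : 0 < φ (Z y) := φ.pos_of_mem_ball h3
    exact absurd h2 (mul_pos h4 h5).ne
  have hmeas0 := measure_eq_zero_iff_ae_notMem.2 hnull
  exact (hopen.measure_pos volume hne).ne' hmeas0

/-- `U` is Lipschitz on `S` up to increments of `∫ h` in the `i`-th variable. -/
def LipUpTo {n : ℕ} (i : Fin n) (h : ℝ → ℝ) (C : ℝ) (S : Set (Coord n)) (U : Coord n → ℝ) : Prop :=
  ∀ x ∈ S, ∀ y ∈ S, |U x - U y| ≤ C * ‖x - y‖ + |∫ r in (y i)..(x i), h r|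

theorem LipUpTo.mono {n : ℕ} {i : Fin n} {h h' : ℝ → ℝ} {C C' : ℝ} {S S' : Set (Coord n)}
    {U : Coord n → ℝ} (hU : LipUpTo i h C S U) (hS : S' ⊆ S) (hC : C ≤ C') (h0 : ∀ r, 0 ≤ h r)
    (hh' : ∀ r, h r ≤ h' r) (hi : Integrable h) (hi' : Integrable h') :
    LipUpTo i h' C' S' U := by
  intro x hx y hy
  refine (hU x (hS hx) y (hS hy)).trans (add_le_add (by gcongr) ?_)
  rw [intervalIntegral.abs_intervalIntegral_eq, intervalIntegral.abs_intervalIntegral_eq,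
    abs_of_nonneg (integral_nonneg h0), abs_of_nonneg (integral_nonneg fun r => (h0 r).trans (hh' r))]
  exact integral_mono hi.integrableOn hi'.integrableOn hh'

/-- A function smooth off the hyperplane `x_i = 0`, whose conormal derivatives of first order in the
normal direction are integrable, and whose normal derivative is a weak derivative across the
hyperplane, is Lipschitz up to increments of the integral of an integrable function. -/
theorem exists_lipUpTo {n : ℕ} {x₀ : Coord n} {R : ℝ} {i : Fin n} {U : Coord n → ℝ}
    (hx₀ : x₀ i = 0) (hR : 0 < R) (hU : ContDiffOn ℝ ∞ U (cutBox x₀ R i))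
    (hUi : IntegrableOn U (box x₀ R))
    (h₀ : TangentiallyIntegrable x₀ R i (pd i U))
    (h₁ : ∀ j ≠ i, TangentiallyIntegrable x₀ R i (pd i (pd j U)))
    (hweak : IsWeakPd i (box x₀ R) U (pd i U)) :
    ∃ C ≥ 0, ∃ h : ℝ → ℝ, Integrable h ∧ (∀ r, 0 ≤ h r) ∧
      LipUpTo i h C (cutBox x₀ (R / 2) i) U := by
  obtain ⟨m, rfl⟩ : ∃ m, n = m + 1 := ⟨n - 1, by have := i.pos; omega⟩
  obtain ⟨k, hk⟩ := exists_normallyDominated hU h₀ h₁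
  obtain ⟨C, hC, hle⟩ := hk.exists_abs_sub_le hx₀ hR
  set h : ℝ → ℝ := fun r => (k r).toReal with hh
  have hi : Integrable h := hk.integrable
  set H : ℝ → ℝ := fun r => ∫ t in (0 : ℝ)..r, h t with hH
  have hHc : Continuous H := intervalIntegral.continuous_primitive
    (fun a b => hi.intervalIntegrable) 0
  have hHs : ∀ a b : ℝ, ∫ r in a..b, h r = H b - H a := fun a b =>
    (intervalIntegral.integral_interval_sub_left hi.intervalIntegrable
      hi.intervalIntegrable).symm
  have hHm : Monotone H := fun a b hab => by
    have := hHs a b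
    have h2 : 0 ≤ ∫ r in a..b, h r :=
      intervalIntegral.integral_nonneg hab fun _ _ => ENNReal.toReal_nonneg
    linarith
  refine ⟨C, hC, h, hi, fun r => ENNReal.toReal_nonneg, ?_⟩
  have hle' : ∀ x ∈ cutBox x₀ (R / 2) i, ∀ y ∈ cutBox x₀ (R / 2) i, 0 < x i * y i →
      |U x - U y| ≤ C * ‖x - y‖ + |H (x i) - H (y i)| := fun x hx y hy hxy => by
    rw [← hHs]; exact hle x hx y hy hxy
  have hsub : box x₀ (R / 2) ⊆ box x₀ R := box_mono (by linarith)
  -- The segment from x to y meets the hyperplane in z, where both one-sided limits of U agree. The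
  -- estimates on the two pieces add up without loss because z lies on the segment and H is
  -- monotone.
  have hcross : ∀ x ∈ cutBox x₀ (R / 2) i, ∀ y ∈ cutBox x₀ (R / 2) i, x i < 0 → 0 < y i →
      |U x - U y| ≤ C * ‖x - y‖ + |H (x i) - H (y i)| := by
    intro x hx y hy hxi hyi
    set t := -x i / (y i - x i) with ht
    have hd : 0 < y i - x i := by linarith
    have ht0 : 0 ≤ t := div_nonneg (by linarith) hd.le
    have ht1 : t ≤ 1 := by rw [ht, div_le_one hd]; linarith
    set z := x + t • (y - x) with hz
    have hzbox : z ∈ box x₀ (R / 2) := convex_box.add_smul_sub_mem hx.1 hy.1 ⟨ht0, ht1⟩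
    have hzi : z i = 0 := by
      change x i + t * (y i - x i) = 0
      rw [ht, div_mul_cancel₀ _ hd.ne']; ring
    have := (neBot_sideBox hzbox hzi).1
    have := (neBot_sideBox hzbox hzi).2
    have hside : ∀ σ : ℝ, ∀ u ∈ sideBox x₀ (R / 2) i σ, ∀ v ∈ sideBox x₀ (R / 2) i σ,
        |U u - U v| ≤ C * ‖u - v‖ + |H (u i) - H (v i)| := fun σ u hu v hv =>
      hle' u (sideBox_subset_cutBox hu) v (sideBox_subset_cutBox hv) (mul_pos_of_mem_sideBox hu hv)
    obtain ⟨a, ha⟩ := exists_tendsto_of_abs_sub_le hHc (hside 1) (z := z)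
    obtain ⟨b, hb⟩ := exists_tendsto_of_abs_sub_le hHc (hside (-1)) (z := z)
    have hab : a = b := limits_eq_of_isWeakPd hx₀ hHc
      (hU.mono (cutBox_mono (by linarith))) hle' (hUi.mono_set hsub)
      ((h₀.integrableOn [] (by simp)).mono_set hsub)
      (fun φ h1 h2 h3 => hweak φ h1 h2 (h3.trans hsub)) hzbox hzi ha hb
    have hpass : ∀ σ ℓ : ℝ, ∀ u ∈ sideBox x₀ (R / 2) i σ, (𝓝[sideBox x₀ (R / 2) i σ] z).NeBot →
        Tendsto U (𝓝[sideBox x₀ (R / 2) i σ] z) (𝓝 ℓ) →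
        |U u - ℓ| ≤ C * ‖u - z‖ + |H (u i) - H (z i)| := by
      intro σ ℓ u hu _ hℓ
      have hid : Tendsto (fun v : Coord (m + 1) => v) (𝓝[sideBox x₀ (R / 2) i σ] z) (𝓝 z) :=
        nhdsWithin_le_nhds
      have hev : Tendsto (fun v : Coord (m + 1) => H (v i)) (𝓝 z) (𝓝 (H (z i))) :=
        Continuous.tendsto (by fun_prop) z
      refine le_of_tendsto_of_tendsto (hℓ.const_sub (U u)).abs
        (((hid.const_sub u).norm.const_mul C).add ((hev.comp hid).const_sub (H (u i))).abs) ?_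
      filter_upwards [self_mem_nhdsWithin] with v hv
      exact hside σ u hu v hv
    have e1 := hpass 1 a y ⟨hy.1, by simpa using hyi⟩ inferInstance ha
    have e2 := hpass (-1) b x ⟨hx.1, by simpa using hxi⟩ inferInstance hb
    rw [hzi] at e1 e2
    have n1 : ‖x - z‖ = t * ‖x - y‖ := by
      rw [hz, sub_add_cancel_left, norm_neg, norm_smul, Real.norm_of_nonneg ht0, norm_sub_rev y x]
    have n2 : ‖y - z‖ = (1 - t) * ‖x - y‖ := by
      have : y - z = (1 - t) • (y - x) := by rw [hz]; module
      rw [this, norm_smul, Real.norm_of_nonneg (by linarith), norm_sub_rev y x]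
    have m1 := hHm hxi.le
    have m2 := hHm hyi.le
    rw [abs_of_nonneg (by linarith : 0 ≤ H (y i) - H 0), n2] at e1
    rw [abs_of_nonpos (by linarith : H (x i) - H 0 ≤ 0), n1] at e2
    rw [abs_of_nonpos (by linarith : H (x i) - H (y i) ≤ 0)]
    rw [hab] at e1
    have e3 : |U x - U y| ≤ |U x - b| + |U y - b| := by
      have : U x - U y = (U x - b) - (U y - b) := by ring
      rw [this]; exact abs_sub _ _
    nlinarith
  intro x hx y hy
  rw [hHs]
  rcases lt_or_gt_of_ne hx.2 with h1 | h1 <;> rcases lt_or_gt_of_ne hy.2 with h2 | h2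
  · exact hle' x hx y hy (mul_pos_of_neg_of_neg h1 h2)
  · exact hcross x hx y hy h1 h2
  · rw [abs_sub_comm, norm_sub_rev, abs_sub_comm (H (x i))]
    exact hcross y hy x hx h2 h1
  · exact hle' x hx y hy (mul_pos h1 h2)

end NoJump

/-! ### Weak derivatives of functions smooth off a hyperplane -/

section WeakPd

variable {n : ℕ} {Ω : Set (Coord n)} {i : Fin n}

theorem volume_hyperplane (i : Fin n) : volume {x : Coord n | x i = 0} = 0 := by
  have h : {x : Coord n | x i = 0} =
      (LinearMap.ker (EuclideanSpace.proj i : Coord n →L[ℝ] ℝ).toLinearMap : Set (Coord n)) := by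
    ext x; simp
  rw [h]
  refine Measure.addHaar_submodule _ _ fun htop => ?_
  have : coordVec i ∈ LinearMap.ker (EuclideanSpace.proj i : Coord n →L[ℝ] ℝ).toLinearMap := by
    rw [htop]; trivial
  simp at this

theorem ae_coord_ne_zero (i : Fin n) : ∀ᵐ x : Coord n, x i ≠ 0 :=
  measure_eq_zero_iff_ae_notMem.1 (volume_hyperplane i)

theorem isOpen_inter_coord_ne (hΩ : IsOpen Ω) (i : Fin n) : IsOpen (Ω ∩ {x | x i ≠ 0}) :=
  hΩ.inter (isOpen_ne_fun (by fun_prop) continuous_const)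

theorem locallyIntegrableOn_congr_ae (hΩ : IsOpen Ω) {u v : Coord n → ℝ}
    (hu : LocallyIntegrableOn u Ω) (h : ∀ᵐ x, x ∈ Ω → u x = v x) : LocallyIntegrableOn v Ω := by
  intro x hx
  obtain ⟨s, hs, hinteg⟩ := hu x hx
  refine ⟨s ∩ Ω, inter_mem hs self_mem_nhdsWithin, ?_⟩
  refine (hinteg.mono_set inter_subset_left).congr ?_
  refine ae_restrict_of_ae_restrict_of_subset inter_subset_right ?_
  exact (ae_restrict_iff' hΩ.measurableSet).2 h

theorem ae_of_eqOn_inter {u v : Coord n → ℝ} (h : EqOn u v (Ω ∩ {x | x i ≠ 0})) :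
    ∀ᵐ x, x ∈ Ω → u x = v x := by
  filter_upwards [ae_coord_ne_zero i] with x hx hxΩ
  exact h ⟨hxΩ, hx⟩

theorem integrable_mul_of_locallyIntegrableOn {u ψ : Coord n → ℝ} (hu : LocallyIntegrableOn u Ω)
    (hψ : Continuous ψ) (hc : HasCompactSupport ψ) (hs : tsupport ψ ⊆ Ω) :
    Integrable fun x => u x * ψ x :=
  integrable_mul_of_tsupport_subset (hu.integrableOn_compact_subset hs hc) hψ hc subset_rfl

theorem continuous_pd {φ : Coord n → ℝ} (hφ : ContDiff ℝ ∞ φ) (j : Fin n) : Continuous (pd j φ) :=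
  (hφ.continuous_fderiv (by simp)).clm_apply continuous_const

theorem hasCompactSupport_pd {φ : Coord n → ℝ} (hφ : HasCompactSupport φ) (j : Fin n) :
    HasCompactSupport (pd j φ) :=
  hφ.of_isClosed_subset (isClosed_tsupport _) (tsupport_pd_subset j φ)

theorem IsWeakPd.congr_ae {j : Fin n} {U U' w w' : Coord n → ℝ} (h : IsWeakPd j Ω U w)
    (hU : ∀ᵐ x, x ∈ Ω → U x = U' x) (hw : ∀ᵐ x, x ∈ Ω → w x = w' x) : IsWeakPd j Ω U' w' := by
  intro φ h1 h2 h3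
  have e1 : ∫ x, U' x * pd j φ x = ∫ x, U x * pd j φ x := by
    refine integral_congr_ae ?_
    filter_upwards [hU] with x hx
    by_cases hx' : x ∈ tsupport (pd j φ)
    · rw [hx (h3 (tsupport_pd_subset j φ hx'))]
    · simp [image_eq_zero_of_notMem_tsupport hx']
  have e2 : ∫ x, w' x * φ x = ∫ x, w x * φ x := by
    refine integral_congr_ae ?_
    filter_upwards [hw] with x hx
    by_cases hx' : x ∈ tsupport φ
    · rw [hx (h3 hx')]
    · simp [image_eq_zero_of_notMem_tsupport hx']
  rw [e1, e2]
  exact h φ h1 h2 h3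

/-- Off the hyperplane a weak derivative of a smooth function is the classical one. -/
theorem ae_eq_pd_of_isWeakPd (hΩ : IsOpen Ω) {j : Fin n} {U Ũ w : Coord n → ℝ}
    (hŨ : ContDiffOn ℝ ∞ Ũ (Ω ∩ {x | x i ≠ 0})) (hU : ∀ᵐ x, x ∈ Ω → U x = Ũ x)
    (hweak : IsWeakPd j Ω U w) (hw : LocallyIntegrableOn w Ω) :
    ∀ᵐ x, x ∈ Ω → w x = pd j Ũ x := by
  set D := Ω ∩ {x : Coord n | x i ≠ 0} with hD
  have hDo : IsOpen D := isOpen_inter_coord_ne hΩ i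
  have hpd : LocallyIntegrableOn (pd j Ũ) D :=
    (contDiffOn_pd hDo hŨ j).continuousOn.locallyIntegrableOn hDo.measurableSet
  have hwD : LocallyIntegrableOn w D := hw.mono_set inter_subset_left
  -- Integration by parts against test functions supported off the hyperplane identifies the two
  -- derivatives there, and the hyperplane is a null set.
  have key := hDo.ae_eq_zero_of_integral_contDiff_smul_eq_zero (hwD.sub hpd) (fun g h1 h2 h3 => by
    have i1 := integrable_mul_of_locallyIntegrableOn hwD h1.continuous h2 h3
    have i2 := integrable_mul_of_locallyIntegrableOn hpd h1.continuous h2 h3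
    have i3 : Integrable fun x => Ũ x * pd j g x := integrable_mul_of_locallyIntegrableOn
      (hŨ.continuousOn.locallyIntegrableOn hDo.measurableSet) (continuous_pd h1 j)
      (hasCompactSupport_pd h2 j) ((tsupport_pd_subset j g).trans h3)
    have i4 : Integrable fun x => Ũ x * g x := integrable_mul_of_locallyIntegrableOn
      (hŨ.continuousOn.locallyIntegrableOn hDo.measurableSet) h1.continuous h2 h3
    have e1 := (hweak.congr_ae hU (.of_forall fun _ _ => rfl)) g h1 h2
      (h3.trans inter_subset_left)
    have e2 : ∫ x, Ũ x * pd j g x = -∫ x, pd j Ũ x * g x :=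
      integral_mul_fderiv_eq_neg_fderiv_mul_of_integrable i2 i3 i4
        (fun x hx => (hŨ.contDiffAt (hDo.mem_nhds (h3 hx))).differentiableAt (by simp))
        (fun x _ => h1.contDiffAt.differentiableAt (by simp))
    have e3 : ∫ x, g x • (w - pd j Ũ) x = (∫ x, w x * g x) - ∫ x, pd j Ũ x * g x := by
      rw [← integral_sub i1 i2]
      refine integral_congr_ae (.of_forall fun x => ?_)
      simp only [Pi.sub_apply, smul_eq_mul]; ring
    rw [e3]; linarith)
  filter_upwards [key, ae_coord_ne_zero i] with x hx hxi hxΩ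
  exact sub_eq_zero.1 (hx ⟨hxΩ, hxi⟩)

/-- The classical (off the hyperplane) partial derivatives of `U` up to order `k` are locally
integrable and are weak derivatives on `Ω`. -/
def ClassicalW (Ω : Set (Coord n)) : ℕ → (Coord n → ℝ) → Prop
  | 0, U => LocallyIntegrableOn U Ω
  | k + 1, U => LocallyIntegrableOn U Ω ∧ ∀ m, IsWeakPd m Ω U (pd m U) ∧ ClassicalW Ω k (pd m U)

/-- The integrability hypothesis has the normal derivative outermost, which is how conormal
regularity supplies it: tangential fields act first, membership in W^{1,1} is tested afterwards.
Commuting the derivatives is classical off the hyperplane, hence harmless almost everywhere. -/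
theorem exists_lipUpTo_of_locallyIntegrableOn (hΩ : IsOpen Ω) {x₀ : Coord n} {R : ℝ} (hR : 0 < R)
    (hx₀ : x₀ i = 0) (hbox : {x : Coord n | ∀ k, |x k - x₀ k| ≤ R} ⊆ Ω) {U : Coord n → ℝ}
    (hU : ContDiffOn ℝ ∞ U (Ω ∩ {x | x i ≠ 0})) (hUi : LocallyIntegrableOn U Ω)
    (hL : ∀ l : List (Fin n), (∀ j ∈ l, j ≠ i) → LocallyIntegrableOn (pd i (pds l U)) Ω)
    (hweak : IsWeakPd i Ω U (pd i U)) :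
    ∃ C ≥ 0, ∃ h : ℝ → ℝ, Integrable h ∧ (∀ r, 0 ≤ h r) ∧
      LipUpTo i h C (cutBox x₀ (R / 2) i) U := by
  have hDo := isOpen_inter_coord_ne hΩ i
  have hsub : box x₀ R ⊆ {x : Coord n | ∀ k, |x k - x₀ k| ≤ R} := fun x hx k => (hx k).le
  have hcut : cutBox x₀ R i ⊆ Ω ∩ {x | x i ≠ 0} := fun x hx => ⟨hbox (hsub hx.1), hx.2⟩
  have hinteg : ∀ u : Coord n → ℝ, LocallyIntegrableOn u Ω → IntegrableOn u (box x₀ R) :=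
    fun u hu => (hu.integrableOn_compact_subset hbox (isCompact_closedBox x₀ R)).mono_set hsub
  have hTI : ∀ l' : List (Fin n), (∀ j ∈ l', j ≠ i) →
      TangentiallyIntegrable x₀ R i (pd i (pds l' U)) := fun l' hl' =>
    ⟨(contDiffOn_pd hDo (contDiffOn_pds hDo hU l') i).mono hcut, fun l hl => hinteg _ <| by
      have h1 := hL (l ++ l') (fun j hj => (List.mem_append.1 hj).elim (hl j) (hl' j))
      have h2 : pds (l ++ l') U = pds l (pds l' U) := by simp [pds]
      rw [h2] at h1
      exact locallyIntegrableOn_congr_ae hΩ h1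
        (ae_of_eqOn_inter (pd_pds_comm hDo (contDiffOn_pds hDo hU l') i l))⟩
  exact exists_lipUpTo hx₀ hR (hU.mono hcut) (hinteg U hUi) (hTI [] (by simp))
    (fun j hj => hTI [j] (by simpa using hj))
    (fun φ h1 h2 h3 => hweak φ h1 h2 (h3.trans (hsub.trans hbox)))

theorem exists_common_lipUpTo {S : Set (Coord n)} {V : Coord n → ℝ} {q : Fin n → Prop}
    (hV : ∃ C ≥ 0, ∃ h : ℝ → ℝ, Integrable h ∧ (∀ r, 0 ≤ h r) ∧ LipUpTo i h C S V)
    (hq : ∀ j, q j → ∃ C ≥ 0, ∃ h : ℝ → ℝ, Integrable h ∧ (∀ r, 0 ≤ h r) ∧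
      LipUpTo i h C S (pd j V)) :
    ∃ C ≥ 0, ∃ h : ℝ → ℝ, Integrable h ∧ (∀ r, 0 ≤ h r) ∧ LipUpTo i h C S V ∧
      ∀ j, q j → LipUpTo i h C S (pd j V) := by
  classical
  obtain ⟨C₀, hC₀, h₀, hi₀, hn₀, hl₀⟩ := hV
  have hex : ∀ j, ∃ C ≥ 0, ∃ h : ℝ → ℝ, Integrable h ∧ (∀ r, 0 ≤ h r) ∧
      (q j → LipUpTo i h C S (pd j V)) := fun j => by
    by_cases hj : q j
    · obtain ⟨C, hC, h, h1, h2, h3⟩ := hq j hj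
      exact ⟨C, hC, h, h1, h2, fun _ => h3⟩
    · exact ⟨0, le_rfl, 0, integrable_zero _ _ _, fun _ => le_rfl, fun h => absurd h hj⟩
  choose C hC h hi hn hl using hex
  have hit : Integrable fun r => h₀ r + ∑ j, h j r :=
    hi₀.add (integrable_finsetSum _ fun j _ => hi j)
  have hs : ∀ r, 0 ≤ ∑ j, h j r := fun r => Finset.sum_nonneg fun j _ => hn j r
  have hCs : 0 ≤ ∑ j, C j := Finset.sum_nonneg fun j _ => hC j
  refine ⟨C₀ + ∑ j, C j, add_nonneg hC₀ hCs, fun r => h₀ r + ∑ j, h j r, hit,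
    fun r => add_nonneg (hn₀ r) (hs r), ?_, fun j hj => ?_⟩
  · exact hl₀.mono subset_rfl (by linarith) hn₀ (fun r => by linarith [hs r]) hi₀ hit
  · refine (hl j hj).mono subset_rfl ?_ (hn j) (fun r => ?_) (hi j) hit
    · have := Finset.single_le_sum (f := C) (fun j _ => hC j) (Finset.mem_univ j)
      linarith
    · have := Finset.single_le_sum (f := fun j => h j r) (fun j _ => hn j r) (Finset.mem_univ j)
      linarith [hn₀ r]

theorem exists_closedBox_subset (hΩ : IsOpen Ω) {x₀ : Coord n} (hx₀ : x₀ ∈ Ω) :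
    ∃ R > 0, {x : Coord n | ∀ k, |x k - x₀ k| ≤ R} ⊆ Ω := by
  have hO : IsOpen ((WithLp.toLp 2 : (Fin n → ℝ) → Coord n) ⁻¹' Ω) :=
    hΩ.preimage (PiLp.continuous_toLp 2 _)
  obtain ⟨R, hR, hsub⟩ := Metric.nhds_basis_closedBall.mem_iff.1
    (hO.mem_nhds (x := WithLp.ofLp x₀) hx₀)
  refine ⟨R, hR, fun x hx => ?_⟩
  have : WithLp.ofLp x ∈ Metric.closedBall (WithLp.ofLp x₀) R := by
    rw [Metric.mem_closedBall, dist_pi_le_iff hR.le]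
    exact hx
  exact hsub this

/-- The local structure of a potential in `IW^{1,1}` (`q j ↔ j ≠ i`) or `IW^{2,1}` (`q = ⊤`). -/
structure HasLocalBounds (i : Fin n) (x₀ : Coord n) (q : Fin n → Prop) (V : Coord n → ℝ)
    (r C : ℝ) (h : ℝ → ℝ) : Prop where
  r_pos : 0 < r
  C_nonneg : 0 ≤ C
  integrable : Integrable h
  nonneg : ∀ t, 0 ≤ h t
  contDiffOn : ContDiffOn ℝ ∞ V (cutBox x₀ r i)
  lip : LipUpTo i h C (cutBox x₀ r i) V
  lip_pd : ∀ j, q j → LipUpTo i h C (cutBox x₀ r i) (pd j V)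

/-- Tangential derivatives of a conormal function are conormal, so the increment bound applies to V
and to `pd j V` for j ≠ i. Nothing is claimed for `pd i V`, which may be unbounded at the
hyperplane. -/
theorem exists_hasLocalBounds_one (hΩ : IsOpen Ω) {x₀ : Coord n} (hxΩ : x₀ ∈ Ω) (hx₀ : x₀ i = 0)
    {V : Coord n → ℝ} (hV : ContDiffOn ℝ ∞ V (Ω ∩ {x | x i ≠ 0}))
    (hW : ∀ l : List (Fin n), (∀ j ∈ l, j ≠ i) → ClassicalW Ω 1 (pds l V)) :
    ∃ r C h, box x₀ r ⊆ Ω ∧ HasLocalBounds i x₀ (fun j => j ≠ i) V r C h := by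
  obtain ⟨R, hR, hbox⟩ := exists_closedBox_subset hΩ hxΩ
  have hDo := isOpen_inter_coord_ne hΩ i
  have hgen : ∀ l' : List (Fin n), (∀ j ∈ l', j ≠ i) → ∃ C ≥ 0, ∃ h : ℝ → ℝ, Integrable h ∧
      (∀ r, 0 ≤ h r) ∧ LipUpTo i h C (cutBox x₀ (R / 2) i) (pds l' V) := fun l' hl' =>
    exists_lipUpTo_of_locallyIntegrableOn hΩ hR hx₀ hbox (contDiffOn_pds hDo hV l') (hW l' hl').1
      (fun l hl => by
        have h1 := (hW (l ++ l') (fun j hj => (List.mem_append.1 hj).elim (hl j) (hl' j))).2 i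
        have h2 : pds (l ++ l') V = pds l (pds l' V) := by simp [pds]
        rw [h2] at h1
        exact h1.2) ((hW l' hl').2 i).1
  obtain ⟨C, hC, h, h1, h2, h3, h4⟩ := exists_common_lipUpTo (q := fun j => j ≠ i)
    (hgen [] (by simp)) (fun j hj => hgen [j] (by simpa using hj))
  have hsub : box x₀ (R / 2) ⊆ Ω := fun x hx => hbox fun k => (hx k).le.trans (by linarith)
  exact ⟨R / 2, C, h, hsub, by positivity, hC, h1, h2,
    hV.mono fun x hx => ⟨hsub hx.1, hx.2⟩, h3, h4⟩

/-- With one more derivative in L¹ the increment bound applies to every first derivative of V, the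
normal one included. -/
theorem exists_hasLocalBounds_two (hΩ : IsOpen Ω) {x₀ : Coord n} (hxΩ : x₀ ∈ Ω) (hx₀ : x₀ i = 0)
    {V : Coord n → ℝ} (hV : ContDiffOn ℝ ∞ V (Ω ∩ {x | x i ≠ 0}))
    (hW : ∀ l : List (Fin n), (∀ j ∈ l, j ≠ i) → ClassicalW Ω 2 (pds l V)) :
    ∃ r C h, box x₀ r ⊆ Ω ∧ HasLocalBounds i x₀ (fun _ => True) V r C h := by
  obtain ⟨R, hR, hbox⟩ := exists_closedBox_subset hΩ hxΩ
  have hDo := isOpen_inter_coord_ne hΩ i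
  have hgen0 := exists_lipUpTo_of_locallyIntegrableOn hΩ hR hx₀ hbox hV (hW [] (by simp)).1
    (fun l hl => ((hW l hl).2 i).2.1) ((hW [] (by simp)).2 i).1
  have hgen : ∀ j : Fin n, ∃ C ≥ 0, ∃ h : ℝ → ℝ, Integrable h ∧
      (∀ r, 0 ≤ h r) ∧ LipUpTo i h C (cutBox x₀ (R / 2) i) (pd j V) := fun j =>
    exists_lipUpTo_of_locallyIntegrableOn hΩ hR hx₀ hbox (contDiffOn_pd hDo hV j)
      ((hW [] (by simp)).2 j).2.1
      (fun l hl => locallyIntegrableOn_congr_ae hΩ ((((hW l hl).2 j).2.2 i).2)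
        (ae_of_eqOn_inter (eqOn_pd hDo (pd_pds_comm hDo hV j l) i)))
      (((hW [] (by simp)).2 j).2.2 i).1
  obtain ⟨C, hC, h, h1, h2, h3, h4⟩ := exists_common_lipUpTo (q := fun _ => True) hgen0
    (fun j _ => hgen j)
  have hsub : box x₀ (R / 2) ⊆ Ω := fun x hx => hbox fun k => (hx k).le.trans (by linarith)
  exact ⟨R / 2, C, h, hsub, by positivity, hC, h1, h2,
    hV.mono fun x hx => ⟨hsub hx.1, hx.2⟩, h3, h4⟩

end WeakPd

/-! ### Charts, adapted charts and vector fields supported in a chart -/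

section Charts

variable {n : ℕ} {M : Type*} [TopologicalSpace M] [ChartedSpace (Coord n) M]
  {e e' : OpenPartialHomeomorph M (Coord n)}

theorem mdifferentiable_of_mem_maximalAtlas [IsManifold (𝓡 n) ∞ M]
    (he : e ∈ IsManifold.maximalAtlas (𝓡 n) ∞ M) : e.MDifferentiable (𝓡 n) (𝓡 n) :=
  ⟨(contMDiffOn_of_mem_maximalAtlas he).mdifferentiableOn (by simp),
    (contMDiffOn_symm_of_mem_maximalAtlas he).mdifferentiableOn (by simp)⟩

theorem contDiffOn_comp_symm [IsManifold (𝓡 n) ∞ M] (he : e ∈ IsManifold.maximalAtlas (𝓡 n) ∞ M)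
    {k : ℕ∞} {u : M → ℝ} {s : Set M} (hu : ContMDiffOn (𝓡 n) 𝓘(ℝ) k u s) :
    ContDiffOn ℝ k (fun x => u (e.symm x)) (e.target ∩ e.symm ⁻¹' s) := by
  rw [← contMDiffOn_iff_contDiffOn]
  exact hu.comp (((contMDiffOn_symm_of_mem_maximalAtlas he).of_le
    (by exact_mod_cast le_top)).mono inter_subset_left) fun x hx => hx.2

theorem contDiffOn_transition [IsManifold (𝓡 n) ∞ M] (he : e ∈ IsManifold.maximalAtlas (𝓡 n) ∞ M)
    (he' : e' ∈ IsManifold.maximalAtlas (𝓡 n) ∞ M) :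
    ContDiffOn ℝ ∞ (fun x => e' (e.symm x)) (e.target ∩ e.symm ⁻¹' e'.source) := by
  rw [← contMDiffOn_iff_contDiffOn]
  exact (contMDiffOn_of_mem_maximalAtlas he').comp
    ((contMDiffOn_symm_of_mem_maximalAtlas he).mono inter_subset_left) fun x hx => hx.2

theorem isOpen_transition {M : Type*} [TopologicalSpace M]
    (e e' : OpenPartialHomeomorph M (Coord n)) :
    IsOpen (e.target ∩ e.symm ⁻¹' e'.source) :=
  e.isOpen_inter_preimage_symm e'.open_source

/-- A smooth vector field along the chart, transported to the manifold. -/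
theorem contMDiffOn_mfderiv_symm [IsManifold (𝓡 n) ∞ M]
    (he : e ∈ IsManifold.maximalAtlas (𝓡 n) ∞ M)
    {Z : Coord n → Coord n} (hZ : ContDiff ℝ ∞ Z) :
    ContMDiffOn (𝓡 n) (𝓡 n).tangent ∞
      (fun x => (⟨e.symm x, mfderiv (𝓡 n) (𝓡 n) e.symm x (Z x)⟩ : TangentBundle (𝓡 n) M))
      e.target := by
  have h1 := (contMDiffOn_symm_of_mem_maximalAtlas he).contMDiffOn_tangentMapWithin (m := ∞)
    (by simp) e.open_target.uniqueMDiffOn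
  have h2 : ContMDiffOn (𝓡 n) (𝓡 n).tangent ∞
      (fun x => (⟨x, Z x⟩ : TangentBundle (𝓡 n) (Coord n))) e.target := fun x _ =>
    (contMDiffWithinAt_vectorSpace_iff_contDiffWithinAt).2 hZ.contDiffWithinAt
  refine (h1.comp h2 fun x hx => hx).congr fun x hx => ?_
  simp only [Function.comp, tangentMapWithin]
  rw [mfderivWithin_of_isOpen e.open_target hx]

/-- The field `Z` on the chart domain, extended by zero. -/
def chartField (e : OpenPartialHomeomorph M (Coord n)) (Z : Coord n → Coord n) (m : M) :
    TangentSpace (𝓡 n) m :=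
  open Classical in
  if m ∈ e.source then
    (mfderiv (𝓡 n) (𝓡 n) e m).inverse (Z (e m)) else 0

theorem inverse_mfderiv [IsManifold (𝓡 n) ∞ M] (he : e ∈ IsManifold.maximalAtlas (𝓡 n) ∞ M)
    {m : M} (hm : m ∈ e.source) :
    (mfderiv (𝓡 n) (𝓡 n) e m).inverse = mfderiv (𝓡 n) (𝓡 n) e.symm (e m) := by
  have h := mdifferentiable_of_mem_maximalAtlas he
  have h1 : mfderiv (𝓡 n) (𝓡 n) e m = (h.mfderiv hm : TangentSpace (𝓡 n) m →L[ℝ] _) := rfl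
  rw [h1, ContinuousLinearMap.inverse_equiv]
  rfl

theorem mfderiv_apply_inverse [IsManifold (𝓡 n) ∞ M]
    (he : e ∈ IsManifold.maximalAtlas (𝓡 n) ∞ M)
    {m : M} (hm : m ∈ e.source) (v : Coord n) :
    mfderiv (𝓡 n) (𝓡 n) e m ((mfderiv (𝓡 n) (𝓡 n) e m).inverse v) = v := by
  have h := mdifferentiable_of_mem_maximalAtlas he
  have h1 : mfderiv (𝓡 n) (𝓡 n) e m = (h.mfderiv hm : TangentSpace (𝓡 n) m →L[ℝ] _) := rfl
  rw [h1, ContinuousLinearMap.inverse_equiv]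
  exact (h.mfderiv hm).apply_symm_apply v

theorem inverse_mfderiv_apply [IsManifold (𝓡 n) ∞ M]
    (he : e ∈ IsManifold.maximalAtlas (𝓡 n) ∞ M)
    {m : M} (hm : m ∈ e.source) (v : TangentSpace (𝓡 n) m) :
    (mfderiv (𝓡 n) (𝓡 n) e m).inverse (mfderiv (𝓡 n) (𝓡 n) e m v) = v := by
  have h := mdifferentiable_of_mem_maximalAtlas he
  have h1 : mfderiv (𝓡 n) (𝓡 n) e m = (h.mfderiv hm : TangentSpace (𝓡 n) m →L[ℝ] _) := rfl
  rw [h1, ContinuousLinearMap.inverse_equiv]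
  exact (h.mfderiv hm).symm_apply_apply v

theorem fieldInChart_chartField [IsManifold (𝓡 n) ∞ M]
    (he : e ∈ IsManifold.maximalAtlas (𝓡 n) ∞ M)
    (Z : Coord n → Coord n) {x : Coord n} (hx : x ∈ e.target) :
    fieldInChart e (chartField e Z) x = Z x := by
  have hm := e.map_target hx
  rw [fieldInChart, chartField, if_pos hm, mfderiv_apply_inverse he hm, e.right_inv hx]

/-- Inside the chart smoothness is transported from Z. The image of the support of Z is compact,
hence closed in a Hausdorff space, so the field vanishes near every point outside the chart domain.
-/
theorem isSmoothField_chartField [T2Space M] [IsManifold (𝓡 n) ∞ M]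
    (he : e ∈ IsManifold.maximalAtlas (𝓡 n) ∞ M) {Z : Coord n → Coord n} (hZ : ContDiff ℝ ∞ Z)
    (hc : HasCompactSupport Z) (hs : tsupport Z ⊆ e.target) : IsSmoothField (chartField e Z) := by
  intro m
  by_cases hm : m ∈ e.source
  · have h1 : ContMDiffOn (𝓡 n) (𝓡 n).tangent ∞
        (fun m => (⟨m, chartField e Z m⟩ : TangentBundle (𝓡 n) M)) e.source := by
      refine ((contMDiffOn_mfderiv_symm he hZ).comp (contMDiffOn_of_mem_maximalAtlas he)
        fun x hx => e.map_source hx).congr fun y hy => ?_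
      have hy' := e.left_inv hy
      have h2 : chartField e Z y = mfderiv (𝓡 n) (𝓡 n) e.symm (e y) (Z (e y)) := by
        rw [chartField, if_pos hy, inverse_mfderiv he hy]
        rfl
      exact Bundle.TotalSpace.ext hy'.symm (heq_of_eq h2)
    exact h1.contMDiffAt (e.open_source.mem_nhds hm)
  · set K := e.symm '' tsupport Z with hK
    have hKc : IsClosed K := (hc.isCompact.image_of_continuousOn
      (e.continuousOn_symm.mono hs)).isClosed
    have hmK : m ∉ K := by
      rintro ⟨x, hx, rfl⟩
      exact hm (e.map_target (hs hx))
    have hz : ∀ y ∉ K, chartField e Z y = 0 := fun y hy => by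
      by_cases hy' : y ∈ e.source
      · have h0 : Z (e y) = 0 :=
          image_eq_zero_of_notMem_tsupport fun h => hy ⟨e y, h, e.left_inv hy'⟩
        rw [chartField, if_pos hy', h0]
        exact map_zero (mfderiv (𝓡 n) (𝓡 n) e y).inverse
      · rw [chartField, if_neg hy']
    have h0 : ContMDiffAt (𝓡 n) (𝓡 n).tangent ∞
        (fun m => (⟨m, 0⟩ : TangentBundle (𝓡 n) M)) m :=
      Bundle.contMDiff_zeroSection ℝ (TangentSpace (𝓡 n) : M → Type _) m
    refine h0.congr_of_eventuallyEq ?_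
    filter_upwards [hKc.isOpen_compl.mem_nhds hmK] with y hy
    rw [hz y hy]

theorem isTangentTo_chartField [IsManifold (𝓡 n) ∞ M]
    (he : e ∈ IsManifold.maximalAtlas (𝓡 n) ∞ M) {Y : Set M} {f : M → ℝ}
    (hf : IsDefiningFunction (n := n) Y f) {i : Fin n}
    (hfe : ∀ x ∈ e.target, f (e.symm x) = x i)
    {Z : Coord n → Coord n} (hZ : ∀ x, Z x i = 0) : IsTangentTo Y f (chartField e Z) := by
  intro m _
  by_cases hm : m ∈ e.source
  · rw [chartField, if_pos hm, inverse_mfderiv he hm]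
    have h := mdifferentiable_of_mem_maximalAtlas he
    have hx := e.map_source hm
    have hfm : MDifferentiableAt (𝓡 n) 𝓘(ℝ) f (e.symm (e m)) :=
      hf.smooth.mdifferentiable (by simp) _
    have h2 : mfderiv (𝓡 n) 𝓘(ℝ) (f ∘ e.symm) (e m) = EuclideanSpace.proj i := by
      have h3 : f ∘ e.symm =ᶠ[𝓝 (e m)] (EuclideanSpace.proj i : Coord n →L[ℝ] ℝ) := by
        filter_upwards [e.open_target.mem_nhds hx] with x hx
        exact hfe x hx
      rw [h3.mfderiv_eq, mfderiv_eq_fderiv, ContinuousLinearMap.fderiv]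
    rw [mfderiv_comp (e m) hfm (h.mdifferentiableAt_symm hx), e.left_inv hm] at h2
    have h4 := congrArg (fun L : Coord n →L[ℝ] ℝ => L (Z (e m))) h2
    exact h4.trans (hZ (e m))
  · rw [chartField, if_neg hm]
    exact map_zero (mfderiv (𝓡 n) 𝓘(ℝ) f m)

/-- Around every point of the hypersurface there is a chart in which `f` is a coordinate. -/
theorem exists_adapted_chart [IsManifold (𝓡 n) ∞ M] {Y : Set M} {f : M → ℝ}
    (hf : IsDefiningFunction (n := n) Y f) {m : M} (hm : m ∈ Y) :
    ∃ e ∈ IsManifold.maximalAtlas (𝓡 n) ∞ M, m ∈ e.source ∧ ∃ i : Fin n,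
      ∀ x ∈ e.target, f (e.symm x) = x i := by
  set c := chartAt (Coord n) m with hc
  have hcm : c ∈ IsManifold.maximalAtlas (𝓡 n) ∞ M := IsManifold.chart_mem_maximalAtlas m
  have hms : m ∈ c.source := mem_chart_source _ m
  set F : Coord n → ℝ := fun x => f (c.symm x) with hF
  have hFs : ContDiffOn ℝ ∞ F c.target := by
    simpa using contDiffOn_comp_symm (k := ⊤) hcm hf.smooth.contMDiffOn (s := univ)
  have hx₀ : c m ∈ c.target := c.map_source hms
  have hDF : fderiv ℝ F (c m) ≠ 0 := by
    intro h0
    have h := mdifferentiable_of_mem_maximalAtlas hcm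
    have h1 : mfderiv (𝓡 n) 𝓘(ℝ) f m =
        (mfderiv (𝓡 n) 𝓘(ℝ) F (c m)).comp (mfderiv (𝓡 n) (𝓡 n) c m) := by
      rw [← mfderiv_comp m ((hFs.contDiffAt (c.open_target.mem_nhds hx₀)).differentiableAt
        (by simp)).mdifferentiableAt (h.mdifferentiableAt hms)]
      refine Filter.EventuallyEq.mfderiv_eq ?_
      filter_upwards [c.open_source.mem_nhds hms] with y hy
      simp [hF, c.left_inv hy]
    refine hf.mfderiv_ne_zero m hm ?_
    rw [h1, mfderiv_eq_fderiv, h0]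
    exact ContinuousLinearMap.zero_comp _
  obtain ⟨i, hi⟩ : ∃ i, pd i F (c m) ≠ 0 := by
    by_contra! hall
    refine hDF (ContinuousLinearMap.ext fun v => ?_)
    rw [clm_apply_eq_sum]
    exact Finset.sum_eq_zero fun j _ => by
      have := hall j
      rw [pd] at this
      rw [this, mul_zero]
  -- The i-th coordinate is replaced by F; this is a local diffeomorphism wherever ∂_i F ≠ 0.
  set Θ : Coord n → Coord n := fun x => x + (F x - x i) • coordVec i with hΘ
  have hΘi : ∀ x, Θ x i = F x := fun x => by simp [hΘ]
  set U := c.target ∩ {x | pd i F x ≠ 0} with hU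
  have hUo : IsOpen U := (contDiffOn_pd c.open_target hFs i).continuousOn.isOpen_inter_preimage
    c.open_target isOpen_ne
  have hcoord : ContDiff ℝ ∞ (fun x : Coord n => x i) :=
    (EuclideanSpace.proj i : Coord n →L[ℝ] ℝ).contDiff
  have hΘs : ContDiffOn ℝ ∞ Θ c.target :=
    contDiffOn_id.add ((hFs.sub hcoord.contDiffOn).smul contDiffOn_const)
  have hD : ∀ x ∈ U, ∃ L : Coord n ≃L[ℝ] Coord n, HasFDerivAt Θ (L : Coord n →L[ℝ] Coord n) x := by
    intro x hx
    have h1 : HasFDerivAt F (fderiv ℝ F x) x :=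
      ((hFs.contDiffAt (c.open_target.mem_nhds hx.1)).differentiableAt (by simp)).hasFDerivAt
    have h2 : HasFDerivAt (fun x : Coord n => x i) (EuclideanSpace.proj i : Coord n →L[ℝ] ℝ) x :=
      (EuclideanSpace.proj i : Coord n →L[ℝ] ℝ).hasFDerivAt
    have h3 : HasFDerivAt Θ (ContinuousLinearMap.id ℝ (Coord n) +
        (fderiv ℝ F x - EuclideanSpace.proj i).smulRight (coordVec i)) x :=
      (hasFDerivAt_id x).add ((h1.sub h2).smul_const (coordVec i))
    set D := ContinuousLinearMap.id ℝ (Coord n) +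
        (fderiv ℝ F x - EuclideanSpace.proj i).smulRight (coordVec i) with hDdef
    have hinj : Function.Injective D := by
      refine (injective_iff_map_eq_zero D).2 fun v hv => ?_
      have hk : ∀ k, k ≠ i → v k = 0 := fun k hk => by
        have := congrArg (fun w : Coord n => w k) hv
        simpa [hDdef, coordVec, hk] using this
      have hv' : v = v i • coordVec i := by
        ext k
        by_cases h : k = i
        · subst h; simp [coordVec]
        · simp [coordVec, h, hk k h]
      have hvi : fderiv ℝ F x v = 0 := by
        have := congrArg (fun w : Coord n => w i) hv
        simpa [hDdef, coordVec] using this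
      rw [hv', map_smul, smul_eq_mul] at hvi
      have : v i = 0 := (mul_eq_zero.1 hvi).resolve_right hx.2
      rw [hv', this, zero_smul]
    refine ⟨(LinearEquiv.ofInjectiveEndo D.toLinearMap hinj).toContinuousLinearEquiv, ?_⟩
    convert h3
    rfl
  obtain ⟨L, hL⟩ := hD (c m) ⟨hx₀, hi⟩
  have hΘat : ∀ x ∈ U, ContDiffAt ℝ ∞ Θ x := fun x hx =>
    hΘs.contDiffAt (c.open_target.mem_nhds hx.1)
  -- Restricting to U keeps the derivative invertible at every point of the source, so the inverse
  -- is smooth on the whole target.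
  set Φ := ((hΘat _ ⟨hx₀, hi⟩).toOpenPartialHomeomorph Θ hL (by simp)).restrOpen U hUo with hΦ
  have hΦc : ∀ x, Φ x = Θ x := fun x => rfl
  have hΦs : Φ.source ⊆ U := inter_subset_right
  have hΦ1 : ContDiffOn ℝ ∞ Φ Φ.source := fun x hx => (hΘat x (hΦs hx)).contDiffWithinAt
  have hΦ2 : ContDiffOn ℝ ∞ Φ.symm Φ.target := fun y hy => by
    have hy' := Φ.map_target hy
    obtain ⟨L', hL'⟩ := hD _ (hΦs hy')
    exact (Φ.contDiffAt_symm hy hL' (hΘat _ (hΦs hy'))).contDiffWithinAt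
  have hmΦ : c m ∈ Φ.source :=
    ⟨ContDiffAt.mem_toOpenPartialHomeomorph_source _ hL (by simp), hx₀, hi⟩
  refine ⟨c.trans Φ, OpenPartialHomeomorph.mem_maximalAtlas_of_contMDiffOn _ ?_ ?_, ?_, i, ?_⟩
  · refine (contMDiffOn_iff_contDiffOn.2 hΦ1).comp
      ((contMDiffOn_of_mem_maximalAtlas hcm).mono ?_) ?_
    · simp
    · intro x hx
      rw [OpenPartialHomeomorph.trans_source] at hx
      exact hx.2
  · refine (contMDiffOn_symm_of_mem_maximalAtlas hcm).comp
      ((contMDiffOn_iff_contDiffOn.2 hΦ2).mono ?_) ?_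
    · rw [OpenPartialHomeomorph.trans_target]; exact inter_subset_left
    · intro x hx
      rw [OpenPartialHomeomorph.trans_target] at hx
      exact hx.2
  · rw [OpenPartialHomeomorph.trans_source]
    exact ⟨hms, hmΦ⟩
  · intro x hx
    rw [OpenPartialHomeomorph.trans_target] at hx
    have h1 : Θ (Φ.symm x) = x := Φ.right_inv hx.1
    have h2 : f ((c.trans Φ).symm x) = F (Φ.symm x) := rfl
    rw [h2, ← hΘi, h1]

end Charts

/-! ### From weak derivatives on the manifold to weak derivatives in an adapted chart -/

section WeakInChart

variable {n : ℕ} {M : Type*} [TopologicalSpace M] [ChartedSpace (Coord n) M]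
  {e : OpenPartialHomeomorph M (Coord n)}

theorem divergence_smul_coordVec {φ : Coord n → ℝ} (hφ : Differentiable ℝ φ) (j : Fin n)
    (x : Coord n) : divergence (fun y => φ y • coordVec j) x = pd j φ x := by
  have h : fderiv ℝ (fun y => φ y • coordVec j) x = (fderiv ℝ φ x).smulRight (coordVec j) :=
    ((hφ x).hasFDerivAt.smul_const _).fderiv
  rw [divergence, h]
  have h2 : ((fderiv ℝ φ x).smulRight (coordVec j)).toLinearMap =
      dualTensorHom ℝ (Coord n) (Coord n) ((fderiv ℝ φ x).toLinearMap ⊗ₜ coordVec j) := by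
    ext v
    simp [dualTensorHom_apply]
  rw [h2, LinearMap.trace_eq_contract_apply, contractLeft_apply]
  rfl

/-- A coordinate field lives only in the chart; multiplied by a cutoff it becomes a global field,
and test functions supported where the cutoff equals 1 do not see the difference. -/
theorem isWeakPd_of_isWeakDeriv [IsManifold (𝓡 n) ∞ M]
    (he : e ∈ IsManifold.maximalAtlas (𝓡 n) ∞ M) {Ω : Set (Coord n)} (hΩ : Ω ⊆ e.target)
    {χ : Coord n → ℝ} (hχ : ∀ x ∈ Ω, χ x = 1) {j : Fin n} {u w : M → ℝ}
    (h : IsWeakDeriv (chartField e fun x => χ x • coordVec j) u w) :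
    IsWeakPd j Ω (fun x => u (e.symm x)) (fun x => w (e.symm x)) := by
  intro φ h1 h2 h3
  rw [← h e he φ h1 h2 (h3.trans hΩ)]
  have hfun : (fun y => φ y • fieldInChart e (chartField e fun x => χ x • coordVec j) y) =
      fun y => φ y • coordVec j := by
    funext y
    by_cases hy : y ∈ tsupport φ
    · rw [fieldInChart_chartField he _ (hΩ (h3 hy)), hχ y (h3 hy), one_smul]
    · rw [image_eq_zero_of_notMem_tsupport hy, zero_smul, zero_smul]
  rw [hfun]
  simp_rw [divergence_smul_coordVec (h1.differentiable (by simp)) j]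

theorem MemW1Loc.memL1Loc [IsManifold (𝓡 n) ∞ M] {k : ℕ} {u : M → ℝ}
    (h : MemW1Loc (n := n) k u) : MemL1Loc n u := by
  cases k with
  | zero => exact h
  | succ k => exact h.1

theorem MemIWUpTo.memW1Loc [IsManifold (𝓡 n) ∞ M] {Y : Set M} {f : M → ℝ} {k N : ℕ} {u : M → ℝ}
    (h : MemIWUpTo (n := n) Y f k N u) : MemW1Loc (n := n) k u := by
  cases N with
  | zero => exact h
  | succ k => exact h.1

/-- A cutoff equal to one near `Ω`, with compact support in the chart. -/
structure IsChartCutoff (e : OpenPartialHomeomorph M (Coord n)) (Ω : Set (Coord n))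
    (χ : Coord n → ℝ) : Prop where
  isOpen : IsOpen Ω
  subset : Ω ⊆ e.target
  contDiff : ContDiff ℝ ∞ χ
  hasCompactSupport : HasCompactSupport χ
  tsupport_subset : tsupport χ ⊆ e.target
  eq_one : ∀ x ∈ Ω, χ x = 1

theorem exists_isChartCutoff {M : Type*} [TopologicalSpace M]
    (e : OpenPartialHomeomorph M (Coord n)) {x₀ : Coord n}
    (hx₀ : x₀ ∈ e.target) : ∃ Ω χ, x₀ ∈ Ω ∧ IsChartCutoff e Ω χ := by
  obtain ⟨r, hr, hsub⟩ := Metric.nhds_basis_closedBall.mem_iff.1 (e.open_target.mem_nhds hx₀)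
  let ψ : ContDiffBump x₀ := ⟨r / 2, r, by positivity, by linarith⟩
  refine ⟨Metric.ball x₀ (r / 2), ψ, Metric.mem_ball_self (by positivity), Metric.isOpen_ball,
    fun x hx => hsub (Metric.closedBall_subset_closedBall (by linarith)
      (Metric.ball_subset_closedBall hx)), ψ.contDiff, ψ.hasCompactSupport, ?_, fun x hx =>
      ψ.one_of_mem_closedBall (Metric.ball_subset_closedBall hx)⟩
  rw [ψ.tsupport_eq]
  exact hsub

theorem IsChartCutoff.isSmoothField [T2Space M] [IsManifold (𝓡 n) ∞ M]
    (he : e ∈ IsManifold.maximalAtlas (𝓡 n) ∞ M) {Ω : Set (Coord n)} {χ : Coord n → ℝ}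
    (hχ : IsChartCutoff e Ω χ) (j : Fin n) :
    IsSmoothField (chartField e fun x => χ x • coordVec j) :=
  isSmoothField_chartField he (hχ.contDiff.smul contDiff_const)
    (hχ.hasCompactSupport.smul_right) ((tsupport_smul_subset_left _ _).trans hχ.tsupport_subset)

theorem IsChartCutoff.locallyIntegrableOn {Ω : Set (Coord n)} {χ : Coord n → ℝ}
    (he : e ∈ IsManifold.maximalAtlas (𝓡 n) ∞ M) (hχ : IsChartCutoff e Ω χ) {u : M → ℝ}
    (hu : MemL1Loc n u) : LocallyIntegrableOn (fun x => u (e.symm x)) Ω :=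
  (hu e he).mono_set hχ.subset

/-- Weak derivatives along the cut-off coordinate fields agree almost everywhere with the classical
derivatives off the hyperplane, so the induction on the order can continue with the latter. This is
why u and U are only required to agree almost everywhere. -/
theorem MemW1Loc.classicalW [T2Space M] [IsManifold (𝓡 n) ∞ M]
    (he : e ∈ IsManifold.maximalAtlas (𝓡 n) ∞ M) {Ω : Set (Coord n)} {χ : Coord n → ℝ}
    (hχ : IsChartCutoff e Ω χ) {i : Fin n} {k : ℕ} {u : M → ℝ} (hu : MemW1Loc (n := n) k u)
    {U : Coord n → ℝ} (hU : ContDiffOn ℝ ∞ U (Ω ∩ {x | x i ≠ 0}))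
    (huU : ∀ᵐ x, x ∈ Ω → u (e.symm x) = U x) : ClassicalW Ω k U := by
  induction k generalizing u U with
  | zero =>
    exact locallyIntegrableOn_congr_ae hχ.isOpen
      (hχ.locallyIntegrableOn he hu.memL1Loc) huU
  | succ k ih =>
    refine ⟨locallyIntegrableOn_congr_ae hχ.isOpen (hχ.locallyIntegrableOn he hu.memL1Loc) huU,
      fun j => ?_⟩
    obtain ⟨w, hw1, hw2⟩ := hu.2 _ (hχ.isSmoothField he j)
    have h1 := isWeakPd_of_isWeakDeriv he hχ.subset hχ.eq_one hw1
    have h2 := ae_eq_pd_of_isWeakPd hχ.isOpen hU huU h1 (hχ.locallyIntegrableOn he hw2.memL1Loc)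
    exact ⟨h1.congr_ae huU h2,
      ih hw2 (contDiffOn_pd (isOpen_inter_coord_ne hχ.isOpen i) hU j) h2⟩

/-- The outermost field in `MemIWUpTo` acts on u first, as does the last entry of the list in `pds`;
hence the induction from the end of the list. The cut-off field in direction j ≠ i is tangent to Y
because f is the coordinate x_i. -/
theorem MemIWUpTo.classicalW [T2Space M] [IsManifold (𝓡 n) ∞ M]
    (he : e ∈ IsManifold.maximalAtlas (𝓡 n) ∞ M) {Y : Set M} {f : M → ℝ}
    (hf : IsDefiningFunction (n := n) Y f) {i : Fin n}
    (hfe : ∀ x ∈ e.target, f (e.symm x) = x i) {Ω : Set (Coord n)} {χ : Coord n → ℝ}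
    (hχ : IsChartCutoff e Ω χ) {k : ℕ} (l : List (Fin n)) (hl : ∀ j ∈ l, j ≠ i) {u : M → ℝ}
    (hu : MemIWUpTo (n := n) Y f k l.length u)
    {U : Coord n → ℝ} (hU : ContDiffOn ℝ ∞ U (Ω ∩ {x | x i ≠ 0}))
    (huU : ∀ᵐ x, x ∈ Ω → u (e.symm x) = U x) : ClassicalW Ω k (pds l U) := by
  induction l using List.reverseRecOn generalizing u U with
  | nil => exact hu.memW1Loc.classicalW he hχ hU huU
  | append_singleton l j ih =>
    rw [← pds_pd]
    rw [List.length_append, List.length_singleton] at hu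
    have hj : j ≠ i := hl j (by simp)
    obtain ⟨w, hw1, hw2⟩ := hu.2 _ (hχ.isSmoothField he j)
      (isTangentTo_chartField he hf hfe fun x => by simp [coordVec, hj.symm])
    have h1 := isWeakPd_of_isWeakDeriv he hχ.subset hχ.eq_one hw1
    have h2 := ae_eq_pd_of_isWeakPd hχ.isOpen hU huU h1
      (hχ.locallyIntegrableOn he hw2.memW1Loc.memL1Loc)
    exact ih (fun k hk => hl k (by simp [hk])) hw2
      (contDiffOn_pd (isOpen_inter_coord_ne hχ.isOpen i) hU j) h2

end WeakInChart

/-! ### Extension across the hyperplane -/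

section Extension

variable {n : ℕ} {i : Fin n} {x₀ : Coord n} {r C : ℝ} {h : ℝ → ℝ} {U : Coord n → ℝ}

theorem subset_closure_cutBox : box x₀ r ⊆ closure (cutBox x₀ r i) := by
  intro z hz
  by_cases hzi : z i = 0
  · exact closure_mono sideBox_subset_cutBox
      (mem_closure_iff_nhdsWithin_neBot.2 (neBot_sideBox hz hzi).1)
  · exact subset_closure ⟨hz, hzi⟩

theorem continuous_primitive (hh : Integrable h) : Continuous fun t => ∫ r in (0 : ℝ)..t, h r :=
  intervalIntegral.continuous_primitive (fun _ _ => hh.intervalIntegrable) 0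

theorem primitive_sub (hh : Integrable h) (a b : ℝ) :
    (∫ r in (0 : ℝ)..a, h r) - ∫ r in (0 : ℝ)..b, h r = ∫ r in b..a, h r :=
  intervalIntegral.integral_interval_sub_left hh.intervalIntegrable hh.intervalIntegrable

/-- Continuity of the primitive of h turns the increment bound into a Cauchy criterion at the
hyperplane, and the bound persists when both points pass to the limit. -/
theorem exists_continuousOn_extension (hh : Integrable h) (hU : LipUpTo i h C (cutBox x₀ r i) U)
    (hUc : ContinuousOn U (cutBox x₀ r i)) :
    ∃ Ū : Coord n → ℝ, ContinuousOn Ū (box x₀ r) ∧ EqOn Ū U (cutBox x₀ r i) ∧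
      LipUpTo i h C (box x₀ r) Ū := by
  set H : ℝ → ℝ := fun t => ∫ r in (0 : ℝ)..t, h r with hH
  have hHc : Continuous H := continuous_primitive hh
  have hlim : ∀ z ∈ box x₀ r, ∃ ℓ, Tendsto U (𝓝[cutBox x₀ r i] z) (𝓝 ℓ) := fun z hz => by
    have := mem_closure_iff_nhdsWithin_neBot.1 (subset_closure_cutBox (i := i) hz)
    refine exists_tendsto_of_abs_sub_le (H := H) (C := C) (i := i) hHc fun x hx y hy => ?_
    rw [primitive_sub hh]
    exact hU x hx y hy
  have hcont := continuousOn_extendFrom subset_closure_cutBox hlim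
  have heq : EqOn (extendFrom (cutBox x₀ r i) U) U (cutBox x₀ r i) := fun x hx =>
    extendFrom_eq (subset_closure hx) (hUc x hx)
  refine ⟨extendFrom (cutBox x₀ r i) U, hcont, heq, fun x hx y hy => ?_⟩
  have hx' := mem_closure_iff_nhdsWithin_neBot.1 (subset_closure_cutBox (i := i) hx)
  have hy' := mem_closure_iff_nhdsWithin_neBot.1 (subset_closure_cutBox (i := i) hy)
  have hx2 : Tendsto (extendFrom (cutBox x₀ r i) U) (𝓝[cutBox x₀ r i] x)
      (𝓝 (extendFrom (cutBox x₀ r i) U x)) := (hcont x hx).mono inter_subset_left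
  have hy2 : Tendsto (extendFrom (cutBox x₀ r i) U) (𝓝[cutBox x₀ r i] y)
      (𝓝 (extendFrom (cutBox x₀ r i) U y)) := (hcont y hy).mono inter_subset_left
  have hcoord : Continuous fun x : Coord n => H (x i) := hHc.comp (by fun_prop)
  have hxx : Tendsto (fun p : Coord n × Coord n => p.1)
      (𝓝[cutBox x₀ r i] x ×ˢ 𝓝[cutBox x₀ r i] y) (𝓝 x) :=
    tendsto_fst.mono_right nhdsWithin_le_nhds
  have hyy : Tendsto (fun p : Coord n × Coord n => p.2)
      (𝓝[cutBox x₀ r i] x ×ˢ 𝓝[cutBox x₀ r i] y) (𝓝 y) :=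
    tendsto_snd.mono_right nhdsWithin_le_nhds
  rw [← primitive_sub hh]
  have t1 := ((Tendsto.comp hx2 tendsto_fst).sub (Tendsto.comp hy2 (tendsto_snd
    (f := 𝓝[cutBox x₀ r i] x)))).abs
  have t2 := ((hxx.sub hyy).norm.const_mul C).add
    (((hcoord.tendsto x).comp hxx).sub ((hcoord.tendsto y).comp hyy)).abs
  refine le_of_tendsto_of_tendsto t1 t2 ?_
  filter_upwards [prod_mem_prod self_mem_nhdsWithin self_mem_nhdsWithin] with p hp
  simp only [Function.comp]
  rw [heq hp.1, heq hp.2, hH, primitive_sub hh]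
  exact hU _ hp.1 _ hp.2

/-- A potential near a point of the hyperplane `x_i = 0`: the field `W` extends the derivatives
`∂_j v`, `q j`, across the hyperplane, and both `v` and `W` are Lipschitz up to increments of
`H(x_i)`. -/
structure IsLocalPotential (i : Fin n) (q : Fin n → Prop) (Ω : Set (Coord n)) (v : Coord n → ℝ)
    (W : Coord n → Coord n) (H : ℝ → ℝ) (C : ℝ) : Prop where
  isOpen : IsOpen Ω
  monotone : Monotone H
  continuous : Continuous H
  absolutelyContinuous : ∀ a b, AbsolutelyContinuousOnInterval H a b
  nonneg : 0 ≤ C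
  contDiffOn : ContDiffOn ℝ ∞ v (Ω ∩ {x | x i ≠ 0})
  lip : ∀ x ∈ Ω, ∀ y ∈ Ω, |v x - v y| ≤ C * (‖x - y‖ + |H (x i) - H (y i)|)
  lip_grad : ∀ x ∈ Ω, ∀ y ∈ Ω, ‖W x - W y‖ ≤ C * (‖x - y‖ + |H (x i) - H (y i)|)
  eq_grad : ∀ x ∈ Ω, x i ≠ 0 → ∀ j, q j → W x j = pd j v x

theorem norm_le_sum_abs (x : Coord n) : ‖x‖ ≤ ∑ j, |x j| := by
  have h : x = ∑ j, x j • coordVec j := by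
    ext k
    simp [coordVec, Finset.sum_apply, Pi.single_apply]
  calc ‖x‖ = ‖∑ j, x j • coordVec j‖ := by rw [← h]
    _ ≤ ∑ j, ‖x j • coordVec j‖ := norm_sum_le _ _
    _ = ∑ j, |x j| := by simp [norm_smul, coordVec]

/-- H is the primitive of h, which is monotone and absolutely continuous. The factor n + 1 in the
constant pays for assembling n scalar components into the vector W. -/
theorem HasLocalBounds.exists_isLocalPotential {q : Fin n → Prop} {V : Coord n → ℝ}
    (hV : HasLocalBounds i x₀ q V r C h) :
    ∃ (v : Coord n → ℝ) (W : Coord n → Coord n) (H : ℝ → ℝ) (C' : ℝ),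
      EqOn v V (cutBox x₀ r i) ∧ IsLocalPotential i q (box x₀ r) v W H C' := by
  classical
  have hinteg := hV.integrable
  have hDo := isOpen_cutBox x₀ r i
  obtain ⟨v, hvc, hvV, hvl⟩ :=
    exists_continuousOn_extension hinteg hV.lip hV.contDiffOn.continuousOn
  have hex : ∀ j, ∃ w : Coord n → ℝ, (q j → EqOn w (pd j V) (cutBox x₀ r i)) ∧
      LipUpTo i h C (box x₀ r) w := fun j => by
    by_cases hj : q j
    · obtain ⟨w, _, h2, h3⟩ := exists_continuousOn_extension hinteg (hV.lip_pd j hj)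
        (contDiffOn_pd hDo hV.contDiffOn j).continuousOn
      exact ⟨w, fun _ => h2, h3⟩
    -- A derivative outside the control of q is replaced by the zero component; no equation for it
    -- is claimed.
    · refine ⟨0, fun h => absurd h hj, fun x _ y _ => ?_⟩
      have := hV.C_nonneg
      simp only [Pi.zero_apply, sub_self, abs_zero]
      positivity
  choose w hw1 hw2 using hex
  have hstep : ∀ u : Coord n → ℝ, LipUpTo i h C (box x₀ r) u → ∀ x ∈ box x₀ r, ∀ y ∈ box x₀ r,
      |u x - u y| ≤ (C + 1) * (‖x - y‖ + |(∫ r in (0 : ℝ)..(x i), h r) -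
        ∫ r in (0 : ℝ)..(y i), h r|) := fun u hu x hx y hy => by
    refine (hu x hx y hy).trans ?_
    rw [primitive_sub hinteg]
    nlinarith [hV.C_nonneg, norm_nonneg (x - y), abs_nonneg (∫ r in (y i)..(x i), h r),
      mul_nonneg hV.C_nonneg (abs_nonneg (∫ r in (y i)..(x i), h r))]
  refine ⟨v, fun x => WithLp.toLp 2 fun j => w j x, fun t => ∫ r in (0 : ℝ)..t, h r,
    (n + 1) * (C + 1), hvV, isOpen_box x₀ r, ?_, continuous_primitive hinteg, ?_, ?_, ?_, ?_, ?_, ?_⟩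
  · intro a b hab
    rw [← sub_nonneg, primitive_sub hinteg]
    exact intervalIntegral.integral_nonneg hab fun u _ => hV.nonneg u
  · intro a b
    exact (hinteg.intervalIntegrable (a := min a (min b 0)) (b := max a (max b 0))
      |>.absolutelyContinuousOnInterval_intervalIntegral (by simp [uIcc_of_le])).mono (by
        rw [uIcc_of_le (show min a (min b 0) ≤ max a (max b 0) by simp)]
        exact uIcc_subset_Icc (by simp) (by simp))
  · have := hV.C_nonneg; positivity
  · exact hV.contDiffOn.congr hvV
  · intro x hx y hy
    refine (hstep v hvl x hx y hy).trans ?_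
    have := hV.C_nonneg
    gcongr
    have : (0 : ℝ) ≤ n * (C + 1) := by positivity
    linarith
  · intro x hx y hy
    refine (norm_le_sum_abs _).trans ?_
    have h1 : ∑ j : Fin n, |((WithLp.toLp 2 fun j => w j x : Coord n) -
        WithLp.toLp 2 fun j => w j y) j| ≤ ∑ _j : Fin n, (C + 1) * (‖x - y‖ +
          |(∫ r in (0 : ℝ)..(x i), h r) - ∫ r in (0 : ℝ)..(y i), h r|) :=
      Finset.sum_le_sum fun j _ => by simpa using hstep (w j) (hw2 j) x hx y hy
    refine h1.trans ?_
    rw [Finset.sum_const, Finset.card_univ, Fintype.card_fin, nsmul_eq_mul, ← mul_assoc]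
    have := hV.C_nonneg
    gcongr
    linarith
  · intro x hx hxi j hj
    have h1 : w j x = pd j V x := hw1 j hj ⟨hx, hxi⟩
    exact h1.trans (eqOn_pd hDo hvV.symm j ⟨hx, hxi⟩)

end Extension

/-! ### The extended potential -/

section Potential

variable {n : ℕ} {i : Fin n} {q : Fin n → Prop} {Ω : Set (Coord n)} {v v' : Coord n → ℝ}
  {W : Coord n → Coord n} {H : ℝ → ℝ} {C : ℝ}

theorem continuousOn_of_norm_sub_le {F : Type*} [NormedAddCommGroup F] {u : Coord n → F}
    (hH : Continuous H)
    (h : ∀ x ∈ Ω, ∀ y ∈ Ω, ‖u x - u y‖ ≤ C * (‖x - y‖ + |H (x i) - H (y i)|)) :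
    ContinuousOn u Ω := by
  intro y hy
  refine tendsto_iff_norm_sub_tendsto_zero.2 ?_
  have hc : Continuous fun x : Coord n => C * (‖x - y‖ + |H (x i) - H (y i)|) := by
    have : Continuous fun x : Coord n => H (x i) := hH.comp (by fun_prop)
    fun_prop
  have h0 : Tendsto (fun x : Coord n => C * (‖x - y‖ + |H (x i) - H (y i)|)) (𝓝[Ω] y) (𝓝 0) := by
    simpa using (hc.tendsto y).mono_left nhdsWithin_le_nhds
  refine squeeze_zero' (.of_forall fun _ => norm_nonneg _) ?_ h0
  filter_upwards [self_mem_nhdsWithin] with x hx using h x hx y hy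

namespace IsLocalPotential

theorem continuousOn (h : IsLocalPotential i q Ω v W H C) : ContinuousOn v Ω :=
  continuousOn_of_norm_sub_le h.continuous h.lip

theorem continuousOn_grad (h : IsLocalPotential i q Ω v W H C) : ContinuousOn W Ω :=
  continuousOn_of_norm_sub_le h.continuous h.lip_grad

theorem congr (h : IsLocalPotential i q Ω v W H C) (hv : EqOn v' v Ω) :
    IsLocalPotential i q Ω v' W H C where
  isOpen := h.isOpen
  monotone := h.monotone
  continuous := h.continuous
  absolutelyContinuous := h.absolutelyContinuous
  nonneg := h.nonneg
  contDiffOn := h.contDiffOn.congr fun x hx => hv hx.1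
  lip x hx y hy := by rw [hv hx, hv hy]; exact h.lip x hx y hy
  lip_grad := h.lip_grad
  eq_grad x hx hxi j hj := (h.eq_grad x hx hxi j hj).trans (eqOn_pd h.isOpen hv.symm j hx)

theorem differentiableAt (h : IsLocalPotential i q Ω v W H C) {x : Coord n} (hx : x ∈ Ω)
    (hxi : x i ≠ 0) : DifferentiableAt ℝ v x :=
  (h.contDiffOn.contDiffAt ((isOpen_inter_coord_ne h.isOpen i).mem_nhds ⟨hx, hxi⟩)).differentiableAt
    (by simp)

theorem fderiv_eq (h : IsLocalPotential i (fun _ => True) Ω v W H C) {x : Coord n}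
    (hx : x ∈ Ω) (hxi : x i ≠ 0) : fderiv ℝ v x = InnerProductSpace.toDual ℝ (Coord n) (W x) := by
  refine ContinuousLinearMap.ext fun u => ?_
  rw [clm_apply_eq_sum, InnerProductSpace.toDual_apply_apply, PiLp.inner_apply]
  refine Finset.sum_congr rfl fun j _ => ?_
  have := h.eq_grad x hx hxi j trivial
  rw [pd] at this
  rw [← this]
  simp

/-- On each open half ball v is differentiable, and its derivative tends to that given by W x. By
convexity v then has this derivative within each closed half at x, and the two halves cover the
ball. -/
theorem hasGradientAt (h : IsLocalPotential i (fun _ => True) Ω v W H C) {x : Coord n}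
    (hx : x ∈ Ω) : HasGradientAt v (W x) x := by
  rw [hasGradientAt_iff_hasFDerivAt]
  by_cases hxi : x i = 0
  · obtain ⟨δ, hδ, hsub⟩ := Metric.nhds_basis_closedBall.mem_iff.1 (h.isOpen.mem_nhds hx)
    have key : ∀ σ : ℝ, σ ≠ 0 → HasFDerivWithinAt v (InnerProductSpace.toDual ℝ (Coord n) (W x))
        (closure (Metric.ball x δ ∩ {y | 0 < σ * y i})) x := fun σ hσ => by
      set s := Metric.ball x δ ∩ {y : Coord n | 0 < σ * y i} with hs
      have hsΩ : s ⊆ Ω := fun y hy => hsub (Metric.ball_subset_closedBall hy.1)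
      have hsi : ∀ y ∈ s, y i ≠ 0 := fun y hy h0 => by
        have : 0 < σ * y i := hy.2
        simp [h0] at this
      have hcl : closure s ⊆ Ω := (closure_mono inter_subset_left).trans
        (Metric.closure_ball_subset_closedBall.trans hsub)
      refine hasFDerivWithinAt_closure_of_tendsto_fderiv ?_ ?_ ?_ ?_ ?_
      · exact fun y hy => (h.differentiableAt (hsΩ hy) (hsi y hy)).differentiableWithinAt
      · refine (convex_ball x δ).inter ?_
        exact convex_halfSpace_gt (f := fun y : Coord n => σ * y i)
          ⟨fun a b => by simp [mul_add], fun c a => by simp [mul_left_comm]⟩ 0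
      · exact Metric.isOpen_ball.inter (isOpen_lt continuous_const (by fun_prop))
      · exact fun y hy => (h.continuousOn y (hcl hy)).mono hsΩ
      · have h1 : Tendsto (fun y => InnerProductSpace.toDual ℝ (Coord n) (W y)) (𝓝[s] x)
            (𝓝 (InnerProductSpace.toDual ℝ (Coord n) (W x))) :=
          ((InnerProductSpace.toDual ℝ (Coord n)).continuous.tendsto _).comp
            ((h.continuousOn_grad x hx).mono hsΩ)
        refine h1.congr' ?_
        filter_upwards [self_mem_nhdsWithin] with y hy
        exact (h.fderiv_eq (hsΩ hy) (hsi y hy)).symm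
    have hcov : Metric.ball x δ ⊆ closure (Metric.ball x δ ∩ {y : Coord n | 0 < 1 * y i}) ∪
        closure (Metric.ball x δ ∩ {y : Coord n | 0 < (-1) * y i}) := by
      intro y hy
      rcases lt_trichotomy (y i) 0 with hyi | hyi | hyi
      · exact .inr (subset_closure ⟨hy, by simpa using hyi⟩)
      · refine .inl (mem_closure_of_tendsto (f := fun t : ℝ => y + t • coordVec i)
          (b := 𝓝[>] 0) ?_ ?_)
        · have : Continuous fun t : ℝ => y + t • coordVec i := by fun_prop
          simpa using (this.tendsto 0).mono_left nhdsWithin_le_nhds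
        · have hc : Continuous fun t : ℝ => y + t • coordVec i := by fun_prop
          have h1 : ∀ᶠ t in 𝓝 (0 : ℝ), y + t • coordVec i ∈ Metric.ball x δ :=
            hc.continuousAt.eventually (Metric.isOpen_ball.mem_nhds (by simpa using hy))
          filter_upwards [h1.filter_mono nhdsWithin_le_nhds, self_mem_nhdsWithin] with t h1 h2
          exact ⟨h1, by simpa [hyi, coordVec] using h2⟩
      · exact .inl (subset_closure ⟨hy, by simpa using hyi⟩)
    exact ((key 1 one_ne_zero).union (key (-1) (by simp))).hasFDerivAt
      (mem_of_superset (Metric.ball_mem_nhds x hδ) hcov)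
  · rw [← h.fderiv_eq hx hxi]
    exact (h.differentiableAt hx hxi).hasFDerivAt

theorem contDiffOn_one (h : IsLocalPotential i (fun _ => True) Ω v W H C) :
    ContDiffOn ℝ 1 v Ω := by
  rw [show (1 : WithTop ℕ∞) = 0 + 1 from (zero_add 1).symm,
    contDiffOn_succ_iff_fderiv_of_isOpen h.isOpen]
  refine ⟨fun x hx => (h.hasGradientAt hx).differentiableAt.differentiableWithinAt, by simp, ?_⟩
  rw [contDiffOn_zero]
  refine ((InnerProductSpace.toDual ℝ (Coord n)).continuous.comp_continuousOn
    h.continuousOn_grad).congr fun x hx => ?_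
  exact (hasGradientAt_iff_hasFDerivAt.1 (h.hasGradientAt hx)).fderiv

end IsLocalPotential

end Potential

/-! ### Extension of the potential on the manifold -/

section Global

variable {n : ℕ} {M : Type*} [TopologicalSpace M] [ChartedSpace (Coord n) M]
  {Y : Set M} {f V V₀ : M → ℝ}

/-- A chart around `m` in which `f` is the coordinate `x_i`, together with the local structure of
the potential `V₀` there. -/
structure IsAdaptedAt (f V₀ : M → ℝ) (q : Fin n → Fin n → Prop) (m : M)
    (e : OpenPartialHomeomorph M (Coord n)) (i : Fin n) (Ω : Set (Coord n))
    (W : Coord n → Coord n) (H : ℝ → ℝ) (C : ℝ) : Prop where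
  mem_atlas : e ∈ IsManifold.maximalAtlas (𝓡 n) ∞ M
  mem_source : m ∈ e.source
  defining : ∀ x ∈ e.target, f (e.symm x) = x i
  mem : e m ∈ Ω
  subset : Ω ⊆ e.target
  potential : IsLocalPotential i (q i) Ω (fun x => V₀ (e.symm x)) W H C

theorem IsDefiningFunction.isClosed {M : Type*} [TopologicalSpace M] [ChartedSpace (Coord n) M]
    {Y : Set M} {f : M → ℝ} (hf : IsDefiningFunction (n := n) Y f) : IsClosed Y := by
  have : Y = f ⁻¹' {0} := by ext m; simp [hf.mem_iff m]
  rw [this]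
  exact isClosed_singleton.preimage hf.smooth.continuous

/-- The complement of Y is dense, and the local extensions show that V has a limit along it at every
point of Y. Limits do not depend on charts, so the local extensions agree with one global function.
-/
theorem exists_extension [IsManifold (𝓡 n) ∞ M] (hf : IsDefiningFunction (n := n) Y f)
    (hV : ContMDiffOn (𝓡 n) 𝓘(ℝ) ∞ V Yᶜ) {q : Fin n → Fin n → Prop}
    (hloc : ∀ m ∈ Y, ∃ e ∈ IsManifold.maximalAtlas (𝓡 n) ∞ M, m ∈ e.source ∧ ∃ i : Fin n,
      (∀ x ∈ e.target, f (e.symm x) = x i) ∧ ∃ r C h, box (e m) r ⊆ e.target ∧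
        HasLocalBounds i (e m) (q i) (fun x => V (e.symm x)) r C h) :
    ∃ V₀ : M → ℝ, Continuous V₀ ∧ EqOn V₀ V Yᶜ ∧
      ∀ m ∈ Y, ∃ e i Ω W H C, IsAdaptedAt f V₀ q m e i Ω W H C := by
  have hYo : IsOpen Yᶜ := hf.isClosed.isOpen_compl
  have hY : ∀ m ∈ Y, ∃ e ∈ IsManifold.maximalAtlas (𝓡 n) ∞ M, m ∈ e.source ∧ ∃ i : Fin n,
      (∀ x ∈ e.target, f (e.symm x) = x i) ∧ ∃ Ω v W H C, e m ∈ Ω ∧ Ω ⊆ e.target ∧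
        IsLocalPotential i (q i) Ω v W H C ∧ ∀ x ∈ Ω, e.symm x ∈ closure Yᶜ ∧
          Tendsto V (𝓝[Yᶜ] (e.symm x)) (𝓝 (v x)) := by
    intro m hm
    obtain ⟨e, he, hme, i, hfe, r, C, h, hsub, hb⟩ := hloc m hm
    obtain ⟨v, W, H, C', hvV, hpot⟩ := hb.exists_isLocalPotential
    have hmem : e m ∈ box (e m) r := fun k => by simpa using hb.r_pos
    have hYx : ∀ x ∈ e.target, e.symm x ∈ Yᶜ ↔ x i ≠ 0 := fun x hx => by
      rw [mem_compl_iff, hf.mem_iff, hfe x hx]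
    refine ⟨e, he, hme, i, hfe, box (e m) r, v, W, H, C', hmem, hsub, hpot, fun x hx => ?_⟩
    have hxt := hsub hx
    constructor
    · have h1 := ((e.continuousAt_symm hxt).continuousWithinAt).mem_closure_image
        (subset_closure_cutBox (i := i) hx)
      refine closure_mono ?_ h1
      rintro _ ⟨y, hy, rfl⟩
      exact (hYx y (hsub hy.1)).2 hy.2
    · have hxs := e.map_target hxt
      have h1 : Tendsto (fun m' => v (e m')) (𝓝 (e.symm x)) (𝓝 (v x)) := by
        have h2 : Tendsto e (𝓝 (e.symm x)) (𝓝 x) := by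
          have := e.continuousAt hxs
          rwa [ContinuousAt, e.right_inv hxt] at this
        exact Tendsto.comp ((hpot.continuousOn.continuousAt (hpot.isOpen.mem_nhds hx)).tendsto) h2
      refine (h1.mono_left nhdsWithin_le_nhds).congr' ?_
      have h3 : ∀ᶠ m' in 𝓝 (e.symm x), m' ∈ e.source ∩ e ⁻¹' box (e m) r :=
        (e.isOpen_inter_preimage hpot.isOpen).mem_nhds ⟨hxs, by simpa [e.right_inv hxt] using hx⟩
      filter_upwards [h3.filter_mono nhdsWithin_le_nhds, self_mem_nhdsWithin] with m' h4 h5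
      have h6 : e m' i ≠ 0 := (hYx _ (e.map_source h4.1)).1 (by rwa [e.left_inv h4.1])
      simp only [hvV ⟨h4.2, h6⟩, e.left_inv h4.1]
  have hcl : ∀ m, m ∈ closure Yᶜ := fun m => by
    by_cases hm : m ∈ Y
    · obtain ⟨e, he, hme, i, hfe, Ω, v, W, H, C, h1, h2, h3, h4⟩ := hY m hm
      simpa [e.left_inv hme] using (h4 _ h1).1
    · exact subset_closure hm
  have hlimV : ∀ m ∈ Yᶜ, Tendsto V (𝓝[Yᶜ] m) (𝓝 (V m)) := fun m hm => hV.continuousOn m hm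
  refine ⟨extendFrom Yᶜ V, continuous_extendFrom (fun m => hcl m) fun m => ?_,
    fun m hm => extendFrom_eq (hcl m) (hlimV m hm), fun m hm => ?_⟩
  · by_cases hm : m ∈ Y
    · obtain ⟨e, he, hme, i, hfe, Ω, v, W, H, C, h1, h2, h3, h4⟩ := hY m hm
      exact ⟨_, by simpa [e.left_inv hme] using (h4 _ h1).2⟩
    · exact ⟨_, hlimV m hm⟩
  · obtain ⟨e, he, hme, i, hfe, Ω, v, W, H, C, h1, h2, h3, h4⟩ := hY m hm
    exact ⟨e, i, Ω, W, H, C, he, hme, hfe, h1, h2, h3.congr fun x hx =>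
      extendFrom_eq (hcl _) (h4 x hx).2⟩

theorem contMDiff_one_of_adapted [IsManifold (𝓡 n) ∞ M] (hf : IsDefiningFunction (n := n) Y f)
    (hV : ContMDiffOn (𝓡 n) 𝓘(ℝ) ∞ V Yᶜ) (hVV : EqOn V₀ V Yᶜ)
    (h : ∀ m ∈ Y, ∃ e i Ω W H C, IsAdaptedAt (n := n) f V₀ (fun _ _ => True) m e i Ω W H C) :
    ContMDiff (𝓡 n) 𝓘(ℝ) 1 V₀ := by
  intro m
  by_cases hm : m ∈ Y
  · obtain ⟨e, i, Ω, W, H, C, ha⟩ := h m hm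
    have h1 : ContMDiffOn (𝓡 n) 𝓘(ℝ) 1 (fun m' => V₀ (e.symm (e m'))) (e.source ∩ e ⁻¹' Ω) :=
      (contMDiffOn_iff_contDiffOn.2 ha.potential.contDiffOn_one).comp
        (((contMDiffOn_of_mem_maximalAtlas ha.mem_atlas).of_le (by exact_mod_cast le_top)).mono
          inter_subset_left) fun x hx => hx.2
    have ho := e.isOpen_inter_preimage ha.potential.isOpen
    refine (h1.contMDiffAt (ho.mem_nhds ⟨ha.mem_source, ha.mem⟩)).congr_of_eventuallyEq ?_
    filter_upwards [ho.mem_nhds ⟨ha.mem_source, ha.mem⟩] with x hx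
    rw [e.left_inv hx.1]
  · have ho := hf.isClosed.isOpen_compl.mem_nhds hm
    exact ((hV.contMDiffAt ho).of_le (by exact_mod_cast le_top)).congr_of_eventuallyEq
      (hVV.eventuallyEq_of_mem ho)

theorem exists_hasLocalBounds_of_memIW [T2Space M] [IsManifold (𝓡 n) ∞ M]
    (hf : IsDefiningFunction (n := n) Y f)
    (hV : ContMDiffOn (𝓡 n) 𝓘(ℝ) ∞ V Yᶜ) {k : ℕ} (hW : MemIW n Y f k V) {m : M} (hm : m ∈ Y) :
    ∃ e ∈ IsManifold.maximalAtlas (𝓡 n) ∞ M, m ∈ e.source ∧ ∃ i : Fin n,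
      (∀ x ∈ e.target, f (e.symm x) = x i) ∧ ∃ Ω, IsOpen Ω ∧ Ω ⊆ e.target ∧ e m ∈ Ω ∧ e m i = 0 ∧
        ContDiffOn ℝ ∞ (fun x => V (e.symm x)) (Ω ∩ {x | x i ≠ 0}) ∧
        ∀ l : List (Fin n), (∀ j ∈ l, j ≠ i) → ClassicalW Ω k (pds l fun x => V (e.symm x)) := by
  obtain ⟨e, he, hme, i, hfe⟩ := exists_adapted_chart hf hm
  obtain ⟨Ω, χ, hmΩ, hχ⟩ := exists_isChartCutoff e (e.map_source hme)
  have hs : ContDiffOn ℝ ∞ (fun x => V (e.symm x)) (Ω ∩ {x | x i ≠ 0}) :=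
    (contDiffOn_comp_symm (k := ⊤) he hV).mono fun x hx => ⟨hχ.subset hx.1, by
      rw [mem_preimage, mem_compl_iff, hf.mem_iff, hfe x (hχ.subset hx.1)]
      exact hx.2⟩
  refine ⟨e, he, hme, i, hfe, Ω, hχ.isOpen, hχ.subset, hmΩ, ?_, hs, fun l hl => ?_⟩
  · rw [← hfe _ (e.map_source hme), e.left_inv hme]
    exact (hf.mem_iff m).1 hm
  · exact (hW l.length).classicalW he hf hfe hχ l hl hs (.of_forall fun _ _ => rfl)

theorem exists_extension_one [T2Space M] [IsManifold (𝓡 n) ∞ M]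
    (hf : IsDefiningFunction (n := n) Y f)
    (hV : ContMDiffOn (𝓡 n) 𝓘(ℝ) ∞ V Yᶜ) (hW : MemIW n Y f 1 V) :
    ∃ V₀ : M → ℝ, Continuous V₀ ∧ EqOn V₀ V Yᶜ ∧
      ∀ m ∈ Y, ∃ e i Ω W H C, IsAdaptedAt (n := n) f V₀ (fun i j => j ≠ i) m e i Ω W H C := by
  refine exists_extension hf hV fun m hm => ?_
  obtain ⟨e, he, hme, i, hfe, Ω, h1, h2, h3, h4, h5, h6⟩ :=
    exists_hasLocalBounds_of_memIW hf hV hW hm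
  obtain ⟨r, C, h, hsub, hb⟩ := exists_hasLocalBounds_one h1 h3 h4 h5 h6
  exact ⟨e, he, hme, i, hfe, r, C, h, hsub.trans h2, hb⟩

theorem exists_extension_two [T2Space M] [IsManifold (𝓡 n) ∞ M]
    (hf : IsDefiningFunction (n := n) Y f)
    (hV : ContMDiffOn (𝓡 n) 𝓘(ℝ) ∞ V Yᶜ) (hW : MemIW n Y f 2 V) :
    ∃ V₀ : M → ℝ, Continuous V₀ ∧ EqOn V₀ V Yᶜ ∧
      ∀ m ∈ Y, ∃ e i Ω W H C, IsAdaptedAt (n := n) f V₀ (fun _ _ => True) m e i Ω W H C := by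
  refine exists_extension hf hV fun m hm => ?_
  obtain ⟨e, he, hme, i, hfe, Ω, h1, h2, h3, h4, h5, h6⟩ :=
    exists_hasLocalBounds_of_memIW hf hV hW hm
  obtain ⟨r, C, h, hsub, hb⟩ := exists_hasLocalBounds_two h1 h3 h4 h5 h6
  exact ⟨e, he, hme, i, hfe, r, C, h, hsub.trans h2, hb⟩

end Global

/-! ### The Hamilton vector field and cotangent lifts -/

section Symplectic

variable {n : ℕ}

/-- The symplectic form `⟨a_x, b_ξ⟩ - ⟨b_x, a_ξ⟩`. -/
def sympl (a b : Coord n × Coord n) : ℝ := inner ℝ a.1 b.2 - inner ℝ b.1 a.2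

theorem eq_of_sympl_eq {a b : Coord n × Coord n} (h : ∀ c, sympl a c = sympl b c) : a = b := by
  refine Prod.ext ?_ ?_
  · refine ext_inner_right ℝ fun u => ?_
    simpa [sympl] using h (0, u)
  · refine ext_inner_left ℝ fun u => ?_
    simpa [sympl] using h (u, 0)

/-- This identity characterizes the Hamilton vector field through the symplectic form; its
invariance and the conservation of energy both rest on it. -/
theorem sympl_hamField {P : Coord n × Coord n → ℝ} {z : Coord n × Coord n}
    (hP : DifferentiableAt ℝ P z) (c : Coord n × Coord n) :
    sympl (hamField P z) c = fderiv ℝ P z c := by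
  have h1 : HasFDerivAt (fun ξ => P (z.1, ξ))
      ((fderiv ℝ P z).comp (ContinuousLinearMap.inr ℝ (Coord n) (Coord n))) z.2 :=
    HasFDerivAt.comp z.2 (f := fun ξ => (z.1, ξ)) hP.hasFDerivAt (hasFDerivAt_prodMk_right z.1 z.2)
  have h2 : HasFDerivAt (fun x => P (x, z.2))
      ((fderiv ℝ P z).comp (ContinuousLinearMap.inl ℝ (Coord n) (Coord n))) z.1 :=
    HasFDerivAt.comp z.1 (f := fun x => (x, z.2)) hP.hasFDerivAt (hasFDerivAt_prodMk_left z.1 z.2)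
  rw [sympl, hamField, inner_neg_right, sub_neg_eq_add, gradient, gradient, h1.fderiv, h2.fderiv,
    InnerProductSpace.toDual_symm_apply, real_inner_comm, InnerProductSpace.toDual_symm_apply]
  simp only [ContinuousLinearMap.comp_apply, ContinuousLinearMap.inr_apply,
    ContinuousLinearMap.inl_apply]
  rw [← map_add]
  simp

/-- The cotangent lift of `ψ`, where `φ` is the inverse of `ψ`. -/
def cotangentLift (ψ φ : Coord n → Coord n) (z : Coord n × Coord n) : Coord n × Coord n :=
  (ψ z.1, ContinuousLinearMap.adjoint (fderiv ℝ φ (ψ z.1)) z.2)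

variable {ψ φ : Coord n → Coord n} {z : Coord n × Coord n}

theorem contDiffAt_cotangentLift (hψ : ContDiffAt ℝ ∞ ψ z.1) (hφ : ContDiffAt ℝ ∞ φ (ψ z.1)) :
    ContDiffAt ℝ ∞ (cotangentLift ψ φ) z := by
  have h1 : ContDiffAt ℝ ∞ (fun z : Coord n × Coord n => ψ z.1) z := hψ.comp z contDiffAt_fst
  have h2 : ContDiffAt ℝ ∞ (fun z : Coord n × Coord n => fderiv ℝ φ (ψ z.1)) z :=
    ContDiffAt.comp z (hφ.fderiv_right (m := ∞) (by simp)) h1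
  have h3 : ContDiffAt ℝ ∞ (fun z : Coord n × Coord n =>
      ContinuousLinearMap.adjoint (fderiv ℝ φ (ψ z.1))) z :=
    (ContinuousLinearMap.adjoint (𝕜 := ℝ) (E := Coord n) (F := Coord n)).contDiff.contDiffAt.comp z
      h2
  exact h1.prodMk (h3.clm_apply contDiffAt_snd)

theorem fderiv_comp_eq_of_leftInverse {x : Coord n} (hψ : DifferentiableAt ℝ ψ x)
    (hφ : DifferentiableAt ℝ φ (ψ x)) (hinv : ∀ᶠ y in 𝓝 x, φ (ψ y) = y) (u : Coord n) :
    fderiv ℝ φ (ψ x) (fderiv ℝ ψ x u) = u := by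
  have h1 : HasFDerivAt (fun y => φ (ψ y)) ((fderiv ℝ φ (ψ x)).comp (fderiv ℝ ψ x)) x :=
    hφ.hasFDerivAt.comp x hψ.hasFDerivAt
  have h2 : HasFDerivAt (fun y => φ (ψ y)) (ContinuousLinearMap.id ℝ (Coord n)) x :=
    (hasFDerivAt_id x).congr_of_eventuallyEq hinv
  exact congrArg (fun L : Coord n →L[ℝ] Coord n => L u) (h1.unique h2)

/-- The momentum η of the lift satisfies ⟨Dψ(x) u, η⟩ = ⟨u, ξ⟩. Differentiating this identity and
antisymmetrizing cancels the second derivative of ψ by its symmetry. -/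
theorem sympl_fderiv_cotangentLift (hψ : ContDiffAt ℝ ∞ ψ z.1) (hφ : ContDiffAt ℝ ∞ φ (ψ z.1))
    (hinv : ∀ᶠ y in 𝓝 z.1, φ (ψ y) = y) (a b : Coord n × Coord n) :
    sympl (fderiv ℝ (cotangentLift ψ φ) z a) (fderiv ℝ (cotangentLift ψ φ) z b) = sympl a b := by
  have hκ : HasFDerivAt (cotangentLift ψ φ) (fderiv ℝ (cotangentLift ψ φ) z) z :=
    ((contDiffAt_cotangentLift hψ hφ).differentiableAt (by simp)).hasFDerivAt
  set D := fderiv ℝ (cotangentLift ψ φ) z with hD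
  have hD1 : ∀ c, (D c).1 = fderiv ℝ ψ z.1 c.1 := fun c => by
    have h1 : HasFDerivAt (fun w : Coord n × Coord n => ψ w.1)
        ((fderiv ℝ ψ z.1).comp (ContinuousLinearMap.fst ℝ _ _)) z :=
      HasFDerivAt.comp z (hψ.differentiableAt (by simp)).hasFDerivAt hasFDerivAt_fst
    have h2 : HasFDerivAt (fun w : Coord n × Coord n => ψ w.1)
        ((ContinuousLinearMap.fst ℝ _ _).comp D) z := hκ.fst
    exact congrArg (fun L : Coord n × Coord n →L[ℝ] Coord n => L c) (h2.unique h1)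
  have hDD : HasFDerivAt (fderiv ℝ ψ) (fderiv ℝ (fderiv ℝ ψ) z.1) z.1 :=
    ((hψ.fderiv_right (m := ∞) (by simp)).differentiableAt (by simp)).hasFDerivAt
  have key : ∀ (u : Coord n) (c : Coord n × Coord n),
      inner ℝ (fderiv ℝ (fderiv ℝ ψ) z.1 c.1 u) (cotangentLift ψ φ z).2 +
        inner ℝ (fderiv ℝ ψ z.1 u) (D c).2 = inner ℝ u c.2 := fun u c => by
    have h1 : HasFDerivAt (fun w : Coord n × Coord n => fderiv ℝ ψ w.1 u)
        (((ContinuousLinearMap.apply ℝ (Coord n) u).comp (fderiv ℝ (fderiv ℝ ψ) z.1)).comp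
          (ContinuousLinearMap.fst ℝ _ _)) z :=
      HasFDerivAt.comp z ((ContinuousLinearMap.apply ℝ (Coord n) u).hasFDerivAt.comp z.1 hDD)
        hasFDerivAt_fst
    have h2 := h1.inner ℝ hκ.snd
    have h3 : HasFDerivAt (fun w : Coord n × Coord n => inner ℝ u w.2)
        ((innerSL ℝ u).comp (ContinuousLinearMap.snd ℝ _ _)) z :=
      HasFDerivAt.comp z (innerSL ℝ u).hasFDerivAt hasFDerivAt_snd
    have hψ' : ∀ᶠ y in 𝓝 z.1, ContDiffAt ℝ 1 ψ y :=
      (hψ.of_le (by exact_mod_cast le_top)).eventually (by simp)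
    have hφ' : ∀ᶠ y in 𝓝 z.1, ContDiffAt ℝ 1 φ (ψ y) :=
      hψ.continuousAt.eventually ((hφ.of_le (by exact_mod_cast le_top)).eventually (by simp))
    have h4 : (fun w : Coord n × Coord n =>
        inner ℝ (fderiv ℝ ψ w.1 u) (cotangentLift ψ φ w).2) =ᶠ[𝓝 z] fun w => inner ℝ u w.2 := by
      have h5 := hψ'.and (hφ'.and hinv.eventually_nhds)
      filter_upwards [(continuousAt_fst (p := z)).eventually h5] with w hw
      rw [cotangentLift, ContinuousLinearMap.adjoint_inner_right,
        fderiv_comp_eq_of_leftInverse (hw.1.differentiableAt (by simp))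
          (hw.2.1.differentiableAt (by simp)) hw.2.2]
    have h6 := congrArg (fun L : Coord n × Coord n →L[ℝ] ℝ => L c)
      (h2.unique (h3.congr_of_eventuallyEq h4))
    simp only [ContinuousLinearMap.comp_apply, ContinuousLinearMap.prod_apply,
      fderivInnerCLM_apply, ContinuousLinearMap.coe_fst', ContinuousLinearMap.coe_snd',
      ContinuousLinearMap.apply_apply, innerSL_apply_apply] at h6
    rw [← h6, add_comm]
  have hsymm : fderiv ℝ (fderiv ℝ ψ) z.1 a.1 b.1 = fderiv ℝ (fderiv ℝ ψ) z.1 b.1 a.1 :=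
    (hψ.isSymmSndFDerivAt (by simpa using WithTop.coe_le_coe.2 (le_top : (2 : ℕ∞) ≤ ⊤))).eq a.1 b.1
  have k1 := key a.1 b
  have k2 := key b.1 a
  rw [hsymm] at k2
  rw [sympl, sympl, hD1, hD1]
  linarith

/-- The Hamilton vector field is invariant under cotangent lifts. -/
theorem fderiv_cotangentLift_hamField (hψ : ContDiffAt ℝ ∞ ψ z.1)
    (hφ : ContDiffAt ℝ ∞ φ (ψ z.1)) (hinv : ∀ᶠ y in 𝓝 z.1, φ (ψ y) = y)
    {P P' : Coord n × Coord n → ℝ} (hP' : DifferentiableAt ℝ P' (cotangentLift ψ φ z))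
    (hPP : P =ᶠ[𝓝 z] fun w => P' (cotangentLift ψ φ w)) :
    fderiv ℝ (cotangentLift ψ φ) z (hamField P z) = hamField P' (cotangentLift ψ φ z) := by
  have hκ : HasFDerivAt (cotangentLift ψ φ) (fderiv ℝ (cotangentLift ψ φ) z) z :=
    ((contDiffAt_cotangentLift hψ hφ).differentiableAt (by simp)).hasFDerivAt
  set D := fderiv ℝ (cotangentLift ψ φ) z with hD
  have hω := sympl_fderiv_cotangentLift hψ hφ hinv
  -- A map preserving a nondegenerate form is injective, hence bijective in finite dimension, so it
  -- suffices to test against vectors of the form D v.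
  have hinj : Function.Injective D := by
    refine (injective_iff_map_eq_zero D).2 fun v hv => eq_of_sympl_eq fun c => ?_
    rw [← hω v c, ← hD, hv]
    simp [sympl]
  have hsurj : Function.Surjective D :=
    LinearMap.injective_iff_surjective.1 (show Function.Injective D.toLinearMap from hinj)
  have hP : HasFDerivAt P ((fderiv ℝ P' (cotangentLift ψ φ z)).comp D) z :=
    (hP'.hasFDerivAt.comp z hκ).congr_of_eventuallyEq hPP
  refine eq_of_sympl_eq fun c => ?_
  obtain ⟨v, rfl⟩ := hsurj c
  rw [hω, sympl_hamField hP.differentiableAt, sympl_hamField hP', hP.fderiv]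
  rfl

end Symplectic

/-! ### The symbol in canonical coordinates -/

/-- The identification of the model space with its dual. -/
def dualEquiv (n : ℕ) : Coord n ≃L[ℝ] (Coord n →L[ℝ] ℝ) :=
  (InnerProductSpace.toDual ℝ (Coord n)).toContinuousLinearEquiv

section PositiveForm

variable {n : ℕ} {G : Coord n →L[ℝ] Coord n →L[ℝ] ℝ}

/-- `ContinuousLinearMap.inverse` has the default value 0 at a non-invertible map, so every use of
it for the metric needs this invertibility, which in finite dimension follows from the trivial
kernel. -/
theorem exists_equiv_of_pos (hG : ∀ v, v ≠ 0 → 0 < G v v) :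
    ∃ L : Coord n ≃L[ℝ] (Coord n →L[ℝ] ℝ), (L : Coord n →L[ℝ] (Coord n →L[ℝ] ℝ)) = G := by
  set T : Coord n →ₗ[ℝ] Coord n :=
    (InnerProductSpace.toDual ℝ (Coord n)).symm.toLinearEquiv.toLinearMap ∘ₗ G.toLinearMap with hT
  have hinj : Function.Injective T := by
    refine (injective_iff_map_eq_zero T).2 fun v hv => ?_
    by_contra hne
    have h1 : G v = 0 := (InnerProductSpace.toDual ℝ (Coord n)).symm.injective (by
      rw [map_zero]; exact hv)
    have := hG v hne
    rw [h1] at this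
    exact lt_irrefl _ this
  refine ⟨(LinearEquiv.ofInjectiveEndo T hinj).toContinuousLinearEquiv.trans
    (InnerProductSpace.toDual ℝ (Coord n)).toContinuousLinearEquiv, ?_⟩
  refine ContinuousLinearMap.ext fun v => ?_
  exact (InnerProductSpace.toDual ℝ (Coord n)).apply_symm_apply (G v)

theorem apply_inverse_of_pos (hG : ∀ v, v ≠ 0 → 0 < G v v) (a : Coord n →L[ℝ] ℝ) :
    G (G.inverse a) = a := by
  obtain ⟨L, rfl⟩ := exists_equiv_of_pos hG
  rw [ContinuousLinearMap.inverse_equiv]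
  exact L.apply_symm_apply a

theorem inverse_apply_of_pos (hG : ∀ v, v ≠ 0 → 0 < G v v) (v : Coord n) :
    G.inverse (G v) = v := by
  obtain ⟨L, rfl⟩ := exists_equiv_of_pos hG
  rw [ContinuousLinearMap.inverse_equiv]
  exact L.symm_apply_apply v

end PositiveForm

/-- `A(x)` is a smooth family of symmetric positive operators on `D`. -/
structure IsCometric {n : ℕ} (A : Coord n → Coord n →L[ℝ] Coord n) (D : Set (Coord n)) : Prop where
  isOpen : IsOpen D
  contDiffOn : ContDiffOn ℝ ∞ A D
  symm : ∀ x ∈ D, ∀ ξ η, inner ℝ (A x ξ) η = inner ℝ ξ (A x η)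
  pos : ∀ x ∈ D, ∀ ξ, ξ ≠ 0 → 0 < inner ℝ (A x ξ) ξ

section SymbolInChart

variable {n : ℕ} {M : Type*} [TopologicalSpace M] [ChartedSpace (Coord n) M]
  [IsManifold (𝓡 n) ∞ M] {e e' : OpenPartialHomeomorph M (Coord n)}

/-- The metric at `m` as a bilinear form on the model space. -/
def metricAt (g : RiemannianMetric n M) (m : M) : Coord n →L[ℝ] Coord n →L[ℝ] ℝ := g.inner m

theorem metricAt_pos (g : RiemannianMetric n M) (m : M) (v : Coord n) (hv : v ≠ 0) :
    0 < metricAt g m v v := g.pos m v hv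

theorem metricAt_symm (g : RiemannianMetric n M) (m : M) (v w : Coord n) :
    metricAt g m v w = metricAt g m w v := g.symm m v w

/-- The derivative of the inverse chart. -/
def symmDeriv (e : OpenPartialHomeomorph M (Coord n)) (x : Coord n) : Coord n →L[ℝ] Coord n :=
  mfderiv (𝓡 n) (𝓡 n) e.symm x

/-- The derivative of the chart at the point with coordinates `x`. -/
def chartDeriv (e : OpenPartialHomeomorph M (Coord n)) (x : Coord n) : Coord n →L[ℝ] Coord n :=
  mfderiv (𝓡 n) (𝓡 n) e (e.symm x)

theorem chartDeriv_symmDeriv (he : e ∈ IsManifold.maximalAtlas (𝓡 n) ∞ M) {x : Coord n}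
    (hx : x ∈ e.target) (v : Coord n) : chartDeriv e x (symmDeriv e x v) = v :=
  congrArg (fun L : Coord n →L[ℝ] Coord n => L v)
    ((mdifferentiable_of_mem_maximalAtlas he).comp_symm_deriv hx)

theorem symmDeriv_chartDeriv (he : e ∈ IsManifold.maximalAtlas (𝓡 n) ∞ M) {x : Coord n}
    (hx : x ∈ e.target) (v : Coord n) : symmDeriv e x (chartDeriv e x v) = v := by
  have h := (mdifferentiable_of_mem_maximalAtlas he).symm_comp_deriv (e.map_target hx)
  rw [e.right_inv hx] at h
  exact congrArg (fun L : Coord n →L[ℝ] Coord n => L v) h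

/-- The metric in the chart. -/
def metricInChart (g : RiemannianMetric n M) (e : OpenPartialHomeomorph M (Coord n))
    (x : Coord n) : Coord n →L[ℝ] Coord n →L[ℝ] ℝ :=
  (metricAt g (e.symm x)).bilinearComp (symmDeriv e x) (symmDeriv e x)

theorem metricInChart_apply (g : RiemannianMetric n M) (e : OpenPartialHomeomorph M (Coord n))
    (x u v : Coord n) : metricInChart g e x u v =
      metricAt g (e.symm x) (symmDeriv e x u) (symmDeriv e x v) := rfl

theorem metricInChart_pos (g : RiemannianMetric n M) (he : e ∈ IsManifold.maximalAtlas (𝓡 n) ∞ M)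
    {x : Coord n} (hx : x ∈ e.target) (v : Coord n) (hv : v ≠ 0) :
    0 < metricInChart g e x v v := by
  rw [metricInChart_apply]
  refine metricAt_pos g _ _ fun h0 => hv ?_
  rw [← chartDeriv_symmDeriv he hx v, h0, map_zero]

theorem contDiffOn_metricInChart (g : RiemannianMetric n M)
    (he : e ∈ IsManifold.maximalAtlas (𝓡 n) ∞ M) :
    ContDiffOn ℝ ∞ (metricInChart g e) e.target := by
  rw [contDiffOn_clm_apply]
  intro u
  rw [contDiffOn_clm_apply]
  intro v
  have hv := contMDiffOn_mfderiv_symm he (contDiff_const (c := v))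
  have hu := contMDiffOn_mfderiv_symm he (contDiff_const (c := u))
  have hg : ContMDiffOn (𝓡 n) ((𝓡 n).prod 𝓘(ℝ, Coord n →L[ℝ] Coord n →L[ℝ] ℝ)) ∞
      (fun x => Bundle.TotalSpace.mk' (Coord n →L[ℝ] Coord n →L[ℝ] ℝ)
        (E := fun m : M => TangentSpace (𝓡 n) m →L[ℝ] TangentSpace (𝓡 n) m →L[ℝ] ℝ)
        (e.symm x) (g.inner (e.symm x))) e.target :=
    g.contMDiff.comp_contMDiffOn (contMDiffOn_symm_of_mem_maximalAtlas he)
  have h : ContMDiffOn (𝓡 n) ((𝓡 n).prod 𝓘(ℝ)) ∞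
      (fun x => Bundle.TotalSpace.mk' ℝ (E := Bundle.Trivial M ℝ) (e.symm x)
        (g.inner (e.symm x) (mfderiv (𝓡 n) (𝓡 n) e.symm x u)
          (mfderiv (𝓡 n) (𝓡 n) e.symm x v))) e.target :=
    ContMDiffOn.clm_bundle_apply₂ (F₁ := Coord n) (F₂ := Coord n) hg hu hv
  rw [← contMDiffOn_iff_contDiffOn]
  intro x hx
  have h2 := h x hx
  simp only [Bundle.contMDiffWithinAt_totalSpace] at h2
  exact h2.2

/-- The dual metric in the chart. -/
def cometric (g : RiemannianMetric n M) (e : OpenPartialHomeomorph M (Coord n)) (x : Coord n) :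
    Coord n →L[ℝ] Coord n :=
  (metricInChart g e x).inverse.comp (dualEquiv n : Coord n →L[ℝ] (Coord n →L[ℝ] ℝ))

theorem metricInChart_cometric (g : RiemannianMetric n M)
    (he : e ∈ IsManifold.maximalAtlas (𝓡 n) ∞ M) {x : Coord n} (hx : x ∈ e.target)
    (ξ : Coord n) : metricInChart g e x (cometric g e x ξ) = InnerProductSpace.toDual ℝ _ ξ :=
  apply_inverse_of_pos (metricInChart_pos g he hx) _

theorem isCometric_cometric (g : RiemannianMetric n M)
    (he : e ∈ IsManifold.maximalAtlas (𝓡 n) ∞ M) : IsCometric (cometric g e) e.target where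
  isOpen := e.open_target
  contDiffOn := by
    intro x hx
    obtain ⟨L, hL⟩ := exists_equiv_of_pos (metricInChart_pos g he hx)
    have h1 : ContDiffAt ℝ ∞ ContinuousLinearMap.inverse (metricInChart g e x) := by
      rw [← hL]; exact contDiffAt_map_inverse L
    have h2 : ContDiffWithinAt ℝ ∞ (fun y => (metricInChart g e y).inverse) e.target x :=
      h1.comp_contDiffWithinAt x (contDiffOn_metricInChart g he x hx)
    exact h2.clm_comp contDiffWithinAt_const
  symm x hx ξ η := by
    have h1 := metricInChart_cometric g he hx ξ
    have h2 := metricInChart_cometric g he hx η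
    have h3 : inner ℝ ξ (cometric g e x η) = metricInChart g e x (cometric g e x ξ)
        (cometric g e x η) := by rw [h1]; rfl
    have h4 : inner ℝ η (cometric g e x ξ) = metricInChart g e x (cometric g e x η)
        (cometric g e x ξ) := by rw [h2]; rfl
    rw [real_inner_comm, h3, h4, metricInChart_apply, metricInChart_apply, metricAt_symm]
  pos x hx ξ hξ := by
    have h1 := metricInChart_cometric g he hx ξ
    have h3 : inner ℝ ξ (cometric g e x ξ) = metricInChart g e x (cometric g e x ξ)
        (cometric g e x ξ) := by rw [h1]; rfl
    rw [real_inner_comm, h3]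
    refine metricInChart_pos g he hx _ fun h0 => hξ ?_
    rw [h0, map_zero] at h1
    exact (map_eq_zero_iff _ (InnerProductSpace.toDual ℝ (Coord n)).injective).1 h1.symm

/-- The vector dual to a covector. -/
def sharp (g : RiemannianMetric n M) (ρ : Cotangent n M) : Coord n :=
  (metricAt g ρ.proj).inverse ρ.snd

theorem conormSq_eq (g : RiemannianMetric n M) (ρ : Cotangent n M) :
    conormSq g ρ = ρ.snd (sharp g ρ) := rfl

/-- Both sides have the same image under the metric in the chart, because g(α^♯, ·) = α is a
chart-free relation. -/
theorem chartDeriv_sharp (g : RiemannianMetric n M) (he : e ∈ IsManifold.maximalAtlas (𝓡 n) ∞ M)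
    {z : Coord n × Coord n} (hz : z.1 ∈ e.target) :
    chartDeriv e z.1 (sharp g (ofCoord e z)) = cometric g e z.1 z.2 := by
  have hpos := metricAt_pos g (e.symm z.1)
  have h1 : metricAt g (e.symm z.1) (sharp g (ofCoord e z)) =
      (InnerProductSpace.toDual ℝ (Coord n) z.2).comp (chartDeriv e z.1) :=
    apply_inverse_of_pos hpos _
  have h2 : metricInChart g e z.1 (chartDeriv e z.1 (sharp g (ofCoord e z))) =
      InnerProductSpace.toDual ℝ (Coord n) z.2 := by
    refine ContinuousLinearMap.ext fun u => ?_
    rw [metricInChart_apply, symmDeriv_chartDeriv he hz, h1, ContinuousLinearMap.comp_apply,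
      chartDeriv_symmDeriv he hz]
  rw [← inverse_apply_of_pos (metricInChart_pos g he hz)
    (chartDeriv e z.1 (sharp g (ofCoord e z))), h2]
  rfl

/-- The symbol `⟨A(x)ξ, ξ⟩` of the dual metric. -/
def quad (A : Coord n → Coord n →L[ℝ] Coord n) (z : Coord n × Coord n) : ℝ :=
  inner ℝ (A z.1 z.2) z.2

theorem symbol_ofCoord (g : RiemannianMetric n M) (V : M → ℝ)
    (he : e ∈ IsManifold.maximalAtlas (𝓡 n) ∞ M) {z : Coord n × Coord n} (hz : z.1 ∈ e.target) :
    symbol g V (ofCoord e z) = quad (cometric g e) z + V (e.symm z.1) := by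
  have h : conormSq g (ofCoord e z) = quad (cometric g e) z := by
    rw [conormSq_eq, quad, ← chartDeriv_sharp g he hz, real_inner_comm]
    rfl
  rw [symbol, h]
  rfl

theorem toCoord_ofCoord (he : e ∈ IsManifold.maximalAtlas (𝓡 n) ∞ M) {z : Coord n × Coord n}
    (hz : z.1 ∈ e.target) : toCoord e (ofCoord e z) = z := by
  refine Prod.ext (e.right_inv hz) ?_
  have h : ((InnerProductSpace.toDual ℝ (Coord n) z.2).comp (chartDeriv e z.1)).comp
      (chartDeriv e z.1).inverse = InnerProductSpace.toDual ℝ (Coord n) z.2 := by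
    refine ContinuousLinearMap.ext fun u => ?_
    have := mfderiv_apply_inverse he (e.map_target hz) u
    exact congrArg (fun w => InnerProductSpace.toDual ℝ (Coord n) z.2 w) this
  exact (congrArg (InnerProductSpace.toDual ℝ (Coord n)).symm h).trans
    ((InnerProductSpace.toDual ℝ (Coord n)).symm_apply_apply z.2)

theorem ofCoord_toCoord (he : e ∈ IsManifold.maximalAtlas (𝓡 n) ∞ M) {ρ : Cotangent n M}
    (hρ : ρ.proj ∈ e.source) : ofCoord e (toCoord e ρ) = ρ := by
  obtain ⟨m, α⟩ := ρ
  have hm : e.symm (e m) = m := e.left_inv hρ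
  refine Bundle.TotalSpace.ext hm (heq_of_eq ?_)
  have h1 : (ofCoord e (toCoord e ⟨m, α⟩)).snd =
      ContinuousLinearMap.comp (InnerProductSpace.toDual ℝ (Coord n)
        ((InnerProductSpace.toDual ℝ (Coord n)).symm
          (α.comp (mfderiv (𝓡 n) (𝓡 n) e m).inverse)))
        (mfderiv (𝓡 n) (𝓡 n) e (e.symm (e m))) := rfl
  rw [h1, LinearIsometryEquiv.apply_symm_apply]
  refine ContinuousLinearMap.ext fun v => ?_
  have h2 : mfderiv (𝓡 n) (𝓡 n) e (e.symm (e m)) v = mfderiv (𝓡 n) (𝓡 n) e m v := by rw [hm]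
  have h3 := inverse_mfderiv_apply he hρ v
  have h4 : ∀ w : Coord n, ContinuousLinearMap.comp α (mfderiv (𝓡 n) (𝓡 n) e m).inverse w =
    α ((mfderiv (𝓡 n) (𝓡 n) e m).inverse w) := fun w => rfl
  exact (h4 _).trans (congrArg α ((congrArg (mfderiv (𝓡 n) (𝓡 n) e m).inverse h2).trans h3))

end SymbolInChart

/-! ### Hamilton's equations in canonical coordinates -/

section Quad

variable {n : ℕ} {A : Coord n → Coord n →L[ℝ] Coord n} {D : Set (Coord n)}

/-- The `x`-gradient of `⟨A(x)ξ, ξ⟩`. -/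
def quadGrad (A : Coord n → Coord n →L[ℝ] Coord n) (z : Coord n × Coord n) : Coord n :=
  (dualEquiv n).symm ((fderiv ℝ (quad A) z).comp (ContinuousLinearMap.inl ℝ _ _))

theorem IsCometric.contDiffAt_apply (hA : IsCometric A D) {z : Coord n × Coord n}
    (hz : z.1 ∈ D) : ContDiffAt ℝ ∞ (fun z : Coord n × Coord n => A z.1 z.2) z :=
  (ContDiffAt.comp z (hA.contDiffOn.contDiffAt (hA.isOpen.mem_nhds hz))
    contDiffAt_fst).clm_apply contDiffAt_snd

theorem IsCometric.contDiffAt_quad (hA : IsCometric A D) {z : Coord n × Coord n}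
    (hz : z.1 ∈ D) : ContDiffAt ℝ ∞ (quad A) z :=
  (hA.contDiffAt_apply hz).inner ℝ contDiffAt_snd

theorem IsCometric.contDiffAt_quadGrad (hA : IsCometric A D) {z : Coord n × Coord n}
    (hz : z.1 ∈ D) : ContDiffAt ℝ ∞ (quadGrad A) z :=
  (dualEquiv n).symm.contDiff.contDiffAt.comp z
    (((hA.contDiffAt_quad hz).fderiv_right (m := ∞) (by simp)).clm_comp contDiffAt_const)

theorem hasGradientAt_of_hasFDerivAt {u : Coord n → ℝ} {L : Coord n →L[ℝ] ℝ} {x w : Coord n}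
    (h : HasFDerivAt u L x) (hL : ∀ y, L y = inner ℝ w y) : HasGradientAt u w x := by
  rw [hasGradientAt_iff_hasFDerivAt]
  have : L = InnerProductSpace.toDual ℝ (Coord n) w := ContinuousLinearMap.ext fun y => by
    rw [hL, InnerProductSpace.toDual_apply_apply]
  rwa [← this]

theorem inner_quadGrad (z : Coord n × Coord n) (u : Coord n) :
    inner ℝ (quadGrad A z) u = fderiv ℝ (quad A) z (u, 0) :=
  congrArg (fun L : Coord n →L[ℝ] ℝ => L u) ((dualEquiv n).apply_symm_apply
    ((fderiv ℝ (quad A) z).comp (ContinuousLinearMap.inl ℝ _ _)))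

theorem IsCometric.hasFDerivAt_quad_snd (hA : IsCometric A D) {z : Coord n × Coord n}
    (hz : z.1 ∈ D) : HasFDerivAt (fun ξ => quad A (z.1, ξ))
      (innerSL ℝ ((2 : ℝ) • A z.1 z.2)) z.2 := by
  have h : HasFDerivAt (fun ξ => inner ℝ (A z.1 ξ) ξ) _ z.2 :=
    (A z.1).hasFDerivAt.inner ℝ (hasFDerivAt_id z.2)
  refine h.congr_fderiv (ContinuousLinearMap.ext fun u => ?_)
  simp only [innerSL_apply_apply, ContinuousLinearMap.comp_apply,
    ContinuousLinearMap.prod_apply, fderivInnerCLM_apply, ContinuousLinearMap.id_apply]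
  rw [real_inner_smul_left, hA.symm z.1 hz u z.2, real_inner_comm (A z.1 z.2) u]
  ring

/-- For fixed x the term v(x) is constant in ξ, so the velocity of x requires no regularity of v and
the formula is valid on the hypersurface too. -/
theorem IsCometric.hamField_fst (hA : IsCometric A D) {z : Coord n × Coord n} (hz : z.1 ∈ D)
    (v : Coord n → ℝ) :
    (hamField (fun z => quad A z + v z.1) z).1 = (2 : ℝ) • A z.1 z.2 :=
  (hasGradientAt_of_hasFDerivAt ((hA.hasFDerivAt_quad_snd hz).add_const (v z.1))
    fun _ => rfl).gradient

theorem IsCometric.hamField_eq (hA : IsCometric A D) {z : Coord n × Coord n} (hz : z.1 ∈ D)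
    {v : Coord n → ℝ} {w : Coord n} (hv : HasGradientAt v w z.1) :
    hamField (fun z => quad A z + v z.1) z = ((2 : ℝ) • A z.1 z.2, -(quadGrad A z + w)) := by
  refine Prod.ext (hA.hamField_fst hz v) (congrArg Neg.neg (HasGradientAt.gradient ?_))
  have h : HasFDerivAt (fun x => quad A (x, z.2))
      ((fderiv ℝ (quad A) z).comp (ContinuousLinearMap.inl ℝ (Coord n) (Coord n))) z.1 :=
    HasFDerivAt.comp z.1 (f := fun x => (x, z.2))
      ((hA.contDiffAt_quad hz).differentiableAt (by simp)).hasFDerivAt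
      (hasFDerivAt_prodMk_left z.1 z.2)
  refine hasGradientAt_of_hasFDerivAt (h.add (hasGradientAt_iff_hasFDerivAt.1 hv)) fun u => ?_
  rw [inner_add_left, inner_quadGrad]
  rfl

theorem IsCometric.hamField_snd_apply (hA : IsCometric A D) {z : Coord n × Coord n} (hz : z.1 ∈ D)
    {v : Coord n → ℝ} (hv : DifferentiableAt ℝ v z.1) (j : Fin n) :
    (hamField (fun z => quad A z + v z.1) z).2 j = -(quadGrad A z j + pd j v z.1) := by
  rw [hA.hamField_eq hz hv.hasGradientAt]
  have : gradient v z.1 j = pd j v z.1 := by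
    have h := inner_gradient_left (𝕜 := ℝ) (f := v) (x := z.1) (y := coordVec j)
    rw [pd, ← h, coordVec, EuclideanSpace.inner_single_right]
    simp
  simp [this]

end Quad

/-! ### Changes of canonical coordinates and invariance of the Hamilton vector field -/

section Transition

variable {n : ℕ} {M : Type*} [TopologicalSpace M] [ChartedSpace (Coord n) M]
  [IsManifold (𝓡 n) ∞ M] {e e' : OpenPartialHomeomorph M (Coord n)} {z : Coord n × Coord n}

theorem fderiv_comp_symm_chartDeriv (he : e ∈ IsManifold.maximalAtlas (𝓡 n) ∞ M)
    {f : M → ℝ} (hf : ContMDiff (𝓡 n) 𝓘(ℝ) ∞ f) {x : Coord n} (hx : x ∈ e.target) (v : Coord n) :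
    fderiv ℝ (fun y => f (e.symm y)) x (chartDeriv e x v) =
      mfderiv (𝓡 n) 𝓘(ℝ) f (e.symm x) v := by
  have h := mdifferentiable_of_mem_maximalAtlas he
  have h1 : mfderiv (𝓡 n) 𝓘(ℝ) (f ∘ e.symm) x =
      (mfderiv (𝓡 n) 𝓘(ℝ) f (e.symm x)).comp (mfderiv (𝓡 n) (𝓡 n) e.symm x) :=
    mfderiv_comp x (hf.mdifferentiable (by simp) _) (h.mdifferentiableAt_symm hx)
  rw [mfderiv_eq_fderiv] at h1
  have h2 := congrArg (fun L : Coord n →L[ℝ] ℝ => L (chartDeriv e x v)) h1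
  refine h2.trans ?_
  exact congrArg (fun w : Coord n => (mfderiv (𝓡 n) 𝓘(ℝ) f (e.symm x) : Coord n →L[ℝ] ℝ) w)
    (symmDeriv_chartDeriv he hx v)

theorem fderiv_transition (he : e ∈ IsManifold.maximalAtlas (𝓡 n) ∞ M)
    (he' : e' ∈ IsManifold.maximalAtlas (𝓡 n) ∞ M) {x : Coord n} (hx : x ∈ e'.target)
    (hx' : e'.symm x ∈ e.source) :
    fderiv ℝ (fun y => e (e'.symm y)) x =
      ContinuousLinearMap.comp (mfderiv (𝓡 n) (𝓡 n) e (e'.symm x) : Coord n →L[ℝ] Coord n)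
        (symmDeriv e' x) := by
  have h := mdifferentiable_of_mem_maximalAtlas he
  have h' := mdifferentiable_of_mem_maximalAtlas he'
  have h1 : mfderiv (𝓡 n) (𝓡 n) (e ∘ e'.symm) x =
      (mfderiv (𝓡 n) (𝓡 n) e (e'.symm x)).comp (mfderiv (𝓡 n) (𝓡 n) e'.symm x) :=
    mfderiv_comp x (h.mdifferentiableAt hx') (h'.mdifferentiableAt_symm hx)
  rw [mfderiv_eq_fderiv] at h1
  exact h1

/-- The change of canonical coordinates. -/
def coordChange (e e' : OpenPartialHomeomorph M (Coord n)) :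
    Coord n × Coord n → Coord n × Coord n :=
  cotangentLift (fun x => e' (e.symm x)) fun x => e (e'.symm x)

theorem toCoord_ofCoord_eq_coordChange (he : e ∈ IsManifold.maximalAtlas (𝓡 n) ∞ M)
    (he' : e' ∈ IsManifold.maximalAtlas (𝓡 n) ∞ M) (hz : z.1 ∈ e.target)
    (hz' : e.symm z.1 ∈ e'.source) : toCoord e' (ofCoord e z) = coordChange e e' z := by
  refine Prod.ext rfl ((dualEquiv n).injective ?_)
  have hm : e'.symm (e' (e.symm z.1)) = e.symm z.1 := e'.left_inv hz'
  have h1 : dualEquiv n (toCoord e' (ofCoord e z)).2 =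
      ((InnerProductSpace.toDual ℝ (Coord n) z.2).comp (chartDeriv e z.1)).comp
        (mfderiv (𝓡 n) (𝓡 n) e' (e.symm z.1) : Coord n →L[ℝ] Coord n).inverse :=
    (InnerProductSpace.toDual ℝ (Coord n)).apply_symm_apply _
  have hinv : (mfderiv (𝓡 n) (𝓡 n) e' (e.symm z.1) : Coord n →L[ℝ] Coord n).inverse =
      symmDeriv e' (e' (e.symm z.1)) := inverse_mfderiv he' hz'
  have h2 := fderiv_transition he he' (e'.map_source hz') (by rw [hm]; exact e.map_target hz)
  rw [hm] at h2
  refine h1.trans (ContinuousLinearMap.ext fun u : Coord n => ?_)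
  have h3 : dualEquiv n (coordChange e e' z).2 u = inner ℝ (coordChange e e' z).2 u := rfl
  have h4 : inner ℝ (coordChange e e' z).2 u = inner ℝ z.2
      (chartDeriv e z.1 (symmDeriv e' (e' (e.symm z.1)) u)) := by
    rw [coordChange, cotangentLift, ContinuousLinearMap.adjoint_inner_left, h2]
    rfl
  refine Eq.trans ?_ (h3.trans h4).symm
  exact congrArg (fun L : Coord n →L[ℝ] Coord n => inner ℝ z.2 (chartDeriv e z.1 (L u))) hinv

theorem coordChange_hyps (he : e ∈ IsManifold.maximalAtlas (𝓡 n) ∞ M)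
    (he' : e' ∈ IsManifold.maximalAtlas (𝓡 n) ∞ M) {x : Coord n} (hx : x ∈ e.target)
    (hx' : e.symm x ∈ e'.source) :
    ContDiffAt ℝ ∞ (fun x => e' (e.symm x)) x ∧
      ContDiffAt ℝ ∞ (fun x => e (e'.symm x)) (e' (e.symm x)) ∧
      ∀ᶠ y in 𝓝 x, e (e'.symm (e' (e.symm y))) = y := by
  refine ⟨(contDiffOn_transition he he').contDiffAt ((isOpen_transition e e').mem_nhds ⟨hx, hx'⟩),
    (contDiffOn_transition he' he).contDiffAt ((isOpen_transition e' e).mem_nhds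
      ⟨e'.map_source hx', ?_⟩), ?_⟩
  · rw [mem_preimage, e'.left_inv hx']
    exact e.map_target hx
  · filter_upwards [(isOpen_transition e e').mem_nhds ⟨hx, hx'⟩] with y hy
    rw [e'.left_inv hy.2, e.right_inv hy.1]

theorem contDiffAt_coordChange (he : e ∈ IsManifold.maximalAtlas (𝓡 n) ∞ M)
    (he' : e' ∈ IsManifold.maximalAtlas (𝓡 n) ∞ M) (hz : z.1 ∈ e.target)
    (hz' : e.symm z.1 ∈ e'.source) : ContDiffAt ℝ ∞ (coordChange e e') z := by
  obtain ⟨h1, h2, _⟩ := coordChange_hyps he he' hz hz'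
  exact contDiffAt_cotangentLift h1 h2

theorem ofCoord_coordChange (he : e ∈ IsManifold.maximalAtlas (𝓡 n) ∞ M)
    (he' : e' ∈ IsManifold.maximalAtlas (𝓡 n) ∞ M) (hz : z.1 ∈ e.target)
    (hz' : e.symm z.1 ∈ e'.source) : ofCoord e' (coordChange e e' z) = ofCoord e z := by
  rw [← toCoord_ofCoord_eq_coordChange he he' hz hz']
  exact ofCoord_toCoord he' hz'

theorem eventually_fst_mem {D : Set (Coord n)} (hD : IsOpen D) (hz : z.1 ∈ D) :
    ∀ᶠ w : Coord n × Coord n in 𝓝 z, w.1 ∈ D :=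
  continuousAt_fst.eventually (hD.mem_nhds hz)

theorem symbol_ofCoord_eventuallyEq (g : RiemannianMetric n M) (V : M → ℝ)
    (he : e ∈ IsManifold.maximalAtlas (𝓡 n) ∞ M) (hz : z.1 ∈ e.target) :
    (fun w => symbol g V (ofCoord e w)) =ᶠ[𝓝 z]
      fun w => quad (cometric g e) w + V (e.symm w.1) := by
  filter_upwards [eventually_fst_mem e.open_target hz] with w hw using symbol_ofCoord g V he hw

theorem hamField_congr {P P' : Coord n × Coord n → ℝ} (h : P =ᶠ[𝓝 z] P') :
    hamField P z = hamField P' z := by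
  have h1 : (fun ξ => P (z.1, ξ)) =ᶠ[𝓝 z.2] fun ξ => P' (z.1, ξ) :=
    ((Continuous.prodMk_right z.1).continuousAt (x := z.2)).eventually h
  have h2 : (fun x => P (x, z.2)) =ᶠ[𝓝 z.1] fun x => P' (x, z.2) :=
    ((Continuous.prodMk_left z.2).continuousAt (x := z.1)).eventually h
  rw [hamField, hamField, gradient, gradient, gradient, gradient, h1.fderiv_eq, h2.fderiv_eq]

theorem differentiableAt_symbol (g : RiemannianMetric n M) {V : M → ℝ}
    (he : e ∈ IsManifold.maximalAtlas (𝓡 n) ∞ M) (hz : z.1 ∈ e.target)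
    (hV : DifferentiableAt ℝ (fun x => V (e.symm x)) z.1) :
    DifferentiableAt ℝ (fun w => symbol g V (ofCoord e w)) z := by
  refine DifferentiableAt.congr_of_eventuallyEq ?_ (symbol_ofCoord_eventuallyEq g V he hz)
  exact (((isCometric_cometric g he).contDiffAt_quad hz).differentiableAt (by simp)).add
    (DifferentiableAt.comp (g := fun x => V (e.symm x)) z hV differentiableAt_fst)

theorem differentiableAt_comp_symm {V : M → ℝ} (he : e ∈ IsManifold.maximalAtlas (𝓡 n) ∞ M)
    (he' : e' ∈ IsManifold.maximalAtlas (𝓡 n) ∞ M) {x : Coord n} (hx : x ∈ e.target)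
    (hx' : e.symm x ∈ e'.source) (hV : DifferentiableAt ℝ (fun x => V (e.symm x)) x) :
    DifferentiableAt ℝ (fun x => V (e'.symm x)) (e' (e.symm x)) := by
  obtain ⟨_, h2, h3⟩ := coordChange_hyps he he' hx hx'
  have h4 : e (e'.symm (e' (e.symm x))) = x := h3.self_of_nhds
  have h5 : DifferentiableAt ℝ (fun y => V (e.symm (e (e'.symm y)))) (e' (e.symm x)) := by
    refine DifferentiableAt.comp (g := fun x => V (e.symm x)) _ ?_ (h2.differentiableAt (by simp))
    rwa [h4]
  refine h5.congr_of_eventuallyEq ?_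
  have hmem : e' (e.symm x) ∈ e'.target ∩ e'.symm ⁻¹' e.source := ⟨e'.map_source hx', by
    rw [mem_preimage, e'.left_inv hx']; exact e.map_target hx⟩
  filter_upwards [(isOpen_transition e' e).mem_nhds hmem] with y hy
  rw [e.left_inv hy.2]

theorem fderiv_coordChange_hamField (g : RiemannianMetric n M) {V : M → ℝ}
    (he : e ∈ IsManifold.maximalAtlas (𝓡 n) ∞ M) (he' : e' ∈ IsManifold.maximalAtlas (𝓡 n) ∞ M)
    (hz : z.1 ∈ e.target) (hz' : e.symm z.1 ∈ e'.source)
    (hV : DifferentiableAt ℝ (fun x => V (e.symm x)) z.1) :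
    fderiv ℝ (coordChange e e') z (hamField (fun w => symbol g V (ofCoord e w)) z) =
      hamField (fun w => symbol g V (ofCoord e' w)) (coordChange e e' z) := by
  obtain ⟨h1, h2, h3⟩ := coordChange_hyps he he' hz hz'
  refine fderiv_cotangentLift_hamField h1 h2 h3 ?_ ?_
  · exact differentiableAt_symbol g he' (e'.map_source hz')
      (differentiableAt_comp_symm he he' hz hz' hV)
  · filter_upwards [eventually_fst_mem (isOpen_transition e e') ⟨hz, hz'⟩] with w hw
    exact congrArg (symbol g V) (ofCoord_coordChange he he' hw.1 hw.2).symm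

/-- `hamDeriv` is defined through the preferred chart at the base point; symplectic invariance
allows it to be computed in any chart, provided V is differentiable there. -/
theorem hamDeriv_eq (g : RiemannianMetric n M) {V : M → ℝ}
    (he : e ∈ IsManifold.maximalAtlas (𝓡 n) ∞ M) (hz : z.1 ∈ e.target)
    (hV : DifferentiableAt ℝ (fun x => V (e.symm x)) z.1) {a : Cotangent n M → ℝ}
    (ha : DifferentiableAt ℝ (fun w => a (ofCoord e w)) z) :
    hamDeriv (symbol g V) a (ofCoord e z) = fderiv ℝ (fun w => a (ofCoord e w)) z
      (hamField (fun w => symbol g V (ofCoord e w)) z) := by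
  set c := chartAt (Coord n) (e.symm z.1) with hc
  have hcm : c ∈ IsManifold.maximalAtlas (𝓡 n) ∞ M := IsManifold.chart_mem_maximalAtlas _
  have hms : e.symm z.1 ∈ c.source := mem_chart_source _ _
  have hze : e.symm z.1 ∈ e.source := e.map_target hz
  set z₀ := toCoord c (ofCoord e z) with hz₀
  have hz₀c : z₀ = coordChange e c z := toCoord_ofCoord_eq_coordChange he hcm hz hms
  have hz₀1 : z₀.1 = c (e.symm z.1) := rfl
  have hz₀t : z₀.1 ∈ c.target := c.map_source hms
  have hz₀s : c.symm z₀.1 ∈ e.source := by rw [hz₀1, c.left_inv hms]; exact hze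
  have hback : coordChange c e z₀ = z := by
    rw [← toCoord_ofCoord_eq_coordChange hcm he hz₀t hz₀s, ofCoord_toCoord hcm hms,
      toCoord_ofCoord he hz]
  have hVc : DifferentiableAt ℝ (fun x => V (c.symm x)) z₀.1 :=
    differentiableAt_comp_symm he hcm hz hms hV
  have h1 := fderiv_coordChange_hamField g hcm he hz₀t hz₀s hVc
  rw [hback] at h1
  have h2 : HasFDerivAt (fun w => a (ofCoord c w))
      ((fderiv ℝ (fun w => a (ofCoord e w)) z).comp (fderiv ℝ (coordChange c e) z₀)) z₀ := by
    have h3 : HasFDerivAt (fun w => a (ofCoord e w)) (fderiv ℝ (fun w => a (ofCoord e w)) z)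
        (coordChange c e z₀) := by rw [hback]; exact ha.hasFDerivAt
    refine (h3.comp z₀ ((contDiffAt_coordChange hcm he hz₀t hz₀s).differentiableAt
      (by simp)).hasFDerivAt).congr_of_eventuallyEq ?_
    filter_upwards [eventually_fst_mem (isOpen_transition c e) ⟨hz₀t, hz₀s⟩] with w hw
    exact congrArg a (ofCoord_coordChange hcm he hw.1 hw.2).symm
  have h4 : hamDeriv (symbol g V) a (ofCoord e z) = fderiv ℝ (fun w => a (ofCoord c w)) z₀
      (hamField (fun w => symbol g V (ofCoord c w)) z₀) := rfl
  rw [h4, h2.fderiv, ContinuousLinearMap.comp_apply, h1]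

theorem hamField_symbol_fst (g : RiemannianMetric n M) (V : M → ℝ)
    (he : e ∈ IsManifold.maximalAtlas (𝓡 n) ∞ M) (hz : z.1 ∈ e.target) :
    (hamField (fun w => symbol g V (ofCoord e w)) z).1 = (2 : ℝ) • cometric g e z.1 z.2 := by
  rw [hamField_congr (symbol_ofCoord_eventuallyEq g V he hz)]
  exact (isCometric_cometric g he).hamField_fst hz fun x => V (e.symm x)

/-- V need not be differentiable here, so the invariance of the whole Hamilton vector field is not
available. Only its x-component matters, and in every chart the derivative of f along it is twice
df(α^♯). -/
theorem hamDefining_ofCoord (g : RiemannianMetric n M) (V : M → ℝ) {f : M → ℝ}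
    (hf : ContMDiff (𝓡 n) 𝓘(ℝ) ∞ f) (he : e ∈ IsManifold.maximalAtlas (𝓡 n) ∞ M)
    (hz : z.1 ∈ e.target) : hamDefining g V f (ofCoord e z) =
      2 * fderiv ℝ (fun x => f (e.symm x)) z.1 (cometric g e z.1 z.2) := by
  set c := chartAt (Coord n) (e.symm z.1) with hc
  have hcm : c ∈ IsManifold.maximalAtlas (𝓡 n) ∞ M := IsManifold.chart_mem_maximalAtlas _
  have hms : e.symm z.1 ∈ c.source := mem_chart_source _ _
  set z₀ := toCoord c (ofCoord e z) with hz₀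
  have hz₀1 : z₀.1 = c (e.symm z.1) := rfl
  have hz₀t : z₀.1 ∈ c.target := c.map_source hms
  have hback : ofCoord c z₀ = ofCoord e z := ofCoord_toCoord hcm hms
  have h1 : hamDefining g V f (ofCoord e z) = fderiv ℝ (fun w => f (ofCoord c w).proj) z₀
      (hamField (fun w => symbol g V (ofCoord c w)) z₀) := rfl
  have hfc : DifferentiableAt ℝ (fun x => f (c.symm x)) z₀.1 := by
    have := contDiffOn_comp_symm (k := ⊤) hcm hf.contMDiffOn (s := univ)
    simp only [preimage_univ, inter_univ] at this
    exact (this.contDiffAt (c.open_target.mem_nhds hz₀t)).differentiableAt (by simp)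
  have h2 : HasFDerivAt (fun w => f (ofCoord c w).proj)
      ((fderiv ℝ (fun x => f (c.symm x)) z₀.1).comp (ContinuousLinearMap.fst ℝ _ _)) z₀ :=
    HasFDerivAt.comp z₀ (g := fun x => f (c.symm x)) hfc.hasFDerivAt hasFDerivAt_fst
  have h3 : ∀ {e : OpenPartialHomeomorph M (Coord n)} {z : Coord n × Coord n},
      e ∈ IsManifold.maximalAtlas (𝓡 n) ∞ M → z.1 ∈ e.target →
      fderiv ℝ (fun x => f (e.symm x)) z.1 (cometric g e z.1 z.2) =
        (mfderiv (𝓡 n) 𝓘(ℝ) f (ofCoord e z).proj : Coord n →L[ℝ] ℝ) (sharp g (ofCoord e z)) :=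
    fun he hz => by
      rw [← chartDeriv_sharp g he hz]
      exact fderiv_comp_symm_chartDeriv he hf hz _
  rw [h1, h2.fderiv, ContinuousLinearMap.comp_apply, ContinuousLinearMap.coe_fst',
    hamField_symbol_fst g V hcm hz₀t, map_smul, smul_eq_mul, h3 hcm hz₀t, h3 he hz, hback]

theorem hamDefining_adapted (g : RiemannianMetric n M) (V : M → ℝ) {f : M → ℝ}
    (hf : ContMDiff (𝓡 n) 𝓘(ℝ) ∞ f) (he : e ∈ IsManifold.maximalAtlas (𝓡 n) ∞ M)
    {i : Fin n} (hfe : ∀ x ∈ e.target, f (e.symm x) = x i) (hz : z.1 ∈ e.target) :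
    hamDefining g V f (ofCoord e z) = 2 * cometric g e z.1 z.2 i := by
  rw [hamDefining_ofCoord g V hf he hz]
  have h : HasFDerivAt (fun x => f (e.symm x)) (EuclideanSpace.proj i : Coord n →L[ℝ] ℝ) z.1 := by
    refine (EuclideanSpace.proj i : Coord n →L[ℝ] ℝ).hasFDerivAt.congr_of_eventuallyEq ?_
    filter_upwards [e.open_target.mem_nhds hz] with x hx using hfe x hx
  rw [h.fderiv]
  rfl

end Transition

/-! ### Local solutions of ordinary differential equations in the sense of Carathéodory -/

section SolvesNear

variable {E E' : Type*} [NormedAddCommGroup E] [NormedSpace ℝ E] [NormedAddCommGroup E']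
  [NormedSpace ℝ E'] {F G : E → E} {z y : ℝ → E} {t₀ : ℝ}

/-- Near `t₀` the curve `z` is absolutely continuous and solves `z' = F(z)` almost everywhere. -/
def SolvesNear (F : E → E) (z : ℝ → E) (t₀ : ℝ) : Prop :=
  ∃ δ > 0, AbsolutelyContinuousOnInterval z (t₀ - δ) (t₀ + δ) ∧
    ∀ᵐ t, t ∈ Icc (t₀ - δ) (t₀ + δ) → HasDerivAt z (F (z t)) t

theorem SolvesNear.eventually_continuousAt (h : SolvesNear F z t₀) :
    ∀ᶠ t in 𝓝 t₀, ContinuousAt z t := by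
  obtain ⟨δ, hδ, hac, -⟩ := h
  filter_upwards [Ioo_mem_nhds (show t₀ - δ < t₀ by linarith) (show t₀ < t₀ + δ by linarith)]
    with t ht
  have := hac.continuousOn
  rw [uIcc_of_le (by linarith)] at this
  exact this.continuousAt (Icc_mem_nhds ht.1 ht.2)

theorem SolvesNear.continuousAt (h : SolvesNear F z t₀) : ContinuousAt z t₀ :=
  h.eventually_continuousAt.self_of_nhds

theorem exists_Icc_of_eventually {p : ℝ → Prop} (h : ∀ᶠ t in 𝓝 t₀, p t) {δ : ℝ} (hδ : 0 < δ) :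
    ∃ ε > 0, ε ≤ δ ∧ ∀ t ∈ Icc (t₀ - ε) (t₀ + ε), p t := by
  obtain ⟨ε, hε, hb⟩ := Metric.nhds_basis_closedBall.mem_iff.1 h
  refine ⟨min ε δ, lt_min hε hδ, min_le_right _ _, fun t ht => hb ?_⟩
  rw [Real.closedBall_eq_Icc]
  exact ⟨by linarith [ht.1, min_le_left ε δ], by linarith [ht.2, min_le_left ε δ]⟩

/-- A component of the solution with continuous velocity is continuously differentiable. -/
theorem SolvesNear.eventually_hasDerivAt_clm [CompleteSpace E'] (h : SolvesNear F z t₀)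
    (Λ : E →L[ℝ] E') {w : ℝ → E'} (hw : ∀ᶠ t in 𝓝 t₀, ContinuousAt w t)
    (hFw : ∀ᶠ t in 𝓝[≠] t₀, Λ (F (z t)) = w t) :
    ∀ᶠ t in 𝓝 t₀, HasDerivAt (fun s => Λ (z s)) (w t) t := by
  obtain ⟨δ, hδ, hac, hae⟩ := h
  obtain ⟨ε, hε, hεδ, hall⟩ := exists_Icc_of_eventually
    (hw.and (eventually_nhdsWithin_iff.1 hFw)) hδ
  have hac' : AbsolutelyContinuousOnInterval (fun s => Λ (z s)) (t₀ - ε) (t₀ + ε) :=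
    absolutelyContinuousOnInterval_lipschitz_comp (hac.mono (by
      rw [uIcc_of_le (by linarith), uIcc_of_le (by linarith)]
      exact Icc_subset_Icc (by linarith) (by linarith))) (Λ.lipschitz.lipschitzOnWith (s := univ))
      fun _ _ => mem_univ _
  filter_upwards [Ioo_mem_nhds (show t₀ - ε < t₀ by linarith) (show t₀ < t₀ + ε by linarith)]
    with t ht
  refine hasDerivAt_of_absolutelyContinuous (by linarith) hac'
    (fun s hs => (hall s hs).1.continuousWithinAt) ?_ ht
  filter_upwards [hae, Measure.ae_ne volume t₀] with s hs hs0 hsI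
  rw [← (hall s hsI).2 hs0]
  exact Λ.hasFDerivAt.comp_hasDerivAt s (hs ⟨by linarith [hsI.1], by linarith [hsI.2]⟩)

theorem SolvesNear.eventually_hasDerivAt [CompleteSpace E] (h : SolvesNear F z t₀)
    (hG : ∀ᶠ w in 𝓝 (z t₀), ContinuousAt G w)
    (hFG : ∀ᶠ t in 𝓝[≠] t₀, F (z t) = G (z t)) : ∀ᶠ t in 𝓝 t₀, HasDerivAt z (G (z t)) t := by
  refine h.eventually_hasDerivAt_clm (ContinuousLinearMap.id ℝ E) (w := fun t => G (z t)) ?_ hFG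
  filter_upwards [h.eventually_continuousAt, h.continuousAt.eventually hG] with t h1 h2
  exact ContinuousAt.comp h2 h1

theorem exists_lipschitzOnWith_of_eventually (hz : ∀ᶠ t in 𝓝 t₀, HasDerivAt z (F (z t)) t)
    (hF : ∀ᶠ w in 𝓝 (z t₀), ContinuousAt F w) :
    ∃ ε > 0, (∀ t ∈ Icc (t₀ - ε) (t₀ + ε), HasDerivAt z (F (z t)) t) ∧
      ∃ K, LipschitzOnWith K z (Icc (t₀ - ε) (t₀ + ε)) := by
  have hzc : ContinuousAt z t₀ := hz.self_of_nhds.continuousAt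
  obtain ⟨ε, hε, -, hall⟩ := exists_Icc_of_eventually (hz.and (hzc.eventually hF)) one_pos
  refine ⟨ε, hε, fun t ht => (hall t ht).1, ?_⟩
  have hd : ∀ t ∈ Icc (t₀ - ε) (t₀ + ε), HasDerivWithinAt z (F (z t)) (Icc (t₀ - ε) (t₀ + ε)) t :=
    fun t ht => (hall t ht).1.hasDerivWithinAt
  have hcont : ContinuousOn (fun t => F (z t)) (Icc (t₀ - ε) (t₀ + ε)) := fun t ht =>
    (ContinuousAt.comp (hall t ht).2 (hall t ht).1.continuousAt).continuousWithinAt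
  obtain ⟨B, hB⟩ := isCompact_Icc.exists_bound_of_continuousOn hcont
  exact ⟨_, (convex_Icc (t₀ - ε) (t₀ + ε)).lipschitzOnWith_of_nnnorm_hasDerivWithin_le
    (C := B.toNNReal) hd fun t ht => by
      rw [← NNReal.coe_le_coe, coe_nnnorm]
      exact (hB t ht).trans (Real.le_coe_toNNReal B)⟩

theorem solvesNear_of_eventually (hz : ∀ᶠ t in 𝓝 t₀, HasDerivAt z (F (z t)) t)
    (hF : ∀ᶠ w in 𝓝 (z t₀), ContinuousAt F w) : SolvesNear F z t₀ := by
  obtain ⟨ε, hε, hd, K, hlip⟩ := exists_lipschitzOnWith_of_eventually hz hF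
  refine ⟨ε, hε, ?_, .of_forall hd⟩
  rw [← uIcc_of_le (by linarith : t₀ - ε ≤ t₀ + ε)] at hlip
  exact hlip.absolutelyContinuousOnInterval

theorem eventuallyEq_of_contDiffAt (hF : ContDiffAt ℝ 1 F (z t₀))
    (hz : ∀ᶠ t in 𝓝 t₀, HasDerivAt z (F (z t)) t) (hy : ∀ᶠ t in 𝓝 t₀, HasDerivAt y (F (y t)) t)
    (h0 : z t₀ = y t₀) : z =ᶠ[𝓝 t₀] y := by
  obtain ⟨K, U, hU, hK⟩ := hF.exists_lipschitzOnWith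
  refine ODE_solution_unique_of_eventually (v := fun _ => F) (s := fun _ => U) (K := K)
    (.of_forall fun _ => hK) (hz.and (hz.self_of_nhds.continuousAt.eventually_mem hU))
    (hy.and (hy.self_of_nhds.continuousAt.eventually_mem (by rwa [← h0]))) h0

end SolvesNear

/-! ### The Hamilton vector field with a continuous potential gradient -/

section Field

variable {n : ℕ} {A : Coord n → Coord n →L[ℝ] Coord n} {D Ω : Set (Coord n)} {i : Fin n}
  {v : Coord n → ℝ} {W : Coord n → Coord n} {H : ℝ → ℝ} {C : ℝ} {q : Fin n → Prop}

/-- The `i`-th coordinate of the base point, as a functional on phase space. -/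
def baseCoord (i : Fin n) : Coord n × Coord n →L[ℝ] ℝ :=
  (EuclideanSpace.proj i).comp (ContinuousLinearMap.fst ℝ (Coord n) (Coord n))

@[simp] theorem baseCoord_apply (i : Fin n) (z : Coord n × Coord n) : baseCoord i z = z.1 i := rfl

/-- A smooth function of `z`, `v(x)` and `W(x)` is Lipschitz up to increments of `H(x_i)`. -/
theorem IsLocalPotential.lipschitzUpTo (hp : IsLocalPotential i q Ω v W H C)
    {Φ : (Coord n × Coord n) × (ℝ × Coord n) → Coord n × Coord n} {z₀ : Coord n × Coord n}
    (hz₀ : z₀.1 ∈ Ω) (hΦ : ContDiffAt ℝ 1 Φ (z₀, (v z₀.1, W z₀.1))) :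
    ∃ K, LipschitzUpTo (fun z => Φ (z, (v z.1, W z.1))) (baseCoord i) H K z₀ := by
  obtain ⟨K, U, hU, hK⟩ := hΦ.exists_lipschitzOnWith
  -- Φ is K-Lipschitz for the maximum norm of (z, v, W); the entry z contributes 1 and the entries v
  -- and W contribute C.
  refine ⟨K * (1 + C), hp.monotone, hp.continuous, ?_, ?_⟩
  · have := hp.nonneg; positivity
  have hvc := hp.continuousOn.continuousAt (hp.isOpen.mem_nhds hz₀)
  have hWc := hp.continuousOn_grad.continuousAt (hp.isOpen.mem_nhds hz₀)
  have hc : ContinuousAt (fun z : Coord n × Coord n => (z, (v z.1, W z.1))) z₀ :=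
    continuousAt_id.prodMk ((ContinuousAt.comp (f := Prod.fst) hvc continuousAt_fst).prodMk
      (ContinuousAt.comp (f := Prod.fst) hWc continuousAt_fst))
  refine ⟨_, inter_mem (hc hU) (eventually_fst_mem hp.isOpen hz₀), fun z hz y hy => ?_⟩
  have h1 := hK.dist_le_mul _ hz.1 _ hy.1
  rw [dist_eq_norm] at h1
  refine h1.trans ?_
  rw [mul_assoc]
  refine mul_le_mul_of_nonneg_left ?_ K.2
  have hxy : ‖z.1 - y.1‖ ≤ ‖z - y‖ := norm_fst_le (z - y)
  have hH : 0 ≤ |H (z.1 i) - H (y.1 i)| := abs_nonneg _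
  have hn : 0 ≤ ‖z - y‖ := norm_nonneg _
  have hCn := hp.nonneg
  have hb : C * (‖z.1 - y.1‖ + |H (z.1 i) - H (y.1 i)|) ≤
      C * (‖z - y‖ + |H (z.1 i) - H (y.1 i)|) := by gcongr
  have h0 : 0 ≤ ‖z - y‖ + |H (z.1 i) - H (y.1 i)| := by positivity
  change max (dist z y) (max (dist (v z.1) (v y.1)) (dist (W z.1) (W y.1))) ≤
    (1 + C) * (‖z - y‖ + |H (z.1 i) - H (y.1 i)|)
  rw [dist_eq_norm z, Real.dist_eq, dist_eq_norm (W z.1)]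
  refine max_le ?_ (max_le ?_ ?_)
  · nlinarith [mul_nonneg hCn h0]
  · have := hp.lip z.1 hz.2 y.1 hy.2
    nlinarith
  · have := hp.lip_grad z.1 hz.2 y.1 hy.2
    nlinarith

theorem IsLocalPotential.continuousAt_comp (hp : IsLocalPotential i q Ω v W H C)
    {X : Type*} [TopologicalSpace X]
    {Φ : (Coord n × Coord n) × (ℝ × Coord n) → X} {z : Coord n × Coord n}
    (hz : z.1 ∈ Ω) (hΦ : ContinuousAt Φ (z, (v z.1, W z.1))) :
    ContinuousAt (fun z => Φ (z, (v z.1, W z.1))) z := by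
  have hvc := hp.continuousOn.continuousAt (hp.isOpen.mem_nhds hz)
  have hWc := hp.continuousOn_grad.continuousAt (hp.isOpen.mem_nhds hz)
  have hc : ContinuousAt (fun z : Coord n × Coord n => (z, (v z.1, W z.1))) z :=
    continuousAt_id.prodMk ((ContinuousAt.comp (f := Prod.fst) hvc continuousAt_fst).prodMk
      (ContinuousAt.comp (f := Prod.fst) hWc continuousAt_fst))
  exact ContinuousAt.comp hΦ hc

/-- The Hamilton vector field with the gradient of the potential replaced by the parameter. -/
def hamParam (A : Coord n → Coord n →L[ℝ] Coord n)
    (p : (Coord n × Coord n) × (ℝ × Coord n)) : Coord n × Coord n :=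
  ((2 : ℝ) • A p.1.1 p.1.2, -(quadGrad A p.1 + p.2.2))

theorem IsCometric.contDiffAt_hamParam (hA : IsCometric A D)
    {p : (Coord n × Coord n) × (ℝ × Coord n)} (hp : p.1.1 ∈ D) :
    ContDiffAt ℝ 1 (hamParam A) p := by
  have h1 : ContDiffAt ℝ ∞ (fun p : (Coord n × Coord n) × (ℝ × Coord n) =>
      A p.1.1 p.1.2) p := ContDiffAt.comp p (hA.contDiffAt_apply hp) contDiffAt_fst
  have h2 : ContDiffAt ℝ ∞ (fun p : (Coord n × Coord n) × (ℝ × Coord n) =>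
      quadGrad A p.1) p := ContDiffAt.comp p (g := quadGrad A) (hA.contDiffAt_quadGrad hp) contDiffAt_fst
  have h3 : ContDiffAt ℝ ∞ (fun p : (Coord n × Coord n) × (ℝ × Coord n) => p.2.2) p :=
    contDiffAt_snd.comp p contDiffAt_snd
  have h4 : ContDiffAt ℝ ∞ (hamParam A) p :=
    (h1.const_smul (2 : ℝ)).prodMk (h2.add h3).neg
  exact h4.of_le (by exact_mod_cast le_top)

/-- The Hamilton vector field of `⟨A(x)ξ, ξ⟩ + v(x)`. -/
abbrev ham (A : Coord n → Coord n →L[ℝ] Coord n) (v : Coord n → ℝ) :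
    Coord n × Coord n → Coord n × Coord n := hamField fun w => quad A w + v w.1

/-- Uniqueness where the potential is smooth. -/
theorem eventuallyEq_of_smooth (hA : IsCometric A D) {z y : ℝ → Coord n × Coord n} {t₀ : ℝ}
    (hD : (z t₀).1 ∈ D) (hv : ContDiffAt ℝ ∞ v (z t₀).1) (hz : SolvesNear (ham A v) z t₀)
    (hy : SolvesNear (ham A v) y t₀) (h0 : z t₀ = y t₀) : z =ᶠ[𝓝 t₀] y := by
  set G : Coord n × Coord n → Coord n × Coord n :=
    fun w => hamParam A (w, (0, gradient v w.1)) with hG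
  have hgrad : ContDiffAt ℝ 1 (gradient v) (z t₀).1 :=
    (dualEquiv n).symm.contDiff.contDiffAt.comp _
      ((hv.fderiv_right (m := ∞) (by simp)).of_le (by exact_mod_cast le_top))
  have hGs : ContDiffAt ℝ 1 G (z t₀) :=
    ContDiffAt.comp (z t₀) (hA.contDiffAt_hamParam hD)
      (contDiffAt_id.prodMk (contDiffAt_const.prodMk
        (ContDiffAt.comp (z t₀) (f := Prod.fst) hgrad contDiffAt_fst)))
  have hGc : ∀ᶠ w in 𝓝 (z t₀), ContinuousAt G w :=
    (hGs.eventually (by simp)).mono fun w hw => hw.continuousAt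
  have hev : ∀ᶠ w in 𝓝 (z t₀), ham A v w = G w := by
    have h1 : ∀ᶠ x in 𝓝 (z t₀).1, DifferentiableAt ℝ v x :=
      ((hv.of_le (m := 1) (by exact_mod_cast le_top)).eventually (by simp)).mono fun x hx =>
        hx.differentiableAt (by simp)
    filter_upwards [continuousAt_fst.eventually h1, eventually_fst_mem hA.isOpen hD] with w h1 h2
    exact hA.hamField_eq h2 h1.hasGradientAt
  refine eventuallyEq_of_contDiffAt hGs (hz.eventually_hasDerivAt hGc ?_)
    (hy.eventually_hasDerivAt (by rwa [← h0]) ?_) h0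
  · exact (hz.continuousAt.eventually hev).filter_mono nhdsWithin_le_nhds
  · exact (hy.continuousAt.eventually (by rwa [← h0])).filter_mono nhdsWithin_le_nhds

/-- Uniqueness at second order glancing points. -/
theorem eventuallyEq_of_glancing (hA : IsCometric A D)
    (hp : IsLocalPotential i (fun _ => True) Ω v W H C) {z y : ℝ → Coord n × Coord n} {t₀ : ℝ}
    (hD : (z t₀).1 ∈ D) (hΩ : (z t₀).1 ∈ Ω) (hζ0 : A (z t₀).1 (z t₀).2 i = 0)
    (hne : fderiv ℝ (fun w : Coord n × Coord n => 2 * A w.1 w.2 i) (z t₀) (ham A v (z t₀)) ≠ 0)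
    (hz : SolvesNear (ham A v) z t₀) (hy : SolvesNear (ham A v) y t₀) (h0 : z t₀ = y t₀) :
    z =ᶠ[𝓝 t₀] y := by
  set G : Coord n × Coord n → Coord n × Coord n :=
    fun w => hamParam A (w, (v w.1, W w.1)) with hG
  have hev : ∀ w : Coord n × Coord n, w.1 ∈ D → w.1 ∈ Ω → ham A v w = G w := fun w h1 h2 =>
    hA.hamField_eq h1 (hp.hasGradientAt h2)
  have hev' : ∀ᶠ w in 𝓝 (z t₀), w.1 ∈ D ∧ w.1 ∈ Ω :=
    (eventually_fst_mem hA.isOpen hD).and (eventually_fst_mem hp.isOpen hΩ)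
  have hGc : ∀ᶠ w in 𝓝 (z t₀), ContinuousAt G w := hev'.mono fun w hw =>
    hp.continuousAt_comp hw.2 (hA.contDiffAt_hamParam hw.1).continuousAt
  obtain ⟨K, hK⟩ := hp.lipschitzUpTo hΩ (hA.contDiffAt_hamParam hD)
  have hζ : ContDiffAt ℝ 1 (fun w : Coord n × Coord n => 2 * A w.1 w.2 i) (z t₀) :=
    contDiffAt_const.mul (((EuclideanSpace.proj i : Coord n →L[ℝ] ℝ).contDiff.contDiffAt.comp _
      (hA.contDiffAt_apply hD)).of_le (by exact_mod_cast le_top))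
  -- The field itself is continuous and Lipschitz up to H(x_i), and the speed of x_i is 2 (A ξ)_i, a
  -- smooth function on phase space.
  refine eventuallyEq_of_tangential (ζ := fun w => 2 * A w.1 w.2 i) hK hGc.self_of_nhds hζ
    (.of_forall fun w => by simp [hamParam]) (by simp [hζ0]) ?_
    (hz.eventually_hasDerivAt hGc ?_) rfl (hy.eventually_hasDerivAt (by rwa [← h0]) ?_) h0.symm
  · rwa [hev _ hD hΩ] at hne
  · exact (hz.continuousAt.eventually (hev'.mono fun w hw => hev w hw.1 hw.2)).filter_mono
      nhdsWithin_le_nhds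
  · rw [h0] at hev'
    exact (hy.continuousAt.eventually (hev'.mono fun w hw => hev w hw.1 hw.2)).filter_mono
      nhdsWithin_le_nhds

theorem sympl_self (a : Coord n × Coord n) : sympl a a = 0 := by
  rw [sympl, sub_self]

theorem differentiableAt_energy (hA : IsCometric A D) {w : Coord n × Coord n} (hw : w.1 ∈ D)
    (hv : DifferentiableAt ℝ v w.1) : DifferentiableAt ℝ (fun w => quad A w + v w.1) w :=
  ((hA.contDiffAt_quad hw).differentiableAt (by simp)).add
    (DifferentiableAt.comp w (f := Prod.fst) hv differentiableAt_fst)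

theorem eventually_eq_of_eventually_hasDerivAt_zero {u : ℝ → ℝ} {t₀ : ℝ}
    (h : ∀ᶠ t in 𝓝 t₀, HasDerivAt u 0 t) : ∀ᶠ t in 𝓝 t₀, u t = u t₀ := by
  obtain ⟨ε, hε, hb⟩ := Metric.eventually_nhds_iff_ball.1 h
  filter_upwards [Metric.ball_mem_nhds t₀ hε] with t ht
  refine (convex_ball t₀ ε).is_const_of_fderivWithin_eq_zero (𝕜 := ℝ) (f := u)
    (fun s hs => (hb s hs).differentiableAt.differentiableWithinAt) (fun s hs => ?_) ht
    (Metric.mem_ball_self hε)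
  rw [fderivWithin_of_isOpen Metric.isOpen_ball hs, (hb s hs).hasFDerivAt.fderiv]
  ext; simp

/-- Existence where the potential is continuously differentiable. -/
theorem exists_solution_of_gradient (hA : IsCometric A D) {U : Set (Coord n)} (hU : IsOpen U)
    (hW : ContinuousOn W U) (hv : ∀ x ∈ U, HasGradientAt v (W x) x) {z₀ : Coord n × Coord n}
    (hD : z₀.1 ∈ D) (hz₀ : z₀.1 ∈ U) :
    ∃ z : ℝ → Coord n × Coord n, z 0 = z₀ ∧ SolvesNear (ham A v) z 0 ∧
      ∀ᶠ t in 𝓝 (0 : ℝ), quad A (z t) + v (z t).1 = quad A z₀ + v z₀.1 := by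
  set G : Coord n × Coord n → Coord n × Coord n := fun w => hamParam A (w, (0, W w.1)) with hG
  set O : Set (Coord n × Coord n) := Prod.fst ⁻¹' (D ∩ U) with hO
  have hOo : IsOpen O := (hA.isOpen.inter hU).preimage continuous_fst
  have hGc : ∀ w ∈ O, ContinuousAt G w := fun w hw => by
    have hWw := hW.continuousAt (hU.mem_nhds hw.2)
    exact ContinuousAt.comp (f := fun w : Coord n × Coord n => (w, ((0 : ℝ), W w.1)))
      (hA.contDiffAt_hamParam hw.1).continuousAt (continuousAt_id.prodMk (continuousAt_const.prodMk
        (ContinuousAt.comp (f := Prod.fst) hWw continuousAt_fst)))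
  have hev : ∀ w ∈ O, ham A v w = G w := fun w hw => hA.hamField_eq hw.1 (hv _ hw.2)
  obtain ⟨z, hz0, hz⟩ := exists_eventually_hasDerivAt_of_continuousOn hOo
    (fun w hw => (hGc w hw).continuousWithinAt) (show z₀ ∈ O from ⟨hD, hz₀⟩)
  have hzO : ∀ᶠ t in 𝓝 (0 : ℝ), z t ∈ O := hz.self_of_nhds.continuousAt.eventually_mem
    (hOo.mem_nhds (by rw [hz0]; exact ⟨hD, hz₀⟩))
  have hz' : ∀ᶠ t in 𝓝 (0 : ℝ), HasDerivAt z (ham A v (z t)) t := by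
    filter_upwards [hz, hzO] with t h1 h2
    rwa [hev _ h2]
  refine ⟨z, hz0, solvesNear_of_eventually hz' ?_, ?_⟩
  · rw [hz0]
    filter_upwards [hOo.mem_nhds (show z₀ ∈ O from ⟨hD, hz₀⟩)] with w hw
    refine (hGc w hw).congr ?_
    filter_upwards [hOo.mem_nhds hw] with w' hw' using (hev w' hw').symm
  · rw [← hz0]
    -- Energy is conserved because dp(H_p) = ω(H_p, H_p) = 0.
    refine eventually_eq_of_eventually_hasDerivAt_zero
      (u := fun t => quad A (z t) + v (z t).1) ?_
    filter_upwards [hz', hzO] with t h1 h2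
    have hd := differentiableAt_energy hA h2.1 (hv _ h2.2).differentiableAt
    have h3 := hd.hasFDerivAt.comp_hasDerivAt t h1
    rwa [← sympl_hamField hd, sympl_self] at h3

end Field

/-! ### Hyperbolic points: elimination of the conormal momentum -/

section Elimination

variable {n : ℕ} {A : Coord n → Coord n →L[ℝ] Coord n} {D : Set (Coord n)} {i : Fin n} {σ : ℝ}

/-- Sets the `i`-th coordinate to zero. -/
def dropCoord (i : Fin n) : Coord n →L[ℝ] Coord n :=
  ContinuousLinearMap.id ℝ _ - (EuclideanSpace.proj i : Coord n →L[ℝ] ℝ).smulRight (coordVec i)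

theorem dropCoord_apply (i : Fin n) (ξ : Coord n) :
    dropCoord i ξ = ξ - ξ i • coordVec i := by simp [dropCoord]

@[simp] theorem dropCoord_same (i : Fin n) (ξ : Coord n) : dropCoord i ξ i = 0 := by
  simp [dropCoord_apply, coordVec]

theorem dropCoord_of_ne {j : Fin n} (hj : j ≠ i) (ξ : Coord n) : dropCoord i ξ j = ξ j := by
  simp [dropCoord_apply, coordVec, hj]

@[simp] theorem dropCoord_dropCoord (i : Fin n) (ξ : Coord n) :
    dropCoord i (dropCoord i ξ) = dropCoord i ξ := by
  rw [dropCoord_apply i (dropCoord i ξ)]; simp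

@[simp] theorem dropCoord_add_smul (i : Fin n) (ξ : Coord n) (s : ℝ) :
    dropCoord i (ξ + s • coordVec i) = dropCoord i ξ := by
  simp [dropCoord_apply, coordVec, add_smul]

theorem dropCoord_add (i : Fin n) (ξ : Coord n) : dropCoord i ξ + ξ i • coordVec i = ξ := by
  simp [dropCoord_apply]

theorem inner_coordVec (ξ : Coord n) (i : Fin n) : inner ℝ ξ (coordVec i) = ξ i := by
  rw [coordVec, EuclideanSpace.inner_single_right]; simp

theorem IsCometric.quad_add (hA : IsCometric A D) {x : Coord n} (hx : x ∈ D) (ζ : Coord n)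
    (s : ℝ) : quad A (x, ζ + s • coordVec i) =
      quad A (x, ζ) + 2 * s * A x ζ i + s ^ 2 * A x (coordVec i) i := by
  have h1 : inner ℝ (A x (coordVec i)) ζ = A x ζ i := by
    rw [hA.symm x hx, real_inner_comm, inner_coordVec]
  simp only [quad, map_add, map_smul, inner_add_left, inner_add_right, real_inner_smul_left,
    real_inner_smul_right, inner_coordVec, h1]
  ring

theorem IsCometric.coordVec_pos (hA : IsCometric A D) {x : Coord n} (hx : x ∈ D) (i : Fin n) :
    0 < A x (coordVec i) i := by
  rw [← inner_coordVec]
  refine hA.pos x hx _ fun h => ?_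
  have := congrArg (fun w : Coord n => w i) h
  simp [coordVec] at this

/-- A quarter of the discriminant of `s ↦ ⟨A(ζ + s e_i), ζ + s e_i⟩ + v`, `ζ = ξ - ξ_i e_i`. -/
def disc (A : Coord n → Coord n →L[ℝ] Coord n) (i : Fin n)
    (p : (Coord n × Coord n) × ℝ) : ℝ :=
  (A p.1.1 (dropCoord i p.1.2) i) ^ 2 -
    A p.1.1 (coordVec i) i * (quad A (p.1.1, dropCoord i p.1.2) + p.2)

/-- The covector with prescribed components other than the `i`-th, and energy zero. -/
def liftCov (A : Coord n → Coord n →L[ℝ] Coord n) (i : Fin n) (σ : ℝ)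
    (p : (Coord n × Coord n) × ℝ) : Coord n :=
  dropCoord i p.1.2 + ((-A p.1.1 (dropCoord i p.1.2) i + σ * √(disc A i p)) /
    A p.1.1 (coordVec i) i) • coordVec i

theorem dropCoord_liftCov (p : (Coord n × Coord n) × ℝ) :
    dropCoord i (liftCov A i σ p) = dropCoord i p.1.2 := by
  simp [liftCov]

theorem liftCov_dropCoord (x ξ : Coord n) (c : ℝ) :
    liftCov A i σ ((x, dropCoord i ξ), c) = liftCov A i σ ((x, ξ), c) := by
  simp [liftCov, disc]

/-- On zero energy the discriminant is the square of half the speed of x_i, so it is positive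
precisely at the transversal points. -/
theorem IsCometric.disc_eq (hA : IsCometric A D) {z : Coord n × Coord n} (hz : z.1 ∈ D) {c : ℝ}
    (h : quad A z + c = 0) : disc A i (z, c) = (A z.1 z.2 i) ^ 2 := by
  obtain ⟨x, ξ⟩ := z
  have h1 := hA.quad_add (i := i) hz (dropCoord i ξ) (ξ i)
  rw [dropCoord_add] at h1
  have h2 : A x ξ i = A x (dropCoord i ξ) i + ξ i * A x (coordVec i) i := by
    conv_lhs => rw [← dropCoord_add i ξ]
    simp
  simp only [disc] at *
  rw [h2]
  linear_combination -(A x (coordVec i)) i * (h - h1)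

/-- The two covectors of zero energy with the same remaining components have opposite values of (A
ξ)_i; the sign σ selects the right root. -/
theorem IsCometric.liftCov_eq (hA : IsCometric A D) (hσ : σ * σ = 1) {z : Coord n × Coord n}
    (hz : z.1 ∈ D) {c : ℝ} (h : quad A z + c = 0) (hpos : 0 < σ * A z.1 z.2 i) :
    liftCov A i σ (z, c) = z.2 := by
  have h1 := hA.disc_eq (i := i) hz h
  have h2 : √(disc A i (z, c)) = σ * A z.1 z.2 i := by
    rw [h1, ← Real.sqrt_sq hpos.le]
    congr 1
    linear_combination (-(A z.1 z.2 i) ^ 2) * hσ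
  have h3 : A z.1 z.2 i = A z.1 (dropCoord i z.2) i + z.2 i * A z.1 (coordVec i) i := by
    conv_lhs => rw [← dropCoord_add i z.2]
    simp
  have ha := (hA.coordVec_pos hz i).ne'
  rw [liftCov, h2]
  conv_rhs => rw [← dropCoord_add i z.2]
  congr 2
  rw [div_eq_iff ha]
  linear_combination A z.1 z.2 i * hσ + h3

theorem IsCometric.apply_liftCov (hA : IsCometric A D) {p : (Coord n × Coord n) × ℝ}
    (hp : p.1.1 ∈ D) : A p.1.1 (liftCov A i σ p) i = σ * √(disc A i p) := by
  have ha := (hA.coordVec_pos hp i).ne'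
  simp only [liftCov, map_add, map_smul, PiLp.add_apply, PiLp.smul_apply, smul_eq_mul]
  field_simp
  ring

theorem IsCometric.quad_liftCov (hA : IsCometric A D) (hσ : σ * σ = 1)
    {p : (Coord n × Coord n) × ℝ} (hp : p.1.1 ∈ D) (hd : 0 ≤ disc A i p) :
    quad A (p.1.1, liftCov A i σ p) + p.2 = 0 := by
  have ha := (hA.coordVec_pos hp i).ne'
  have hs : √(disc A i p) ^ 2 = disc A i p := Real.sq_sqrt hd
  rw [liftCov, hA.quad_add hp]
  have h1 : (σ * √(disc A i p)) ^ 2 = disc A i p := by rw [mul_pow, hs, sq, hσ, one_mul]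
  set S := σ * √(disc A i p)
  have h2 : S ^ 2 = (A p.1.1 (dropCoord i p.1.2) i) ^ 2 -
    A p.1.1 (coordVec i) i * (quad A (p.1.1, dropCoord i p.1.2) + p.2) := h1
  field_simp
  linear_combination h2

theorem IsCometric.contDiffAt_disc (hA : IsCometric A D) {p : (Coord n × Coord n) × ℝ}
    (hp : p.1.1 ∈ D) : ContDiffAt ℝ 1 (disc A i) p := by
  have hA1 : ContDiffAt ℝ 1 A p.1.1 :=
    (hA.contDiffOn.contDiffAt (hA.isOpen.mem_nhds hp)).of_le (by exact_mod_cast le_top)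
  have hx : ContDiffAt ℝ 1 (fun p : (Coord n × Coord n) × ℝ => p.1.1) p :=
    contDiffAt_fst.comp p contDiffAt_fst
  have hAx : ContDiffAt ℝ 1 (fun p : (Coord n × Coord n) × ℝ => A p.1.1) p := hA1.comp p hx
  have hζ : ContDiffAt ℝ 1 (fun p : (Coord n × Coord n) × ℝ => dropCoord i p.1.2) p :=
    (dropCoord i).contDiff.contDiffAt.comp p (contDiffAt_snd.comp p contDiffAt_fst)
  have hAζ := hAx.clm_apply hζ
  have hproj : ContDiff ℝ 1 (fun x : Coord n => x i) :=
    (EuclideanSpace.proj i : Coord n →L[ℝ] ℝ).contDiff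
  have h1 : ContDiffAt ℝ 1 (fun p : (Coord n × Coord n) × ℝ => A p.1.1 (dropCoord i p.1.2) i) p :=
    hproj.contDiffAt.comp p hAζ
  have h2 : ContDiffAt ℝ 1 (fun p : (Coord n × Coord n) × ℝ => A p.1.1 (coordVec i) i) p :=
    hproj.contDiffAt.comp p (hAx.clm_apply contDiffAt_const)
  have h3 : ContDiffAt ℝ 1 (fun p : (Coord n × Coord n) × ℝ =>
      quad A (p.1.1, dropCoord i p.1.2)) p := hAζ.inner ℝ hζ
  exact (h1.pow 2).sub (h2.mul (h3.add contDiffAt_snd))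

theorem IsCometric.contDiffAt_liftCov (hA : IsCometric A D) {p : (Coord n × Coord n) × ℝ}
    (hp : p.1.1 ∈ D) (hd : 0 < disc A i p) : ContDiffAt ℝ 1 (liftCov A i σ) p := by
  have hA1 : ContDiffAt ℝ 1 A p.1.1 :=
    (hA.contDiffOn.contDiffAt (hA.isOpen.mem_nhds hp)).of_le (by exact_mod_cast le_top)
  have hx : ContDiffAt ℝ 1 (fun p : (Coord n × Coord n) × ℝ => p.1.1) p :=
    contDiffAt_fst.comp p contDiffAt_fst
  have hAx : ContDiffAt ℝ 1 (fun p : (Coord n × Coord n) × ℝ => A p.1.1) p := hA1.comp p hx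
  have hζ : ContDiffAt ℝ 1 (fun p : (Coord n × Coord n) × ℝ => dropCoord i p.1.2) p :=
    (dropCoord i).contDiff.contDiffAt.comp p (contDiffAt_snd.comp p contDiffAt_fst)
  have hproj : ContDiff ℝ 1 (fun x : Coord n => x i) :=
    (EuclideanSpace.proj i : Coord n →L[ℝ] ℝ).contDiff
  have h1 : ContDiffAt ℝ 1 (fun p : (Coord n × Coord n) × ℝ => A p.1.1 (dropCoord i p.1.2) i) p :=
    hproj.contDiffAt.comp p (hAx.clm_apply hζ)
  have h2 : ContDiffAt ℝ 1 (fun p : (Coord n × Coord n) × ℝ => A p.1.1 (coordVec i) i) p :=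
    hproj.contDiffAt.comp p (hAx.clm_apply contDiffAt_const)
  have h3 : ContDiffAt ℝ 1 (fun p => √(disc A i p)) p := (hA.contDiffAt_disc hp).sqrt hd.ne'
  exact hζ.add (((h1.neg.add (contDiffAt_const.mul h3)).div h2
    (hA.coordVec_pos hp i).ne').smul contDiffAt_const)

/-- Forgets the `i`-th momentum. -/
def redProj (i : Fin n) : Coord n × Coord n →L[ℝ] Coord n × Coord n :=
  (ContinuousLinearMap.fst ℝ _ _).prod ((dropCoord i).comp (ContinuousLinearMap.snd ℝ _ _))

@[simp] theorem redProj_apply (i : Fin n) (z : Coord n × Coord n) :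
    redProj i z = (z.1, dropCoord i z.2) := rfl

/-- The reduced Hamilton field. -/
def hypParam (A : Coord n → Coord n →L[ℝ] Coord n) (i : Fin n) (σ : ℝ)
    (p : (Coord n × Coord n) × (ℝ × Coord n)) : Coord n × Coord n :=
  redProj i (hamParam A ((p.1.1, liftCov A i σ (p.1, p.2.1)), p.2))

theorem IsCometric.contDiffAt_hypParam (hA : IsCometric A D)
    {p : (Coord n × Coord n) × (ℝ × Coord n)} (hp : p.1.1 ∈ D) (hd : 0 < disc A i (p.1, p.2.1)) :
    ContDiffAt ℝ 1 (hypParam A i σ) p := by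
  have h1 : ContDiffAt ℝ 1 (fun p : (Coord n × Coord n) × (ℝ × Coord n) =>
      liftCov A i σ (p.1, p.2.1)) p :=
    ContDiffAt.comp p (g := liftCov A i σ) (hA.contDiffAt_liftCov hp hd)
      (contDiffAt_fst.prodMk (contDiffAt_fst.comp p contDiffAt_snd))
  have h2 : ContDiffAt ℝ 1 (fun p : (Coord n × Coord n) × (ℝ × Coord n) =>
      (((p.1.1, liftCov A i σ (p.1, p.2.1)), p.2) :
        (Coord n × Coord n) × (ℝ × Coord n))) p :=
    ((contDiffAt_fst.comp p contDiffAt_fst).prodMk h1).prodMk contDiffAt_snd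
  exact (redProj i).contDiff.contDiffAt.comp p
    (ContDiffAt.comp p (g := hamParam A) (hA.contDiffAt_hamParam hp) h2)

theorem exists_sign {a : ℝ} (ha : a ≠ 0) : ∃ σ : ℝ, σ * σ = 1 ∧ 0 < σ * a := by
  rcases lt_or_gt_of_ne ha with h | h
  · exact ⟨-1, by norm_num, by linarith⟩
  · exact ⟨1, by norm_num, by linarith⟩

end Elimination

/-! ### Hyperbolic points: the reduced system and uniqueness -/

section Hyperbolic

variable {n : ℕ} {A : Coord n → Coord n →L[ℝ] Coord n} {D Ω : Set (Coord n)} {i : Fin n} {σ : ℝ}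
  {v : Coord n → ℝ} {W : Coord n → Coord n} {H : ℝ → ℝ} {C : ℝ} {q : Fin n → Prop}

/-- The reduced Hamilton field of a local potential. -/
def hypField (A : Coord n → Coord n →L[ℝ] Coord n) (i : Fin n) (σ : ℝ) (v : Coord n → ℝ)
    (W : Coord n → Coord n) (y : Coord n × Coord n) : Coord n × Coord n :=
  hypParam A i σ (y, (v y.1, W y.1))

/-- The point of zero energy over a point of the reduced space. -/
def expand (A : Coord n → Coord n →L[ℝ] Coord n) (i : Fin n) (σ : ℝ) (v : Coord n → ℝ)
    (y : Coord n × Coord n) : Coord n × Coord n := (y.1, liftCov A i σ (y, v y.1))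

theorem hypField_eq (y : Coord n × Coord n) : hypField A i σ v W y =
    redProj i (hamParam A (expand A i σ v y, (v y.1, W y.1))) := rfl

/-- Dropping the i-th momentum removes the only occurrence of the normal derivative of v; the
tangential ones are components of W. -/
theorem redProj_ham (hA : IsCometric A D) (hp : IsLocalPotential i q Ω v W H C)
    (hq : ∀ j, j ≠ i → q j) {z : Coord n × Coord n} (hD : z.1 ∈ D) (hΩ : z.1 ∈ Ω)
    (hi : z.1 i ≠ 0) :
    redProj i (ham A v z) = redProj i (hamParam A (z, (v z.1, W z.1))) := by
  refine Prod.ext (hA.hamField_fst hD v) ?_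
  ext j
  by_cases hj : j = i
  · subst hj; simp
  · simp only [redProj_apply, dropCoord_of_ne hj]
    rw [hA.hamField_snd_apply hD (hp.differentiableAt hΩ hi), ← hp.eq_grad _ hΩ hi j (hq j hj)]
    simp [hamParam]

theorem IsLocalPotential.eventually_disc_pos (hA : IsCometric A D)
    (hp : IsLocalPotential i q Ω v W H C) {y : Coord n × Coord n} (hD : y.1 ∈ D) (hΩ : y.1 ∈ Ω)
    (hd : 0 < disc A i (y, v y.1)) :
    ∀ᶠ w in 𝓝 y, w.1 ∈ D ∧ w.1 ∈ Ω ∧ 0 < disc A i (w, v w.1) := by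
  have hc : ContinuousAt (fun w : Coord n × Coord n => disc A i (w, v w.1)) y :=
    ContinuousAt.comp (f := fun w : Coord n × Coord n => (w, v w.1))
      (hA.contDiffAt_disc hD).continuousAt (continuousAt_id.prodMk
        (ContinuousAt.comp (f := Prod.fst)
          (hp.continuousOn.continuousAt (hp.isOpen.mem_nhds hΩ)) continuousAt_fst))
  exact (eventually_fst_mem hA.isOpen hD).and ((eventually_fst_mem hp.isOpen hΩ).and
    (hc.eventually (lt_mem_nhds hd)))

theorem continuousAt_hypField (hA : IsCometric A D) (hp : IsLocalPotential i q Ω v W H C)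
    {y : Coord n × Coord n} (hD : y.1 ∈ D) (hΩ : y.1 ∈ Ω) (hd : 0 < disc A i (y, v y.1)) :
    ContinuousAt (hypField A i σ v W) y :=
  hp.continuousAt_comp hΩ (hA.contDiffAt_hypParam hD hd).continuousAt

theorem disc_redProj (z : Coord n × Coord n) (c : ℝ) :
    disc A i (redProj i z, c) = disc A i (z, c) := by simp [disc]

theorem expand_redProj (hA : IsCometric A D) (hσ : σ * σ = 1) {z : Coord n × Coord n}
    (hz : z.1 ∈ D) (h : quad A z + v z.1 = 0) (hpos : 0 < σ * A z.1 z.2 i) :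
    expand A i σ v (redProj i z) = z := by
  refine Prod.ext rfl ?_
  have h1 := hA.liftCov_eq (i := i) hσ hz h hpos
  exact (liftCov_dropCoord z.1 z.2 (v z.1)).trans h1

/-- The velocity of x is continuous with nonzero i-th component at t₀, so the curve is off the
hyperplane at all other times nearby and there obeys the reduced equation almost everywhere. The
reduced field being continuous, the equation then holds at every nearby time. -/
theorem reduced_of_solvesNear (hA : IsCometric A D) (hp : IsLocalPotential i q Ω v W H C)
    (hq : ∀ j, j ≠ i → q j) (hσ : σ * σ = 1) {z : ℝ → Coord n × Coord n} {t₀ : ℝ}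
    (hD : (z t₀).1 ∈ D) (hΩ : (z t₀).1 ∈ Ω)
    (hpos : 0 < σ * A (z t₀).1 (z t₀).2 i) (hz : SolvesNear (ham A v) z t₀)
    (hz0 : ∀ᶠ t in 𝓝 t₀, quad A (z t) + v (z t).1 = 0) :
    ∀ᶠ t in 𝓝 t₀, HasDerivAt (fun s => redProj i (z s)) (hypField A i σ v W (redProj i (z t))) t ∧
      expand A i σ v (redProj i (z t)) = z t := by
  have happly : ∀ w : Coord n × Coord n, w.1 ∈ D → ContinuousAt
      (fun w : Coord n × Coord n => A w.1 w.2) w := fun w hw => (hA.contDiffAt_apply hw).continuousAt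
  have hev : ∀ᶠ t in 𝓝 t₀, (z t).1 ∈ D ∧ (z t).1 ∈ Ω ∧ 0 < σ * A (z t).1 (z t).2 i := by
    refine hz.continuousAt.eventually (p := fun w : Coord n × Coord n =>
      w.1 ∈ D ∧ w.1 ∈ Ω ∧ 0 < σ * A w.1 w.2 i) ?_
    have h1 : ContinuousAt (fun w : Coord n × Coord n => σ * A w.1 w.2 i) (z t₀) :=
      continuousAt_const.mul (((EuclideanSpace.proj i : Coord n →L[ℝ] ℝ).continuous.continuousAt).comp
        (happly _ hD))
    exact (eventually_fst_mem hA.isOpen hD).and ((eventually_fst_mem hp.isOpen hΩ).and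
      (h1.eventually (lt_mem_nhds hpos)))
  have hexp : ∀ᶠ t in 𝓝 t₀, expand A i σ v (redProj i (z t)) = z t := by
    filter_upwards [hev, hz0] with t h1 h2 using expand_redProj hA hσ h1.1 h2 h1.2.2
  have hx : ∀ᶠ t in 𝓝 t₀, HasDerivAt (fun s => (z s).1) ((2 : ℝ) • A (z t).1 (z t).2) t := by
    refine hz.eventually_hasDerivAt_clm (ContinuousLinearMap.fst ℝ _ _)
      (w := fun t => (2 : ℝ) • A (z t).1 (z t).2) ?_ ?_
    · filter_upwards [hev, hz.eventually_continuousAt] with t h1 h2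
      exact (ContinuousAt.comp (f := z) (happly _ h1.1) h2).const_smul (2 : ℝ)
    · exact (hev.mono fun t h => hA.hamField_fst h.1 v).filter_mono nhdsWithin_le_nhds
  have hxi : ∀ᶠ t in 𝓝[≠] t₀, (z t).1 i ≠ 0 := by
    have h1 : HasDerivAt (fun s => (z s).1 i) (((2 : ℝ) • A (z t₀).1 (z t₀).2) i) t₀ :=
      (EuclideanSpace.proj i : Coord n →L[ℝ] ℝ).hasFDerivAt.comp_hasDerivAt t₀ hx.self_of_nhds
    refine h1.eventually_ne ?_
    intro h0
    have : A (z t₀).1 (z t₀).2 i = 0 := by simpa using h0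
    rw [this, mul_zero] at hpos
    exact lt_irrefl _ hpos
  refine (hz.eventually_hasDerivAt_clm (redProj i)
    (w := fun t => hypField A i σ v W (redProj i (z t))) ?_ ?_).and hexp
  · filter_upwards [hev, hz0, hz.eventually_continuousAt] with t h1 h2 h3
    refine ContinuousAt.comp (f := fun t => redProj i (z t)) (g := hypField A i σ v W)
      (continuousAt_hypField hA hp h1.1 h1.2.1 ?_) ((redProj i).continuous.continuousAt.comp h3)
    have h4 : (redProj i (z t)).1 = (z t).1 := rfl
    rw [disc_redProj, h4, hA.disc_eq h1.1 h2]
    have h5 : A (z t).1 (z t).2 i ≠ 0 := fun h0 => by simp [h0] at h1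
    positivity
  · filter_upwards [hxi, hev.filter_mono nhdsWithin_le_nhds, hexp.filter_mono nhdsWithin_le_nhds]
      with t h1 h2 h3
    rw [hypField_eq, h3]
    exact redProj_ham hA hp hq h2.1 h2.2.1 h1

/-- Uniqueness at hyperbolic points. -/
theorem eventuallyEq_of_hyperbolic (hA : IsCometric A D) (hp : IsLocalPotential i q Ω v W H C)
    (hq : ∀ j, j ≠ i → q j) {z y : ℝ → Coord n × Coord n} {t₀ : ℝ}
    (hD : (z t₀).1 ∈ D) (hΩ : (z t₀).1 ∈ Ω)
    (hne : A (z t₀).1 (z t₀).2 i ≠ 0) (hz : SolvesNear (ham A v) z t₀)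
    (hz0 : ∀ᶠ t in 𝓝 t₀, quad A (z t) + v (z t).1 = 0) (hy : SolvesNear (ham A v) y t₀)
    (hy0 : ∀ᶠ t in 𝓝 t₀, quad A (y t) + v (y t).1 = 0) (h0 : z t₀ = y t₀) : z =ᶠ[𝓝 t₀] y := by
  obtain ⟨σ, hσ, hpos⟩ := exists_sign hne
  have hz' := reduced_of_solvesNear hA hp hq hσ hD hΩ hpos hz hz0
  have hy' := reduced_of_solvesNear hA hp hq hσ (h0 ▸ hD) (h0 ▸ hΩ) (h0 ▸ hpos) hy hy0
  have hd : 0 < disc A i (redProj i (z t₀), v (redProj i (z t₀)).1) := by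
    have h4 : (redProj i (z t₀)).1 = (z t₀).1 := rfl
    rw [disc_redProj, h4, hA.disc_eq hD hz0.self_of_nhds]
    positivity
  obtain ⟨K, hK⟩ := hp.lipschitzUpTo (z₀ := redProj i (z t₀)) hΩ
    (hA.contDiffAt_hypParam (σ := σ) hD hd)
  have hred := eventuallyEq_of_transversal (F := hypField A i σ v W) hK
    (continuousAt_hypField hA hp hD hΩ hd) (by
      have h1 : hypField A i σ v W (redProj i (z t₀)) = redProj i (hamParam A (z t₀,
          (v (redProj i (z t₀)).1, W (redProj i (z t₀)).1))) := by
        rw [hypField_eq, hz'.self_of_nhds.2]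
      rw [h1]
      simpa [hamParam] using hne) (hz'.mono fun t h => h.1) rfl (hy'.mono fun t h => h.1)
      (by rw [h0])
  -- Equality of the reduced curves suffices, since the missing momentum is a function of them on
  -- zero energy.
  filter_upwards [hred, hz', hy'] with t h1 h2 h3
  have h1' : redProj i (z t) = redProj i (y t) := h1
  rw [← h2.2, ← h3.2, h1']

end Hyperbolic

/-! ### Hyperbolic points: existence -/

section Existence

variable {n : ℕ} {A : Coord n → Coord n →L[ℝ] Coord n} {D Ω : Set (Coord n)} {i : Fin n} {σ : ℝ}
  {v : Coord n → ℝ} {W : Coord n → Coord n} {H : ℝ → ℝ} {C : ℝ} {q : Fin n → Prop}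

/-- A vector tangent to the energy level agrees with the Hamilton vector field if it does so after
forgetting the conormal momentum. -/
theorem eq_ham_of_redProj (hA : IsCometric A D) {z : Coord n × Coord n} (hD : z.1 ∈ D)
    (hv : DifferentiableAt ℝ v z.1) (hne : A z.1 z.2 i ≠ 0) {w : Coord n × Coord n}
    (hw : redProj i w = redProj i (ham A v z))
    (hw0 : fderiv ℝ (fun w => quad A w + v w.1) z w = 0) : w = ham A v z := by
  have h1 : w.1 = (ham A v z).1 := (Prod.ext_iff.1 hw).1
  have h2 : dropCoord i w.2 = dropCoord i (ham A v z).2 := (Prod.ext_iff.1 hw).2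
  -- Tangency to the energy level gives ω(H_p, w) = dp(w) = 0. As the other components agree and the
  -- x_i-component of H_p is nonzero, this relation fixes the i-th momentum component of w.
  have h3 : sympl (ham A v z) w = sympl (ham A v z) (ham A v z) := by
    rw [sympl_hamField (differentiableAt_energy hA hD hv), hw0, sympl_self]
  have h4 : (ham A v z).1 i ≠ 0 := by
    have : (ham A v z).1 = (2 : ℝ) • A z.1 z.2 := hA.hamField_fst hD v
    rw [this]
    simpa using hne
  refine Prod.ext h1 ?_
  rw [sympl, sympl, h1, ← dropCoord_add i w.2, h2] at h3
  have h6 : inner ℝ (ham A v z).1 (ham A v z).2 = inner ℝ (ham A v z).1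
      (dropCoord i (ham A v z).2 + (ham A v z).2 i • coordVec i) := by rw [dropCoord_add]
  simp only [inner_add_right, real_inner_smul_right, inner_coordVec] at h3 h6
  have h5 : w.2 i = (ham A v z).2 i := mul_right_cancel₀ h4 (by linarith)
  rw [← dropCoord_add i w.2, ← dropCoord_add i (ham A v z).2, h2, h5]

theorem isOpen_hyperbolicRegion (hA : IsCometric A D) (hp : IsLocalPotential i q Ω v W H C) :
    IsOpen {w : Coord n × Coord n | w.1 ∈ D ∧ w.1 ∈ Ω ∧ 0 < disc A i (w, v w.1)} :=
  isOpen_iff_mem_nhds.2 fun _ hw => hp.eventually_disc_pos hA hw.1 hw.2.1 hw.2.2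

theorem hasDerivAt_baseCoord_of_hypField (hA : IsCometric A D) {y : ℝ → Coord n × Coord n} {t : ℝ}
    (hD : (y t).1 ∈ D) (h : HasDerivAt y (hypField A i σ v W (y t)) t) :
    HasDerivAt (fun s => (y s).1 i) (2 * (σ * √(disc A i (y t, v (y t).1)))) t := by
  have h1 := (baseCoord i).hasFDerivAt.comp_hasDerivAt t h
  have h2 : baseCoord i (hypField A i σ v W (y t)) = 2 * (σ * √(disc A i (y t, v (y t).1))) := by
    rw [← hA.apply_liftCov (p := (y t, v (y t).1)) hD]
    simp [hypField, hypParam, hamParam]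
  rwa [h2] at h1

theorem monotoneOn_or_antitoneOn_baseCoord (hA : IsCometric A D) (hσ : σ * σ = 1)
    {y : ℝ → Coord n × Coord n} {a b : ℝ} (hD : ∀ t ∈ Icc a b, (y t).1 ∈ D)
    (h : ∀ t ∈ Icc a b, HasDerivAt y (hypField A i σ v W (y t)) t) :
    MonotoneOn (fun s => (y s).1 i) (Icc a b) ∨ AntitoneOn (fun s => (y s).1 i) (Icc a b) := by
  have hd := fun t ht => hasDerivAt_baseCoord_of_hypField hA (hD t ht) (h t ht)
  have hc : ContinuousOn (fun s => (y s).1 i) (Icc a b) := fun t ht =>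
    (hd t ht).continuousAt.continuousWithinAt
  have hdiff : DifferentiableOn ℝ (fun s => (y s).1 i) (interior (Icc a b)) := fun t ht =>
    (hd t (interior_subset ht)).differentiableAt.differentiableWithinAt
  rcases mul_self_eq_one_iff.1 hσ with rfl | rfl
  · refine .inl (monotoneOn_of_deriv_nonneg (convex_Icc a b) hc hdiff fun t ht => ?_)
    rw [(hd t (interior_subset ht)).deriv]
    positivity
  · refine .inr (antitoneOn_of_deriv_nonpos (convex_Icc a b) hc hdiff fun t ht => ?_)
    rw [(hd t (interior_subset ht)).deriv]
    linarith [Real.sqrt_nonneg (disc A i (y t, v (y t).1))]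

/-- A local potential is absolutely continuous along curves crossing the hypersurface
monotonically. -/
theorem IsLocalPotential.absolutelyContinuousOnInterval_comp
    (hp : IsLocalPotential i q Ω v W H C) {x : ℝ → Coord n} {a b : ℝ} (hab : a ≤ b) {K : ℝ≥0}
    (hx : LipschitzOnWith K x (Icc a b)) (hΩ : ∀ t ∈ Icc a b, x t ∈ Ω)
    (hmono : MonotoneOn (fun s => x s i) (Icc a b) ∨ AntitoneOn (fun s => x s i) (Icc a b)) :
    AbsolutelyContinuousOnInterval (fun t => v (x t)) a b := by
  rw [← uIcc_of_le hab] at hx hΩ hmono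
  have hxi : LipschitzOnWith K (fun s => x s i) (uIcc a b) := fun s hs t ht => by
    refine le_trans ?_ (hx hs ht)
    rw [edist_dist, edist_dist, Real.dist_eq, dist_eq_norm]
    exact ENNReal.ofReal_le_ofReal (by simpa using PiLp.norm_apply_le (x s - x t) i)
  have hmaps : ∀ t ∈ uIcc a b, x t i ∈ uIcc (x a i) (x b i) := fun t ht => by
    rcases hmono with h | h
    · exact (h.mapsTo_uIcc) ht
    · exact (h.mapsTo_uIcc) ht
  -- The increments of v along the curve are bounded by those of x, which is Lipschitz, and those of
  -- H(x_i), which is absolutely continuous because x_i is Lipschitz and monotone.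
  refine absolutelyContinuousOnInterval_of_dist_le (K := C) hx.absolutelyContinuousOnInterval
    (absolutelyContinuousOnInterval_comp_monotone (hp.absolutelyContinuous _ _) hxi hmono hmaps)
    fun s hs t ht => ?_
  rw [Real.dist_eq, Real.dist_eq, dist_eq_norm]
  exact hp.lip _ (hΩ s hs) _ (hΩ t ht)

/-- Off the hyperplane everything is differentiable. The reduced velocity is correct by
construction, and staying at zero energy forces the recovered momentum to obey its own equation. -/
theorem hasDerivAt_expand (hA : IsCometric A D) (hp : IsLocalPotential i q Ω v W H C)
    (hq : ∀ j, j ≠ i → q j) (hσ : σ * σ = 1) {y : ℝ → Coord n × Coord n} {t : ℝ}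
    (hD : (y t).1 ∈ D) (hΩ : (y t).1 ∈ Ω) (hd : 0 < disc A i (y t, v (y t).1))
    (hy : HasDerivAt y (hypField A i σ v W (y t)) t) (hi : (y t).1 i ≠ 0)
    (hE : ∀ᶠ s in 𝓝 t, quad A (expand A i σ v (y s)) + v (y s).1 = 0) :
    HasDerivAt (fun s => expand A i σ v (y s)) (ham A v (expand A i σ v (y t))) t := by
  have hv : DifferentiableAt ℝ v (y t).1 := hp.differentiableAt hΩ hi
  have hex : DifferentiableAt ℝ (expand A i σ v) (y t) := by
    have h1 : DifferentiableAt ℝ (fun w : Coord n × Coord n => (w, v w.1)) (y t) :=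
      differentiableAt_id.prodMk (DifferentiableAt.comp (y t) (f := Prod.fst) hv
        differentiableAt_fst)
    exact differentiableAt_fst.prodMk (DifferentiableAt.comp (y t)
      (g := liftCov A i σ) (f := fun w : Coord n × Coord n => (w, v w.1))
      ((hA.contDiffAt_liftCov (σ := σ) hD hd).differentiableAt (by simp)) h1)
  have hz := hex.hasFDerivAt.comp_hasDerivAt t hy
  set w := fderiv ℝ (expand A i σ v) (y t) (hypField A i σ v W (y t)) with hw
  have hne : A (expand A i σ v (y t)).1 (expand A i σ v (y t)).2 i ≠ 0 := by
    have h1 : A (y t).1 (liftCov A i σ (y t, v (y t).1)) i = σ * √(disc A i (y t, v (y t).1)) :=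
      hA.apply_liftCov (p := (y t, v (y t).1)) hD
    have h2 : σ ≠ 0 := fun h => by simp [h] at hσ
    have h3 : √(disc A i (y t, v (y t).1)) ≠ 0 := (Real.sqrt_pos.2 hd).ne'
    exact h1 ▸ mul_ne_zero h2 h3
  have hred : redProj i w = redProj i (ham A v (expand A i σ v (y t))) := by
    rw [redProj_ham hA hp hq (z := expand A i σ v (y t)) hD hΩ hi]
    have h1 : HasDerivAt (fun s => redProj i (expand A i σ v (y s))) (redProj i w) t :=
      (redProj i).hasFDerivAt.comp_hasDerivAt t hz
    have h2 : HasDerivAt (fun s => redProj i (y s)) (redProj i (hypField A i σ v W (y t))) t :=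
      (redProj i).hasFDerivAt.comp_hasDerivAt t hy
    have h3 : (fun s => redProj i (expand A i σ v (y s))) = fun s => redProj i (y s) := by
      funext s
      exact Prod.ext rfl (dropCoord_liftCov (y s, v (y s).1))
    rw [h3] at h1
    rw [h1.unique h2, hypField_eq]
    simp [expand]
  have hE0 : fderiv ℝ (fun w => quad A w + v w.1) (expand A i σ v (y t)) w = 0 := by
    have h1 := (differentiableAt_energy (v := v) (w := expand A i σ v (y t)) hA hD
      hv).hasFDerivAt.comp_hasDerivAt t hz
    have h2 : HasDerivAt (fun _ : ℝ => (0 : ℝ)) 0 t := hasDerivAt_const t 0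
    exact h1.unique (h2.congr_of_eventuallyEq hE)
  rw [← eq_ham_of_redProj (z := expand A i σ v (y t)) hA hD hv hne hred hE0]
  exact hz

/-- Existence at hyperbolic points of the hypersurface. -/
theorem exists_solution_hyperbolic (hA : IsCometric A D) (hp : IsLocalPotential i q Ω v W H C)
    (hq : ∀ j, j ≠ i → q j) {z₀ : Coord n × Coord n} (hD : z₀.1 ∈ D) (hΩ : z₀.1 ∈ Ω)
    (hne : A z₀.1 z₀.2 i ≠ 0) (h0 : quad A z₀ + v z₀.1 = 0) :
    ∃ z : ℝ → Coord n × Coord n, z 0 = z₀ ∧ SolvesNear (ham A v) z 0 ∧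
      (∀ᶠ t in 𝓝 (0 : ℝ), quad A (z t) + v (z t).1 = 0) ∧
      ∀ᶠ t in 𝓝[≠] (0 : ℝ), (z t).1 i ≠ 0 := by
  obtain ⟨σ, hσ, hpos⟩ := exists_sign hne
  set O := {w : Coord n × Coord n | w.1 ∈ D ∧ w.1 ∈ Ω ∧ 0 < disc A i (w, v w.1)} with hO
  have hOo : IsOpen O := isOpen_hyperbolicRegion hA hp
  have hFc : ∀ w ∈ O, ContinuousAt (hypField A i σ v W) w := fun w hw =>
    continuousAt_hypField hA hp hw.1 hw.2.1 hw.2.2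
  have hy₀ : redProj i z₀ ∈ O := by
    refine ⟨hD, hΩ, ?_⟩
    have h4 : (redProj i z₀).1 = z₀.1 := rfl
    rw [disc_redProj, h4, hA.disc_eq hD h0]
    positivity
  obtain ⟨y, hy0, hy⟩ := exists_eventually_hasDerivAt_of_continuousOn hOo
    (fun w hw => (hFc w hw).continuousWithinAt) hy₀
  have hyc : ContinuousAt y 0 := hy.self_of_nhds.continuousAt
  have hyO : ∀ᶠ t in 𝓝 (0 : ℝ), y t ∈ O :=
    hyc.eventually_mem (hOo.mem_nhds (by rwa [hy0]))
  have hE : ∀ᶠ t in 𝓝 (0 : ℝ), quad A (expand A i σ v (y t)) + v (y t).1 = 0 :=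
    hyO.mono fun t ht => hA.quad_liftCov (p := (y t, v (y t).1)) hσ ht.1 ht.2.2.le
  -- The speed of x_i is nonzero, so the hyperplane is met only at time 0, a null set for the
  -- differential equation.
  have hne0 : ∀ᶠ t in 𝓝[≠] (0 : ℝ), (y t).1 i ≠ 0 := by
    refine (hasDerivAt_baseCoord_of_hypField hA hyO.self_of_nhds.1 hy.self_of_nhds).eventually_ne ?_
    have h2 : σ ≠ 0 := fun h => by simp [h] at hσ
    have h3 := (Real.sqrt_pos.2 hyO.self_of_nhds.2.2).ne'
    exact mul_ne_zero two_ne_zero (mul_ne_zero h2 h3)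
  have hp0 := hA.contDiffAt_liftCov (i := i) (σ := σ) (p := (y 0, v (y 0).1))
    hyO.self_of_nhds.1 hyO.self_of_nhds.2.2
  obtain ⟨L, N, hN, hL⟩ := hp0.exists_lipschitzOnWith
  have hyN : ∀ᶠ t in 𝓝 (0 : ℝ), (y t, v (y t).1) ∈ N := by
    have h1 : ContinuousAt (fun t => v (y t).1) 0 :=
      ContinuousAt.comp (f := fun t => (y t).1) (hp.continuousOn.continuousAt
        (hp.isOpen.mem_nhds hyO.self_of_nhds.2.1)) (continuousAt_fst.comp hyc)
    exact (hyc.prodMk h1).eventually_mem hN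
  obtain ⟨ε₀, hε₀, -, K, hK⟩ := exists_lipschitzOnWith_of_eventually hy
    (by rw [hy0]; filter_upwards [hOo.mem_nhds hy₀] with w hw using hFc w hw)
  obtain ⟨ε, hε, hεε, hall⟩ := exists_Icc_of_eventually
    (hy.eventually_nhds.and (hyO.and (hyN.and (hE.eventually_nhds.and
      (eventually_nhdsWithin_iff.1 hne0))))) hε₀
  have hab : (0 : ℝ) - ε ≤ 0 + ε := by linarith
  have hK' := hK.mono (Icc_subset_Icc (by linarith) (by linarith) :
    Icc (0 - ε) (0 + ε) ⊆ Icc (0 - ε₀) (0 + ε₀))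
  refine ⟨fun t => expand A i σ v (y t), ?_, ⟨ε, hε, ?_, ?_⟩, hE, hne0⟩
  · change expand A i σ v (y 0) = z₀
    rw [hy0]
    exact expand_redProj hA hσ hD h0 hpos
  · have hx : LipschitzOnWith K (fun t => (y t).1) (Icc (0 - ε) (0 + ε)) := by
      have h := LipschitzWith.prod_fst.comp_lipschitzOnWith hK'
      rwa [one_mul] at h
    have hyac : AbsolutelyContinuousOnInterval y (0 - ε) (0 + ε) := by
      rw [← uIcc_of_le hab] at hK'
      exact hK'.absolutelyContinuousOnInterval
    have hxac : AbsolutelyContinuousOnInterval (fun t => (y t).1) (0 - ε) (0 + ε) := by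
      rw [← uIcc_of_le hab] at hx
      exact hx.absolutelyContinuousOnInterval
    have hvac := hp.absolutelyContinuousOnInterval_comp hab hx (fun t ht => (hall t ht).2.1.2.1)
      (monotoneOn_or_antitoneOn_baseCoord hA hσ (fun t ht => (hall t ht).2.1.1)
        fun t ht => (hall t ht).1.self_of_nhds)
    -- The recovered momentum is a Lipschitz function of the reduced curve and of v along it, both
    -- of which are absolutely continuous.
    refine absolutelyContinuousOnInterval_prodMk hxac
      (absolutelyContinuousOnInterval_lipschitz_comp
        (absolutelyContinuousOnInterval_prodMk hyac hvac) hL fun t ht => ?_)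
    rw [uIcc_of_le hab] at ht
    exact (hall t ht).2.2.1
  · filter_upwards [Measure.ae_ne volume (0 : ℝ)] with t ht0 ht
    obtain ⟨h1, h2, -, h3, h4⟩ := hall t ht
    exact hasDerivAt_expand hA hp hq hσ h2.1 h2.2.1 h2.2.2 h1.self_of_nhds (h4 ht0) h3

end Existence

/-! ### Integral curves in charts -/

section Curves

variable {n : ℕ} {M : Type*} [TopologicalSpace M] [ChartedSpace (Coord n) M]
  {e : OpenPartialHomeomorph M (Coord n)} {γ γ' : ℝ → Cotangent n M} {J J' : Set ℝ} {t₀ : ℝ}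

theorem IsIntegralCurve.eventually_mem_source {p : Cotangent n M → ℝ} (h : IsIntegralCurve p γ J)
    (ht : t₀ ∈ J) (hs : (γ t₀).proj ∈ e.source) :
    ∀ᶠ t in 𝓝 t₀, t ∈ J ∧ (γ t).proj ∈ e.source :=
  (h.isOpen.eventually_mem ht).and ((h.continuousOn.continuousAt
    (h.isOpen.mem_nhds ht)).eventually_mem (e.open_source.mem_nhds hs))

theorem IsIntegralCurve.exists_absolutelyContinuousOnInterval {p : Cotangent n M → ℝ}
    (h : IsIntegralCurve p γ J) (he : e ∈ IsManifold.maximalAtlas (𝓡 n) ∞ M) (ht : t₀ ∈ J)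
    (hs : (γ t₀).proj ∈ e.source) :
    ∃ δ > 0, (∀ t ∈ Icc (t₀ - δ) (t₀ + δ), t ∈ J ∧ (γ t).proj ∈ e.source) ∧
      AbsolutelyContinuousOnInterval (fun t => toCoord e (γ t)) (t₀ - δ) (t₀ + δ) := by
  obtain ⟨δ, hδ, -, hall⟩ := exists_Icc_of_eventually (h.eventually_mem_source ht hs) one_pos
  refine ⟨δ, hδ, hall, h.absolutelyContinuous e he _ _ ?_ ?_⟩
  · rw [uIcc_of_le (by linarith)]; exact fun t ht => (hall t ht).1
  · rw [uIcc_of_le (by linarith)]; exact fun t ht => (hall t ht).2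

theorem IsIntegralCurve.continuousAt_toCoord {p : Cotangent n M → ℝ} (h : IsIntegralCurve p γ J)
    (he : e ∈ IsManifold.maximalAtlas (𝓡 n) ∞ M) (ht : t₀ ∈ J) (hs : (γ t₀).proj ∈ e.source) :
    ContinuousAt (fun t => toCoord e (γ t)) t₀ := by
  obtain ⟨δ, hδ, -, hac⟩ := h.exists_absolutelyContinuousOnInterval he ht hs
  have := hac.continuousOn
  rw [uIcc_of_le (by linarith)] at this
  exact this.continuousAt (Icc_mem_nhds (by linarith) (by linarith))

variable [IsManifold (𝓡 n) ∞ M] (g : RiemannianMetric n M) {V : M → ℝ}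

theorem IsIntegralCurve.solvesNear (h : IsIntegralCurve (symbol g V) γ J)
    (he : e ∈ IsManifold.maximalAtlas (𝓡 n) ∞ M) (ht : t₀ ∈ J) (hs : (γ t₀).proj ∈ e.source) :
    SolvesNear (ham (cometric g e) fun x => V (e.symm x)) (fun t => toCoord e (γ t)) t₀ := by
  obtain ⟨δ, hδ, hall, hac⟩ := h.exists_absolutelyContinuousOnInterval he ht hs
  refine ⟨δ, hδ, hac, ?_⟩
  filter_upwards [h.equation e he] with t h1 h2
  have h3 := h1 (hall t h2).1 (hall t h2).2
  rwa [hamField_congr (symbol_ofCoord_eventuallyEq g V he (e.map_source (hall t h2).2))] at h3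

theorem energy_toCoord (he : e ∈ IsManifold.maximalAtlas (𝓡 n) ∞ M) {ρ : Cotangent n M}
    (hs : ρ.proj ∈ e.source) :
    quad (cometric g e) (toCoord e ρ) + V (e.symm (toCoord e ρ).1) = symbol g V ρ := by
  rw [← symbol_ofCoord g V he (e.map_source hs), ofCoord_toCoord he hs]

theorem IsIntegralCurve.eventually_energy (h : IsIntegralCurve (symbol g V) γ J)
    (he : e ∈ IsManifold.maximalAtlas (𝓡 n) ∞ M) (ht : t₀ ∈ J) (hs : (γ t₀).proj ∈ e.source)
    (h0 : ∀ t ∈ J, symbol g V (γ t) = 0) :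
    ∀ᶠ t in 𝓝 t₀, quad (cometric g e) (toCoord e (γ t)) + V (e.symm (toCoord e (γ t)).1) = 0 := by
  filter_upwards [h.eventually_mem_source ht hs] with t h1
  rw [energy_toCoord g he h1.2, h0 t h1.1]

theorem IsIntegralCurve.eventuallyEq {p : Cotangent n M → ℝ} (h : IsIntegralCurve p γ J)
    (h' : IsIntegralCurve p γ' J') (he : e ∈ IsManifold.maximalAtlas (𝓡 n) ∞ M) (ht : t₀ ∈ J)
    (ht' : t₀ ∈ J') (hs : (γ t₀).proj ∈ e.source) (h0 : γ t₀ = γ' t₀)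
    (heq : (fun t => toCoord e (γ t)) =ᶠ[𝓝 t₀] fun t => toCoord e (γ' t)) : γ =ᶠ[𝓝 t₀] γ' := by
  filter_upwards [heq, h.eventually_mem_source ht hs,
    h'.eventually_mem_source ht' (by rwa [← h0])] with t h1 h2 h3
  rw [← ofCoord_toCoord he h2.2, h1, ofCoord_toCoord he h3.2]

/-- The change of coordinates is C¹, hence locally Lipschitz and therefore Lipschitz on the compact
image of the curve. -/
theorem absolutelyContinuousOnInterval_toCoord {e' : OpenPartialHomeomorph M (Coord n)}
    (he : e ∈ IsManifold.maximalAtlas (𝓡 n) ∞ M) (he' : e' ∈ IsManifold.maximalAtlas (𝓡 n) ∞ M)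
    {z : ℝ → Coord n × Coord n} {a b : ℝ} (hz : AbsolutelyContinuousOnInterval z a b)
    (ht : ∀ t ∈ uIcc a b, (z t).1 ∈ e.target) (hs : ∀ t ∈ uIcc a b, e.symm (z t).1 ∈ e'.source) :
    AbsolutelyContinuousOnInterval (fun t => toCoord e' (ofCoord e (z t))) a b := by
  have hl : LocallyLipschitzOn (z '' uIcc a b) (coordChange e e') := by
    rintro _ ⟨t, htI, rfl⟩
    obtain ⟨K, U, hU, hK⟩ := ((contDiffAt_coordChange he he' (ht t htI) (hs t htI)).of_le
      (m := 1) (by exact_mod_cast le_top)).exists_lipschitzOnWith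
    exact ⟨K, U, mem_nhdsWithin_of_mem_nhds hU, hK⟩
  obtain ⟨K, hK⟩ := hl.exists_lipschitzOnWith_of_compact (isCompact_uIcc.image_of_continuousOn
    hz.continuousOn)
  refine absolutelyContinuousOnInterval_of_dist_le (K := K) hz hz fun s hs' t ht' => ?_
  rw [toCoord_ofCoord_eq_coordChange he he' (ht s hs') (hs s hs'),
    toCoord_ofCoord_eq_coordChange he he' (ht t ht') (hs t ht')]
  have := hK.dist_le_mul _ (mem_image_of_mem z hs') _ (mem_image_of_mem z ht')
  have h2 : 0 ≤ K * dist (z s) (z t) := by positivity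
  linarith

theorem hasDerivAt_toCoord {e' : OpenPartialHomeomorph M (Coord n)}
    (he : e ∈ IsManifold.maximalAtlas (𝓡 n) ∞ M) (he' : e' ∈ IsManifold.maximalAtlas (𝓡 n) ∞ M)
    {z : ℝ → Coord n × Coord n} {t : ℝ} (ht : (z t).1 ∈ e.target) (hs : e.symm (z t).1 ∈ e'.source)
    (hV : DifferentiableAt ℝ (fun x => V (e.symm x)) (z t).1)
    (hz : HasDerivAt z (ham (cometric g e) (fun x => V (e.symm x)) (z t)) t) :
    HasDerivAt (fun s => toCoord e' (ofCoord e (z s)))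
      (hamField (fun w => symbol g V (ofCoord e' w)) (toCoord e' (ofCoord e (z t)))) t := by
  rw [ham, ← hamField_congr (symbol_ofCoord_eventuallyEq g V he ht)] at hz
  have h1 := ((contDiffAt_coordChange he he' ht hs).differentiableAt
    (by simp)).hasFDerivAt.comp_hasDerivAt t hz
  rw [fderiv_coordChange_hamField g he he' ht hs hV] at h1
  rw [toCoord_ofCoord_eq_coordChange he he' ht hs]
  refine h1.congr_of_eventuallyEq ?_
  filter_upwards [hz.continuousAt.eventually
    (eventually_fst_mem (isOpen_transition e e') ⟨ht, hs⟩)] with s hs'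
  exact toCoord_ofCoord_eq_coordChange he he' hs'.1 hs'.2

/-- Passes from a solution in one chart to an integral curve tested in all charts. Transporting the
equation needs V differentiable along the curve, but only at almost every time, so time 0 may be
left out. -/
theorem exists_isIntegralCurveIn (he : e ∈ IsManifold.maximalAtlas (𝓡 n) ∞ M)
    {ρ : Cotangent n M} (hρ : ρ.proj ∈ e.source) {S : Set (Cotangent n M)}
    {z : ℝ → Coord n × Coord n} (hz0 : z 0 = toCoord e ρ)
    (hz : SolvesNear (ham (cometric g e) fun x => V (e.symm x)) z 0)
    (hS : ∀ᶠ t in 𝓝 (0 : ℝ), ofCoord e (z t) ∈ S)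
    (hV : ∀ᶠ t in 𝓝[≠] (0 : ℝ), DifferentiableAt ℝ (fun x => V (e.symm x)) (z t).1) :
    ∃ γ J, IsIntegralCurveIn (symbol g V) S ρ γ J := by
  have hz1 : ∀ᶠ t in 𝓝 (0 : ℝ), (z t).1 ∈ e.target := hz.continuousAt.eventually
    (eventually_fst_mem e.open_target (by rw [hz0]; exact e.map_source hρ))
  obtain ⟨δ, hδ, hac, hae⟩ := hz
  obtain ⟨ε, hε, hεδ, hall⟩ := exists_Icc_of_eventually
    (hz1.and (hS.and (eventually_nhdsWithin_iff.1 hV))) hδ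
  have hsub : Icc (0 - ε) (0 + ε) ⊆ Icc (0 - δ) (0 + δ) :=
    Icc_subset_Icc (by linarith) (by linarith)
  have hIoo : Ioo (0 - ε) (0 + ε) ⊆ Icc (0 - ε) (0 + ε) := Ioo_subset_Icc_self
  refine ⟨fun t => ofCoord e (z t), Ioo (0 - ε) (0 + ε), ⟨⟨isOpen_Ioo, ordConnected_Ioo, ?_, ?_, ?_⟩,
    ⟨by linarith, by linarith⟩, ?_, fun t ht => (hall t (hIoo ht)).2.1⟩⟩
  · have hc := hac.continuousOn
    rw [uIcc_of_le (by linarith)] at hc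
    refine e.continuousOn_symm.comp (f := fun t => (z t).1)
      (continuous_fst.comp_continuousOn (hc.mono (hIoo.trans hsub))) fun t ht => (hall t (hIoo ht)).1
  · intro e' he' a b hab hs
    refine absolutelyContinuousOnInterval_toCoord he he' (hac.mono ?_)
      (fun t ht => (hall t (hIoo (hab ht))).1) hs
    rw [uIcc_of_le (by linarith : 0 - δ ≤ 0 + δ)]
    exact hab.trans (hIoo.trans hsub)
  · intro e' he'
    filter_upwards [hae, Measure.ae_ne volume (0 : ℝ)] with t h1 h2 h3 h4
    have h5 := hall t (hIoo h3)
    exact hasDerivAt_toCoord g he he' h5.1 h4 (h5.2.2 h2) (h1 (hsub (hIoo h3)))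
  · rw [hz0, ofCoord_toCoord he hρ]

end Curves

/-! ### Local existence and uniqueness of integral curves -/

section Local

variable {n : ℕ} {M : Type*} [TopologicalSpace M] [ChartedSpace (Coord n) M]
  [IsManifold (𝓡 n) ∞ M] (g : RiemannianMetric n M) {Y : Set M} {f V : M → ℝ}
  {q : Fin n → Fin n → Prop} {γ γ' : ℝ → Cotangent n M} {J J' : Set ℝ} {t₀ : ℝ}

theorem contDiffOn_off_hypersurface (hV : ContMDiffOn (𝓡 n) 𝓘(ℝ) ∞ V Yᶜ)
    {e : OpenPartialHomeomorph M (Coord n)} (he : e ∈ IsManifold.maximalAtlas (𝓡 n) ∞ M) :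
    ContDiffOn ℝ ∞ (fun x => V (e.symm x)) (e.target ∩ e.symm ⁻¹' Yᶜ) :=
  contDiffOn_comp_symm (k := ⊤) he hV

theorem isOpen_off_hypersurface {M : Type*} [TopologicalSpace M] [ChartedSpace (Coord n) M]
    {Y : Set M} {f : M → ℝ} (hf : IsDefiningFunction (n := n) Y f)
    (e : OpenPartialHomeomorph M (Coord n)) : IsOpen (e.target ∩ e.symm ⁻¹' Yᶜ) :=
  e.isOpen_inter_preimage_symm hf.isClosed.isOpen_compl

theorem eventuallyEq_of_notMem (hf : IsDefiningFunction (n := n) Y f)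
    (hV : ContMDiffOn (𝓡 n) 𝓘(ℝ) ∞ V Yᶜ) (h : IsIntegralCurve (symbol g V) γ J)
    (h' : IsIntegralCurve (symbol g V) γ' J') (ht : t₀ ∈ J) (ht' : t₀ ∈ J') (h0 : γ t₀ = γ' t₀)
    (hm : (γ t₀).proj ∉ Y) : γ =ᶠ[𝓝 t₀] γ' := by
  set e := chartAt (Coord n) (γ t₀).proj with he'
  have he : e ∈ IsManifold.maximalAtlas (𝓡 n) ∞ M := IsManifold.chart_mem_maximalAtlas _
  have hs : (γ t₀).proj ∈ e.source := mem_chart_source _ _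
  refine h.eventuallyEq h' he ht ht' hs h0 (eventuallyEq_of_smooth (isCometric_cometric g he)
    (e.map_source hs) ?_ (h.solvesNear g he ht hs) (h'.solvesNear g he ht' (by rwa [← h0]))
    (by rw [h0]))
  refine (contDiffOn_off_hypersurface hV he).contDiffAt
    ((isOpen_off_hypersurface hf e).mem_nhds ⟨e.map_source hs, ?_⟩)
  change e.symm (e (γ t₀).proj) ∉ Y
  rwa [e.left_inv hs]

theorem IsAdaptedAt.hamDefining_eq {ρ : Cotangent n M} {e : OpenPartialHomeomorph M (Coord n)}
    {i : Fin n} {Ω : Set (Coord n)} {W : Coord n → Coord n} {H : ℝ → ℝ} {C : ℝ}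
    (ha : IsAdaptedAt f V q ρ.proj e i Ω W H C) (hf : ContMDiff (𝓡 n) 𝓘(ℝ) ∞ f) :
    hamDefining g V f ρ = 2 * cometric g e (toCoord e ρ).1 (toCoord e ρ).2 i := by
  have h1 := hamDefining_adapted g V hf ha.mem_atlas ha.defining
    (z := toCoord e ρ) (e.map_source ha.mem_source)
  rwa [ofCoord_toCoord ha.mem_atlas ha.mem_source] at h1

theorem eventuallyEq_of_hamDefining_ne_zero (hf : IsDefiningFunction (n := n) Y f)
    (hq : ∀ i j, j ≠ i → q i j) {e : OpenPartialHomeomorph M (Coord n)} {i : Fin n}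
    {Ω : Set (Coord n)} {W : Coord n → Coord n} {H : ℝ → ℝ} {C : ℝ}
    (ha : IsAdaptedAt f V q (γ t₀).proj e i Ω W H C)
    (h : IsIntegralCurve (symbol g V) γ J) (h' : IsIntegralCurve (symbol g V) γ' J')
    (hp : ∀ t ∈ J, symbol g V (γ t) = 0) (hp' : ∀ t ∈ J', symbol g V (γ' t) = 0)
    (ht : t₀ ∈ J) (ht' : t₀ ∈ J') (h0 : γ t₀ = γ' t₀)
    (hne : hamDefining g V f (γ t₀) ≠ 0) : γ =ᶠ[𝓝 t₀] γ' := by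
  have he := ha.mem_atlas
  have hs := ha.mem_source
  have hs' : (γ' t₀).proj ∈ e.source := by rwa [← h0]
  rw [ha.hamDefining_eq g hf.smooth] at hne
  exact h.eventuallyEq h' he ht ht' hs h0 (eventuallyEq_of_hyperbolic
    (z := fun t => toCoord e (γ t)) (isCometric_cometric g he)
    ha.potential (hq i) (e.map_source hs) ha.mem (right_ne_zero_of_mul hne)
    (h.solvesNear g he ht hs) (h.eventually_energy g he ht hs hp)
    (h'.solvesNear g he ht' hs') (h'.eventually_energy g he ht' hs' hp') (by rw [h0]))

theorem contDiffAt_conormalMomentum {A : Coord n → Coord n →L[ℝ] Coord n} {D : Set (Coord n)}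
    (hA : IsCometric A D) (i : Fin n) {z : Coord n × Coord n} (hz : z.1 ∈ D) :
    ContDiffAt ℝ ∞ (fun w : Coord n × Coord n => 2 * A w.1 w.2 i) z :=
  contDiffAt_const.mul ((EuclideanSpace.proj i : Coord n →L[ℝ] ℝ).contDiff.contDiffAt.comp _
    (hA.contDiffAt_apply hz))

theorem IsAdaptedAt.hamDeriv_hamDefining {m : M} {e : OpenPartialHomeomorph M (Coord n)}
    {i : Fin n} {Ω : Set (Coord n)} {W : Coord n → Coord n} {H : ℝ → ℝ} {C : ℝ}
    (ha : IsAdaptedAt f V (fun _ _ => True) m e i Ω W H C) (hf : ContMDiff (𝓡 n) 𝓘(ℝ) ∞ f)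
    {z : Coord n × Coord n} (hz : z.1 ∈ Ω) :
    hamDeriv (symbol g V) (hamDefining g V f) (ofCoord e z) =
      fderiv ℝ (fun w : Coord n × Coord n => 2 * cometric g e w.1 w.2 i) z
        (ham (cometric g e) (fun x => V (e.symm x)) z) := by
  have he := ha.mem_atlas
  have hzt : z.1 ∈ e.target := ha.subset hz
  have hev : (fun w => hamDefining g V f (ofCoord e w)) =ᶠ[𝓝 z]
      fun w : Coord n × Coord n => 2 * cometric g e w.1 w.2 i := by
    filter_upwards [eventually_fst_mem e.open_target hzt] with w hw
    exact hamDefining_adapted g V hf he ha.defining hw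
  have hd := (contDiffAt_conormalMomentum (isCometric_cometric g he) i hzt).differentiableAt
    (by simp)
  rw [hamDeriv_eq g he hzt (ha.potential.hasGradientAt hz).differentiableAt
    (hd.congr_of_eventuallyEq hev), hev.fderiv_eq,
    hamField_congr (symbol_ofCoord_eventuallyEq g V he hzt)]

theorem eventuallyEq_of_mem_glancingSet (hf : IsDefiningFunction (n := n) Y f)
    {e : OpenPartialHomeomorph M (Coord n)} {i : Fin n}
    {Ω : Set (Coord n)} {W : Coord n → Coord n} {H : ℝ → ℝ} {C : ℝ}
    (ha : IsAdaptedAt f V (fun _ _ => True) (γ t₀).proj e i Ω W H C)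
    (h : IsIntegralCurve (symbol g V) γ J) (h' : IsIntegralCurve (symbol g V) γ' J')
    (ht : t₀ ∈ J) (ht' : t₀ ∈ J') (h0 : γ t₀ = γ' t₀)
    (hG : γ t₀ ∈ glancingSet g V f) : γ =ᶠ[𝓝 t₀] γ' := by
  have he := ha.mem_atlas
  have hs := ha.mem_source
  obtain ⟨-, -, hζ, hne⟩ := hG
  rw [ha.hamDefining_eq g hf.smooth] at hζ
  rw [← ofCoord_toCoord he hs, ha.hamDeriv_hamDefining g hf.smooth ha.mem] at hne
  exact h.eventuallyEq h' he ht ht' hs h0 (eventuallyEq_of_glancing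
    (z := fun t => toCoord e (γ t)) (isCometric_cometric g he)
    ha.potential (e.map_source hs) ha.mem (by simpa using hζ) hne
    (h.solvesNear g he ht hs) (h'.solvesNear g he ht' (by rwa [← h0])) (by rw [h0]))

theorem exists_isIntegralCurveIn_of_notMem (hf : IsDefiningFunction (n := n) Y f)
    (hV : ContMDiffOn (𝓡 n) 𝓘(ℝ) ∞ V Yᶜ) {S : Set (Cotangent n M)}
    (hS : hyperbolicSet g V f ⊆ S) {ρ : Cotangent n M} (hm : ρ.proj ∉ Y)
    (hp : symbol g V ρ = 0) : ∃ γ J, IsIntegralCurveIn (symbol g V) S ρ γ J := by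
  set e := chartAt (Coord n) ρ.proj with he'
  have he : e ∈ IsManifold.maximalAtlas (𝓡 n) ∞ M := IsManifold.chart_mem_maximalAtlas _
  have hs : ρ.proj ∈ e.source := mem_chart_source _ _
  set U := e.target ∩ e.symm ⁻¹' Yᶜ with hU
  have hUo : IsOpen U := isOpen_off_hypersurface hf e
  have hv := contDiffOn_off_hypersurface hV he
  have hz₀ : (toCoord e ρ).1 ∈ U := by
    refine ⟨e.map_source hs, ?_⟩
    change e.symm (e ρ.proj) ∉ Y
    rwa [e.left_inv hs]
  obtain ⟨z, hz0, hz, hE⟩ := exists_solution_of_gradient (isCometric_cometric g he) hUo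
    (W := gradient fun x => V (e.symm x)) (v := fun x => V (e.symm x))
    ((dualEquiv n).symm.continuous.comp_continuousOn
      (hv.continuousOn_fderiv_of_isOpen hUo (by exact_mod_cast le_top)))
    (fun x hx => ((hv.contDiffAt (hUo.mem_nhds hx)).differentiableAt (by simp)).hasGradientAt)
    (e.map_source hs) hz₀
  have hzU : ∀ᶠ t in 𝓝 (0 : ℝ), (z t).1 ∈ U :=
    hz.continuousAt.eventually (eventually_fst_mem hUo (by rwa [hz0]))
  refine exists_isIntegralCurveIn g he hs hz0 hz ?_ ?_
  · filter_upwards [hE, hzU] with t h1 h2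
    refine hS ⟨?_, .inl fun h => h2.2 ((hf.mem_iff _).2 h)⟩
    rw [symbol_ofCoord g V he h2.1, h1, energy_toCoord g he hs, hp]
  · refine (hzU.mono fun t ht => ?_).filter_mono nhdsWithin_le_nhds
    exact (hv.contDiffAt (hUo.mem_nhds ht)).differentiableAt (by simp)

theorem exists_isIntegralCurveIn_of_hamDefining_ne_zero (hf : IsDefiningFunction (n := n) Y f)
    (hq : ∀ i j, j ≠ i → q i j) {S : Set (Cotangent n M)} (hS : hyperbolicSet g V f ⊆ S)
    {ρ : Cotangent n M} {e : OpenPartialHomeomorph M (Coord n)} {i : Fin n}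
    {Ω : Set (Coord n)} {W : Coord n → Coord n} {H : ℝ → ℝ} {C : ℝ}
    (ha : IsAdaptedAt f V q ρ.proj e i Ω W H C) (hp : symbol g V ρ = 0)
    (hne : hamDefining g V f ρ ≠ 0) : ∃ γ J, IsIntegralCurveIn (symbol g V) S ρ γ J := by
  have he := ha.mem_atlas
  have hs := ha.mem_source
  have hA := isCometric_cometric g he
  rw [ha.hamDefining_eq g hf.smooth] at hne
  obtain ⟨z, hz0, hz, hE, hi⟩ := exists_solution_hyperbolic hA
    ha.potential (hq i) (z₀ := toCoord e ρ) (e.map_source hs) ha.mem (right_ne_zero_of_mul hne)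
    ((energy_toCoord g he hs).trans hp)
  have hzΩ : ∀ᶠ t in 𝓝 (0 : ℝ), (z t).1 ∈ Ω :=
    hz.continuousAt.eventually (eventually_fst_mem ha.potential.isOpen (by rw [hz0]; exact ha.mem))
  refine exists_isIntegralCurveIn g he hs hz0 hz ?_ ?_
  · have hc : ∀ᶠ w in 𝓝 (z 0), 2 * cometric g e w.1 w.2 i ≠ 0 :=
      (contDiffAt_conormalMomentum hA i
        (by rw [hz0]; exact e.map_source hs)).continuousAt.eventually_ne (by rwa [hz0])
    filter_upwards [hE, hzΩ, hz.continuousAt.eventually hc] with t h1 h2 h3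
    refine hS ⟨?_, .inr ?_⟩
    · rw [symbol_ofCoord g V he (ha.subset h2), h1]
    · rwa [hamDefining_adapted g V hf.smooth he ha.defining (ha.subset h2)]
  · filter_upwards [hi, hzΩ.filter_mono nhdsWithin_le_nhds] with t h1 h2
    exact ha.potential.differentiableAt h2 h1

/-- In the adapted chart the Hamilton vector field is continuous, so H_p² f ≠ 0 persists nearby as
an expression in coordinates. A nearby point of zero energy is then either hyperbolic or again
glancing to exactly second order, and the curve stays in the union. -/
theorem exists_isIntegralCurveIn_of_mem_glancingSet (hf : IsDefiningFunction (n := n) Y f)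
    {ρ : Cotangent n M} {e : OpenPartialHomeomorph M (Coord n)} {i : Fin n}
    {Ω : Set (Coord n)} {W : Coord n → Coord n} {H : ℝ → ℝ} {C : ℝ}
    (ha : IsAdaptedAt f V (fun _ _ => True) ρ.proj e i Ω W H C) (hG : ρ ∈ glancingSet g V f) :
    ∃ γ J, IsIntegralCurveIn (symbol g V) (hyperbolicSet g V f ∪ glancingSet g V f) ρ γ J := by
  have he := ha.mem_atlas
  have hs := ha.mem_source
  have hA := isCometric_cometric g he
  obtain ⟨hp, -, -, hne⟩ := hG
  rw [← ofCoord_toCoord he hs, ha.hamDeriv_hamDefining g hf.smooth ha.mem] at hne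
  set v : Coord n → ℝ := fun x => V (e.symm x) with hv
  obtain ⟨z, hz0, hz, hE⟩ := exists_solution_of_gradient hA ha.potential.isOpen
    ha.potential.continuousOn_grad (fun x hx => ha.potential.hasGradientAt hx)
    (z₀ := toCoord e ρ) (e.map_source hs) ha.mem
  have hzΩ : ∀ᶠ t in 𝓝 (0 : ℝ), (z t).1 ∈ Ω :=
    hz.continuousAt.eventually (eventually_fst_mem ha.potential.isOpen (by rw [hz0]; exact ha.mem))
  refine exists_isIntegralCurveIn g he hs hz0 hz ?_ ?_
  · set Φ : Coord n × Coord n → ℝ := fun w =>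
      fderiv ℝ (fun w : Coord n × Coord n => 2 * cometric g e w.1 w.2 i) w
        (ham (cometric g e) v w) with hΦ
    have hham : ContinuousAt (ham (cometric g e) v) (toCoord e ρ) := by
      refine (ha.potential.continuousAt_comp (z := toCoord e ρ) ha.mem
        (hA.contDiffAt_hamParam (e.map_source hs)).continuousAt).congr ?_
      filter_upwards [eventually_fst_mem ha.potential.isOpen
        (show (toCoord e ρ).1 ∈ Ω from ha.mem)] with w hw
      exact (hA.hamField_eq (ha.subset hw) (ha.potential.hasGradientAt hw)).symm
    have hΦc : ContinuousAt Φ (toCoord e ρ) :=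
      ((contDiffAt_conormalMomentum hA i (z := toCoord e ρ) (e.map_source hs)).fderiv_right
        (m := 0) (by exact_mod_cast le_top)).continuousAt.clm_apply hham
    have hΦne : ∀ᶠ w in 𝓝 (z 0), Φ w ≠ 0 := by
      rw [hz0]
      exact hΦc.eventually_ne hne
    filter_upwards [hE, hzΩ, hz.continuousAt.eventually hΦne] with t h1 h2 h3
    have h4 : symbol g V (ofCoord e (z t)) = 0 := by
      rw [symbol_ofCoord g V he (ha.subset h2)]
      exact h1.trans ((energy_toCoord g he hs).trans hp)
    by_cases h5 : f (ofCoord e (z t)).proj ≠ 0 ∨ hamDefining g V f (ofCoord e (z t)) ≠ 0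
    · exact .inl ⟨h4, h5⟩
    · push Not at h5
      refine .inr ⟨h4, h5.1, h5.2, ?_⟩
      rwa [ha.hamDeriv_hamDefining g hf.smooth h2]
  · exact (hzΩ.mono fun t ht => (ha.potential.hasGradientAt ht).differentiableAt).filter_mono
      nhdsWithin_le_nhds

end Local

/-! ### Maximal integral curves -/

section Gluing

/-- The functions f(min(t, b)) and f(max(t, b)) are absolutely continuous on the whole interval by
monotone substitution, and their increments together dominate those of f. -/
theorem absolutelyContinuousOnInterval_union {X : Type*} [PseudoMetricSpace X] {f : ℝ → X}
    {a b c : ℝ} (hab : a ≤ b) (hbc : b ≤ c) (h₁ : AbsolutelyContinuousOnInterval f a b)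
    (h₂ : AbsolutelyContinuousOnInterval f b c) : AbsolutelyContinuousOnInterval f a c := by
  have hl : LipschitzOnWith 1 (fun t : ℝ => min t b) (uIcc a c) :=
    (LipschitzWith.id.min_const b).lipschitzOnWith
  have hr : LipschitzOnWith 1 (fun t : ℝ => max t b) (uIcc a c) :=
    (LipschitzWith.id.max_const b).lipschitzOnWith
  have h₁' : AbsolutelyContinuousOnInterval (fun t => f (min t b)) a c := by
    refine absolutelyContinuousOnInterval_comp_monotone h₁ hl
      (.inl fun s _ t _ hst => min_le_min_right b hst) fun t ht => ?_
    rw [uIcc_of_le (hab.trans hbc)] at ht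
    rw [uIcc_of_le hab]
    exact ⟨le_min ht.1 hab, min_le_right _ _⟩
  have h₂' : AbsolutelyContinuousOnInterval (fun t => f (max t b)) a c := by
    refine absolutelyContinuousOnInterval_comp_monotone h₂ hr
      (.inl fun s _ t _ hst => max_le_max_right b hst) fun t ht => ?_
    rw [uIcc_of_le (hab.trans hbc)] at ht
    rw [uIcc_of_le hbc]
    exact ⟨le_max_right _ _, max_le ht.2 hbc⟩
  refine absolutelyContinuousOnInterval_of_dist_le (K := 1) h₁' h₂' fun s _ t _ => ?_
  rw [one_mul]
  rcases le_total s b with hs | hs <;> rcases le_total t b with ht | ht <;>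
    simp only [min_eq_left, min_eq_right, max_eq_left, max_eq_right, hs, ht, dist_self, add_zero,
      zero_add, le_refl]
  · exact dist_triangle _ _ _
  · rw [add_comm]; exact dist_triangle _ _ _

theorem absolutelyContinuousOnInterval_congr {X : Type*} [PseudoMetricSpace X] {f f' : ℝ → X}
    {a b : ℝ} (h : AbsolutelyContinuousOnInterval f a b) (hff : EqOn f' f (uIcc a b)) :
    AbsolutelyContinuousOnInterval f' a b := by
  refine absolutelyContinuousOnInterval_of_dist_le (K := 1) h h fun s hs t ht => ?_
  rw [hff hs, hff ht, one_mul]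
  linarith [dist_nonneg (x := f s) (y := f t)]

variable {n : ℕ} {M : Type*} [TopologicalSpace M] [ChartedSpace (Coord n) M]
  {p : Cotangent n M → ℝ} {S : Set (Cotangent n M)}

/-- Integral curves in `S` which meet agree near the time of meeting. -/
def HasLocalUniqueness (p : Cotangent n M → ℝ) (S : Set (Cotangent n M)) : Prop :=
  ∀ (γ γ' : ℝ → Cotangent n M) (J J' : Set ℝ) (t₀ : ℝ), IsIntegralCurve p γ J →
    IsIntegralCurve p γ' J' → MapsTo γ J S → MapsTo γ' J' S → t₀ ∈ J → t₀ ∈ J' →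
    γ t₀ = γ' t₀ → γ =ᶠ[𝓝 t₀] γ'

/-- Makes the set where two curves agree relatively closed: the base points agree by continuity in
the Hausdorff space M, and then the covectors agree in a common chart. -/
theorem IsIntegralCurve.eq_of_frequently_eq [IsManifold (𝓡 n) ∞ M] [T2Space M]
    {γ γ' : ℝ → Cotangent n M} {J J' : Set ℝ} {t₀ : ℝ}
    (h : IsIntegralCurve p γ J) (h' : IsIntegralCurve p γ' J') (ht : t₀ ∈ J)
    (ht' : t₀ ∈ J') (hfr : ∃ᶠ t in 𝓝 t₀, γ t = γ' t) : γ t₀ = γ' t₀ := by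
  have hc := h.continuousOn.continuousAt (h.isOpen.mem_nhds ht)
  have hc' := h'.continuousOn.continuousAt (h'.isOpen.mem_nhds ht')
  have hproj : (γ t₀).proj = (γ' t₀).proj :=
    tendsto_nhds_unique_of_frequently_eq hc hc' (hfr.mono fun t h => congrArg (·.proj) h)
  set e := chartAt (Coord n) (γ t₀).proj
  have he : e ∈ IsManifold.maximalAtlas (𝓡 n) ∞ M := IsManifold.chart_mem_maximalAtlas _
  have hs : (γ t₀).proj ∈ e.source := mem_chart_source _ _
  have hs' : (γ' t₀).proj ∈ e.source := by rwa [← hproj]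
  have hcoord : toCoord e (γ t₀) = toCoord e (γ' t₀) :=
    tendsto_nhds_unique_of_frequently_eq (h.continuousAt_toCoord he ht hs)
      (h'.continuousAt_toCoord he ht' hs') (hfr.mono fun t h => congrArg (toCoord e) h)
  rw [← ofCoord_toCoord he hs, hcoord, ofCoord_toCoord he hs']

/-- A connectedness argument on the interval J ∩ J': the set of times near which the curves coincide
is open, nonempty and relatively closed. -/
theorem HasLocalUniqueness.eqOn [IsManifold (𝓡 n) ∞ M] [T2Space M]
    (hu : HasLocalUniqueness p S) {ρ : Cotangent n M}
    {γ γ' : ℝ → Cotangent n M} {J J' : Set ℝ} (h : IsIntegralCurveIn p S ρ γ J)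
    (h' : IsIntegralCurveIn p S ρ γ' J') : EqOn γ γ' (J ∩ J') := by
  have hloc : ∀ t ∈ J ∩ J', γ t = γ' t → γ =ᶠ[𝓝 t] γ' := fun t ht heq =>
    hu γ γ' J J' t h.toIsIntegralCurve h'.toIsIntegralCurve h.mapsTo h'.mapsTo ht.1 ht.2 heq
  have hsub : J ∩ J' ⊆ {t | γ =ᶠ[𝓝 t] γ'} := by
    refine (h.ordConnected.inter h'.ordConnected).isPreconnected.subset_of_closure_inter_subset
      ?_ ⟨0, ⟨h.zero_mem, h'.zero_mem⟩, ?_⟩ ?_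
    · exact isOpen_iff_mem_nhds.2 fun t ht => Filter.Eventually.eventually_nhds ht
    · exact hloc 0 ⟨h.zero_mem, h'.zero_mem⟩ (h.map_zero.trans h'.map_zero.symm)
    · rintro t ⟨htc, ht⟩
      refine hloc t ht (h.toIsIntegralCurve.eq_of_frequently_eq h'.toIsIntegralCurve ht.1 ht.2 ?_)
      exact (mem_closure_iff_frequently.1 htc).mono fun s hs => Filter.EventuallyEq.eq_of_nhds hs
  exact fun t ht => (hsub ht).eq_of_nhds

/-- The union of all integral curves through a point is an integral curve. -/
theorem isIntegralCurveIn_iUnion {ρ : Cotangent n M} {ι : Type*} [Nonempty ι]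
    {c : ι → ℝ → Cotangent n M} {J : ι → Set ℝ} (h : ∀ k, IsIntegralCurveIn p S ρ (c k) (J k))
    {γ : ℝ → Cotangent n M} (hγ : ∀ k, EqOn γ (c k) (J k)) :
    IsIntegralCurveIn p S ρ γ (⋃ k, J k) := by
  have hev : ∀ k, ∀ t ∈ J k, γ =ᶠ[𝓝 t] c k := fun k t ht =>
    (hγ k).eventuallyEq_of_mem ((h k).isOpen.mem_nhds ht)
  have hac : ∀ e ∈ IsManifold.maximalAtlas (𝓡 n) ∞ M, ∀ a b : ℝ, ∀ k, uIcc a b ⊆ J k →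
      (∀ t ∈ uIcc a b, (γ t).proj ∈ e.source) →
      AbsolutelyContinuousOnInterval (fun t => toCoord e (γ t)) a b := fun e he a b k hsub hs => by
    refine absolutelyContinuousOnInterval_congr ((h k).absolutelyContinuous e he a b hsub
      fun t ht => ?_) fun t ht => congrArg (toCoord e) (hγ k (hsub ht))
    rw [← hγ k (hsub ht)]
    exact hs t ht
  -- Every domain contains 0, so a compact interval in the union lies in one domain if it is on one
  -- side of 0 and is otherwise split at 0 between two domains.
  have hac' : ∀ e ∈ IsManifold.maximalAtlas (𝓡 n) ∞ M, ∀ a b : ℝ, a ≤ b → Icc a b ⊆ ⋃ k, J k →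
      (∀ t ∈ Icc a b, (γ t).proj ∈ e.source) →
      AbsolutelyContinuousOnInterval (fun t => toCoord e (γ t)) a b :=
      fun e he a b hab hsub hs => by
    obtain ⟨k, hk⟩ := mem_iUnion.1 (hsub (left_mem_Icc.2 hab))
    obtain ⟨l, hl⟩ := mem_iUnion.1 (hsub (right_mem_Icc.2 hab))
    rcases le_total b 0 with hb | hb
    · refine hac e he a b k ?_ (by rwa [uIcc_of_le hab])
      rw [uIcc_of_le hab]
      exact (Icc_subset_Icc_right hb).trans ((h k).ordConnected.out hk (h k).zero_mem)
    rcases le_total 0 a with ha | ha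
    · refine hac e he a b l ?_ (by rwa [uIcc_of_le hab])
      rw [uIcc_of_le hab]
      exact (Icc_subset_Icc_left ha).trans ((h l).ordConnected.out (h l).zero_mem hl)
    · refine absolutelyContinuousOnInterval_union ha hb (hac e he a 0 k ?_ ?_)
        (hac e he 0 b l ?_ ?_)
      · rw [uIcc_of_le ha]; exact (h k).ordConnected.out hk (h k).zero_mem
      · rw [uIcc_of_le ha]; exact fun t ht => hs t ⟨ht.1, ht.2.trans hb⟩
      · rw [uIcc_of_le hb]; exact (h l).ordConnected.out (h l).zero_mem hl
      · rw [uIcc_of_le hb]; exact fun t ht => hs t ⟨ha.trans ht.1, ht.2⟩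
  obtain ⟨k₀⟩ := ‹Nonempty ι›
  refine ⟨⟨isOpen_iUnion fun k => (h k).isOpen, ?_, ?_, ?_, ?_⟩,
    mem_iUnion.2 ⟨k₀, (h k₀).zero_mem⟩, ?_, ?_⟩
  · refine IsPreconnected.ordConnected (isPreconnected_iUnion
      ⟨0, mem_iInter.2 fun k => (h k).zero_mem⟩ fun k => (h k).ordConnected.isPreconnected)
  · intro t ht
    obtain ⟨k, hk⟩ := mem_iUnion.1 ht
    refine (((h k).continuousOn.continuousAt ((h k).isOpen.mem_nhds hk)).congr
      ?_).continuousWithinAt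
    exact (hev k t hk).mono fun s hs => congrArg (·.proj) (Eq.symm hs)
  · intro e he a b hsub hs
    rcases le_total a b with hab | hab
    · rw [uIcc_of_le hab] at hsub hs
      exact hac' e he a b hab hsub hs
    · rw [uIcc_of_ge hab] at hsub hs
      exact (hac' e he b a hab hsub hs).symm
  · intro e he
    -- By the Lindelöf property countably many of the domains suffice, so the union of the
    -- exceptional null sets is null.
    obtain ⟨T, hT, hTJ⟩ := TopologicalSpace.isOpen_iUnion_countable J fun k => (h k).isOpen
    have hall : ∀ᵐ t : ℝ, ∀ k ∈ T, t ∈ J k → (c k t).proj ∈ e.source →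
        HasDerivAt (fun s => toCoord e (c k s))
          (hamField (fun z => p (ofCoord e z)) (toCoord e (c k t))) t :=
      (ae_ball_iff hT).2 fun k _ => (h k).equation e he
    filter_upwards [hall] with t ht htJ hs
    rw [← hTJ] at htJ
    obtain ⟨k, hkT, hk⟩ := mem_iUnion₂.1 htJ
    have heq := hev k t hk
    have h1 := ht k hkT hk (by rwa [← hγ k hk])
    rw [hγ k hk]
    exact h1.congr_of_eventuallyEq (heq.mono fun s hs => congrArg (toCoord e) hs)
  · rw [hγ k₀ (h k₀).zero_mem, (h k₀).map_zero]
  · intro t ht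
    obtain ⟨k, hk⟩ := mem_iUnion.1 ht
    rw [hγ k hk]
    exact (h k).mapsTo hk

/-- The maximal curve is the union of all integral curves through the point; its values are well
defined because any two of these curves agree on their common domain. -/
theorem HasLocalUniqueness.hasUniqueMaximalCurves [IsManifold (𝓡 n) ∞ M] [T2Space M]
    (hu : HasLocalUniqueness p S)
    (hex : ∀ ρ ∈ S, ∃ γ J, IsIntegralCurveIn p S ρ γ J) : HasUniqueMaximalCurves p S := by
  classical
  intro ρ hρ
  let ι := {c : (ℝ → Cotangent n M) × Set ℝ // IsIntegralCurveIn p S ρ c.1 c.2}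
  have hι : Nonempty ι := by
    obtain ⟨γ, J, h⟩ := hex ρ hρ
    exact ⟨⟨(γ, J), h⟩⟩
  let γ : ℝ → Cotangent n M := fun t =>
    -- Outside the union of the domains the value ρ is arbitrary.
    if h : ∃ k : ι, t ∈ k.1.2 then h.choose.1.1 t else ρ
  have hγ : ∀ k : ι, EqOn γ k.1.1 k.1.2 := fun k t ht => by
    have h : ∃ k : ι, t ∈ k.1.2 := ⟨k, ht⟩
    simp only [γ, dif_pos h]
    exact hu.eqOn h.choose.2 k.2 ⟨h.choose_spec, ht⟩
  have hcurve : IsIntegralCurveIn p S ρ γ (⋃ k : ι, k.1.2) :=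
    isIntegralCurveIn_iUnion (fun k : ι => k.2) hγ
  have hsub : ∀ (γ' : ℝ → Cotangent n M) (J' : Set ℝ), IsIntegralCurveIn p S ρ γ' J' →
      J' ⊆ (⋃ k : ι, k.1.2) ∧ EqOn γ' γ J' := fun γ' J' h' =>
    ⟨subset_iUnion (fun k : ι => k.1.2) ⟨(γ', J'), h'⟩, (hγ ⟨(γ', J'), h'⟩).symm⟩
  refine ⟨γ, ⋃ k : ι, k.1.2, ⟨hcurve, fun γ' J' h' hJ _ => (hsub γ' J' h').1.antisymm hJ⟩,
    fun γ' J' h' => ?_, hsub⟩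
  obtain ⟨h1, h2⟩ := hsub γ' J' h'.toIsIntegralCurveIn
  have h3 := h'.maximal γ _ hcurve h1 h2
  exact ⟨h3.symm, h3 ▸ h2⟩

end Gluing

/-! ### Assembly: local existence and uniqueness on the two sets -/

section Main

variable {n : ℕ} {M : Type*} [TopologicalSpace M] [ChartedSpace (Coord n) M]
  [IsManifold (𝓡 n) ∞ M] (g : RiemannianMetric n M) {Y : Set M} {f V : M → ℝ}

theorem eventuallyEq_of_mem_hyperbolicSet {q : Fin n → Fin n → Prop} (hq : ∀ i j, j ≠ i → q i j)
    (hf : IsDefiningFunction (n := n) Y f) (hV : ContMDiffOn (𝓡 n) 𝓘(ℝ) ∞ V Yᶜ)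
    (hY : ∀ m ∈ Y, ∃ e i Ω W H C, IsAdaptedAt (n := n) f V q m e i Ω W H C)
    {γ γ' : ℝ → Cotangent n M} {J J' : Set ℝ} {t₀ : ℝ}
    (h : IsIntegralCurve (symbol g V) γ J) (h' : IsIntegralCurve (symbol g V) γ' J')
    (hp : ∀ t ∈ J, symbol g V (γ t) = 0) (hp' : ∀ t ∈ J', symbol g V (γ' t) = 0)
    (ht : t₀ ∈ J) (ht' : t₀ ∈ J') (h0 : γ t₀ = γ' t₀) (hmem : γ t₀ ∈ hyperbolicSet g V f) :
    γ =ᶠ[𝓝 t₀] γ' := by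
  by_cases hm : (γ t₀).proj ∈ Y
  · obtain ⟨e, i, Ω, W, H, C, ha⟩ := hY _ hm
    exact eventuallyEq_of_hamDefining_ne_zero g hf hq ha h h' hp hp' ht ht' h0
      (hmem.2.resolve_left fun hne => hne ((hf.mem_iff _).1 hm))
  · exact eventuallyEq_of_notMem g hf hV h h' ht ht' h0 hm

theorem exists_isIntegralCurveIn_of_mem_hyperbolicSet {q : Fin n → Fin n → Prop}
    (hq : ∀ i j, j ≠ i → q i j) (hf : IsDefiningFunction (n := n) Y f)
    (hV : ContMDiffOn (𝓡 n) 𝓘(ℝ) ∞ V Yᶜ)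
    (hY : ∀ m ∈ Y, ∃ e i Ω W H C, IsAdaptedAt (n := n) f V q m e i Ω W H C)
    {S : Set (Cotangent n M)} (hS : hyperbolicSet g V f ⊆ S) {ρ : Cotangent n M}
    (hρ : ρ ∈ hyperbolicSet g V f) : ∃ γ J, IsIntegralCurveIn (symbol g V) S ρ γ J := by
  by_cases hm : ρ.proj ∈ Y
  · obtain ⟨e, i, Ω, W, H, C, ha⟩ := hY _ hm
    exact exists_isIntegralCurveIn_of_hamDefining_ne_zero g hf hq hS ha hρ.1
      (hρ.2.resolve_left fun hne => hne ((hf.mem_iff _).1 hm))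
  · exact exists_isIntegralCurveIn_of_notMem g hf hV hS hm hρ.1

/-- Maximal integral curves in the hyperbolic set. -/
theorem hasUniqueMaximalCurves_hyperbolicSet [T2Space M] (hf : IsDefiningFunction (n := n) Y f)
    (hV : ContMDiffOn (𝓡 n) 𝓘(ℝ) ∞ V Yᶜ)
    (hY : ∀ m ∈ Y, ∃ e i Ω W H C,
      IsAdaptedAt (n := n) f V (fun i j => j ≠ i) m e i Ω W H C) :
    HasUniqueMaximalCurves (symbol g V) (hyperbolicSet g V f) :=
  HasLocalUniqueness.hasUniqueMaximalCurves
    (fun _ _ _ _ _ h h' hS hS' ht ht' h0 => eventuallyEq_of_mem_hyperbolicSet g (fun _ _ hij => hij)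
      hf hV hY h h' (fun _ hs => (hS hs).1) (fun _ hs => (hS' hs).1) ht ht' h0 (hS ht))
    fun _ => exists_isIntegralCurveIn_of_mem_hyperbolicSet g (fun _ _ hij => hij) hf hV hY
      Subset.rfl

/-- Maximal integral curves in the union of the hyperbolic and the second order glancing set. -/
theorem hasUniqueMaximalCurves_union_glancingSet [T2Space M]
    (hf : IsDefiningFunction (n := n) Y f)
    (hV : ContMDiffOn (𝓡 n) 𝓘(ℝ) ∞ V Yᶜ)
    (hY : ∀ m ∈ Y, ∃ e i Ω W H C,
      IsAdaptedAt (n := n) f V (fun _ _ => True) m e i Ω W H C) :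
    HasUniqueMaximalCurves (symbol g V) (hyperbolicSet g V f ∪ glancingSet g V f) := by
  have hp : ∀ ρ ∈ hyperbolicSet g V f ∪ glancingSet g V f, symbol g V ρ = 0 := fun ρ hρ =>
    hρ.elim (fun h => h.1) fun h => h.1
  refine HasLocalUniqueness.hasUniqueMaximalCurves
    (fun γ γ' J J' t₀ h h' hS hS' ht ht' h0 => ?_) fun ρ hρ => ?_
  · rcases hS ht with hH | hG
    · exact eventuallyEq_of_mem_hyperbolicSet g (fun _ _ _ => trivial) hf hV hY h h'
        (fun _ hs => hp _ (hS hs)) (fun _ hs => hp _ (hS' hs)) ht ht' h0 hH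
    · obtain ⟨e, i, Ω, W, H, C, ha⟩ := hY _ ((hf.mem_iff _).2 hG.2.1)
      exact eventuallyEq_of_mem_glancingSet g hf ha h h' ht ht' h0 hG
  · rcases hρ with hH | hG
    · exact exists_isIntegralCurveIn_of_mem_hyperbolicSet g (fun _ _ _ => trivial) hf hV hY
        subset_union_left hH
    · obtain ⟨e, i, Ω, W, H, C, ha⟩ := hY _ ((hf.mem_iff _).2 hG.2.1)
      exact exists_isIntegralCurveIn_of_mem_glancingSet g hf ha hG

end Main

end

end ConormalFlow

theorem mainTheorem3 {n : ℕ} {M : Type*} [TopologicalSpace M] [T2Space M]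
    [SecondCountableTopology M] [ChartedSpace (Coord n) M] [IsManifold (𝓡 n) ∞ M]
    (g : ConormalFlow.RiemannianMetric n M) (Y : Set M) (f : M → ℝ) (hf : IsDefiningFunction (n := n) Y f)
    (V : M → ℝ) (hV : ContMDiffOn (𝓡 n) 𝓘(ℝ) ∞ V Yᶜ) :
    (MemIW n Y f 1 V → ∃ V₀ : M → ℝ, Continuous V₀ ∧ Set.EqOn V₀ V Yᶜ ∧
      HasUniqueMaximalCurves (symbol g V₀) (hyperbolicSet g V₀ f)) ∧
    (MemIW n Y f 2 V → ∃ V₀ : M → ℝ, ContMDiff (𝓡 n) 𝓘(ℝ) 1 V₀ ∧ Set.EqOn V₀ V Yᶜ ∧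
      HasUniqueMaximalCurves (symbol g V₀) (hyperbolicSet g V₀ f ∪ glancingSet g V₀ f)) := by
  refine ⟨fun hW => ?_, fun hW => ?_⟩
  · obtain ⟨V₀, hc, hVV, hY⟩ := exists_extension_one hf hV hW
    -- The flow is that of the extension, which inherits smoothness off Y from V because the two
    -- agree there.
    exact ⟨V₀, hc, hVV, hasUniqueMaximalCurves_hyperbolicSet g hf (hV.congr hVV) hY⟩
  · obtain ⟨V₀, -, hVV, hY⟩ := exists_extension_two hf hV hW
    exact ⟨V₀, contMDiff_one_of_adapted hf hV hVV hY, hVV,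
      hasUniqueMaximalCurves_union_glancingSet g hf (hV.congr hVV) hY⟩
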